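/- **Setting.** Let $d\in\mathbb N=\{1,2,\dots\}$, let $\|\cdot\|$ be a norm on $\mathbb R^d$, let $p_1,p_2\in[1,\infty)$ with $\frac6{p_1}+\frac2{p_2}\le 1$, let $c,T\in(0,\infty)$, let $f\colon\mathbb R\to\mathbb R$, $g\colon\mathbb R^d\to\mathbb R$ and $V\colon[0,T]\times\mathbb R^d\to[1,\infty)$ be continuous, and let $(\Omega,\mathcal F,\mathbb P)$ be a probability space; write $\|Z\|_q=(\mathbb E|Z|^q)^{1/q}\in[0,\infty]$. Let $\Theta=\bigcup_{n\in\mathbb N}\mathbb Z^n$. A random field $(Y_i)_{i\in I}$ is called measurable if each $Y_i$ is a random variable and $(i,\omega)\mapsto Y_i(\omega)$ is measurable with respect to the product of the $\sigma$-algebra of $I$ and the $\sigma$-algebra generated by the field. Let $X^x_{s,t}$ and $\mathcal X^{n,\theta,x}_{s,t}$ ($0\le s\le t\le T$, $x\in\mathbb R^d$, $n\in\mathbb N$, $\theta\in\Theta$) be $\mathbb R^d$-valued random variables and $\mathfrak r^\theta$ ($\theta\in\Theta$) be i.i.d. random variables with values in $[0,1]$, $\mathbb P(\mathfrak r^0\le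 t)=t$ for $t\in[0,1]$, such that: $(s,t,x,\omega)\mapsto X^x_{s,t}(\omega)$ is measurable; for each $s$ the field $(X^x_{s,t})_{t\in[s,T],x}$ is measurable; for each $\theta$ the field $(\mathcal X^{n,\theta,x}_{s,t})_{n,s,t,x}$ is measurable; the fields $(\mathcal X^{n,\theta,x}_{s,t})_{n,s,t,x}$, $\theta\in\Theta$, are i.i.d.; and the family of all $X^x_{s,t}$, $\mathcal X^{n,\theta,x}_{s,t}$ (all $n,\theta,s,t,x$ jointly) is independent of $(\mathfrak r^\theta)_{\theta\in\Theta}$. Assume for all $x,y,\tilde x,\tilde y\in\mathbb R^d$, $v,w,\tilde v,\tilde w\in\mathbb R$, $0\le s\le t\le r\le T$ that 1. $|g(x)|\le V(T,x)$ and $|Tf(0)|\le V(s,x)$; 2. $|(g(x)-g(y))-(g(\tilde x)-g(\tilde y))|\le\frac{V(T,x)+V(T,y)+V(T,\tilde x)+V(T,\tilde y)}4\Big(\frac{\|(x-y)-(\tilde x-\tilde y)\|}{\sqrt T}+\frac{(\|x-y\|+\|\tilde x-\tilde y\|)\|x-\tilde x\|}{2T}\Big)$; 3. $|(f(v)-f(w))-(f(\tilde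 v)-f(\tilde w))|\le c|(v-w)-(\tilde v-\tilde w)|+\frac{c(|v-w|+|\tilde v-\tilde w|)|v-\tilde v|}2$; 4. $\mathbb P\big(X_{t,r}^{X^x_{s,t}}=X^x_{s,r}\big)=1$, and the fields $(X^z_{s,t})_{z}$ and $(X^z_{t,\rho})_{\rho\in[t,T],z}$ are independent; 5. $\big\|\|(X^x_{s,t}-X^y_{s,t})-(X^{\tilde x}_{s,t}-X^{\tilde y}_{s,t})\|\big\|_{p_2}\le\frac{V(s,x)+V(s,y)+V(s,\tilde x)+V(s,\tilde y)}4\Big[\|(x-y)-(\tilde x-\tilde y)\|+\frac{(\|x-y\|+\|\tilde x-\tilde y\|)\|x-\tilde x\|}{2\sqrt T}\Big]$; 6. $\big\|\|(X^x_{s,t}-X^y_{s,t})-(x-y)\|\big\|_{p_2}\le\frac{V(s,x)+V(s,y)}2\|x-y\|\frac{|t-s|^{1/2}}{\sqrt T}$; and for all $n\in\mathbb N$, $s\in[0,T]$, $\tilde s,t\in[s,T]$, $\tilde t\in[\tilde s,T]$, $x,\tilde x\in\mathbb R^d$ that 7. $\big\|\|\mathcal X^{n,0,x}_{s,t}-\mathcal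 X^{n,0,\tilde x}_{\tilde s,\tilde t}\|\big\|_{p_2}\le\frac{V(s,x)+V(\tilde s,\tilde x)}2\cdot\frac{|s-\tilde s|^{1/2}+|t-\tilde t|^{1/2}}2+e^{cT}\|x-\tilde x\|$; 8. $\big\|\|(\mathcal X^{n,0,x}_{s,t}-X^x_{s,t})-(\mathcal X^{n,0,\tilde x}_{\tilde s,\tilde t}-X^{\tilde x}_{\tilde s,\tilde t})\|\big\|_{p_2}\le\frac{V(s,x)+V(\tilde s,\tilde x)}2\Big[\frac{|s-\tilde s|^{1/2}+|t-\tilde t|^{1/2}}2+\|x-\tilde x\|\Big]\frac1{\sqrt n}$; 9. $\mathbb P(X^x_{s,s}=x)=\mathbb P(\mathcal X^{n,0,x}_{s,s}=x)=1$ and $e^{cT}\le\|V(t,\mathcal X^{n,0,x}_{s,t})\|_{p_1}\le V(s,x)$. The MLP approximations are given for $m,n\in\mathbb N$, $\theta\in\Theta$, $t\in[0,T]$, $x\in\mathbb R^d$ by $U^\theta_{0,m}=0$ and, with $\eta=(\theta,\ell,i)$, $\bar\eta=(\theta,\ell,-i)$, $\rho=t+(T-t)\mathfrak r^{\eta}$,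 $$U^\theta_{n,m}(t,x)=\sum_{\ell=0}^{n-1}\frac1{m^{n-\ell}}\sum_{i=1}^{m^{n-\ell}}\Big[g(\mathcal X^{m^\ell,\eta,x}_{t,T})-\mathbf 1_{\mathbb N}(\ell)\,g(\mathcal X^{m^{\ell-1},\eta,x}_{t,T})+(T-t)f\big(U^{\eta}_{\ell,m}(\rho,\mathcal X^{m^\ell,\eta,x}_{t,\rho})\big)-\mathbf 1_{\mathbb N}(\ell)(T-t)f\big(U^{\bar\eta}_{\ell-1,m}(\rho,\mathcal X^{m^{\ell-1},\eta,x}_{t,\rho})\big)\Big].$$ Let $p\in[2,\infty)$, $q_1\in[3,\infty)$, $q_2\in[9,\infty)$ with $\frac{q_2+1}{p_1}+\frac2{p_2}\le\frac1p$ and $q_1+2\le q_2$. For $s\in[0,T]$ and a random field $H\colon[0,T]\times\mathbb R^d\times\Omega\to\mathbb R$ let $|||H|||_s=\max\{|||H|||_{1,s},|||H|||_{2,s}\}$, where $$|||H|||_{1,s}=\sup_{t\in[s,T],\,x\in\mathbb R^d}\frac{\|H(t,x)\|_p}{V(t,x)^{q_1}},\qquad |||H|||_{2,s}=\sup_{\substack{t_1,t_2\in[s,T],\,x_1,x_2\in\mathbb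 R^d\\(t_1,x_1)\ne(t_2,x_2)}}\frac{\|H(t_1,x_1)-H(t_2,x_2)\|_p}{\frac{V(t_1,x_1)^{q_2}+V(t_2,x_2)^{q_2}}2\Big[\frac{V(t_1,x_1)+V(t_2,x_2)}2\frac{|t_1-t_2|^{1/2}}{\sqrt T}+\frac{\|x_1-x_2\|}{\sqrt T}\Big]}.$$ **Theorem.** (i) There is a unique measurable $u\colon[0,T]\times\mathbb R^d\to\mathbb R$ such that for all $t\in[0,T]$, $x\in\mathbb R^d$ it holds that $\mathbb E|g(X^x_{t,T})|+\int_t^T\mathbb E|f(u(r,X^x_{t,r}))|\,dr+\sup_{r\in[0,T],\xi\in\mathbb R^d}\frac{|u(r,\xi)|}{V(r,\xi)}<\infty$ and $$u(t,x)=\mathbb E[g(X^x_{t,T})]+\int_t^T\mathbb E[f(u(r,X^x_{t,r}))]\,dr.$$ (ii) For all $s\in[0,T]$: $|||u|||_{1,s}\le 2e^{cT}$ and $|||u|||_{2,s}\le 8e^{2cT}$. (iii) For all $n,m\in\mathbb N$, $t\in[0,T]$: $$|||U^0_{n,m}-u|||_t\le 1776\,m\,n\,e^{6cT}e^{m^{p/2}/p}\,m^{-n/2}\,37^n\,e^{4ncT}(p-1)^{n/2}.$$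 -/

import Mathlib

open MeasureTheory ProbabilityTheory Set
open scoped ENNReal

noncomputable section

namespace MLPHoelder

/-- The index set `Θ = ⋃_{n ≥ 1} ℤⁿ` of all nonempty finite tuples of integers. -/
def Idx : Type := {l : List ℤ // l ≠ []}

/-- The one-component index `0 ∈ ℤ¹ ⊆ Θ`. -/
def Idx.zero : Idx := ⟨[0], by simp⟩

/-- The index `(θ, a, b)` obtained from `θ ∈ Θ` by appending the integers `a` and `b`. -/
def Idx.snoc (θ : Idx) (a b : ℤ) : Idx := ⟨θ.1 ++ [a, b], by simp⟩

/-- The time domain `{(s, t) ∈ [0, T]² : s ≤ t}`. -/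
abbrev TimeDom (T : ℝ) : Type := {q : ℝ × ℝ // 0 ≤ q.1 ∧ q.1 ≤ q.2 ∧ q.2 ≤ T}

/-- A measurable random field `Y = (Y i)_{i ∈ ι}`: every `Y i` is a random variable, and
`(i, ω) ↦ Y i ω` is measurable with respect to the product of the sigma-algebra of the index set
with the sigma-algebra on `Ω` that is generated by the field itself. -/
def MeasurableField {ι Ω E : Type*} [MeasurableSpace ι] [MeasurableSpace Ω] [MeasurableSpace E]
    (Y : ι → Ω → E) : Prop :=
  (∀ i, Measurable (Y i)) ∧
  Measurable[(inferInstance : MeasurableSpace ι).prod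
    (MeasurableSpace.comap (fun ω i => Y i ω) MeasurableSpace.pi)] (fun q : ι × Ω => Y q.1 q.2)

section Objects

variable {E Ω : Type*}

/-- The whole forward random field `(X s t x)_{(s, t), x}` as an element of path space. -/
def flowPath (T : ℝ) (X : ℝ → ℝ → E → Ω → E) (ω : Ω) : TimeDom T × E → E :=
  fun q => X q.1.1.1 q.1.1.2 q.2 ω

/-- The random field `(Y n θ s t x)_{n, (s, t), x}` (all `n ≥ 1`, fixed `θ`) as an element of
path space. -/
def approxPath (T : ℝ) (Y : ℕ → Idx → ℝ → ℝ → E → Ω → E) (θ : Idx) (ω : Ω) :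
    {n : ℕ // 1 ≤ n} × TimeDom T × E → E :=
  fun q => Y q.1.1 θ q.2.1.1.1 q.2.1.1.2 q.2.2 ω

/-- The multilevel Picard approximations `U n m θ t x`, for `n = 0, 1, 2, …`
(`U 0 = 0` because the sum over levels is then empty):
`U n m θ t x = ∑_{l < n} m^{-(n-l)} ∑_{i = 1}^{m^{n-l}}
  [ g (Y (m^l) (θ,l,i) t T x) - 1_{l ≥ 1} g (Y (m^{l-1}) (θ,l,i) t T x)
    + (T - t) f (U l m (θ,l,i) (ρ, Y (m^l) (θ,l,i) t ρ x))
    - 1_{l ≥ 1} (T - t) f (U (l-1) m (θ,l,-i) (ρ, Y (m^{l-1}) (θ,l,i) t ρ x)) ]`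
with `ρ = t + (T - t) r (θ,l,i)`. -/
def mlp (T : ℝ) (f : ℝ → ℝ) (g : E → ℝ) (r : Idx → Ω → ℝ)
    (Y : ℕ → Idx → ℝ → ℝ → E → Ω → E) (n m : ℕ) (θ : Idx) (t : ℝ) (x : E) (ω : Ω) : ℝ :=
  ∑ l : Fin n, (1 / (m : ℝ) ^ (n - (l : ℕ))) *
    ∑ i ∈ Finset.Icc 1 (m ^ (n - (l : ℕ))),
      (g (Y (m ^ (l : ℕ)) (θ.snoc (l : ℕ) i) t T x ω)
        - (if (l : ℕ) = 0 then 0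
            else g (Y (m ^ ((l : ℕ) - 1)) (θ.snoc (l : ℕ) i) t T x ω))
        + (T - t) * f (mlp T f g r Y (l : ℕ) m (θ.snoc (l : ℕ) i)
            (t + (T - t) * r (θ.snoc (l : ℕ) i) ω)
            (Y (m ^ (l : ℕ)) (θ.snoc (l : ℕ) i) t
              (t + (T - t) * r (θ.snoc (l : ℕ) i) ω) x ω) ω)
        - (if (l : ℕ) = 0 then 0
            else (T - t) * f (mlp T f g r Y ((l : ℕ) - 1) m (θ.snoc (l : ℕ) (-(i : ℤ)))
              (t + (T - t) * r (θ.snoc (l : ℕ) i) ω)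
              (Y (m ^ ((l : ℕ) - 1)) (θ.snoc (l : ℕ) i) t
                (t + (T - t) * r (θ.snoc (l : ℕ) i) ω) x ω) ω)))
termination_by n
decreasing_by
  · exact l.2
  · exact lt_of_le_of_lt (Nat.sub_le _ _) l.2

end Objects

section Assumptions

variable {E : Type*} [NormedAddCommGroup E] [NormedSpace ℝ E] [MeasurableSpace E]
  {Ω : Type*} [MeasurableSpace Ω]

/-- Standing assumptions on the coefficients `f`, `g`, the Lyapunov-type function `V` and the
forward random field `X s t x` (`0 ≤ s ≤ t ≤ T`; values at other times are irrelevant).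
`E` is `ℝᵈ` with an arbitrary norm; the `L^q`-norm of a random variable is `eLpNorm` with values
in `[0, ∞]`. -/
structure FlowAssumptions (P : Measure Ω) (p₁ p₂ c T : ℝ) (f : ℝ → ℝ) (g : E → ℝ)
    (V : ℝ → E → ℝ) (X : ℝ → ℝ → E → Ω → E) : Prop where
  one_le_p₁ : 1 ≤ p₁
  one_le_p₂ : 1 ≤ p₂
  exponents : 6 / p₁ + 2 / p₂ ≤ 1
  c_pos : 0 < c
  T_pos : 0 < T
  f_cont : Continuous f
  g_cont : Continuous g
  V_cont : ContinuousOn (fun q : ℝ × E => V q.1 q.2) (Icc 0 T ×ˢ univ)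
  one_le_V : ∀ t ∈ Icc 0 T, ∀ x, 1 ≤ V t x
  X_meas : Measurable (fun q : (TimeDom T × E) × Ω => flowPath T X q.2 q.1)
  /-- For each starting time `s`, `(X s t x)_{t ∈ [s, T], x}` is a measurable random field. -/
  X_field : ∀ s ∈ Icc 0 T,
    MeasurableField (fun (q : Icc s T × E) (ω : Ω) => X s q.1 q.2 ω)
  g_growth : ∀ x, |g x| ≤ V T x
  f_zero : ∀ s ∈ Icc 0 T, ∀ x, |T * f 0| ≤ V s x
  g_diff : ∀ x y x' y' : E,
    |(g x - g y) - (g x' - g y')| ≤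
      (V T x + V T y + V T x' + V T y') / 4 *
        (‖(x - y) - (x' - y')‖ / √T + (‖x - y‖ + ‖x' - y'‖) * ‖x - x'‖ / (2 * T))
  f_diff : ∀ v w v' w' : ℝ,
    |(f v - f w) - (f v' - f w')| ≤
      c * |(v - w) - (v' - w')| + c * (|v - w| + |v' - w'|) * |v - v'| / 2
  flow : ∀ s t r : ℝ, 0 ≤ s → s ≤ t → t ≤ r → r ≤ T → ∀ x,
    ∀ᵐ ω ∂P, X t r (X s t x ω) ω = X s r x ω
  /-- `(X s t x)_x` and `(X t r x)_{r ∈ [t, T], x}` are independent random fields. -/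
  flow_indep : ∀ s t : ℝ, 0 ≤ s → s ≤ t → t ≤ T →
    IndepFun (fun (ω : Ω) (x : E) => X s t x ω)
      (fun (ω : Ω) (q : Icc t T × E) => X t q.1 q.2 ω) P
  X_diff : ∀ s t : ℝ, 0 ≤ s → s ≤ t → t ≤ T → ∀ x y x' y' : E,
    eLpNorm (fun ω => (X s t x ω - X s t y ω) - (X s t x' ω - X s t y' ω))
        (ENNReal.ofReal p₂) P ≤
      ENNReal.ofReal ((V s x + V s y + V s x' + V s y') / 4 *
        (‖(x - y) - (x' - y')‖ + (‖x - y‖ + ‖x' - y'‖) * ‖x - x'‖ / (2 * √T)))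
  X_incr : ∀ s t : ℝ, 0 ≤ s → s ≤ t → t ≤ T → ∀ x y : E,
    eLpNorm (fun ω => (X s t x ω - X s t y ω) - (x - y)) (ENNReal.ofReal p₂) P ≤
      ENNReal.ofReal ((V s x + V s y) / 2 * ‖x - y‖ * (√|t - s| / √T))

/-- Standing assumptions on the uniform random times `r θ` and the approximations
`Y n θ s t x` (`n ≥ 1`, `0 ≤ s ≤ t ≤ T`) of the forward random field. -/
structure ApproxAssumptions (P : Measure Ω) (p₁ p₂ c T : ℝ) (V : ℝ → E → ℝ)
    (X : ℝ → ℝ → E → Ω → E) (r : Idx → Ω → ℝ) (Y : ℕ → Idx → ℝ → ℝ → E → Ω → E) :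
    Prop where
  r_meas : ∀ θ, Measurable (r θ)
  r_mem : ∀ θ ω, r θ ω ∈ Icc (0 : ℝ) 1
  r_indep : iIndepFun r P
  r_ident : ∀ θ, IdentDistrib (r θ) (r Idx.zero) P P
  r_unif : ∀ t ∈ Icc (0 : ℝ) 1, P {ω | r Idx.zero ω ≤ t} = ENNReal.ofReal t
  Y_field : ∀ θ, MeasurableField (fun q (ω : Ω) => approxPath T Y θ ω q)
  Y_indep : iIndepFun (fun θ => approxPath T Y θ) P
  Y_ident : ∀ θ, IdentDistrib (approxPath T Y θ) (approxPath T Y Idx.zero) P P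
  indep_r : IndepFun (fun ω => (flowPath T X ω, fun θ => approxPath T Y θ ω))
    (fun ω θ => r θ ω) P
  Y_hoelder : ∀ n : ℕ, 1 ≤ n → ∀ s t s' t' : ℝ, 0 ≤ s → s ≤ s' → s ≤ t → s' ≤ t' →
    t ≤ T → t' ≤ T → ∀ x x' : E,
    eLpNorm (fun ω => Y n Idx.zero s t x ω - Y n Idx.zero s' t' x' ω) (ENNReal.ofReal p₂) P ≤
      ENNReal.ofReal ((V s x + V s' x') / 2 * ((√|s - s'| + √|t - t'|) / 2)
        + Real.exp (c * T) * ‖x - x'‖)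
  Y_error : ∀ n : ℕ, 1 ≤ n → ∀ s t s' t' : ℝ, 0 ≤ s → s ≤ s' → s ≤ t → s' ≤ t' →
    t ≤ T → t' ≤ T → ∀ x x' : E,
    eLpNorm (fun ω => (Y n Idx.zero s t x ω - X s t x ω)
        - (Y n Idx.zero s' t' x' ω - X s' t' x' ω)) (ENNReal.ofReal p₂) P ≤
      ENNReal.ofReal ((V s x + V s' x') / 2 *
        ((√|s - s'| + √|t - t'|) / 2 + ‖x - x'‖) * (1 / √(n : ℝ)))
  X_start : ∀ s ∈ Icc 0 T, ∀ x, ∀ᵐ ω ∂P, X s s x ω = x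
  Y_start : ∀ n : ℕ, 1 ≤ n → ∀ s ∈ Icc 0 T, ∀ x, ∀ᵐ ω ∂P, Y n Idx.zero s s x ω = x
  le_V_moment : ∀ n : ℕ, 1 ≤ n → ∀ s t : ℝ, 0 ≤ s → s ≤ t → t ≤ T → ∀ x,
    ENNReal.ofReal (Real.exp (c * T)) ≤
      eLpNorm (fun ω => V t (Y n Idx.zero s t x ω)) (ENNReal.ofReal p₁) P
  V_moment_le : ∀ n : ℕ, 1 ≤ n → ∀ s t : ℝ, 0 ≤ s → s ≤ t → t ≤ T → ∀ x,
    eLpNorm (fun ω => V t (Y n Idx.zero s t x ω)) (ENNReal.ofReal p₁) P ≤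
      ENNReal.ofReal (V s x)

/-- `u : [0, T] × E → ℝ` (values of `u` at other times are irrelevant) is a measurable solution of
the stochastic fixed-point equation
`u(t, x) = 𝔼[g(X_{t,T}^x)] + ∫_t^T 𝔼[f(u(r, X_{t,r}^x))] dr` such that
`𝔼|g(X_{t,T}^x)| + ∫_t^T 𝔼|f(u(r, X_{t,r}^x))| dr + sup |u| / V < ∞`. -/
structure IsFixedPointSolution (P : Measure Ω) (T : ℝ) (f : ℝ → ℝ) (g : E → ℝ)
    (V : ℝ → E → ℝ) (X : ℝ → ℝ → E → Ω → E) (u : ℝ → E → ℝ) : Prop where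
  meas : Measurable (fun q : Icc (0 : ℝ) T × E => u q.1 q.2)
  finite : ∀ t ∈ Icc 0 T, ∀ x,
    (∫⁻ ω, ENNReal.ofReal |g (X t T x ω)| ∂P)
      + (∫⁻ r in Icc t T, ∫⁻ ω, ENNReal.ofReal |f (u r (X t r x ω))| ∂P)
      + (⨆ r ∈ Icc 0 T, ⨆ ξ : E, ENNReal.ofReal (|u r ξ| / V r ξ)) < ∞
  eq : ∀ t ∈ Icc 0 T, ∀ x,
    u t x = (∫ ω, g (X t T x ω) ∂P) + ∫ r in t..T, ∫ ω, f (u r (X t r x ω)) ∂P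

/-- The weighted supremum norm
`|||H|||_{1,s} = sup_{t ∈ [s,T], x} ‖H(t,x)‖_{L^p} / V(t,x)^{q₁}`. -/
def norm₁ (P : Measure Ω) (T p q₁ : ℝ) (V : ℝ → E → ℝ) (H : ℝ → E → Ω → ℝ) (s : ℝ) : ℝ≥0∞ :=
  ⨆ t ∈ Icc s T, ⨆ x : E,
    eLpNorm (H t x) (ENNReal.ofReal p) P / ENNReal.ofReal (V t x ^ q₁)

/-- The weighted temporal-spatial Hölder seminorm `|||H|||_{2,s}`, the supremum over
`(t₁,x₁) ≠ (t₂,x₂)` in `[s,T] × E` of `‖H(t₁,x₁) - H(t₂,x₂)‖_{L^p}` divided by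
`(V(t₁,x₁)^{q₂} + V(t₂,x₂)^{q₂})/2 ·
  [ (V(t₁,x₁) + V(t₂,x₂))/2 · |t₁-t₂|^{1/2}/√T + ‖x₁-x₂‖/√T ]`. -/
def norm₂ (P : Measure Ω) (T p q₂ : ℝ) (V : ℝ → E → ℝ) (H : ℝ → E → Ω → ℝ) (s : ℝ) : ℝ≥0∞ :=
  ⨆ t₁ ∈ Icc s T, ⨆ t₂ ∈ Icc s T, ⨆ x₁ : E, ⨆ x₂ : E, ⨆ _ : (t₁, x₁) ≠ (t₂, x₂),
    eLpNorm (fun ω => H t₁ x₁ ω - H t₂ x₂ ω) (ENNReal.ofReal p) P /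
      ENNReal.ofReal ((V t₁ x₁ ^ q₂ + V t₂ x₂ ^ q₂) / 2 *
        ((V t₁ x₁ + V t₂ x₂) / 2 * (√|t₁ - t₂| / √T) + ‖x₁ - x₂‖ / √T))

/-- The weighted temporal-spatial Hölder norm `|||H|||_s = max {|||H|||_{1,s}, |||H|||_{2,s}}`. -/
def hoelderNorm (P : Measure Ω) (T p q₁ q₂ : ℝ) (V : ℝ → E → ℝ) (H : ℝ → E → Ω → ℝ) (s : ℝ) :
    ℝ≥0∞ :=
  max (norm₁ P T p q₁ V H s) (norm₂ P T p q₂ V H s)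

end Assumptions

end MLPHoelder

end

/-! Existence and uniqueness. The function f is c-Lipschitz and V(r, X_{t,r}^x) has mean at most
V(t,x). Hence the fixed-point map contracts with factor 1/2 in the norm sup |u| / (e^{2c(T-t)} V),
and it preserves the bound |u| ≤ 2 e^{c(T-t)} V (`picard_sub_le`, `abs_picard_le`).

Regularity of u. Since X is a flow whose later evolution is independent of its earlier position, t ↦
E|∑ a_i u(t, X_{s,t}^{x_i})| satisfies a backward Gronwall inequality (`gronwall_flow`). The
coefficients (1,-1) give a spatial Lipschitz bound, and (1,-1,-1,1) give a bound on second
differences, with the quadratic remainder of f as a source. Dynamic programming adds regularity in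
time; `SolutionBounds` collects the result.

Error analysis. A summand on level l ≥ 1 compares two discretizations driven by the same sample at
the same random time. By `cell_eq` each of its two halves is an `increment`, in which the
approximation U is replaced by u, plus a `nonlinError`, the effect of U - u. Increments along two
close fields differ little in the full Hölder norm (`wBound_increment_sub`), which needs the
second-order bounds on f, g and u. The `nonlinError` is bounded linearly by U - u
(`wBound_nonlinError`): in the second-order condition on f the factor |v - v'| is taken at the
deterministic u, so that no product of two errors appears.

The law of an approximation does not depend on its index (`identDistrib_mlp`), so the level means
telescope. Thus U_{n+1} - u is a sum of averaged centred fluctuations plus the bias on the finest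
level (`wBound_mlp_sub_step`). The fluctuations are controlled by a Marcinkiewicz–Zygmund inequality
with constant √(p-1), which rests on the 2-smoothness of L^p (`rpow_integral_add_le`). The bias is
measured against the increment along X, whose mean is u.

To close the recursion, errors are weighted by exp(m^{p/2} (T-t)/(Tp)). In this weight the average
over the uniform time gains the factor 1/√m (`lpLe_exp_time`), which compensates the loss of one
level. Induction with the ratio 37 √(p-1) e^{4cT} per level then gives the rate (`recursion_arith`,
`wBound_mlp_sub`).

All moment bounds are recorded through reciprocal exponents (`LpLe`), so each use of Hölder's
inequality becomes a linear inequality between costs, which follows from the exponent hypotheses. -/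

section

namespace MLPHoelder

/-! ### Calculus of L^p bounds with reciprocal exponents, and freezing of independent variables. -/

section LpLe

variable {Ω : Type*} [MeasurableSpace Ω] {P : Measure Ω} {F G : Type*} [NormedAddCommGroup F]
  [NormedAddCommGroup G]

/-- `Z` is a random variable whose `L^{1/α}`-norm is at most `b`. The cost `α` is the reciprocal
of the exponent, so that Hölder's inequality adds costs. -/
def LpLe (P : Measure Ω) (α : ℝ) (Z : Ω → F) (b : ℝ) : Prop :=
  AEStronglyMeasurable Z P ∧ eLpNorm Z (ENNReal.ofReal α)⁻¹ P ≤ ENNReal.ofReal b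

lemma lpLe_iff {p : ℝ} (hp : 0 < p) {Z : Ω → F} {b : ℝ} :
    LpLe P (1 / p) Z b ↔
      AEStronglyMeasurable Z P ∧ eLpNorm Z (ENNReal.ofReal p) P ≤ ENNReal.ofReal b := by
  rw [LpLe, one_div, ENNReal.ofReal_inv_of_pos hp, inv_inv]

namespace LpLe

variable {α β a b : ℝ} {Z : Ω → F} {Z' : Ω → G}

lemma mono_bound (h : LpLe P α Z a) (hab : a ≤ b) : LpLe P α Z b :=
  ⟨h.1, h.2.trans (ENNReal.ofReal_le_ofReal hab)⟩

lemma mono_cost [IsProbabilityMeasure P] (h : LpLe P α Z b) (hab : α ≤ β) : LpLe P β Z b :=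
  ⟨h.1, (eLpNorm_le_eLpNorm_of_exponent_le
    (ENNReal.inv_le_inv.2 (ENNReal.ofReal_le_ofReal hab)) h.1).trans h.2⟩

lemma mono_ae (h : LpLe P α Z b) (hm : AEStronglyMeasurable Z' P)
    (hle : ∀ᵐ ω ∂P, ‖Z' ω‖ ≤ ‖Z ω‖) : LpLe P α Z' b :=
  ⟨hm, (eLpNorm_mono_ae hle).trans h.2⟩

lemma mono (h : LpLe P α Z b) (hm : AEStronglyMeasurable Z' P)
    (hle : ∀ ω, ‖Z' ω‖ ≤ ‖Z ω‖) : LpLe P α Z' b :=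
  h.mono_ae hm (.of_forall hle)

lemma mono_real {Z : Ω → ℝ} (h : LpLe P α Z b) (hm : AEStronglyMeasurable Z' P)
    (hle : ∀ ω, ‖Z' ω‖ ≤ Z ω) : LpLe P α Z' b :=
  h.mono hm fun ω => (hle ω).trans (le_abs_self _)

lemma congr_ae {Z₂ : Ω → F} (h : LpLe P α Z b) (he : Z =ᵐ[P] Z₂) : LpLe P α Z₂ b :=
  ⟨h.1.congr he, (eLpNorm_congr_ae he) ▸ h.2⟩

lemma norm (h : LpLe P α Z b) : LpLe P α (fun ω => ‖Z ω‖) b :=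
  ⟨h.1.norm, by rw [eLpNorm_norm]; exact h.2⟩

lemma neg (h : LpLe P α Z b) : LpLe P α (fun ω => -Z ω) b :=
  h.mono h.1.neg fun ω => by simp

lemma add {Z₂ : Ω → F} (h : LpLe P α Z a) (h₂ : LpLe P α Z₂ b) (hα : α ≤ 1) (ha : 0 ≤ a)
    (hb : 0 ≤ b) : LpLe P α (fun ω => Z ω + Z₂ ω) (a + b) := by
  refine ⟨h.1.add h₂.1, (eLpNorm_add_le h.1 h₂.1 ?_).trans ?_⟩
  · rw [ENNReal.one_le_inv]
    exact ENNReal.ofReal_le_one.2 hα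
  · rw [ENNReal.ofReal_add ha hb]
    exact add_le_add h.2 h₂.2

lemma sub {Z₂ : Ω → F} (h : LpLe P α Z a) (h₂ : LpLe P α Z₂ b) (hα : α ≤ 1) (ha : 0 ≤ a)
    (hb : 0 ≤ b) : LpLe P α (fun ω => Z ω - Z₂ ω) (a + b) := by
  simpa [sub_eq_add_neg] using h.add h₂.neg hα ha hb

lemma sum {ι : Type*} {s : Finset ι} {Z : ι → Ω → F} {b : ι → ℝ} (hα : α ≤ 1)
    (hb : ∀ i ∈ s, 0 ≤ b i) (h : ∀ i ∈ s, LpLe P α (Z i) (b i)) :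
    LpLe P α (fun ω => ∑ i ∈ s, Z i ω) (∑ i ∈ s, b i) := by
  classical
  induction s using Finset.induction_on with
  | empty => simp [LpLe, aestronglyMeasurable_const]
  | insert i s hi ih =>
    simp only [Finset.sum_insert hi]
    refine (h i (by simp)).add (ih (fun j hj => hb j (by simp [hj])) fun j hj => h j (by simp [hj]))
      hα (hb i (by simp)) (Finset.sum_nonneg fun j hj => hb j (by simp [hj]))

lemma const_mul {Z : Ω → ℝ} (h : LpLe P α Z b) (r : ℝ) :
    LpLe P α (fun ω => r * Z ω) (|r| * b) := by
  refine ⟨h.1.const_mul r, ?_⟩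
  have := eLpNorm_const_smul_le (c := r) (f := Z) (p := (ENNReal.ofReal α)⁻¹) (μ := P)
  refine this.trans ?_
  rw [ENNReal.ofReal_mul (abs_nonneg r), Real.enorm_eq_ofReal_abs]
  gcongr
  exact h.2

lemma const [IsProbabilityMeasure P] (r : F) (α : ℝ) : LpLe P α (fun _ : Ω => r) ‖r‖ := by
  refine ⟨aestronglyMeasurable_const, ?_⟩
  rw [eLpNorm_const _ (by simp) (IsProbabilityMeasure.ne_zero P)]
  simp

lemma mul {Z Z₂ : Ω → ℝ} (h : LpLe P α Z a) (h₂ : LpLe P β Z₂ b) (hα : 0 ≤ α) (hβ : 0 ≤ β)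
    (ha : 0 ≤ a) : LpLe P (α + β) (fun ω => Z ω * Z₂ ω) (a * b) := by
  refine ⟨h.1.mul h₂.1, ?_⟩
  have : ENNReal.HolderTriple (ENNReal.ofReal α)⁻¹ (ENNReal.ofReal β)⁻¹
    (ENNReal.ofReal (α + β))⁻¹ := ⟨by simp [ENNReal.ofReal_add hα hβ]⟩
  refine (eLpNorm_smul_le_mul_eLpNorm (p := (ENNReal.ofReal α)⁻¹) (q := (ENNReal.ofReal β)⁻¹)
    (r := (ENNReal.ofReal (α + β))⁻¹) h₂.1 h.1).trans ?_
  rw [ENNReal.ofReal_mul ha]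
  exact mul_le_mul' h.2 h₂.2

lemma rpow {Z : Ω → ℝ} (h : LpLe P α Z b) (hZ : ∀ ω, 0 ≤ Z ω) (hb : 0 ≤ b)
    {k : ℝ} (hk : 0 < k) : LpLe P (k * α) (fun ω => Z ω ^ k) (b ^ k) := by
  refine ⟨(h.1.aemeasurable.pow_const k).aestronglyMeasurable, ?_⟩
  have h1 := eLpNorm_norm_rpow (μ := P) (p := (ENNReal.ofReal (k * α))⁻¹) Z hk
  have h2 : (fun x => ‖Z x‖ ^ k) = fun ω => Z ω ^ k := by
    ext ω; rw [Real.norm_of_nonneg (hZ ω)]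
  rw [h2] at h1
  have hk' : ENNReal.ofReal k ≠ 0 := by simpa using hk
  rw [h1, ENNReal.ofReal_mul hk.le, ENNReal.mul_inv (.inl hk') (.inl ENNReal.ofReal_ne_top),
    mul_comm, ← mul_assoc, ENNReal.mul_inv_cancel hk' ENNReal.ofReal_ne_top, one_mul,
    ← ENNReal.ofReal_rpow_of_nonneg hb hk.le]
  exact ENNReal.rpow_le_rpow h.2 hk.le

lemma pow [IsProbabilityMeasure P] {Z : Ω → ℝ} (h : LpLe P α Z b) (hα : 0 ≤ α) (hb : 0 ≤ b)
    (k : ℕ) : LpLe P (k * α) (fun ω => Z ω ^ k) (b ^ k) := by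
  induction k with
  | zero => simpa using const (P := P) (1 : ℝ) (0 * α)
  | succ k ih =>
    have := ih.mul h (by positivity) hα (by positivity)
    simpa only [pow_succ, Nat.cast_succ, add_mul, one_mul] using this

lemma memLp {Z : Ω → F} (h : LpLe P α Z b) : MemLp Z (ENNReal.ofReal α)⁻¹ P :=
  ⟨h.1, h.2.trans_lt ENNReal.ofReal_lt_top⟩

lemma integrable [IsProbabilityMeasure P] (h : LpLe P α Z b) (hα : α ≤ 1) : Integrable Z P :=
  h.memLp.integrable (by
    rw [ENNReal.one_le_inv]
    exact ENNReal.ofReal_le_one.2 hα)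

lemma lintegral_le [IsProbabilityMeasure P] (h : LpLe P α Z b) (hα : α ≤ 1) :
    ∫⁻ ω, ‖Z ω‖ₑ ∂P ≤ ENNReal.ofReal b := by
  have := (h.mono_cost hα).2
  rwa [ENNReal.ofReal_one, inv_one, eLpNorm_one_eq_lintegral_enorm] at this

lemma norm_integral_le [IsProbabilityMeasure P] [NormedSpace ℝ F] (h : LpLe P α Z b)
    (hα : α ≤ 1) (hb : 0 ≤ b) :
    ‖∫ ω, Z ω ∂P‖ ≤ b := by
  have h1 := (enorm_integral_le_lintegral_enorm (μ := P) Z).trans (h.lintegral_le hα)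
  rwa [← ofReal_norm, ENNReal.ofReal_le_ofReal_iff hb] at h1

lemma integral_norm_le [IsProbabilityMeasure P] (h : LpLe P α Z b)
    (hα : α ≤ 1) (hb : 0 ≤ b) : ∫ ω, ‖Z ω‖ ∂P ≤ b := by
  have := h.norm.norm_integral_le hα hb
  exact (le_abs_self _).trans this

lemma of_tendsto {Z : Ω → F} {b : ℕ → ℝ} {l : ℝ} (h : ∀ n, LpLe P α Z (b n))
    (hl : Filter.Tendsto b Filter.atTop (nhds l)) : LpLe P α Z l :=
  ⟨(h 0).1, ge_of_tendsto' ((ENNReal.continuous_ofReal.tendsto l).comp hl) fun n => (h n).2⟩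

end LpLe

lemma _root_.ProbabilityTheory.IdentDistrib.lpLe {Ω' : Type*} [MeasurableSpace Ω']
    {P' : Measure Ω'} [MeasurableSpace F] [BorelSpace F] [SecondCountableTopology F]
    {Z : Ω → F} {Z' : Ω' → F}
    {α b : ℝ} (h : IdentDistrib Z Z' P P') (hZ : LpLe P' α Z' b) : LpLe P α Z b :=
  ⟨h.aemeasurable_fst.aestronglyMeasurable, by rw [h.eLpNorm_eq]; exact hZ.2⟩

end LpLe

section Freeze

variable {S : Type*} [MeasurableSpace S]

section Fun

variable {Ω Ω' : Type*} [MeasurableSpace Ω] [MeasurableSpace Ω'] {P : Measure Ω}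
  [IsProbabilityMeasure P] {W : Ω → S} {G : Ω → Ω'}

/-- Independence makes the law of the pair a product measure, so this is Tonelli's theorem. -/
lemma _root_.ProbabilityTheory.IndepFun.lintegral_comp_prodMk (h : IndepFun W G P)
    (hW : Measurable W) (hG : Measurable G) {Φ : S × Ω' → ℝ≥0∞} (hΦ : Measurable Φ) :
    ∫⁻ ω, Φ (W ω, G ω) ∂P = ∫⁻ ω, ∫⁻ ω', Φ (W ω, G ω') ∂P ∂P := by
  have : IsProbabilityMeasure (P.map G) := Measure.isProbabilityMeasure_map hG.aemeasurable
  rw [← lintegral_map (g := fun ω => (W ω, G ω)) hΦ (hW.prodMk hG),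
    (indepFun_iff_map_prod_eq_prod_map_map hW.aemeasurable hG.aemeasurable).1 h,
    lintegral_prod _ hΦ.aemeasurable, lintegral_map hΦ.lintegral_prod_right' hW]
  exact lintegral_congr fun ω => lintegral_map (hΦ.comp measurable_prodMk_left) hG

lemma _root_.ProbabilityTheory.IndepFun.integral_comp_prodMk (h : IndepFun W G P)
    (hW : Measurable W) (hG : Measurable G) {Φ : S × Ω' → ℝ} (hΦ : Measurable Φ)
    (hint : Integrable (fun ω => Φ (W ω, G ω)) P) :
    ∫ ω, Φ (W ω, G ω) ∂P = ∫ ω, ∫ ω', Φ (W ω, G ω') ∂P ∂P := by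
  have : IsProbabilityMeasure (P.map G) := Measure.isProbabilityMeasure_map hG.aemeasurable
  have hWG := hW.prodMk hG
  have hΦs := hΦ.stronglyMeasurable
  have key := integral_map (φ := fun ω => (W ω, G ω)) hWG.aemeasurable (f := Φ) (μ := P)
    hΦs.aestronglyMeasurable
  have hint' := (integrable_map_measure (f := fun ω => (W ω, G ω)) (g := Φ) (μ := P)
    hΦs.aestronglyMeasurable hWG.aemeasurable).2 hint
  rw [(indepFun_iff_map_prod_eq_prod_map_map hW.aemeasurable hG.aemeasurable).1 h] at key hint'
  rw [← key, integral_prod _ hint', integral_map hW.aemeasurable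
    hΦs.integral_prod_right'.aestronglyMeasurable]
  exact integral_congr_ae (.of_forall fun ω => integral_map hG.aemeasurable
    (hΦ.comp measurable_prodMk_left).aestronglyMeasurable)

end Fun

variable {Ω S' : Type*} {m mΩ : MeasurableSpace Ω} {P : Measure Ω} {W : Ω → S}

lemma measurable_of_sub (hm : m ≤ mΩ) [MeasurableSpace S'] {Φ : S × Ω → S'}
    (hΦ : Measurable[(inferInstance : MeasurableSpace S).prod m] Φ) : Measurable Φ :=
  hΦ.mono (sup_le_sup le_rfl (MeasurableSpace.comap_mono hm)) le_rfl

/-- The identity, viewed as a map into Ω with the smaller sigma-algebra `m`, generates exactly `m`.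
Freezing relative to a sigma-algebra thus reduces to freezing relative to a random variable. -/
lemma _root_.ProbabilityTheory.Indep.indepFun_id
    (h : Indep (MeasurableSpace.comap W inferInstance) m P) :
    @IndepFun Ω S Ω mΩ inferInstance m W id P := by
  refine (IndepFun_iff_Indep (mγ := m) W id P).2 ?_
  rwa [MeasurableSpace.comap_id]

variable [IsProbabilityMeasure P]

/-- If `W` is independent of the sigma-algebra `m`, then in `Φ (W ω, ω)` with an
`m`-measurable dependence on the second argument the value of `W` may be frozen. -/
lemma lintegral_freeze (hm : m ≤ mΩ) (hW : Measurable W)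
    (h : Indep (MeasurableSpace.comap W inferInstance) m P) {Φ : S × Ω → ℝ≥0∞}
    (hΦ : Measurable[(inferInstance : MeasurableSpace S).prod m] Φ) :
    ∫⁻ ω, Φ (W ω, ω) ∂P = ∫⁻ ω, ∫⁻ ω', Φ (W ω, ω') ∂P ∂P :=
  @IndepFun.lintegral_comp_prodMk S _ Ω Ω mΩ m P _ W id h.indepFun_id hW (measurable_id'' hm) Φ hΦ

/-- Bochner version of `lintegral_freeze`. -/
lemma integral_freeze (hm : m ≤ mΩ) (hW : Measurable W)
    (h : Indep (MeasurableSpace.comap W inferInstance) m P) {Φ : S × Ω → ℝ}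
    (hΦ : Measurable[(inferInstance : MeasurableSpace S).prod m] Φ)
    (hint : Integrable (fun ω => Φ (W ω, ω)) P) :
    ∫ ω, Φ (W ω, ω) ∂P = ∫ ω, ∫ ω', Φ (W ω, ω') ∂P ∂P :=
  @IndepFun.integral_comp_prodMk S _ Ω Ω mΩ m P _ W id h.indepFun_id hW (measurable_id'' hm) Φ hΦ
    hint

/-- A bound on the frozen `L^{1/α}`-norms is inherited by the composition. -/
lemma LpLe.freeze {F : Type*} [NormedAddCommGroup F] [MeasurableSpace F] [BorelSpace F]
    [SecondCountableTopology F] (hm : m ≤ mΩ)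
    (hW : Measurable W) (h : Indep (MeasurableSpace.comap W inferInstance) m P) {Φ : S × Ω → F}
    (hΦ : Measurable[(inferInstance : MeasurableSpace S).prod m] Φ) {α : ℝ} (hα : 0 < α)
    {B : S → ℝ} (hB0 : ∀ ω, 0 ≤ B (W ω))
    (hB : ∀ ω, LpLe P α (fun ω' => Φ (W ω, ω')) (B (W ω))) {b : ℝ}
    (hb : LpLe P α (fun ω => B (W ω)) b) : LpLe P α (fun ω => Φ (W ω, ω)) b := by
  have hmeas : Measurable (fun ω => Φ (W ω, ω)) :=
    (measurable_of_sub hm hΦ).comp (hW.prodMk measurable_id)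
  refine ⟨hmeas.aestronglyMeasurable, le_trans ?_ hb.2⟩
  have hq0 : (ENNReal.ofReal α)⁻¹ ≠ 0 := by simp
  have hqt : (ENNReal.ofReal α)⁻¹ ≠ ∞ := by simpa using hα
  rw [eLpNorm_eq_lintegral_rpow_enorm_toReal hq0 hqt, eLpNorm_eq_lintegral_rpow_enorm_toReal hq0 hqt]
  set q := (ENNReal.ofReal α)⁻¹.toReal with hq
  have hqpos : 0 < q := ENNReal.toReal_pos hq0 hqt
  refine ENNReal.rpow_le_rpow ?_ (by positivity)
  rw [lintegral_freeze hm hW h (Φ := fun x => ‖Φ x‖ₑ ^ q) ((measurable_enorm.comp hΦ).pow_const q)]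
  refine lintegral_mono fun ω => ?_
  have h1 := (hB ω).2
  rw [eLpNorm_eq_lintegral_rpow_enorm_toReal hq0 hqt, ← hq, one_div] at h1
  have h2 := ENNReal.rpow_le_rpow h1 hqpos.le
  rw [ENNReal.rpow_inv_rpow hqpos.ne'] at h2
  refine h2.trans_eq ?_
  rw [Real.enorm_of_nonneg (hB0 ω)]

end Freeze

end MLPHoelder

end

/-! ### Backward Gronwall inequality; moment bounds for the forward field and its approximations. -/

section

namespace MLPHoelder

section Gronwall

lemma mul_integral_exp {a : ℝ} (ha : 0 < a) (t T : ℝ) :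
    a * ∫ r in t..T, Real.exp (a * (T - r)) = Real.exp (a * (T - t)) - 1 := by
  have hcont : Continuous fun r : ℝ => Real.exp (a * (T - r)) := by fun_prop
  have hd : ∀ r ∈ uIcc t T, HasDerivAt (fun r => -(Real.exp (a * (T - r)) / a))
      (Real.exp (a * (T - r))) r := by
    intro r _
    have h1 : HasDerivAt (fun r : ℝ => a * (T - r)) (a * (0 - 1)) r :=
      ((hasDerivAt_const r T).sub (hasDerivAt_id r)).const_mul a
    have h2 := ((h1.exp).div_const a).neg
    refine h2.congr_deriv ?_
    rw [zero_sub, mul_neg, mul_one, mul_neg, neg_div, neg_neg, mul_div_assoc, div_self ha.ne',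
      mul_one]
  rw [intervalIntegral.integral_eq_sub_of_hasDerivAt hd (hcont.intervalIntegrable _ _)]
  field_simp
  simp
  ring

lemma lintegral_exp_Icc {a t T : ℝ} (ha : 0 < a) (ht : t ≤ T) :
    ENNReal.ofReal a * ∫⁻ r in Icc t T, ENNReal.ofReal (Real.exp (a * (T - r)))
      = ENNReal.ofReal (Real.exp (a * (T - t)) - 1) := by
  have hcont : Continuous fun r : ℝ => Real.exp (a * (T - r)) := by fun_prop
  rw [← ofReal_integral_eq_lintegral_ofReal
    (hcont.continuousOn.integrableOn_Icc) (.of_forall fun r => (Real.exp_pos _).le),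
    ← ENNReal.ofReal_mul ha.le, ← mul_integral_exp ha, integral_Icc_eq_integral_Ioc,
    ← intervalIntegral.integral_of_le ht]

/-- Backward Gronwall inequality for bounded (not necessarily measurable) functions. -/
lemma gronwall_lintegral {c s T : ℝ} (hc : 0 < c) {w : ℝ → ℝ≥0∞} {A M : ℝ≥0∞} (hM : M ≠ ∞)
    (hwM : ∀ t ∈ Icc s T, w t ≤ M)
    (h : ∀ t ∈ Icc s T, w t ≤ A + ENNReal.ofReal c * ∫⁻ r in Icc t T, w r) :
    ∀ t ∈ Icc s T, w t ≤ A * ENNReal.ofReal (Real.exp (c * (T - t))) := by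
  -- The excess over the Gronwall bound is halved at each step, because c ∫ e^{2c(T-r)} dr over
  -- [t,T] is at most e^{2c(T-t)} / 2. Only the continuous majorants are ever integrated exactly, so
  -- `w` need not be measurable.
  have key : ∀ k : ℕ, ∀ t ∈ Icc s T, w t ≤ A * ENNReal.ofReal (Real.exp (c * (T - t)))
      + M * (2⁻¹ ^ k * ENNReal.ofReal (Real.exp (2 * c * (T - t)))) := by
    intro k
    induction k with
    | zero =>
      intro t ht
      refine (hwM t ht).trans (le_add_left ?_)
      rw [pow_zero, one_mul]
      refine le_mul_of_one_le_right' ?_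
      rw [ENNReal.one_le_ofReal]
      exact Real.one_le_exp (mul_nonneg (by positivity) (sub_nonneg.2 ht.2))
    | succ k ih =>
      intro t ht
      refine (h t ht).trans ?_
      have h1 : ∫⁻ r in Icc t T, w r ≤ ∫⁻ r in Icc t T,
          (A * ENNReal.ofReal (Real.exp (c * (T - r)))
            + M * (2⁻¹ ^ k * ENNReal.ofReal (Real.exp (2 * c * (T - r))))) :=
        setLIntegral_mono (by fun_prop) fun r hr => ih r ⟨ht.1.trans hr.1, hr.2⟩
      rw [lintegral_add_left (by fun_prop), lintegral_const_mul _ (by fun_prop),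
        lintegral_const_mul _ (by fun_prop), lintegral_const_mul _ (by fun_prop)] at h1
      have e1 := lintegral_exp_Icc hc ht.2
      have e2 := lintegral_exp_Icc (a := 2 * c) (by positivity) ht.2
      set I1 := ∫⁻ r in Icc t T, ENNReal.ofReal (Real.exp (c * (T - r)))
      set I2 := ∫⁻ r in Icc t T, ENNReal.ofReal (Real.exp (2 * c * (T - r)))
      have e3 : ENNReal.ofReal c * I2 ≤
          2⁻¹ * ENNReal.ofReal (Real.exp (2 * c * (T - t))) := by
        have : ENNReal.ofReal c * I2 = 2⁻¹ * (ENNReal.ofReal (2 * c) * I2) := by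
          rw [ENNReal.ofReal_mul (by norm_num), ENNReal.ofReal_ofNat, mul_assoc, ← mul_assoc 2⁻¹,
            ENNReal.inv_mul_cancel (by norm_num) (by norm_num), one_mul]
        rw [this, e2]
        gcongr
        linarith
      have e4 : A + ENNReal.ofReal c * (A * I1) = A * ENNReal.ofReal (Real.exp (c * (T - t))) := by
        have : ENNReal.ofReal (Real.exp (c * (T - t)))
            = 1 + ENNReal.ofReal (Real.exp (c * (T - t)) - 1) := by
          rw [← ENNReal.ofReal_one, ← ENNReal.ofReal_add zero_le_one]
          · congr 1; ring
          · exact sub_nonneg.2 (Real.one_le_exp (mul_nonneg hc.le (sub_nonneg.2 ht.2)))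
        rw [this, ← e1]
        ring
      calc A + ENNReal.ofReal c * ∫⁻ r in Icc t T, w r
          ≤ A + ENNReal.ofReal c * (A * I1 + M * (2⁻¹ ^ k * I2)) := by gcongr
        _ = (A + ENNReal.ofReal c * (A * I1)) + M * (2⁻¹ ^ k * (ENNReal.ofReal c * I2)) := by ring
        _ ≤ A * ENNReal.ofReal (Real.exp (c * (T - t)))
            + M * (2⁻¹ ^ k * (2⁻¹ * ENNReal.ofReal (Real.exp (2 * c * (T - t))))) := by
          rw [e4]; gcongr
        _ = _ := by rw [pow_succ]; ring
  intro t ht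
  have hlim : Filter.Tendsto (fun k : ℕ => A * ENNReal.ofReal (Real.exp (c * (T - t)))
      + M * (2⁻¹ ^ k * ENNReal.ofReal (Real.exp (2 * c * (T - t))))) Filter.atTop
      (nhds (A * ENNReal.ofReal (Real.exp (c * (T - t))) + M * (0 * ENNReal.ofReal
        (Real.exp (2 * c * (T - t)))))) := by
    refine tendsto_const_nhds.add (ENNReal.Tendsto.const_mul (ENNReal.Tendsto.mul_const
      (ENNReal.tendsto_pow_atTop_nhds_zero_of_lt_one ?_) (.inr ENNReal.ofReal_ne_top)) (.inr hM))
    exact ENNReal.inv_lt_one.2 (by norm_num)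
  simpa using ge_of_tendsto' hlim fun k => key k t ht

end Gronwall

set_option linter.unusedSectionVars false

lemma tendsto_error_bound (a : ℝ) : Filter.Tendsto (fun n : ℕ => a * (1 / √((n + 1 : ℕ) : ℝ)))
    Filter.atTop (nhds 0) := by
  have h : Filter.Tendsto (fun n : ℕ => 1 / √(n : ℝ)) Filter.atTop (nhds 0) := by
    simp only [one_div]
    exact tendsto_inv_atTop_zero.comp (Real.tendsto_sqrt_atTop.comp tendsto_natCast_atTop_atTop)
  simpa using (h.comp (Filter.tendsto_add_atTop_nat 1)).const_mul a

section Moments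

variable {E : Type*} [NormedAddCommGroup E] [NormedSpace ℝ E] [FiniteDimensional ℝ E]
  [MeasurableSpace E] [BorelSpace E] {Ω : Type*} [MeasurableSpace Ω] {P : Measure Ω}
  {p₁ p₂ c T : ℝ} {f : ℝ → ℝ} {g : E → ℝ} {V : ℝ → E → ℝ}
  {X : ℝ → ℝ → E → Ω → E} {r : Idx → Ω → ℝ} {Y : ℕ → Idx → ℝ → ℝ → E → Ω → E}

/-- Moment and Hölder bounds of a random field `A s t x`, `0 ≤ s ≤ t ≤ T`. -/
structure FieldBound (P : Measure Ω) (p₁ p₂ c T : ℝ) (V : ℝ → E → ℝ) (A : ℝ → ℝ → E → Ω → E) :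
    Prop where
  meas : ∀ s t : ℝ, 0 ≤ s → s ≤ t → t ≤ T → ∀ x, Measurable (A s t x)
  V_le : ∀ s t : ℝ, 0 ≤ s → s ≤ t → t ≤ T → ∀ x,
    LpLe P (1 / p₁) (fun ω => V t (A s t x ω)) (V s x)
  hoelder : ∀ s t s' t' : ℝ, 0 ≤ s → s ≤ s' → s ≤ t → s' ≤ t' → t ≤ T → t' ≤ T → ∀ x x' : E,
    LpLe P (1 / p₂) (fun ω => A s t x ω - A s' t' x' ω)
      ((V s x + V s' x') / 2 * ((√|s - s'| + √|t - t'|) / 2) + Real.exp (c * T) * ‖x - x'‖)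

/-- Two random fields whose difference has small Hölder constant. -/
structure Coupling (P : Measure Ω) (p₁ p₂ c T : ℝ) (V : ℝ → E → ℝ) (A B : ℝ → ℝ → E → Ω → E)
    (ε : ℝ) : Prop where
  left : FieldBound P p₁ p₂ c T V A
  right : FieldBound P p₁ p₂ c T V B
  diff : ∀ s t s' t' : ℝ, 0 ≤ s → s ≤ s' → s ≤ t → s' ≤ t' → t ≤ T → t' ≤ T → ∀ x x' : E,
    LpLe P (1 / p₂) (fun ω => (A s t x ω - B s t x ω) - (A s' t' x' ω - B s' t' x' ω))
      ((V s x + V s' x') / 2 * ((√|s - s'| + √|t - t'|) / 2 + ‖x - x'‖) * ε)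
  dist : ∀ s t : ℝ, 0 ≤ s → s ≤ t → t ≤ T → ∀ x,
    LpLe P (1 / p₂) (fun ω => A s t x ω - B s t x ω) (V s x * (√(t - s) / 2) * ε)

namespace FlowAssumptions

variable (hX : FlowAssumptions P p₁ p₂ c T f g V X)
include hX

/-- The second-order condition with the second pair collapsed onto `v`: its quadratic term vanishes.
-/
lemma abs_f_sub_le (v w : ℝ) : |f v - f w| ≤ c * |v - w| := by
  have := hX.f_diff v w v v
  simpa using this

/-- Collapsing the second pair onto `x` gives the weight (3V(x)+V(y))/4, and collapsing it onto `y`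
gives (V(x)+3V(y))/4. The mean of the two is the symmetric weight. -/
lemma abs_g_sub_le (x y : E) : |g x - g y| ≤ (V T x + V T y) / 2 * (‖x - y‖ / √T) := by
  have h1 := hX.g_diff x y x x
  have h2 := hX.g_diff y x y y
  simp only [sub_self, sub_zero, norm_zero, add_zero, mul_zero, zero_div] at h1 h2
  rw [abs_sub_comm, norm_sub_rev y x] at h2
  linarith

lemma continuous_V {t : ℝ} (ht : t ∈ Icc 0 T) : Continuous (V t) := by
  have := hX.V_cont.comp_continuous (f := fun x : E => (t, x)) (by fun_prop)
    fun x => ⟨ht, mem_univ _⟩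
  exact this

lemma measurable_X {s t : ℝ} (hs : 0 ≤ s) (hst : s ≤ t) (ht : t ≤ T) (x : E) :
    Measurable (X s t x) :=
  (hX.X_field s ⟨hs, hst.trans ht⟩).1 (⟨t, hst, ht⟩, x)

lemma V_pos {t : ℝ} (ht : t ∈ Icc 0 T) (x : E) : 0 < V t x :=
  one_pos.trans_le (hX.one_le_V t ht x)

end FlowAssumptions

namespace ApproxAssumptions

variable (hX : FlowAssumptions P p₁ p₂ c T f g V X) (hY : ApproxAssumptions P p₁ p₂ c T V X r Y)
include hY

lemma measurable_Y {n : ℕ} (hn : 1 ≤ n) (θ : Idx) {s t : ℝ} (hs : 0 ≤ s) (hst : s ≤ t)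
    (ht : t ≤ T) (x : E) : Measurable (Y n θ s t x) :=
  (hY.Y_field θ).1 (⟨n, hn⟩, ⟨(s, t), hs, hst, ht⟩, x)

/-- Finite-dimensional functionals of the approximating fields have laws independent of `θ`. -/
lemma identDistrib_comp {S : Type*} [MeasurableSpace S] {ι : Type*} (θ θ' : Idx)
    (q : ι → {n : ℕ // 1 ≤ n} × TimeDom T × E) {u : (ι → E) → S} (hu : Measurable u) :
    IdentDistrib (fun ω => u fun i => approxPath T Y θ ω (q i))
      (fun ω => u fun i => approxPath T Y θ' ω (q i)) P P :=
  ((hY.Y_ident θ).trans (hY.Y_ident θ').symm).comp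
    (u := fun y : {n : ℕ // 1 ≤ n} × TimeDom T × E → E => u fun i => y (q i))
    (hu.comp (measurable_pi_lambda _ fun i => measurable_pi_apply (q i)))

include hX

/-- At equal times the field sits at `x`, so the lower moment bound becomes a pointwise one. It
later allows factors e^{cT} to be absorbed into the weight V. -/
lemma exp_le_V [IsProbabilityMeasure P] {t : ℝ} (ht : t ∈ Icc 0 T) (x : E) :
    Real.exp (c * T) ≤ V t x := by
  have h1 := hY.le_V_moment 1 le_rfl t t ht.1 le_rfl ht.2 x
  have h2 : (fun ω => V t (Y 1 Idx.zero t t x ω)) =ᵐ[P] fun _ => V t x := by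
    filter_upwards [hY.Y_start 1 le_rfl t ht x] with ω hω
    rw [hω]
  rw [eLpNorm_congr_ae h2, eLpNorm_const _ (by simpa using one_pos.trans_le hX.one_le_p₁)
    (IsProbabilityMeasure.ne_zero P)] at h1
  simp only [measure_univ, ENNReal.one_rpow, mul_one] at h1
  rw [← ofReal_norm, ENNReal.ofReal_le_ofReal_iff (norm_nonneg _),
    Real.norm_of_nonneg (hX.V_pos ht x).le] at h1
  exact h1

/-- The hypotheses concern the index 0 only; equality of the path laws carries them to every `θ`. -/
lemma fieldBound_Y {n : ℕ} (hn : 1 ≤ n) (θ : Idx) :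
    FieldBound P p₁ p₂ c T V (Y n θ) := by
  have hp₁ : 0 < p₁ := one_pos.trans_le hX.one_le_p₁
  have hp₂ : 0 < p₂ := one_pos.trans_le hX.one_le_p₂
  refine ⟨fun s t hs hst ht x => hY.measurable_Y hn θ hs hst ht x, fun s t hs hst ht x => ?_,
    fun s t s' t' hs hss' hst hst' ht ht' x x' => ?_⟩
  · have hV := (hX.continuous_V ⟨hs.trans hst, ht⟩).measurable
    have := hY.identDistrib_comp θ Idx.zero (ι := Unit)
      (fun _ => (⟨n, hn⟩, ⟨(s, t), hs, hst, ht⟩, x)) (u := fun y => V t (y ())) (by fun_prop)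
    refine this.lpLe ((lpLe_iff hp₁).2 ⟨?_, hY.V_moment_le n hn s t hs hst ht x⟩)
    exact (hV.comp (hY.measurable_Y hn _ hs hst ht x)).aestronglyMeasurable
  · have := hY.identDistrib_comp θ Idx.zero (ι := Fin 2)
      ![(⟨n, hn⟩, ⟨(s, t), hs, hst, ht⟩, x),
        (⟨n, hn⟩, ⟨(s', t'), hs.trans hss', hst', ht'⟩, x')]
      (u := fun y => y 0 - y 1) (by fun_prop)
    refine this.lpLe ((lpLe_iff hp₂).2
      ⟨?_, hY.Y_hoelder n hn s t s' t' hs hss' hst hst' ht ht' x x'⟩)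
    exact ((hY.measurable_Y hn _ hs hst ht x).sub
      (hY.measurable_Y hn _ (hs.trans hss') hst' ht' x')).aestronglyMeasurable

lemma lpLe_error {n : ℕ} (hn : 1 ≤ n) {s t s' t' : ℝ} (hs : 0 ≤ s) (hss' : s ≤ s') (hst : s ≤ t)
    (hst' : s' ≤ t') (ht : t ≤ T) (ht' : t' ≤ T) (x x' : E) :
    LpLe P (1 / p₂) (fun ω => (Y n Idx.zero s t x ω - X s t x ω)
      - (Y n Idx.zero s' t' x' ω - X s' t' x' ω))
      ((V s x + V s' x') / 2 * ((√|s - s'| + √|t - t'|) / 2 + ‖x - x'‖) * (1 / √(n : ℝ))) := by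
  refine (lpLe_iff (one_pos.trans_le hX.one_le_p₂)).2
    ⟨?_, hY.Y_error n hn s t s' t' hs hss' hst hst' ht ht' x x'⟩
  exact (((hY.measurable_Y hn _ hs hst ht x).sub (hX.measurable_X hs hst ht x)).sub
    ((hY.measurable_Y hn _ (hs.trans hss') hst' ht' x').sub
      (hX.measurable_X (hs.trans hss') hst' ht' x'))).aestronglyMeasurable

/-- Comparison of (s,t,x) with (s,s,x), where both fields start at `x` and the error vanishes. -/
lemma lpLe_Y_sub_X {n : ℕ} (hn : 1 ≤ n) {s t : ℝ} (hs : 0 ≤ s) (hst : s ≤ t)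
    (ht : t ≤ T) (x : E) :
    LpLe P (1 / p₂) (fun ω => Y n Idx.zero s t x ω - X s t x ω)
      (V s x * (√(t - s) / 2) * (1 / √(n : ℝ))) := by
  have h := hY.lpLe_error hX hn hs le_rfl hst le_rfl ht (hst.trans ht) x x
  simp only [sub_self, abs_zero, Real.sqrt_zero, zero_add, norm_zero, add_zero, add_self_div_two,
    abs_of_nonneg (sub_nonneg.2 hst)] at h
  refine h.congr_ae ?_
  filter_upwards [hY.Y_start n hn s ⟨hs, hst.trans ht⟩ x, hY.X_start s ⟨hs, hst.trans ht⟩ x]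
    with ω h1 h2
  rw [h1, h2, sub_self, sub_zero]

lemma coupling_Y_X [IsProbabilityMeasure P] {n : ℕ} (hn : 1 ≤ n)
    (hXb : FieldBound P p₁ p₂ c T V X) :
    Coupling P p₁ p₂ c T V (Y n Idx.zero) X (1 / √(n : ℝ)) where
  left := hY.fieldBound_Y hX hn _
  right := hXb
  diff _ _ _ _ hs hss' hst hst' ht ht' x x' := hY.lpLe_error hX hn hs hss' hst hst' ht ht' x x'
  dist _ _ hs hst ht x := hY.lpLe_Y_sub_X hX hn hs hst ht x

/-- For the index 0 both fields are compared with X and the two errors are added. X drops out of the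
resulting difference, which involves only the path with one index and hence has the same law for
every `θ`. -/
lemma coupling_Y_Y [IsProbabilityMeasure P] {n k : ℕ} (hn : 1 ≤ n) (hk : 1 ≤ k) (θ : Idx) :
    Coupling P p₁ p₂ c T V (Y n θ) (Y k θ) (1 / √(n : ℝ) + 1 / √(k : ℝ)) := by
  have hp₂ : 1 / p₂ ≤ 1 := (div_le_one (one_pos.trans_le hX.one_le_p₂)).2 hX.one_le_p₂
  refine ⟨hY.fieldBound_Y hX hn θ, hY.fieldBound_Y hX hk θ,
    fun s t s' t' hs hss' hst hst' ht ht' x x' => ?_, fun s t hs hst ht x => ?_⟩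
  · have := hY.identDistrib_comp θ Idx.zero (ι := Fin 4)
      ![(⟨n, hn⟩, ⟨(s, t), hs, hst, ht⟩, x), (⟨k, hk⟩, ⟨(s, t), hs, hst, ht⟩, x),
        (⟨n, hn⟩, ⟨(s', t'), hs.trans hss', hst', ht'⟩, x'),
        (⟨k, hk⟩, ⟨(s', t'), hs.trans hss', hst', ht'⟩, x')]
      (u := fun y => (y 0 - y 1) - (y 2 - y 3)) (by fun_prop)
    refine this.lpLe ?_
    have hV : 0 ≤ (V s x + V s' x') / 2 * ((√|s - s'| + √|t - t'|) / 2 + ‖x - x'‖) := by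
      have := hX.V_pos ⟨hs, hst.trans ht⟩ x
      have := hX.V_pos ⟨hs.trans hss', hst'.trans ht'⟩ x'
      positivity
    have h := (hY.lpLe_error hX hn hs hss' hst hst' ht ht' x x').sub
      (hY.lpLe_error hX hk hs hss' hst hst' ht ht' x x') hp₂ (by positivity) (by positivity)
    rw [← mul_add] at h
    convert h using 2
    simp only [approxPath, Matrix.cons_val]
    abel
  · have := hY.identDistrib_comp θ Idx.zero (ι := Fin 2)
      ![(⟨n, hn⟩, ⟨(s, t), hs, hst, ht⟩, x), (⟨k, hk⟩, ⟨(s, t), hs, hst, ht⟩, x)]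
      (u := fun y => y 0 - y 1) (by fun_prop)
    refine this.lpLe ?_
    have hV : 0 ≤ V s x * (√(t - s) / 2) := by
      have := hX.V_pos ⟨hs, hst.trans ht⟩ x
      positivity
    have h := (hY.lpLe_Y_sub_X hX hn hs hst ht x).sub
      (hY.lpLe_Y_sub_X hX hk hs hst ht x) hp₂ (by positivity) (by positivity)
    rw [← mul_add] at h
    convert h using 2
    simp only [approxPath, Matrix.cons_val]
    abel

/-- X is the limit of its approximations. Fatou's lemma along an almost surely convergent
subsequence gives the moment of V, and the Hölder bound follows by adding the error bound and
letting n → ∞. -/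
lemma fieldBound_X [IsProbabilityMeasure P] : FieldBound P p₁ p₂ c T V X := by
  have hp₁ : 0 < p₁ := one_pos.trans_le hX.one_le_p₁
  have hp₂ : 0 < p₂ := one_pos.trans_le hX.one_le_p₂
  have hp₂' : 1 / p₂ ≤ 1 := (div_le_one hp₂).2 hX.one_le_p₂
  refine ⟨fun s t hs hst ht x => hX.measurable_X hs hst ht x, fun s t hs hst ht x => ?_,
    fun s t s' t' hs hss' hst hst' ht ht' x x' => ?_⟩
  · have hVc := hX.continuous_V ⟨hs.trans hst, ht⟩
    have hconv : Filter.Tendsto (fun n : ℕ => eLpNorm (Y (n + 1) Idx.zero s t x - X s t x)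
        (ENNReal.ofReal p₂) P) Filter.atTop (nhds 0) := by
      refine tendsto_of_tendsto_of_tendsto_of_le_of_le tendsto_const_nhds ?_ (fun _ => zero_le)
        (fun n => ((lpLe_iff hp₂).1 (hY.lpLe_Y_sub_X hX (Nat.le_add_left 1 n) hs hst ht x)).2)
      simpa [Function.comp_def] using (ENNReal.continuous_ofReal.tendsto _).comp
        (tendsto_error_bound (V s x * (√(t - s) / 2)))
    obtain ⟨ns, -, hns⟩ := (tendstoInMeasure_of_tendsto_eLpNorm (by simpa using hp₂)
      (fun n => (hY.measurable_Y (Nat.le_add_left 1 n) _ hs hst ht x).aestronglyMeasurable)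
      (hX.measurable_X hs hst ht x).aestronglyMeasurable hconv).exists_seq_tendsto_ae
    have hYm : ∀ n, AEStronglyMeasurable (fun ω => V t (Y (ns n + 1) Idx.zero s t x ω)) P :=
      fun n => (hVc.measurable.comp
        (hY.measurable_Y (Nat.le_add_left 1 _) _ hs hst ht x)).aestronglyMeasurable
    refine (lpLe_iff hp₁).2 ⟨(hVc.measurable.comp
      (hX.measurable_X hs hst ht x)).aestronglyMeasurable, ?_⟩
    refine (Lp.eLpNorm_lim_le_liminf_eLpNorm hYm _ ?_).trans
      (Filter.liminf_le_of_frequently_le' (Filter.Frequently.of_forall fun n =>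
        hY.V_moment_le _ (Nat.le_add_left 1 _) s t hs hst ht x))
    filter_upwards [hns] with ω hω
    exact (hVc.tendsto _).comp hω
  · have hV : 0 < (V s x + V s' x') / 2 := by
      have := hX.V_pos ⟨hs, hst.trans ht⟩ x
      have := hX.V_pos ⟨hs.trans hss', hst'.trans ht'⟩ x'
      positivity
    have h : ∀ n : ℕ, _ := fun n =>
      ((hY.fieldBound_Y hX (Nat.le_add_left 1 n) Idx.zero).hoelder s t s' t' hs hss' hst hst'
        ht ht' x x').sub
      (hY.lpLe_error hX (Nat.le_add_left 1 n) hs hss' hst hst' ht ht' x x') hp₂' (by positivity)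
        (by positivity)
    have h2 := LpLe.of_tendsto (Z := fun ω => X s t x ω - X s' t' x' ω) (P := P) (α := 1 / p₂)
      (fun n => (by convert h n using 2; abel)) (tendsto_const_nhds.add (tendsto_error_bound _))
    simpa using h2

end ApproxAssumptions

end Moments

end MLPHoelder

end

/-! ### Existence and uniqueness of the fixed point. -/

section

namespace MLPHoelder

set_option linter.unusedSectionVars false

section Clip

/-- The projection of `ℝ` onto `[0, T]`. -/
def clip (T t : ℝ) : ℝ := max 0 (min t T)

lemma clip_mem {T : ℝ} (hT : 0 ≤ T) (t : ℝ) : clip T t ∈ Icc 0 T :=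
  ⟨le_max_left _ _, max_le hT (min_le_right _ _)⟩

lemma clip_eq {T t : ℝ} (ht : t ∈ Icc 0 T) : clip T t = t := by
  rw [clip, min_eq_left ht.2, max_eq_right ht.1]

lemma measurable_clip (T : ℝ) : Measurable (clip T) :=
  measurable_const.max (measurable_id.min measurable_const)

/-- The random field `X` extended to all times by projecting them to `0 ≤ s ≤ t ≤ T`. -/
def clipFlow {E Ω : Type*} (T : ℝ) (X : ℝ → ℝ → E → Ω → E) (s t : ℝ) (x : E) (ω : Ω) : E :=
  X (clip T s) (max (clip T s) (clip T t)) x ω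

lemma clipFlow_eq {E Ω : Type*} {T : ℝ} {X : ℝ → ℝ → E → Ω → E} {s t : ℝ} (hs : 0 ≤ s)
    (hst : s ≤ t) (ht : t ≤ T) : clipFlow T X s t = X s t := by
  ext x ω
  rw [clipFlow, clip_eq ⟨hs, hst.trans ht⟩, clip_eq ⟨hs.trans hst, ht⟩, max_eq_right hst]

end Clip

variable {E : Type*} [NormedAddCommGroup E] [NormedSpace ℝ E] [FiniteDimensional ℝ E]
  [MeasurableSpace E] [BorelSpace E] {Ω : Type*} [MeasurableSpace Ω] {P : Measure Ω}
  {p₁ p₂ c T : ℝ} {f : ℝ → ℝ} {g : E → ℝ} {V : ℝ → E → ℝ} {X : ℝ → ℝ → E → Ω → E}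

/-- Projecting the times removes the constraint s ≤ t from the domain, so joint measurability holds
on an ordinary product space and parameter integrals can be formed. -/
lemma FlowAssumptions.measurable_clipFlow (hX : FlowAssumptions P p₁ p₂ c T f g V X) :
    Measurable (fun q : ((ℝ × E) × ℝ) × Ω => clipFlow T X q.1.1.1 q.1.2 q.1.1.2 q.2) := by
  have hT := hX.T_pos.le
  have h1 : Measurable (fun q : ((ℝ × E) × ℝ) × Ω =>
      (((⟨(clip T q.1.1.1, max (clip T q.1.1.1) (clip T q.1.2)), (clip_mem hT _).1,
        le_max_left _ _, max_le (clip_mem hT _).2 (clip_mem hT _).2⟩ : TimeDom T), q.1.1.2), q.2)) := by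
    refine Measurable.prodMk (Measurable.prodMk (Measurable.subtype_mk ?_) (by fun_prop))
      (by fun_prop)
    have := measurable_clip T
    fun_prop
  exact hX.X_meas.comp h1

/-- The fixed-point map `u ↦ 𝔼[g(X_{t,T}^x)] + ∫_t^T 𝔼[f(u(r, X_{t,r}^x))] dr`. -/
noncomputable def picard (P : Measure Ω) (T : ℝ) (f : ℝ → ℝ) (g : E → ℝ)
    (X : ℝ → ℝ → E → Ω → E) (u : ℝ → E → ℝ) (t : ℝ) (x : E) : ℝ :=
  (∫ ω, g (X t T x ω) ∂P) + ∫ r in t..T, ∫ ω, f (u r (X t r x ω)) ∂P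

/-- Jointly measurable functions with `|u| ≤ C V` on `[0, T] × E`. -/
structure Admissible (T : ℝ) (V : ℝ → E → ℝ) (u : ℝ → E → ℝ) (C : ℝ) : Prop where
  meas : Measurable (Function.uncurry u)
  le : ∀ t ∈ Icc 0 T, ∀ x, |u t x| ≤ C * V t x

namespace FlowAssumptions

variable [IsProbabilityMeasure P] (hX : FlowAssumptions P p₁ p₂ c T f g V X) {u v : ℝ → E → ℝ}
include hX

lemma measurable_mean (hu : Measurable (Function.uncurry u)) :
    Measurable (fun q : (ℝ × E) × ℝ => ∫ ω, f (u q.2 (clipFlow T X q.1.1 q.2 q.1.2 ω)) ∂P) := by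
  have h1 := hX.measurable_clipFlow
  have h2 : Measurable (fun q : ((ℝ × E) × ℝ) × Ω =>
      f (u q.1.2 (clipFlow T X q.1.1.1 q.1.2 q.1.1.2 q.2))) :=
    hX.f_cont.measurable.comp (hu.comp (f := fun q : ((ℝ × E) × ℝ) × Ω =>
      (q.1.2, clipFlow T X q.1.1.1 q.1.2 q.1.1.2 q.2)) (by fun_prop))
  exact (StronglyMeasurable.integral_prod_right' h2.stronglyMeasurable).measurable

lemma measurable_picard (hu : Measurable (Function.uncurry u)) :
    Measurable (Function.uncurry fun t x => picard P T f g X u (clip T t) x) := by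
  have hT := hX.T_pos.le
  have h1 := hX.measurable_clipFlow
  have h2 : Measurable (fun q : (ℝ × E) × Ω => g (clipFlow T X q.1.1 T q.1.2 q.2)) :=
    hX.g_cont.measurable.comp (h1.comp (f := fun q : (ℝ × E) × Ω => ((q.1, T), q.2))
      (by fun_prop))
  have h3 := (StronglyMeasurable.integral_prod_right' h2.stronglyMeasurable (ν := P)).measurable
  -- The variable lower limit of integration is encoded as a cut-off, which turns the time integral
  -- into an integral over ℝ with parameters.
  have h4 : Measurable (fun q : (ℝ × E) × ℝ => if clip T q.1.1 < q.2 ∧ q.2 ≤ T then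
      ∫ ω, f (u q.2 (clipFlow T X q.1.1 q.2 q.1.2 ω)) ∂P else 0) := by
    refine Measurable.ite ?_ (hX.measurable_mean hu) measurable_const
    exact (measurableSet_lt ((measurable_clip T).comp (measurable_fst.comp measurable_fst))
      measurable_snd).inter (measurableSet_le measurable_snd measurable_const)
  have h5 := (StronglyMeasurable.integral_prod_right' h4.stronglyMeasurable
    (ν := (volume : Measure ℝ))).measurable
  convert h3.add h5 using 1
  ext ⟨t, x⟩
  have ht := clip_mem hT t
  simp only [Function.uncurry, picard, Pi.add_apply]
  congr 1
  · have : clipFlow T X t T = X (clip T t) T := by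
      ext x ω
      rw [clipFlow, clip_eq (⟨hT, le_rfl⟩ : T ∈ Icc 0 T), max_eq_right ht.2]
    rw [this]
  · rw [intervalIntegral.integral_of_le ht.2, ← integral_indicator measurableSet_Ioc]
    refine integral_congr_ae (.of_forall fun r => ?_)
    by_cases hr : r ∈ Ioc (clip T t) T
    · have : clipFlow T X t r = X (clip T t) r := by
        ext x ω
        rw [clipFlow, clip_eq (⟨ht.1.trans hr.1.le, hr.2⟩ : r ∈ Icc 0 T), max_eq_right hr.1.le]
      simp only [indicator_of_mem hr]
      rw [if_pos (show clip T t < r ∧ r ≤ T from hr), this]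
    · simp only [indicator_of_notMem hr]
      rw [if_neg (show ¬ (clip T t < r ∧ r ≤ T) from hr)]

lemma abs_f_le (v : ℝ) : |f v| ≤ |f 0| + c * |v| := by
  have h1 := hX.abs_f_sub_le v 0
  have h2 := abs_sub_abs_le_abs_sub (f v) (f 0)
  simp only [sub_zero] at h1
  linarith

lemma measurable_comp_X (hu : Measurable (Function.uncurry u)) {t r : ℝ} (ht : 0 ≤ t) (htr : t ≤ r)
    (hr : r ≤ T) (x : E) : Measurable fun ω => u r (X t r x ω) :=
  hu.comp (measurable_const.prodMk (hX.measurable_X ht htr hr x))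

variable (hXb : FieldBound P p₁ p₂ c T V X)
include hXb

omit hXb in
lemma cost_le_one : 1 / p₁ ≤ 1 ∧ 1 / p₂ ≤ 1 :=
  ⟨(div_le_one (one_pos.trans_le hX.one_le_p₁)).2 hX.one_le_p₁,
    (div_le_one (one_pos.trans_le hX.one_le_p₂)).2 hX.one_le_p₂⟩

lemma lpLe_comp_X (hu : Measurable (Function.uncurry u)) {b t r : ℝ} (ht : 0 ≤ t) (htr : t ≤ r)
    (hr : r ≤ T) (hb : 0 ≤ b) (hub : ∀ y, |u r y| ≤ b * V r y) (x : E) :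
    LpLe P (1 / p₁) (fun ω => u r (X t r x ω)) (b * V t x) := by
  have h := (hXb.V_le t r ht htr hr x).const_mul b
  rw [abs_of_nonneg hb] at h
  exact h.mono_real (hX.measurable_comp_X hu ht htr hr x).aestronglyMeasurable fun _ => hub _

lemma lpLe_f_comp_X (hu : Measurable (Function.uncurry u)) {b t r : ℝ} (ht : 0 ≤ t) (htr : t ≤ r)
    (hr : r ≤ T) (hb : 0 ≤ b) (hub : ∀ y, |u r y| ≤ b * V r y) (x : E) :
    LpLe P (1 / p₁) (fun ω => f (u r (X t r x ω))) (|f 0| + c * (b * V t x)) := by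
  have hc := hX.c_pos
  have hV := hX.V_pos ⟨ht, htr.trans hr⟩ x
  have h1 := (hX.lpLe_comp_X hXb hu ht htr hr hb hub x).norm.const_mul c
  rw [abs_of_pos hc] at h1
  have h2 := (LpLe.const (P := P) (|f 0|) (1 / p₁)).add h1 (hX.cost_le_one).1
    (norm_nonneg _) (by positivity)
  rw [Real.norm_of_nonneg (abs_nonneg _)] at h2
  exact h2.mono_real (hX.f_cont.measurable.comp
    (hX.measurable_comp_X hu ht htr hr x)).aestronglyMeasurable fun _ => hX.abs_f_le _

lemma lpLe_g_X {t : ℝ} (ht : t ∈ Icc 0 T) (x : E) :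
    LpLe P (1 / p₁) (fun ω => g (X t T x ω)) (V t x) :=
  (hXb.V_le t T ht.1 ht.2 le_rfl x).mono_real (hX.g_cont.measurable.comp
    (hX.measurable_X ht.1 ht.2 le_rfl x)).aestronglyMeasurable fun _ => hX.g_growth _

lemma abs_mean_le (hu : Measurable (Function.uncurry u)) {b t r : ℝ} (ht : 0 ≤ t) (htr : t ≤ r)
    (hr : r ≤ T) (hb : 0 ≤ b) (hub : ∀ y, |u r y| ≤ b * V r y) (x : E) :
    |∫ ω, f (u r (X t r x ω)) ∂P| ≤ |f 0| + c * (b * V t x) :=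
  (hX.lpLe_f_comp_X hXb hu ht htr hr hb hub x).norm_integral_le (hX.cost_le_one).1 (by
    have := hX.c_pos
    have := hX.V_pos ⟨ht, htr.trans hr⟩ x
    positivity)

lemma intervalIntegrable_mean {C : ℝ} (hC : 0 ≤ C) (hu : Admissible T V u C) {t s s' : ℝ}
    (ht : 0 ≤ t) (hts : t ≤ s) (hss : s ≤ s') (hs' : s' ≤ T) (x : E) :
    IntervalIntegrable (fun r => ∫ ω, f (u r (X t r x ω)) ∂P) volume s s' := by
  rw [intervalIntegrable_iff_integrableOn_Ioc_of_le hss]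
  have hm : AEStronglyMeasurable (fun r => ∫ ω, f (u r (X t r x ω)) ∂P)
      (volume.restrict (Ioc s s')) := by
    have h1 : Measurable (fun r => ∫ ω, f (u r (clipFlow T X t r x ω)) ∂P) :=
      (hX.measurable_mean hu.meas).comp (measurable_const (a := (t, x)) |>.prodMk measurable_id)
    refine h1.aestronglyMeasurable.congr ?_
    filter_upwards [ae_restrict_mem measurableSet_Ioc] with r hr
    rw [clipFlow_eq ht (hts.trans hr.1.le) (hr.2.trans hs')]
  refine Integrable.of_bound (C := |f 0| + c * (C * V t x)) hm ?_
  filter_upwards [ae_restrict_mem measurableSet_Ioc] with r hr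
  exact hX.abs_mean_le hXb hu.meas ht (hts.trans hr.1.le) (hr.2.trans hs') hC
    (hu.le r ⟨ht.trans (hts.trans hr.1.le), hr.2.trans hs'⟩) x

lemma abs_mean_sub_le {C C' : ℝ} (hC : 0 ≤ C) (hC' : 0 ≤ C') (hu : Admissible T V u C)
    (hv : Admissible T V v C') {b t r : ℝ} (ht : 0 ≤ t) (htr : t ≤ r)
    (hr : r ≤ T) (hb : 0 ≤ b) (hub : ∀ y, |u r y - v r y| ≤ b * V r y) (x : E) :
    |(∫ ω, f (u r (X t r x ω)) ∂P) - ∫ ω, f (v r (X t r x ω)) ∂P| ≤ c * b * V t x := by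
  have hc := hX.c_pos
  have hV := hX.V_pos ⟨ht, htr.trans hr⟩ x
  have hr' : r ∈ Icc 0 T := ⟨ht.trans htr, hr⟩
  have h1 := hX.lpLe_f_comp_X hXb hu.meas ht htr hr hC (hu.le r hr') x
  have h2 := hX.lpLe_f_comp_X hXb hv.meas ht htr hr hC' (hv.le r hr') x
  rw [← integral_sub (h1.integrable (hX.cost_le_one).1)
    (h2.integrable (hX.cost_le_one).1)]
  have h3 := (hXb.V_le t r ht htr hr x).const_mul (c * b)
  rw [abs_of_nonneg (by positivity)] at h3
  refine (h3.mono_real (h1.1.sub h2.1) fun ω => ?_).norm_integral_le (hX.cost_le_one).1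
    (by positivity)
  rw [mul_assoc]
  exact (hX.abs_f_sub_le _ _).trans (mul_le_mul_of_nonneg_left (hub _) hc.le)

/-- The rate 2c is twice the Lipschitz constant: c ∫ e^{2c(T-r)} dr over [t,T] equals (e^{2c(T-t)} -
1)/2. The weight V passes through the mean because its moments along X do not grow. -/
lemma picard_sub_le {C C' M : ℝ} (hC : 0 ≤ C) (hC' : 0 ≤ C') (hM : 0 ≤ M)
    (hu : Admissible T V u C) (hv : Admissible T V v C')
    (h : ∀ t ∈ Icc 0 T, ∀ x, |u t x - v t x| ≤ M * Real.exp (2 * c * (T - t)) * V t x)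
    {t : ℝ} (ht : t ∈ Icc 0 T) (x : E) :
    |picard P T f g X u t x - picard P T f g X v t x|
      ≤ M / 2 * Real.exp (2 * c * (T - t)) * V t x := by
  have hc := hX.c_pos
  have hV := hX.V_pos ht x
  rw [picard, picard, add_sub_add_left_eq_sub, ← intervalIntegral.integral_sub
    (hX.intervalIntegrable_mean hXb hC hu ht.1 le_rfl ht.2 le_rfl x)
    (hX.intervalIntegrable_mean hXb hC' hv ht.1 le_rfl ht.2 le_rfl x)]
  have h1 := intervalIntegral.norm_integral_le_of_norm_le (μ := volume) (a := t) (b := T)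
    (f := fun r => (∫ ω, f (u r (X t r x ω)) ∂P) - ∫ ω, f (v r (X t r x ω)) ∂P)
    (g := fun r => (M * V t x * c) * Real.exp (2 * c * (T - r))) ht.2
    (.of_forall fun r hr => by
      have := hX.abs_mean_sub_le hXb hC hC' hu hv ht.1 hr.1.le hr.2
        (b := M * Real.exp (2 * c * (T - r))) (by positivity)
        (h r ⟨ht.1.trans hr.1.le, hr.2⟩) x
      refine this.trans_eq (by ring))
    (Continuous.intervalIntegrable (by fun_prop) _ _)
  refine h1.trans ?_
  rw [intervalIntegral.integral_const_mul]
  have h2 := mul_integral_exp (a := 2 * c) (by positivity) t T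
  have h3 : M * V t x * c * ∫ r in t..T, Real.exp (2 * c * (T - r))
      = M / 2 * V t x * (Real.exp (2 * c * (T - t)) - 1) := by rw [← h2]; ring
  rw [h3]
  nlinarith [mul_nonneg hM hV.le]

/-- The bound reproduces itself: the terminal value and (T-t)|f(0)| contribute at most V each, and
the Lipschitz part contributes 2(e^{c(T-t)} - 1)V. -/
lemma abs_picard_le (hu : Measurable (Function.uncurry u))
    (h : ∀ t ∈ Icc 0 T, ∀ x, |u t x| ≤ 2 * Real.exp (c * (T - t)) * V t x)
    {t : ℝ} (ht : t ∈ Icc 0 T) (x : E) :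
    |picard P T f g X u t x| ≤ 2 * Real.exp (c * (T - t)) * V t x := by
  have hc := hX.c_pos
  have hV := hX.V_pos ht x
  have h0 := (hX.lpLe_g_X hXb ht x).norm_integral_le (hX.cost_le_one).1 hV.le
  have h1 := intervalIntegral.norm_integral_le_of_norm_le (μ := volume) (a := t) (b := T)
    (f := fun r => ∫ ω, f (u r (X t r x ω)) ∂P)
    (g := fun r => |f 0| + (2 * V t x * c) * Real.exp (c * (T - r))) ht.2
    (.of_forall fun r hr => by
      have := hX.abs_mean_le hXb hu ht.1 hr.1.le hr.2
        (b := 2 * Real.exp (c * (T - r))) (by positivity)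
        (h r ⟨ht.1.trans hr.1.le, hr.2⟩) x
      refine this.trans_eq (by ring))
    (Continuous.intervalIntegrable (by fun_prop) _ _)
  rw [intervalIntegral.integral_add (Continuous.intervalIntegrable (by fun_prop) _ _)
    (Continuous.intervalIntegrable (by fun_prop) _ _), intervalIntegral.integral_const_mul,
    intervalIntegral.integral_const] at h1
  have h2 := mul_integral_exp hc t T
  have h3 : 2 * V t x * c * ∫ r in t..T, Real.exp (c * (T - r))
      = 2 * V t x * (Real.exp (c * (T - t)) - 1) := by rw [← h2]; ring
  have h4 : (T - t) • |f 0| ≤ V t x := by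
    refine le_trans ?_ (hX.f_zero t ht x)
    rw [smul_eq_mul, abs_mul, abs_of_pos hX.T_pos]
    gcongr
    linarith [ht.1]
  rw [picard]
  refine (abs_add_le _ _).trans ?_
  rw [Real.norm_eq_abs] at h0 h1
  linarith

/-- Picard iteration from zero. The iterates converge geometrically at each point; the pointwise
limit keeps measurability and growth, so no function space is needed. -/
lemma exists_fixedPoint :
    ∃ u : ℝ → E → ℝ, Measurable (Function.uncurry u) ∧
      (∀ t ∈ Icc 0 T, ∀ x, |u t x| ≤ 2 * Real.exp (c * (T - t)) * V t x) ∧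
      ∀ t ∈ Icc 0 T, ∀ x, u t x = picard P T f g X u t x := by
  have hc := hX.c_pos
  have hT := hX.T_pos
  set K := 2 * Real.exp (c * T) with hK
  have hK0 : 0 ≤ K := by positivity
  have hexp : ∀ t ∈ Icc 0 T, 2 * Real.exp (c * (T - t)) ≤ K := fun t ht => by
    have : c * (T - t) ≤ c * T := by nlinarith [ht.1]
    exact mul_le_mul_of_nonneg_left (Real.exp_le_exp.2 this) (by norm_num)
  -- Times are clipped so that every iterate is measurable on all of ℝ × E.
  let w : ℕ → ℝ → E → ℝ := fun n => Nat.rec (fun _ _ => 0)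
    (fun _ u t x => picard P T f g X u (clip T t) x) n
  have hw0 : ∀ t x, w 0 t x = 0 := fun _ _ => rfl
  have hws : ∀ n t x, w (n + 1) t x = picard P T f g X (w n) (clip T t) x := fun _ _ _ => rfl
  have hclip : ∀ n t x, w n (clip T t) x = w n t x := by
    intro n t x
    cases n with
    | zero => rfl
    | succ n => rw [hws, hws, clip_eq (clip_mem hT.le t)]
  have hmeas : ∀ n, Measurable (Function.uncurry (w n)) := by
    intro n
    induction n with
    | zero => exact measurable_const
    | succ n ih => exact hX.measurable_picard ih
  have hle : ∀ n, ∀ t ∈ Icc 0 T, ∀ x, |w n t x| ≤ 2 * Real.exp (c * (T - t)) * V t x := by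
    intro n
    induction n with
    | zero =>
      intro t ht x
      have := hX.V_pos ht x
      rw [hw0, abs_zero]; positivity
    | succ n ih =>
      intro t ht x
      rw [hws, clip_eq ht]
      exact hX.abs_picard_le hXb (hmeas n) ih ht x
  have hadm : ∀ n, Admissible T V (w n) K := fun n => ⟨hmeas n, fun t ht x =>
    (hle n t ht x).trans (mul_le_mul_of_nonneg_right (hexp t ht) (hX.V_pos ht x).le)⟩
  have hdiff : ∀ n, ∀ t ∈ Icc 0 T, ∀ x,
      |w n t x - w (n + 1) t x| ≤ (K * (1 / 2) ^ n) * Real.exp (2 * c * (T - t)) * V t x := by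
    intro n
    induction n with
    | zero =>
      intro t ht x
      rw [hw0, zero_sub, abs_neg, pow_zero, mul_one]
      refine ((hadm 1).le t ht x).trans ?_
      have h1 : 1 ≤ Real.exp (2 * c * (T - t)) :=
        Real.one_le_exp (mul_nonneg (by positivity) (sub_nonneg.2 ht.2))
      have := hX.V_pos ht x
      gcongr
      exact le_mul_of_one_le_right hK0 h1
    | succ n ih =>
      intro t ht x
      rw [hws, hws (n + 1), clip_eq ht]
      refine (hX.picard_sub_le hXb hK0 hK0 (by positivity) (hadm n) (hadm (n + 1)) ih ht x).trans_eq
        ?_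
      ring
  have hdist : ∀ t ∈ Icc 0 T, ∀ x n,
      dist (w n t x) (w (n + 1) t x) ≤ (K * Real.exp (2 * c * (T - t)) * V t x) * (1 / 2) ^ n :=
    fun t ht x n => (hdiff n t ht x).trans_eq (by ring)
  have hlim : ∀ t x, ∃ l, Filter.Tendsto (fun n => w n t x) Filter.atTop (nhds l) := by
    intro t x
    simp only [← hclip _ t x]
    exact cauchySeq_tendsto_of_complete (cauchySeq_of_le_geometric _ _ (by norm_num)
      (hdist _ (clip_mem hT.le t) x))
  choose u hu using hlim
  have hum : Measurable (Function.uncurry u) :=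
    measurable_of_tendsto_metrizable hmeas (tendsto_pi_nhds.2 fun q => hu q.1 q.2)
  have hule : ∀ t ∈ Icc 0 T, ∀ x, |u t x| ≤ 2 * Real.exp (c * (T - t)) * V t x :=
    fun t ht x => le_of_tendsto' (hu t x).abs fun n => hle n t ht x
  have huadm : Admissible T V u K := ⟨hum, fun t ht x =>
    (hule t ht x).trans (mul_le_mul_of_nonneg_right (hexp t ht) (hX.V_pos ht x).le)⟩
  refine ⟨u, hum, hule, fun t ht x => ?_⟩
  have hnear : ∀ n, ∀ t ∈ Icc 0 T, ∀ x,
      |w n t x - u t x| ≤ (2 * K * (1 / 2) ^ n) * Real.exp (2 * c * (T - t)) * V t x := by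
    intro n t ht x
    have := dist_le_of_le_geometric_of_tendsto (1 / 2) _ (by norm_num) (hdist t ht x) (hu t x) n
    refine this.trans_eq ?_
    ring
  have h1 : Filter.Tendsto (fun n => w (n + 1) t x) Filter.atTop
      (nhds (picard P T f g X u t x)) := by
    refine tendsto_iff_dist_tendsto_zero.2 (squeeze_zero (fun _ => dist_nonneg)
      (g := fun n : ℕ => (K * Real.exp (2 * c * (T - t)) * V t x) * (1 / 2) ^ n)
      (fun n => ?_) ?_)
    · rw [hws, clip_eq ht, Real.dist_eq]
      refine (hX.picard_sub_le hXb hK0 hK0 (by positivity) (hadm n) huadm (hnear n) ht x).trans_eq ?_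
      ring
    · simpa using (tendsto_pow_atTop_nhds_zero_of_lt_one (r := (1 / 2 : ℝ)) (by norm_num)
        (by norm_num)).const_mul (K * Real.exp (2 * c * (T - t)) * V t x)
  exact tendsto_nhds_unique ((Filter.tendsto_add_atTop_iff_nat 1).2 (hu t x)) h1

/-- Applying the contraction n times bounds the difference by a multiple of 2^{-n}. -/
lemma fixedPoint_unique {C C' : ℝ} (hC : 0 ≤ C) (hC' : 0 ≤ C') (hu : Admissible T V u C)
    (hv : Admissible T V v C') (hup : ∀ t ∈ Icc 0 T, ∀ x, u t x = picard P T f g X u t x)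
    (hvp : ∀ t ∈ Icc 0 T, ∀ x, v t x = picard P T f g X v t x) :
    ∀ t ∈ Icc 0 T, ∀ x, u t x = v t x := by
  have hc := hX.c_pos
  have key : ∀ n : ℕ, ∀ t ∈ Icc 0 T, ∀ x,
      |u t x - v t x| ≤ ((C + C') * (1 / 2) ^ n) * Real.exp (2 * c * (T - t)) * V t x := by
    intro n
    induction n with
    | zero =>
      intro t ht x
      have h1 : 1 ≤ Real.exp (2 * c * (T - t)) :=
        Real.one_le_exp (mul_nonneg (by positivity) (sub_nonneg.2 ht.2))
      have h2 : |u t x - v t x| ≤ (C + C') * V t x := by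
        refine (abs_sub _ _).trans ?_
        rw [add_mul]
        exact add_le_add (hu.le t ht x) (hv.le t ht x)
      have := hX.V_pos ht x
      refine h2.trans ?_
      rw [pow_zero, mul_one]
      exact mul_le_mul_of_nonneg_right (le_mul_of_one_le_right (by positivity) h1) this.le
    | succ n ih =>
      intro t ht x
      rw [hup t ht x, hvp t ht x]
      refine (hX.picard_sub_le hXb hC hC' (by positivity) hu hv ih ht x).trans_eq ?_
      ring
  intro t ht x
  have hlim : Filter.Tendsto (fun n : ℕ => ((C + C') * (1 / 2) ^ n) *
      Real.exp (2 * c * (T - t)) * V t x) Filter.atTop (nhds 0) := by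
    have := ((tendsto_pow_atTop_nhds_zero_of_lt_one (r := (1 / 2 : ℝ)) (by norm_num)
      (by norm_num)).const_mul (C + C')).mul_const (Real.exp (2 * c * (T - t)) * V t x)
    simpa [mul_assoc] using this
  have := ge_of_tendsto' hlim fun n => key n t ht x
  exact sub_eq_zero.1 (abs_eq_zero.1 (le_antisymm this (abs_nonneg _)))

lemma isFixedPointSolution {C : ℝ} (hC : 0 ≤ C) (hu : Admissible T V u C)
    (hup : ∀ t ∈ Icc 0 T, ∀ x, u t x = picard P T f g X u t x) :
    IsFixedPointSolution P T f g V X u where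
  meas := hu.meas.comp (f := fun q : Icc (0 : ℝ) T × E => ((q.1 : ℝ), q.2)) (by fun_prop)
  eq t ht x := hup t ht x
  finite t ht x := by
    have hα := (hX.cost_le_one).1
    refine ENNReal.add_lt_top.2 ⟨ENNReal.add_lt_top.2 ⟨?_, ?_⟩, ?_⟩
    · have h := (hX.lpLe_g_X hXb ht x).lintegral_le hα
      simp only [Real.enorm_eq_ofReal_abs] at h
      exact h.trans_lt ENNReal.ofReal_lt_top
    · refine (setLIntegral_mono (g := fun _ => ENNReal.ofReal (|f 0| + c * (C * V t x)))
        measurable_const fun r hr => ?_).trans_lt ?_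
      · have h := (hX.lpLe_f_comp_X hXb hu.meas ht.1 hr.1 hr.2 hC
          (hu.le r ⟨ht.1.trans hr.1, hr.2⟩) x).lintegral_le hα
        simpa only [Real.enorm_eq_ofReal_abs] using h
      · rw [setLIntegral_const, Real.volume_Icc]
        exact ENNReal.mul_lt_top ENNReal.ofReal_lt_top ENNReal.ofReal_lt_top
    · refine lt_of_le_of_lt (b := ENNReal.ofReal C) ?_ ENNReal.ofReal_lt_top
      refine iSup₂_le fun r hr => iSup_le fun ξ => ENNReal.ofReal_le_ofReal ?_
      rw [div_le_iff₀ (hX.V_pos hr ξ)]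
      exact hu.le r hr ξ

omit hXb in
-- A solution is only known to be measurable and bounded by V on [0,T]. Clipping the time extends it
-- to a function to which uniqueness applies; the finite supremum of |v|/V serves as the constant.
lemma admissible_clip_of_isFixedPointSolution (hv : IsFixedPointSolution P T f g V X v) :
    ∃ C, 0 ≤ C ∧ Admissible T V (fun t x => v (clip T t) x) C ∧
      ∀ t ∈ Icc 0 T, ∀ x, v (clip T t) x
        = picard P T f g X (fun t x => v (clip T t) x) t x := by
  have hT := hX.T_pos.le
  have hfin : (⨆ r ∈ Icc 0 T, ⨆ ξ : E, ENNReal.ofReal (|v r ξ| / V r ξ)) < ∞ :=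
    (le_add_left le_rfl).trans_lt (hv.finite 0 ⟨le_rfl, hT⟩ 0)
  set S := ⨆ r ∈ Icc 0 T, ⨆ ξ : E, ENNReal.ofReal (|v r ξ| / V r ξ) with hS
  refine ⟨S.toReal, ENNReal.toReal_nonneg, ⟨?_, fun t ht x => ?_⟩, fun t ht x => ?_⟩
  · exact hv.meas.comp (f := fun q : ℝ × E => ((⟨clip T q.1, clip_mem hT _⟩ : Icc (0 : ℝ) T), q.2))
      ((Measurable.subtype_mk ((measurable_clip T).comp measurable_fst)).prodMk measurable_snd)
  · rw [clip_eq ht, ← div_le_iff₀ (hX.V_pos ht x)]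
    refine (ENNReal.ofReal_le_iff_le_toReal hfin.ne).1 ?_
    exact le_iSup_of_le t (le_iSup_of_le ht (le_iSup (fun ξ : E =>
      ENNReal.ofReal (|v t ξ| / V t ξ)) x))
  · rw [clip_eq ht, hv.eq t ht x, picard]
    congr 1
    refine intervalIntegral.integral_congr fun r hr => ?_
    rw [uIcc_of_le ht.2] at hr
    simp only [clip_eq (⟨ht.1.trans hr.1, hr.2⟩ : r ∈ Icc 0 T)]

end FlowAssumptions

end MLPHoelder

end

/-! ### Flow property, dynamic programming and Gronwall's inequality along the flow. -/

section

namespace MLPHoelder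

set_option linter.unusedSectionVars false

variable {E : Type*} [NormedAddCommGroup E] [NormedSpace ℝ E] [FiniteDimensional ℝ E]
  [MeasurableSpace E] [BorelSpace E] {Ω : Type*} [MeasurableSpace Ω] {P : Measure Ω}
  {p₁ p₂ c T : ℝ} {f : ℝ → ℝ} {g : E → ℝ} {V : ℝ → E → ℝ} {X : ℝ → ℝ → E → Ω → E}

namespace FlowAssumptions

section Flow

variable [IsProbabilityMeasure P] (hX : FlowAssumptions P p₁ p₂ c T f g V X)
  {ι : Type*} [Fintype ι]
include hX

/-- The flow started at time `t` generates a sub-sigma-algebra of the ambient one. -/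
lemma comap_flow_le {t : ℝ} (ht : t ∈ Icc 0 T) :
    MeasurableSpace.comap (fun (ω : Ω) (q : Icc t T × E) => X t q.1 q.2 ω) MeasurableSpace.pi
      ≤ (inferInstance : MeasurableSpace Ω) :=
  (measurable_pi_lambda _ fun q => (hX.X_field t ht).1 q).comap_le

lemma indep_flow {s t : ℝ} (hs : 0 ≤ s) (hst : s ≤ t) (ht : t ≤ T) (x : ι → E) :
    Indep (MeasurableSpace.comap (fun ω i => X s t (x i) ω) inferInstance)
      (MeasurableSpace.comap (fun (ω : Ω) (q : Icc t T × E) => X t q.1 q.2 ω)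
        MeasurableSpace.pi) P := by
  have h := (IndepFun_iff_Indep _ _ _).1 (hX.flow_indep s t hs hst ht)
  refine indep_of_indep_of_le_left h ?_
  have : (fun ω i => X s t (x i) ω) = (fun (y : E → E) i => y (x i)) ∘ fun ω x => X s t x ω := rfl
  rw [this, ← MeasurableSpace.comap_comp]
  exact MeasurableSpace.comap_mono
    (measurable_pi_lambda _ fun i => measurable_pi_apply (x i)).comap_le

lemma measurable_flow {S : Type*} [MeasurableSpace S] {t r : ℝ} (ht : 0 ≤ t) (htr : t ≤ r)
    (hr : r ≤ T) {F : (ι → E) → S} (hF : Measurable F) :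
    Measurable[(inferInstance : MeasurableSpace (ι → E)).prod
      (MeasurableSpace.comap (fun (ω : Ω) (q : Icc t T × E) => X t q.1 q.2 ω) MeasurableSpace.pi)]
      (fun q : (ι → E) × Ω => F fun i => X t r (q.1 i) q.2) := by
  refine hF.comp ?_
  refine @measurable_pi_lambda _ _ _ (_) _ _ fun i => ?_
  have h := (hX.X_field t ⟨ht, htr.trans hr⟩).2
  refine h.comp (g := fun q : (Icc t T × E) × Ω => X t q.1.1 q.1.2 q.2)
    (f := fun q : (ι → E) × Ω => (((⟨r, htr, hr⟩ : Icc t T), q.1 i), q.2)) ?_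
  refine @Measurable.prodMk _ _ _ (_) (_) (_) _ _ ?_ (@measurable_snd _ _ _ (_))
  refine @Measurable.prodMk _ _ _ (_) (_) (_) _ _ measurable_const ?_
  exact (measurable_pi_apply i).comp (@measurable_fst _ _ _ (_))

lemma flow_ae {s t r : ℝ} (hs : 0 ≤ s) (hst : s ≤ t) (htr : t ≤ r) (hr : r ≤ T) (x : ι → E) :
    ∀ᵐ ω ∂P, (fun i => X t r (X s t (x i) ω) ω) = fun i => X s r (x i) ω := by
  filter_upwards [ae_all_iff.2 fun i => hX.flow s t r hs hst htr hr (x i)] with ω hω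
  exact funext hω

/-- The position at time t is independent of the flow started at t. Unfreezing it produces X_{t,r}
evaluated at X_{s,t}, which the flow property identifies with X_{s,r}. All starting points are moved
by the same ω, as is needed for differences. -/
lemma lintegral_flow {s t r : ℝ} (hs : 0 ≤ s) (hst : s ≤ t) (htr : t ≤ r) (hr : r ≤ T)
    (x : ι → E) {F : (ι → E) → ℝ≥0∞} (hF : Measurable F) :
    ∫⁻ ω, ∫⁻ ω', F (fun i => X t r (X s t (x i) ω) ω') ∂P ∂P
      = ∫⁻ ω, F (fun i => X s r (x i) ω) ∂P := by
  have ht := hs.trans hst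
  have h := lintegral_freeze (hX.comap_flow_le ⟨ht, htr.trans hr⟩)
    (measurable_pi_lambda _ fun i => hX.measurable_X hs hst (htr.trans hr) (x i))
    (hX.indep_flow hs hst (htr.trans hr) x) (hX.measurable_flow ht htr hr hF)
  refine h.symm.trans (lintegral_congr_ae ?_)
  filter_upwards [hX.flow_ae hs hst htr hr x] with ω hω
  simp only [hω]

lemma integral_flow {s t r : ℝ} (hs : 0 ≤ s) (hst : s ≤ t) (htr : t ≤ r) (hr : r ≤ T)
    (x : E) {F : E → ℝ} (hF : Measurable F) (hint : Integrable (fun ω => F (X s r x ω)) P) :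
    ∫ ω, ∫ ω', F (X t r (X s t x ω) ω') ∂P ∂P = ∫ ω, F (X s r x ω) ∂P := by
  have ht := hs.trans hst
  have hae : (fun ω => F (X t r (X s t x ω) ω)) =ᵐ[P] fun ω => F (X s r x ω) := by
    filter_upwards [hX.flow s t r hs hst htr hr x] with ω hω
    rw [hω]
  have h := integral_freeze (P := P) (hX.comap_flow_le ⟨ht, htr.trans hr⟩)
    (measurable_pi_lambda _ fun _ : Unit => hX.measurable_X hs hst (htr.trans hr) x)
    (hX.indep_flow hs hst (htr.trans hr) fun _ : Unit => x)
    (hX.measurable_flow ht htr hr (F := fun z : Unit → E => F (z ())) (by fun_prop))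
    (hint.congr hae.symm)
  exact h.symm.trans (integral_congr_ae hae)

variable (hXb : FieldBound P p₁ p₂ c T V X) {u : ℝ → E → ℝ} {C : ℝ}
include hXb

/-- Dynamic programming principle. -/
lemma dynamic_programming (hC : 0 ≤ C) (hu : Admissible T V u C)
    (hup : ∀ t ∈ Icc 0 T, ∀ x, u t x = picard P T f g X u t x)
    {s t : ℝ} (hs : 0 ≤ s) (hst : s ≤ t) (ht : t ≤ T) (x : E) :
    u s x = (∫ ω, u t (X s t x ω) ∂P) + ∫ r in s..t, ∫ ω, f (u r (X s r x ω)) ∂P := by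
  have hc := hX.c_pos
  have hα := (hX.cost_le_one).1
  have ht0 := hs.trans hst
  have hs' : s ∈ Icc 0 T := ⟨hs, hst.trans ht⟩
  have hmean : Measurable fun q : Ω × ℝ =>
      ∫ ω', f (u q.2 (clipFlow T X t q.2 (X s t x q.1) ω')) ∂P :=
    (hX.measurable_mean hu.meas).comp (f := fun q : Ω × ℝ => ((t, X s t x q.1), q.2))
      ((measurable_const.prodMk ((hX.measurable_X hs hst ht x).comp measurable_fst)).prodMk
        measurable_snd)
  have hcl : ∀ r ∈ Ioc t T, ∀ z, ∫ ω', f (u r (clipFlow T X t r z ω')) ∂P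
      = ∫ ω', f (u r (X t r z ω')) ∂P := fun r hr z => by
    rw [clipFlow_eq ht0 hr.1.le hr.2]
  have hVint := (hXb.V_le s t hs hst ht x).integrable hα
  have hint : Integrable (fun q : Ω × ℝ =>
      ∫ ω', f (u q.2 (clipFlow T X t q.2 (X s t x q.1) ω')) ∂P)
      (P.prod (volume.restrict (Ioc t T))) := by
    have hb : Integrable (fun q : Ω × ℝ => |f 0| + c * (C * V t (X s t x q.1)))
        (P.prod (volume.restrict (Ioc t T))) :=
      ((integrable_const _).add ((hVint.const_mul C).const_mul c)).comp_fst _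
    refine hb.mono' hmean.aestronglyMeasurable ?_
    have : ∀ᵐ q ∂(P.prod (volume.restrict (Ioc t T))), q.2 ∈ Ioc t T :=
      Measure.quasiMeasurePreserving_snd.ae (ae_restrict_mem measurableSet_Ioc)
    filter_upwards [this] with q hq
    rw [hcl q.2 hq]
    exact hX.abs_mean_le hXb hu.meas ht0 hq.1.le hq.2 hC (hu.le _ ⟨ht0.trans hq.1.le, hq.2⟩) _
  -- The equation for u at time t is inserted at the random point X_{s,t}^x; after interchanging
  -- integrals, the flow property collapses each double mean into a single one started at s.
  have h1 : ∫ ω, u t (X s t x ω) ∂P = (∫ ω, ∫ ω', g (X t T (X s t x ω) ω') ∂P ∂P)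
      + ∫ ω, (∫ r in Ioc t T, ∫ ω', f (u r (clipFlow T X t r (X s t x ω) ω')) ∂P) ∂P := by
    rw [← integral_add]
    · refine integral_congr_ae (.of_forall fun ω => ?_)
      simp only
      rw [hup t ⟨ht0, ht⟩, picard, intervalIntegral.integral_of_le ht]
      congr 1
      exact setIntegral_congr_fun measurableSet_Ioc fun r hr => (hcl r hr _).symm
    · have hm : Measurable (fun q : Ω × Ω => g (clipFlow T X t T (X s t x q.1) q.2)) :=
        hX.g_cont.measurable.comp (hX.measurable_clipFlow.comp
          (f := fun q : Ω × Ω => (((t, X s t x q.1), T), q.2))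
          (((measurable_const.prodMk ((hX.measurable_X hs hst ht x).comp measurable_fst)).prodMk
            measurable_const).prodMk measurable_snd))
      rw [clipFlow_eq ht0 ht le_rfl] at hm
      refine hVint.mono' (StronglyMeasurable.integral_prod_right'
        hm.stronglyMeasurable).aestronglyMeasurable (.of_forall fun ω => ?_)
      exact (hX.lpLe_g_X hXb ⟨ht0, ht⟩ _).norm_integral_le hα (hX.V_pos ⟨ht0, ht⟩ _).le
    · exact hint.integral_prod_left
  have h2 : ∫ ω, (∫ r in Ioc t T, ∫ ω', f (u r (clipFlow T X t r (X s t x ω) ω')) ∂P) ∂P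
      = ∫ r in t..T, ∫ ω, f (u r (X s r x ω)) ∂P := by
    rw [integral_integral_swap hint, intervalIntegral.integral_of_le ht]
    refine setIntegral_congr_fun measurableSet_Ioc fun r hr => ?_
    simp only [hcl r hr]
    have hr0 : r ∈ Icc 0 T := ⟨ht0.trans hr.1.le, hr.2⟩
    exact hX.integral_flow hs hst hr.1.le hr.2 x (F := fun z => f (u r z))
      (hX.f_cont.measurable.comp (hu.meas.comp measurable_prodMk_left))
      ((hX.lpLe_f_comp_X hXb hu.meas hs (hst.trans hr.1.le) hr.2 hC (hu.le r hr0) x).integrable hα)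
  rw [h1, h2, hX.integral_flow hs hst ht le_rfl x hX.g_cont.measurable
    ((hX.lpLe_g_X hXb hs' x).integrable hα), hup s hs', picard, add_assoc, add_comm (∫ r in t..T, _),
    intervalIntegral.integral_add_adjacent_intervals
      (hX.intervalIntegrable_mean hXb hC hu hs le_rfl hst ht x)
      (hX.intervalIntegrable_mean hXb hC hu hs hst ht le_rfl x)]

/-- The fixed-point equation is linear in g and in f(u), so it holds for linear combinations before
absolute values are taken; this keeps the cancellation in differences. -/
lemma enorm_sum_fixedPoint_le (hC : 0 ≤ C) (hu : Admissible T V u C)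
    (hup : ∀ t ∈ Icc 0 T, ∀ x, u t x = picard P T f g X u t x) (a : ι → ℝ) {t : ℝ}
    (ht : t ∈ Icc 0 T) (z : ι → E) :
    ‖∑ i, a i * u t (z i)‖ₑ ≤ (∫⁻ ω, ‖∑ i, a i * g (X t T (z i) ω)‖ₑ ∂P)
      + ∫⁻ r in Icc t T, ∫⁻ ω, ‖∑ i, a i * f (u r (X t r (z i) ω))‖ₑ ∂P := by
  have hα := (hX.cost_le_one).1
  have h1 : ∑ i, a i * u t (z i) = (∫ ω, ∑ i, a i * g (X t T (z i) ω) ∂P)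
      + ∫ r in Ioc t T, ∫ ω, ∑ i, a i * f (u r (X t r (z i) ω)) ∂P := by
    rw [integral_finsetSum _ fun i _ => ((hX.lpLe_g_X hXb ht (z i)).integrable hα).const_mul _]
    have h2 : ∫ r in Ioc t T, ∫ ω, ∑ i, a i * f (u r (X t r (z i) ω)) ∂P
        = ∫ r in Ioc t T, ∑ i, a i * ∫ ω, f (u r (X t r (z i) ω)) ∂P := by
      refine setIntegral_congr_fun measurableSet_Ioc fun r hr => ?_
      rw [integral_finsetSum _ fun i _ => ((hX.lpLe_f_comp_X hXb hu.meas ht.1 hr.1.le hr.2 hC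
        (hu.le r ⟨ht.1.trans hr.1.le, hr.2⟩) (z i)).integrable hα).const_mul _]
      simp only [integral_const_mul]
    rw [h2, integral_finsetSum _ fun i _ =>
      ((intervalIntegrable_iff_integrableOn_Ioc_of_le ht.2).1
        (hX.intervalIntegrable_mean hXb hC hu ht.1 le_rfl ht.2 le_rfl (z i))).const_mul _,
      ← Finset.sum_add_distrib]
    refine Finset.sum_congr rfl fun i _ => ?_
    rw [integral_const_mul, integral_const_mul, ← mul_add, hup t ht, picard,
      intervalIntegral.integral_of_le ht.2]
  rw [h1]
  refine (enorm_add_le _ _).trans (add_le_add (enorm_integral_le_lintegral_enorm _) ?_)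
  refine (enorm_integral_le_lintegral_enorm _).trans ?_
  refine (lintegral_mono_set Ioc_subset_Icc_self).trans ?_
  exact lintegral_mono fun r => enorm_integral_le_lintegral_enorm _

/-- Gronwall argument along the flow for linear combinations of values of a fixed point. -/
lemma gronwall_flow (hX₀ : ∀ s ∈ Icc 0 T, ∀ x, ∀ᵐ ω ∂P, X s s x ω = x)
    (hC : 0 ≤ C) (hu : Admissible T V u C)
    (hup : ∀ t ∈ Icc 0 T, ∀ x, u t x = picard P T f g X u t x) (a : ι → ℝ)
    {S : ℝ → (ι → E) → ℝ≥0∞} (hSm : Measurable (Function.uncurry S))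
    (hS : ∀ r ∈ Icc 0 T, ∀ z : ι → E, ‖∑ i, a i * f (u r (z i))‖ₑ
      ≤ ENNReal.ofReal c * ‖∑ i, a i * u r (z i)‖ₑ + S r z)
    {s : ℝ} (hs : s ∈ Icc 0 T) (x : ι → E) {A B : ℝ≥0∞}
    (hA : ∫⁻ ω, ‖∑ i, a i * g (X s T (x i) ω)‖ₑ ∂P ≤ A)
    (hB : ∀ r ∈ Icc s T, ∫⁻ ω, S r (fun i => X s r (x i) ω) ∂P ≤ B) :
    ‖∑ i, a i * u s (x i)‖ₑ
      ≤ (A + B * ENNReal.ofReal T) * ENNReal.ofReal (Real.exp (c * (T - s))) := by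
  have hα := (hX.cost_le_one).1
  have hclip := hX.measurable_clipFlow
  have hum : ∀ i, Measurable fun q : ℝ × (ι → E) => u q.1 (q.2 i) := fun i =>
    hu.meas.comp (f := fun q : ℝ × (ι → E) => (q.1, q.2 i)) (by fun_prop)
  -- The Gronwall function is the mean absolute value of the combination transported along the flow
  -- from s. At time s it is the deterministic quantity to be bounded, because X_{s,s} is the
  -- identity almost surely.
  set w : ℝ → ℝ≥0∞ := fun t => ∫⁻ ω, ‖∑ i, a i * u t (X s t (x i) ω)‖ₑ ∂P with hw
  set H : ℝ → (ι → E) → ℝ≥0∞ := fun r z =>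
    ENNReal.ofReal c * ‖∑ i, a i * u r (z i)‖ₑ + S r z with hH
  have hHm : Measurable (Function.uncurry H) := by
    refine Measurable.add (Measurable.const_mul (Measurable.enorm ?_) _) hSm
    exact Finset.measurable_sum _ fun i _ => (hum i).const_mul _
  have hwM : ∀ t ∈ Icc s T, w t ≤ ENNReal.ofReal (∑ i, |a i| * (C * V s (x i))) := by
    intro t ht
    have ht0 : t ∈ Icc 0 T := ⟨hs.1.trans ht.1, ht.2⟩
    refine (LpLe.sum (P := P) (α := 1 / p₁) hα (fun i _ => ?_) fun i _ =>
      (hX.lpLe_comp_X hXb hu.meas hs.1 ht.1 ht.2 hC (hu.le t ht0) (x i)).const_mul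
        (a i)).lintegral_le hα
    have := hX.V_pos hs (x i)
    positivity
  -- The fixed-point equation at time t is used at the transported points. Averaging over X_{s,t}
  -- turns the terms back into means along the flow from s, that is into `A`, `w` and the source.
  have hstep : ∀ t ∈ Icc s T,
      w t ≤ (A + B * ENNReal.ofReal T) + ENNReal.ofReal c * ∫⁻ r in Icc t T, w r := by
    intro t ht
    have ht0 : t ∈ Icc 0 T := ⟨hs.1.trans ht.1, ht.2⟩
    have hWm : ∀ i, Measurable (X s t (x i)) := fun i => hX.measurable_X hs.1 ht.1 ht.2 (x i)
    have h1 : w t ≤ ∫⁻ ω, ((∫⁻ ω', ‖∑ i, a i * g (X t T (X s t (x i) ω) ω')‖ₑ ∂P)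
        + ∫⁻ r in Icc t T, ∫⁻ ω', H r (fun i => clipFlow T X t r (X s t (x i) ω) ω') ∂P) ∂P := by
      refine lintegral_mono fun ω => ?_
      refine (hX.enorm_sum_fixedPoint_le hXb hC hu hup a ht0 _).trans (add_le_add le_rfl ?_)
      refine setLIntegral_mono' measurableSet_Icc fun r hr => ?_
      rw [clipFlow_eq ht0.1 hr.1 hr.2]
      exact lintegral_mono fun ω' => hS r ⟨ht0.1.trans hr.1, hr.2⟩ _
    have hm1 : Measurable fun q : Ω × Ω => ‖∑ i, a i * g (X t T (X s t (x i) q.1) q.2)‖ₑ := by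
      refine Measurable.enorm (Finset.measurable_sum _ fun i _ => Measurable.const_mul ?_ _)
      have h2 := hclip.comp (f := fun q : Ω × Ω => (((t, X s t (x i) q.1), T), q.2))
        (by have := hWm i; fun_prop)
      have h3 : ((fun q : ((ℝ × E) × ℝ) × Ω => clipFlow T X q.1.1.1 q.1.2 q.1.1.2 q.2) ∘
          fun q : Ω × Ω => (((t, X s t (x i) q.1), T), q.2))
          = fun q : Ω × Ω => X t T (X s t (x i) q.1) q.2 := by
        ext q
        simp only [Function.comp, clipFlow_eq ht0.1 ht0.2 le_rfl]
      rw [h3] at h2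
      exact hX.g_cont.measurable.comp h2
    have hm2 : Measurable fun q : (Ω × ℝ) × Ω =>
        H q.1.2 (fun i => clipFlow T X t q.1.2 (X s t (x i) q.1.1) q.2) := by
      refine hHm.comp (f := fun q : (Ω × ℝ) × Ω =>
        (q.1.2, fun i => clipFlow T X t q.1.2 (X s t (x i) q.1.1) q.2)) ?_
      refine Measurable.prodMk (by fun_prop) (measurable_pi_lambda _ fun i => ?_)
      exact hclip.comp (f := fun q : (Ω × ℝ) × Ω => (((t, X s t (x i) q.1.1), q.1.2), q.2))
        (by have := hWm i; fun_prop)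
    refine h1.trans ?_
    rw [lintegral_add_left hm1.lintegral_prod_right']
    have h4 : ∫⁻ ω, ∫⁻ ω', ‖∑ i, a i * g (X t T (X s t (x i) ω) ω')‖ₑ ∂P ∂P
        = ∫⁻ ω, ‖∑ i, a i * g (X s T (x i) ω)‖ₑ ∂P :=
      hX.lintegral_flow hs.1 ht.1 ht.2 le_rfl x (F := fun z => ‖∑ i, a i * g (z i)‖ₑ)
        (Measurable.enorm (Finset.measurable_sum _ fun i _ =>
          (hX.g_cont.measurable.comp (measurable_pi_apply i)).const_mul _))
    have h5 : ∫⁻ ω, (∫⁻ r in Icc t T, ∫⁻ ω', H r (fun i => clipFlow T X t r (X s t (x i) ω) ω')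
        ∂P) ∂P = ∫⁻ r in Icc t T, ∫⁻ ω, H r (fun i => X s r (x i) ω) ∂P := by
      rw [lintegral_lintegral_swap hm2.lintegral_prod_right'.aemeasurable]
      refine setLIntegral_congr_fun measurableSet_Icc fun r hr => ?_
      rw [clipFlow_eq ht0.1 hr.1 hr.2]
      exact hX.lintegral_flow hs.1 ht.1 hr.1 hr.2 x (F := H r) hHm.of_uncurry_left
    rw [h4, h5]
    have h6 : ∫⁻ r in Icc t T, ∫⁻ ω, H r (fun i => X s r (x i) ω) ∂P
        ≤ ∫⁻ r in Icc t T, (ENNReal.ofReal c * w r + B) := by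
      refine setLIntegral_mono' measurableSet_Icc fun r hr => ?_
      have hr' : r ∈ Icc s T := ⟨ht.1.trans hr.1, hr.2⟩
      simp only [hH, hw]
      rw [lintegral_add_left, lintegral_const_mul' _ _ ENNReal.ofReal_ne_top]
      · exact add_le_add le_rfl (hB r hr')
      · refine Measurable.const_mul (Measurable.enorm (Finset.measurable_sum _ fun i _ =>
          Measurable.const_mul ?_ _)) _
        exact hX.measurable_comp_X hu.meas hs.1 hr'.1 hr'.2 (x i)
    rw [lintegral_add_right _ measurable_const, lintegral_const_mul' _ _ ENNReal.ofReal_ne_top,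
      setLIntegral_const, Real.volume_Icc] at h6
    calc _ ≤ A + ((ENNReal.ofReal c * ∫⁻ r in Icc t T, w r) + B * ENNReal.ofReal (T - t)) :=
          add_le_add hA h6
      _ ≤ A + ((ENNReal.ofReal c * ∫⁻ r in Icc t T, w r) + B * ENNReal.ofReal T) := by
          gcongr
          linarith [ht0.1]
      _ = _ := by ring
  have h := gronwall_lintegral hX.c_pos ENNReal.ofReal_ne_top hwM hstep s ⟨le_rfl, hs.2⟩
  have h0 : w s = ‖∑ i, a i * u s (x i)‖ₑ := by
    have : (fun ω => ‖∑ i, a i * u s (X s s (x i) ω)‖ₑ) =ᵐ[P]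
        fun _ => ‖∑ i, a i * u s (x i)‖ₑ := by
      filter_upwards [ae_all_iff.2 fun i => hX₀ s hs (x i)] with ω hω
      simp only [hω]
    simp only [hw]
    rw [lintegral_congr_ae this, lintegral_const, measure_univ, mul_one]
  rwa [h0] at h

end Flow

end FlowAssumptions

end MLPHoelder

end

/-! ### Spatial first- and second-order estimates for the solution. -/

section

namespace MLPHoelder

set_option linter.unusedSectionVars false

/-- From x ≤ e^{x-1} and 1/e < 37/100. It converts each factor cT into a power of e^{cT}. -/
lemma le_mul_exp (x : ℝ) : x ≤ 37 / 100 * Real.exp x := by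
  have h1 := Real.add_one_le_exp (x - 1)
  rw [Real.exp_sub] at h1
  have h2 := Real.exp_one_gt_d9
  have h3 : Real.exp x / Real.exp 1 ≤ 37 / 100 * Real.exp x := by
    rw [div_le_iff₀ (Real.exp_pos 1)]
    nlinarith [Real.exp_pos x]
  linarith

/-- Trades a time increment for its square root, the parabolic scale of the Hölder norm. -/
lemma le_sqrt_mul_sqrt {a T : ℝ} (h : a ≤ T) : a ≤ √a * √T := by
  rcases le_total a 0 with ha | ha
  · exact ha.trans (by positivity)
  · calc a = √a * √a := (Real.mul_self_sqrt ha).symm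
      _ ≤ √a * √T := by gcongr

section Monomials

variable {Ω : Type*} [MeasurableSpace Ω] {P : Measure Ω} [IsProbabilityMeasure P]
  {v d₁ d₂ : Ω → ℝ} {α₁ α₂ α b b₁ b₂ : ℝ}

/-- Hölder's inequality for `k` weights and one distance: the costs add, and any slack up to `α` is
given away. -/
lemma LpLe.pow_mul (hv : LpLe P α₁ v b) (h₁ : LpLe P α₂ d₁ b₁) (hα₁ : 0 ≤ α₁) (hα₂ : 0 ≤ α₂)
    (hb : 0 ≤ b) (k : ℕ) (hα : k * α₁ + α₂ ≤ α) :
    LpLe P α (fun ω => v ω ^ k * d₁ ω) (b ^ k * b₁) :=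
  ((hv.pow hα₁ hb k).mul h₁ (by positivity) hα₂ (by positivity)).mono_cost hα

lemma LpLe.pow_mul_mul (hv : LpLe P α₁ v b) (h₁ : LpLe P α₂ d₁ b₁) (h₂ : LpLe P α₂ d₂ b₂)
    (hα₁ : 0 ≤ α₁) (hα₂ : 0 ≤ α₂) (hb : 0 ≤ b) (hb₁ : 0 ≤ b₁) (k : ℕ)
    (hα : k * α₁ + 2 * α₂ ≤ α) :
    LpLe P α (fun ω => v ω ^ k * (d₁ ω * d₂ ω)) (b ^ k * (b₁ * b₂)) :=
  hv.pow_mul (h₁.mul h₂ hα₂ hα₂ hb₁) hα₁ (by positivity) hb k (by linarith)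

end Monomials

variable {E : Type*} [NormedAddCommGroup E] [NormedSpace ℝ E] [FiniteDimensional ℝ E]
  [MeasurableSpace E] [BorelSpace E] {Ω : Type*} [MeasurableSpace Ω] {P : Measure Ω}
  {p₁ p₂ c T : ℝ} {f : ℝ → ℝ} {g : E → ℝ} {V : ℝ → E → ℝ} {X : ℝ → ℝ → E → Ω → E}

/-- Regularity of the solution of the stochastic fixed-point equation. -/
structure SolutionBounds (c T : ℝ) (V : ℝ → E → ℝ) (u : ℝ → E → ℝ) : Prop where
  meas : Measurable (Function.uncurry u)
  growth : ∀ t ∈ Icc 0 T, ∀ x, |u t x| ≤ 2 * Real.exp (c * T) * V t x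
  hoelder : ∀ t t' : ℝ, 0 ≤ t → t ≤ t' → t' ≤ T → ∀ x x' : E,
    |u t x - u t' x'| ≤ 8 * Real.exp (c * T) ^ 2 * ((V t x + V t' x') / 2) *
      ((V t x + V t' x') / 2 * (√(t' - t) / √T) + ‖x - x'‖ / √T)
  second : ∀ t t' : ℝ, 0 ≤ t → t ≤ t' → t' ≤ T → ∀ x y x' y' : E,
    |(u t x - u t y) - (u t' x' - u t' y')| ≤ 9 * Real.exp (c * T) ^ 9 *
      ((V t x + V t y + V t' x' + V t' y') / 4) ^ 3 * (‖(x - y) - (x' - y')‖ / √T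
        + (‖x - y‖ + ‖x' - y'‖) * (√(t' - t) + ‖x - x'‖) / T)

namespace FlowAssumptions

variable [IsProbabilityMeasure P] (hX : FlowAssumptions P p₁ p₂ c T f g V X)
  (hXb : FieldBound P p₁ p₂ c T V X)
include hX

lemma costs : 0 ≤ 1 / p₁ ∧ 0 ≤ 1 / p₂ ∧ 6 * (1 / p₁) + 2 * (1 / p₂) ≤ 1 := by
  have h1 := hX.one_le_p₁
  have h2 := hX.one_le_p₂
  have h3 := hX.exponents
  refine ⟨by positivity, by positivity, ?_⟩
  rw [mul_one_div, mul_one_div]; exact h3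

lemma exp_facts : 1 ≤ Real.exp (c * T) ∧ c * T ≤ 37 / 100 * Real.exp (c * T) :=
  ⟨Real.one_le_exp (mul_nonneg hX.c_pos.le hX.T_pos.le), le_mul_exp _⟩

include hXb

lemma lpLe_V_avg₂ {s t : ℝ} (hs : 0 ≤ s) (hst : s ≤ t) (ht : t ≤ T) (x y : E) :
    LpLe P (1 / p₁) (fun ω => (V t (X s t x ω) + V t (X s t y ω)) / 2) ((V s x + V s y) / 2) := by
  have hs' : s ∈ Icc 0 T := ⟨hs, hst.trans ht⟩
  have h := ((hXb.V_le s t hs hst ht x).add (hXb.V_le s t hs hst ht y) (hX.cost_le_one).1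
    (hX.V_pos hs' x).le (hX.V_pos hs' y).le).const_mul (1 / 2)
  rw [abs_of_pos (by norm_num)] at h
  convert h using 2 <;> ring

lemma lpLe_V_avg₄ {s t : ℝ} (hs : 0 ≤ s) (hst : s ≤ t) (ht : t ≤ T) (x y x' y' : E) :
    LpLe P (1 / p₁) (fun ω => (V t (X s t x ω) + V t (X s t y ω) + V t (X s t x' ω)
      + V t (X s t y' ω)) / 4) ((V s x + V s y + V s x' + V s y') / 4) := by
  have hs' : s ∈ Icc 0 T := ⟨hs, hst.trans ht⟩
  have hp := fun z => hX.V_pos hs' z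
  have h := ((hX.lpLe_V_avg₂ hXb hs hst ht x y).add (hX.lpLe_V_avg₂ hXb hs hst ht x' y')
    (hX.cost_le_one).1 (by have := hp x; have := hp y; positivity)
    (by have := hp x'; have := hp y'; positivity)).const_mul (1 / 2)
  rw [abs_of_pos (by norm_num)] at h
  convert h using 2 <;> ring

lemma lpLe_X_sub_X {s t : ℝ} (hs : 0 ≤ s) (hst : s ≤ t) (ht : t ≤ T) (x y : E) :
    LpLe P (1 / p₂) (fun ω => ‖X s t x ω - X s t y ω‖) (Real.exp (c * T) * ‖x - y‖) := by
  simpa using (hXb.hoelder s t s t hs le_rfl hst hst ht ht x y).norm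

lemma lpLe_X_sub_const (hX₀ : ∀ s ∈ Icc 0 T, ∀ x, ∀ᵐ ω ∂P, X s s x ω = x)
    {s t : ℝ} (hs : 0 ≤ s) (hst : s ≤ t) (ht : t ≤ T) (x y : E) :
    LpLe P (1 / p₂) (fun ω => ‖X s t x ω - y‖) (V s x * (√(t - s) / 2) + ‖x - y‖) := by
  have hs' : s ∈ Icc 0 T := ⟨hs, hst.trans ht⟩
  have h1 := hXb.hoelder s t s s hs le_rfl hst le_rfl ht (hst.trans ht) x x
  simp only [sub_self, abs_zero, Real.sqrt_zero, zero_add, norm_zero, mul_zero, add_zero,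
    add_self_div_two, abs_of_nonneg (sub_nonneg.2 hst)] at h1
  have h2 := h1.add (LpLe.const (P := P) (x - y) (1 / p₂)) (hX.cost_le_one).2
    (by have := hX.V_pos hs' x; positivity) (norm_nonneg _)
  refine (h2.congr_ae ?_).norm
  filter_upwards [hX₀ s hs' x] with ω hω
  rw [hω]; abel

/-- The spatial Lipschitz estimate of a fixed point. -/
lemma abs_fixedPoint_sub_le (hX₀ : ∀ s ∈ Icc 0 T, ∀ x, ∀ᵐ ω ∂P, X s s x ω = x)
    {u : ℝ → E → ℝ} {C : ℝ} (hC : 0 ≤ C) (hu : Admissible T V u C)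
    (hup : ∀ t ∈ Icc 0 T, ∀ x, u t x = picard P T f g X u t x)
    {s : ℝ} (hs : s ∈ Icc 0 T) (x y : E) :
    |u s x - u s y| ≤ Real.exp (c * T) ^ 2 * ((V s x + V s y) / 2) * (‖x - y‖ / √T) := by
  obtain ⟨hα₁, hα₂, hα⟩ := hX.costs
  have hT := hX.T_pos
  have hc := hX.c_pos
  have hVx := hX.V_pos hs x
  have hVy := hX.V_pos hs y
  have hg : LpLe P 1 (fun ω => g (X s T x ω) - g (X s T y ω))
      ((V s x + V s y) / 2 * (1 / √T * (Real.exp (c * T) * ‖x - y‖))) := by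
    have h := (hX.lpLe_V_avg₂ hXb hs.1 hs.2 le_rfl x y).pow_mul (α := 1)
      ((hX.lpLe_X_sub_X hXb hs.1 hs.2 le_rfl x y).const_mul (1 / √T)) hα₁ hα₂ (by positivity) 1
      (by push_cast; linarith)
    rw [abs_of_nonneg (by positivity), pow_one] at h
    refine h.mono_real ((hX.g_cont.measurable.comp (hX.measurable_X hs.1 hs.2 le_rfl x)).sub
      (hX.g_cont.measurable.comp (hX.measurable_X hs.1 hs.2 le_rfl y))).aestronglyMeasurable
      fun ω => (hX.abs_g_sub_le _ _).trans_eq ?_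
    rw [pow_one]; ring
  -- The coefficients (1,-1) produce the first difference. Since f is Lipschitz, there is no source
  -- term.
  have h := hX.gronwall_flow hXb hX₀ hC hu hup (ι := Fin 2) ![1, -1] (S := fun _ _ => 0)
    measurable_const (fun r hr z => ?_) hs ![x, y]
    (A := ENNReal.ofReal ((V s x + V s y) / 2 * (1 / √T * (Real.exp (c * T) * ‖x - y‖)))) (B := 0)
    ?_ (by simp)
  · simp only [Fin.sum_univ_two, Matrix.cons_val_zero, Matrix.cons_val_one, one_mul, neg_mul,
      zero_mul, add_zero, ← sub_eq_add_neg] at h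
    rw [← ENNReal.ofReal_mul (by positivity), Real.enorm_eq_ofReal_abs,
      ENNReal.ofReal_le_ofReal_iff (by positivity)] at h
    refine h.trans ?_
    have h2 : Real.exp (c * (T - s)) ≤ Real.exp (c * T) := by
      refine Real.exp_le_exp.2 (by nlinarith [hs.1])
    calc _ ≤ (V s x + V s y) / 2 * (1 / √T * (Real.exp (c * T) * ‖x - y‖)) * Real.exp (c * T) := by
          gcongr
      _ = _ := by ring
  · simp only [Fin.sum_univ_two, Matrix.cons_val_zero, Matrix.cons_val_one, one_mul, neg_mul,
      add_zero, ← sub_eq_add_neg]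
    rw [Real.enorm_eq_ofReal_abs, Real.enorm_eq_ofReal_abs, ← ENNReal.ofReal_mul hc.le]
    exact ENNReal.ofReal_le_ofReal (hX.abs_f_sub_le _ _)
  · simpa [Fin.sum_univ_two, ← sub_eq_add_neg] using hg.lintegral_le le_rfl

omit hX hXb in
-- Here `x` stands for cT, `D` for the second difference of the points and `M` for the mixed
-- product. The coefficient of `M` collects 1/2 + 1/2 + 2·37/100 ≤ 2.
lemma fixedPoint_second_arith {e W D M x : ℝ} (he : 1 ≤ e) (hW : 1 ≤ W) (hD : 0 ≤ D) (hM : 0 ≤ M)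
    (hx : x ≤ 37 / 100 * e) :
    (W ^ 2 * D + (W ^ 2 / 2 + W * e ^ 2 / 2) * M + 2 * x * e ^ 6 * W ^ 2 * M) * e
      ≤ 2 * e ^ 8 * W ^ 2 * (D + M) := by
  have hW2 : W ≤ W ^ 2 := by nlinarith
  have he2 : e ^ 2 ≤ e ^ 7 := pow_le_pow_right₀ he (by norm_num)
  have he7 : 1 ≤ e ^ 7 := one_le_pow₀ he
  have k1 : W ^ 2 ≤ e ^ 7 * W ^ 2 := le_mul_of_one_le_left (by positivity) he7
  have k2 : W * e ^ 2 ≤ W ^ 2 * e ^ 7 := by gcongr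
  have k3 : x * (e ^ 6 * W ^ 2) ≤ (37 / 100 * e) * (e ^ 6 * W ^ 2) := by gcongr
  have k4 : (37 / 100 * e) * (e ^ 6 * W ^ 2) = 37 / 100 * (e ^ 7 * W ^ 2) := by ring
  have h3 : W ^ 2 / 2 + W * e ^ 2 / 2 + 2 * x * e ^ 6 * W ^ 2 ≤ 2 * (e ^ 7 * W ^ 2) := by
    have : 0 ≤ e ^ 7 * W ^ 2 := by positivity
    linarith
  have h4 : W ^ 2 ≤ 2 * (e ^ 7 * W ^ 2) := by
    have : 0 ≤ e ^ 7 * W ^ 2 := by positivity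
    linarith
  calc _ = (W ^ 2 * D + (W ^ 2 / 2 + W * e ^ 2 / 2 + 2 * x * e ^ 6 * W ^ 2) * M) * e := by ring
    _ ≤ (2 * (e ^ 7 * W ^ 2) * D + 2 * (e ^ 7 * W ^ 2) * M) * e := by gcongr
    _ = _ := by ring

/-- The spatial second-order estimate of a fixed point. -/
lemma abs_fixedPoint_second_le (hX₀ : ∀ s ∈ Icc 0 T, ∀ x, ∀ᵐ ω ∂P, X s s x ω = x)
    {u : ℝ → E → ℝ} {C : ℝ} (hC : 0 ≤ C) (hu : Admissible T V u C)
    (hup : ∀ t ∈ Icc 0 T, ∀ x, u t x = picard P T f g X u t x)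
    {s : ℝ} (hs : s ∈ Icc 0 T) (x y x' y' : E) :
    |(u s x - u s y) - (u s x' - u s y')| ≤ 2 * Real.exp (c * T) ^ 8 *
      ((V s x + V s y + V s x' + V s y') / 4) ^ 2 * (‖(x - y) - (x' - y')‖ / √T
        + (‖x - y‖ + ‖x' - y'‖) * ‖x - x'‖ / T) := by
  obtain ⟨hα₁, hα₂, hα⟩ := hX.costs
  obtain ⟨he, hcT⟩ := hX.exp_facts
  have hT := hX.T_pos
  have hc := hX.c_pos
  have h1V := fun z => hX.one_le_V s hs z
  have hα₂' := (hX.cost_le_one).2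
  set W := (V s x + V s y + V s x' + V s y') / 4 with hW
  have hW1 : 1 ≤ W := by linarith [h1V x, h1V y, h1V x', h1V y']
  set e := Real.exp (c * T) with he'
  set δ := ‖(x - y) - (x' - y')‖
  set η := ‖x - y‖ + ‖x' - y'‖
  set l := ‖x - x'‖
  have hδ : 0 ≤ δ := norm_nonneg _
  have hη : 0 ≤ η := by positivity
  have hl : 0 ≤ l := norm_nonneg _
  have hXm : ∀ {r}, s ≤ r → r ≤ T → ∀ z, Measurable (X s r z) := fun h1 h2 z =>
    hX.measurable_X hs.1 h1 h2 z
  have hdη : ∀ {r}, s ≤ r → r ≤ T → LpLe P (1 / p₂) (fun ω => ‖X s r x ω - X s r y ω‖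
      + ‖X s r x' ω - X s r y' ω‖) (e * η) := fun h1 h2 => by
    have h := (hX.lpLe_X_sub_X hXb hs.1 h1 h2 x y).add (hX.lpLe_X_sub_X hXb hs.1 h1 h2 x' y')
      hα₂' (by positivity) (by positivity)
    rwa [← mul_add] at h
  -- `A` bounds the mean second difference of g, with the linear and the quadratic part of the
  -- condition on g in this order. `B` bounds the quadratic remainder of f through two spatial
  -- Lipschitz estimates for u, each contributing e² and twice the four-point average of V.
  set A : ℝ := 1 / √T * (W * (W * (δ + η * l / (2 * √T)))) + 1 / (2 * T) * (W * (e * η * (e * l)))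
    with hA
  set B : ℝ := 2 * c * e ^ 4 / T * (W ^ 2 * (e * η * (e * l))) with hB
  have hA0 : 0 ≤ A := by positivity
  have hB0 : 0 ≤ B := by positivity
  have hg : LpLe P 1 (fun ω => (g (X s T x ω) - g (X s T y ω)) - (g (X s T x' ω) - g (X s T y' ω)))
      A := by
    have hv := hX.lpLe_V_avg₄ hXb hs.1 hs.2 le_rfl x y x' y'
    have hd : LpLe P (1 / p₂) (fun ω => ‖(X s T x ω - X s T y ω) - (X s T x' ω - X s T y' ω)‖)
        (W * (δ + η * l / (2 * √T))) :=
      ((lpLe_iff (one_pos.trans_le hX.one_le_p₂)).2 ⟨(((hXm hs.2 le_rfl x).sub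
        (hXm hs.2 le_rfl y)).sub ((hXm hs.2 le_rfl x').sub
        (hXm hs.2 le_rfl y'))).aestronglyMeasurable, hX.X_diff s T hs.1 hs.2 le_rfl x y x' y'⟩).norm
    have h1 := ((hv.pow_mul (α := 1) hd hα₁ hα₂ (by positivity) 1
      (by push_cast; linarith)).const_mul (1 / √T))
    have h2 := (hv.pow_mul_mul (α := 1) (hdη hs.2 le_rfl)
      (hX.lpLe_X_sub_X hXb hs.1 hs.2 le_rfl x x') hα₁ hα₂ (by positivity) (by positivity) 1
      (by push_cast; linarith)).const_mul (1 / (2 * T))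
    rw [abs_of_nonneg (by positivity), pow_one] at h1 h2
    refine (h1.add h2 le_rfl (by positivity) (by positivity)).mono_real
      ((((hX.g_cont.measurable.comp (hXm hs.2 le_rfl x))).sub
        (hX.g_cont.measurable.comp (hXm hs.2 le_rfl y))).sub
        ((hX.g_cont.measurable.comp (hXm hs.2 le_rfl x')).sub
        (hX.g_cont.measurable.comp (hXm hs.2 le_rfl y')))).aestronglyMeasurable
      fun ω => (hX.g_diff _ _ _ _).trans_eq ?_
    simp only [pow_one]; ring
  have hlip := fun {r : ℝ} (hr : r ∈ Icc 0 T) z z' =>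
    hX.abs_fixedPoint_sub_le hXb hX₀ hC hu hup hr z z'
  -- The quadratic remainder in the second-order condition on f; it is the source in Gronwall's
  -- inequality.
  let S : ℝ → (Fin 4 → E) → ℝ := fun r z =>
    c * (|u r (z 0) - u r (z 1)| + |u r (z 2) - u r (z 3)|) * |u r (z 0) - u r (z 2)| / 2
  have hSm : Measurable (Function.uncurry S) := by
    have h : ∀ i, Measurable fun q : ℝ × (Fin 4 → E) => u q.1 (q.2 i) := fun i =>
      hu.meas.comp (f := fun q : ℝ × (Fin 4 → E) => (q.1, q.2 i)) (by fun_prop)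
    have h' : ∀ i j, Measurable fun q : ℝ × (Fin 4 → E) => |u q.1 (q.2 i) - u q.1 (q.2 j)| :=
      fun i j => ((h i).sub (h j)).abs
    exact ((((h' 0 1).add (h' 2 3)).const_mul c).mul (h' 0 2)).div_const 2
  have hS : ∀ r ∈ Icc s T, LpLe P 1 (fun ω => S r ![X s r x ω, X s r y ω, X s r x' ω, X s r y' ω])
      B := by
    intro r hr
    have hr' : r ∈ Icc 0 T := ⟨hs.1.trans hr.1, hr.2⟩
    have h2 := ((hX.lpLe_V_avg₄ hXb hs.1 hr.1 hr.2 x y x' y').pow_mul_mul (α := 1)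
      (hdη hr.1 hr.2) (hX.lpLe_X_sub_X hXb hs.1 hr.1 hr.2 x x') hα₁ hα₂ (by positivity)
      (by positivity) 2 (by push_cast; linarith)).const_mul (2 * c * e ^ 4 / T)
    rw [abs_of_nonneg (by positivity)] at h2
    refine h2.mono_real ?_ fun ω => ?_
    · refine (hSm.of_uncurry_left.comp (measurable_pi_lambda _ fun i => ?_)).aestronglyMeasurable
      fin_cases i
      exacts [hXm hr.1 hr.2 x, hXm hr.1 hr.2 y, hXm hr.1 hr.2 x', hXm hr.1 hr.2 y']
    · simp only [S, Matrix.cons_val]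
      set a₀ := X s r x ω
      set a₁ := X s r y ω
      set a₂ := X s r x' ω
      set a₃ := X s r y' ω
      have hp := fun z => hX.V_pos hr' z
      set v := (V r a₀ + V r a₁ + V r a₂ + V r a₃) / 4 with hv
      have hv0 : 0 < v := by have := hp a₀; have := hp a₁; have := hp a₂; have := hp a₃; positivity
      have k1 : |u r a₀ - u r a₁| ≤ e ^ 2 * (2 * v) * (‖a₀ - a₁‖ / √T) :=
        (hlip hr' _ _).trans (by gcongr; linarith [hp a₂, hp a₃])
      have k2 : |u r a₂ - u r a₃| ≤ e ^ 2 * (2 * v) * (‖a₂ - a₃‖ / √T) :=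
        (hlip hr' _ _).trans (by gcongr; linarith [hp a₀, hp a₁])
      have k3 : |u r a₀ - u r a₂| ≤ e ^ 2 * (2 * v) * (‖a₀ - a₂‖ / √T) :=
        (hlip hr' _ _).trans (by gcongr; linarith [hp a₁, hp a₃])
      rw [Real.norm_of_nonneg (by positivity)]
      calc _ ≤ c * (e ^ 2 * (2 * v) * (‖a₀ - a₁‖ / √T) + e ^ 2 * (2 * v) * (‖a₂ - a₃‖ / √T))
            * (e ^ 2 * (2 * v) * (‖a₀ - a₂‖ / √T)) / 2 := by gcongr
        _ = 2 * c * e ^ 4 / (√T * √T) * (v ^ 2 * ((‖a₀ - a₁‖ + ‖a₂ - a₃‖) * ‖a₀ - a₂‖)) := by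
          field_simp
        _ = _ := by rw [Real.mul_self_sqrt hT.le]
  have hfun : ∀ r ω, (fun i => X s r (![x, y, x', y'] i) ω)
      = ![X s r x ω, X s r y ω, X s r x' ω, X s r y' ω] := fun r ω => by
    ext i; fin_cases i <;> rfl
  -- The coefficients (1,-1,-1,1) produce the second difference.
  have h := hX.gronwall_flow hXb hX₀ hC hu hup (ι := Fin 4) ![1, -1, -1, 1]
    (S := fun r z => ENNReal.ofReal (S r z))
    hSm.ennreal_ofReal (fun r hr z => ?_) hs ![x, y, x', y']
    (A := ENNReal.ofReal A) (B := ENNReal.ofReal B) ?_ fun r hr => ?_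
  · have hsum : ∑ i, (![1, -1, -1, 1] : Fin 4 → ℝ) i * u s (![x, y, x', y'] i)
        = (u s x - u s y) - (u s x' - u s y') := by
      simp [Fin.sum_univ_four]; ring
    rw [hsum, ← ENNReal.ofReal_mul (by positivity), ← ENNReal.ofReal_add hA0 (by positivity),
      ← ENNReal.ofReal_mul (by positivity), Real.enorm_eq_ofReal_abs,
      ENNReal.ofReal_le_ofReal_iff (by positivity)] at h
    refine h.trans ?_
    have h2 : Real.exp (c * (T - s)) ≤ e := Real.exp_le_exp.2 (by nlinarith [hs.1])
    have hT2 : √T * √T = T := Real.mul_self_sqrt hT.le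
    set D := δ / √T
    set M := η * l / T
    have hM : 0 ≤ M := by positivity
    have hD : 0 ≤ D := by positivity
    have e1 : A = W ^ 2 * D + (W ^ 2 / 2 + W * e ^ 2 / 2) * M := by
      simp only [hA, D, M]
      conv_rhs => rw [← hT2]
      conv_lhs => rw [← hT2]
      rw [Real.sqrt_mul_self (Real.sqrt_nonneg T)]
      field_simp
      ring
    have e2 : B * T = (2 * (c * T) * e ^ 6 * W ^ 2) * M := by
      simp only [hB, M]; field_simp
    calc _ ≤ (A + B * T) * e := by gcongr
      _ ≤ _ := by rw [e1, e2]; exact fixedPoint_second_arith he hW1 hD hM hcT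
  · have hsum : ∀ φ : E → ℝ, ∑ i, (![1, -1, -1, 1] : Fin 4 → ℝ) i * φ (z i)
        = (φ (z 0) - φ (z 1)) - (φ (z 2) - φ (z 3)) := fun φ => by
      simp [Fin.sum_univ_four]; ring
    rw [hsum fun y => f (u r y), hsum fun y => u r y, Real.enorm_eq_ofReal_abs,
      Real.enorm_eq_ofReal_abs, ← ENNReal.ofReal_mul hc.le,
      ← ENNReal.ofReal_add (by positivity) (by positivity)]
    exact ENNReal.ofReal_le_ofReal (hX.f_diff _ _ _ _)
  · have hsum : ∀ ω, ∑ i, (![1, -1, -1, 1] : Fin 4 → ℝ) i * g (X s T (![x, y, x', y'] i) ω)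
        = (g (X s T x ω) - g (X s T y ω)) - (g (X s T x' ω) - g (X s T y' ω)) := fun ω => by
      simp [Fin.sum_univ_four]; ring
    simp only [hsum]
    exact hg.lintegral_le le_rfl
  · simp only [hfun]
    refine le_trans (lintegral_mono fun ω => ?_) ((hS r hr).lintegral_le le_rfl)
    rw [Real.enorm_eq_ofReal_abs]
    exact ENNReal.ofReal_le_ofReal (le_abs_self _)

end FlowAssumptions

end MLPHoelder

end

/-! ### Temporal regularity of the solution. -/

section

namespace MLPHoelder

set_option linter.unusedSectionVars false

variable {E : Type*} [NormedAddCommGroup E] [NormedSpace ℝ E] [FiniteDimensional ℝ E]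
  [MeasurableSpace E] [BorelSpace E] {Ω : Type*} [MeasurableSpace Ω] {P : Measure Ω}
  {p₁ p₂ c T : ℝ} {f : ℝ → ℝ} {g : E → ℝ} {V : ℝ → E → ℝ} {X : ℝ → ℝ → E → Ω → E}

namespace FlowAssumptions

/-- `w` is the spatial contribution and `I` the time integral, with `s` the scaled square root of
the time step. Their shares of the s-term are 1 and 4, within the allowed 8. -/
lemma fixedPoint_time_arith {e W v w s q : ℝ} (he : 1 ≤ e) (hW : 1 ≤ W) (hv : 0 ≤ v) (hvW : v ≤ 2 * W)
    (hs : 0 ≤ s) (hq : 0 ≤ q) {I : ℝ} (hI : I ≤ s * (v + 2 * (37 / 100 * e) * e * v))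
    (hw : w = e ^ 2 * (W * (v * s / 2 + q))) :
    w + I ≤ 8 * e ^ 2 * W * (W * s + q) := by
  have h1 : v + 2 * (37 / 100 * e) * e * v ≤ 2 * e ^ 2 * v := by
    have : v ≤ e ^ 2 * v := le_mul_of_one_le_left hv (one_le_pow₀ he)
    nlinarith
  have h2 : 2 * e ^ 2 * v ≤ 4 * e ^ 2 * (W * W) := by
    have : v ≤ 2 * (W * W) := hvW.trans (by nlinarith)
    have := mul_le_mul_of_nonneg_left this (by positivity : 0 ≤ 2 * e ^ 2)
    linarith
  have h3 : I ≤ s * (4 * e ^ 2 * (W * W)) :=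
    hI.trans (mul_le_mul_of_nonneg_left (h1.trans h2) hs)
  have h4 : w ≤ e ^ 2 * (W * (W * s + q)) := by
    rw [hw]
    gcongr
    nlinarith
  have h5 : 0 ≤ e ^ 2 * (W * q) := by positivity
  have h6 : 0 ≤ e ^ 2 * (W * (W * s)) := by positivity
  nlinarith

/-- The term `a` is the product of the distances with the square root of the time step. Its
coefficient 4 + 4 + 2·37/100 determines the constant 9. -/
lemma fixedPoint_second_time_arith {e W D a M x : ℝ} (he : 1 ≤ e) (hW : 1 ≤ W) (hD : 0 ≤ D)
    (ha : 0 ≤ a) (hM : 0 ≤ M) (hx : x ≤ 37 / 100 * e) :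
    2 * e ^ 8 * W ^ 2 * ((2 * W * a + D) + e * (2 * W * a + M)) + 2 * x * e ^ 3 * W * a
      ≤ 9 * e ^ 9 * W ^ 3 * (D + (a + M)) := by
  have k1 : e ^ 8 * W ^ 2 ≤ e ^ 9 * W ^ 3 := by
    gcongr <;> first | assumption | norm_num
  have k2 : e ^ 9 * W ^ 2 ≤ e ^ 9 * W ^ 3 := by
    gcongr; norm_num
  have k3 : e ^ 8 * W ^ 3 ≤ e ^ 9 * W ^ 3 := by
    gcongr; norm_num
  have k4 : e ^ 4 * W ≤ e ^ 9 * W ^ 3 := by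
    gcongr
    · norm_num
    · exact le_self_pow₀ hW (by norm_num)
  have k5 : x * (e ^ 3 * W) ≤ (37 / 100 * e) * (e ^ 3 * W) := by gcongr
  have k6 : (37 / 100 * e) * (e ^ 3 * W) = 37 / 100 * (e ^ 4 * W) := by ring
  have hp : 0 ≤ e ^ 9 * W ^ 3 := by positivity
  calc _ = (2 * (e ^ 8 * W ^ 2)) * D + (4 * (e ^ 8 * W ^ 3) + 4 * (e ^ 9 * W ^ 3)
        + 2 * (x * (e ^ 3 * W))) * a + (2 * (e ^ 9 * W ^ 2)) * M := by ring
    _ ≤ (9 * (e ^ 9 * W ^ 3)) * D + (9 * (e ^ 9 * W ^ 3)) * a + (9 * (e ^ 9 * W ^ 3)) * M := by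
        have r1 : 2 * (e ^ 8 * W ^ 2) ≤ 9 * (e ^ 9 * W ^ 3) := by linarith
        have r2 : 4 * (e ^ 8 * W ^ 3) + 4 * (e ^ 9 * W ^ 3) + 2 * (x * (e ^ 3 * W))
          ≤ 9 * (e ^ 9 * W ^ 3) := by linarith
        have r3 : 2 * (e ^ 9 * W ^ 2) ≤ 9 * (e ^ 9 * W ^ 3) := by linarith
        gcongr
    _ = _ := by ring

variable [IsProbabilityMeasure P] (hX : FlowAssumptions P p₁ p₂ c T f g V X)
  (hXb : FieldBound P p₁ p₂ c T V X) (hX₀ : ∀ s ∈ Icc 0 T, ∀ x, ∀ᵐ ω ∂P, X s s x ω = x)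
  {u : ℝ → E → ℝ} (hu : Admissible T V u (2 * Real.exp (c * T)))
  (hup : ∀ t ∈ Icc 0 T, ∀ x, u t x = picard P T f g X u t x)
include hX hXb hX₀ hu hup

/-- Dynamic programming reduces the time step to a spatial one. The mean of u(t',X_{t,t'}^x) -
u(t',x') is handled by the spatial Lipschitz bound and by X moving a distance of order V √(t'-t).
The remaining integral is of order t'-t, hence of order √(t'-t) √T. -/
lemma fixedPoint_hoelder {t t' : ℝ} (ht : 0 ≤ t) (htt : t ≤ t') (ht' : t' ≤ T) (x x' : E) :
    |u t x - u t' x'| ≤ 8 * Real.exp (c * T) ^ 2 * ((V t x + V t' x') / 2) *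
      ((V t x + V t' x') / 2 * (√(t' - t) / √T) + ‖x - x'‖ / √T) := by
  obtain ⟨hα₁, hα₂, hα⟩ := hX.costs
  obtain ⟨he, hcT⟩ := hX.exp_facts
  have hT := hX.T_pos
  have hc := hX.c_pos
  have htm : t ∈ Icc 0 T := ⟨ht, htt.trans ht'⟩
  have htm' : t' ∈ Icc 0 T := ⟨ht.trans htt, ht'⟩
  have hV := hX.one_le_V t htm x
  have hV' := hX.one_le_V t' htm' x'
  set e := Real.exp (c * T) with he'
  set W := (V t x + V t' x') / 2 with hW
  have hW1 : 1 ≤ W := by linarith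
  have hXm := hX.measurable_X ht htt ht' x
  have hint := (hX.lpLe_comp_X hXb hu.meas ht htt ht' (by positivity) (hu.le t' htm') x).integrable
    (hX.cost_le_one).1
  have h1 : LpLe P 1 (fun ω => u t' (X t t' x ω) - u t' x')
      (e ^ 2 / √T * (W * (V t x * (√(t' - t) / 2) + ‖x - x'‖))) := by
    have hv : LpLe P (1 / p₁) (fun ω => (V t' (X t t' x ω) + V t' x') / 2) W := by
      have h := ((hXb.V_le t t' ht htt ht' x).add (LpLe.const (P := P) (V t' x') (1 / p₁))
        (hX.cost_le_one).1 (by positivity) (norm_nonneg _)).const_mul (1 / 2)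
      rw [abs_of_pos (by norm_num), Real.norm_of_nonneg (by positivity)] at h
      convert h using 2 <;> ring
    have h := ((hv.pow_mul (α := 1) (hX.lpLe_X_sub_const hXb hX₀ ht htt ht' x x') hα₁ hα₂
      (by positivity) 1 (by push_cast; linarith)).const_mul (e ^ 2 / √T))
    rw [abs_of_nonneg (by positivity), pow_one] at h
    refine h.mono_real (hint.1.sub aestronglyMeasurable_const) fun ω => ?_
    refine (hX.abs_fixedPoint_sub_le hXb hX₀ (by positivity) hu hup htm' _ _).trans_eq ?_
    rw [pow_one]; ring
  have h2 := h1.norm_integral_le le_rfl (by positivity)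
  rw [integral_sub hint (integrable_const _), integral_const, probReal_univ, one_smul,
    Real.norm_eq_abs] at h2
  have h3 := intervalIntegral.norm_integral_le_of_norm_le_const (a := t) (b := t')
    (f := fun r => ∫ ω, f (u r (X t r x ω)) ∂P) (C := |f 0| + c * (2 * e * V t x)) fun r hr => by
      rw [uIoc_of_le htt] at hr
      exact hX.abs_mean_le hXb hu.meas ht hr.1.le (hr.2.trans ht') (by positivity)
        (hu.le r ⟨ht.trans hr.1.le, hr.2.trans ht'⟩) x
  rw [Real.norm_eq_abs, abs_of_nonneg (sub_nonneg.2 htt)] at h3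
  set I := ∫ r in t..t', ∫ ω, f (u r (X t r x ω)) ∂P
  have h4 : u t x - u t' x' = ((∫ ω, u t' (X t t' x ω) ∂P) - u t' x') + I := by
    rw [hX.dynamic_programming hXb (by positivity) hu hup ht htt ht' x]; ring
  rw [h4]
  refine (abs_add_le _ _).trans ((add_le_add_left h2 _).trans ?_)
  refine fixedPoint_time_arith he hW1 (by positivity) (by linarith) (by positivity) (by positivity)
    (v := V t x) (h3.trans ?_) (by ring)
  have h5 : t' - t ≤ √(t' - t) * √T := le_sqrt_mul_sqrt (by linarith)
  have h6 : T * |f 0| ≤ V t x := by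
    have := hX.f_zero t htm x
    rwa [abs_mul, abs_of_pos hT] at this
  calc _ ≤ (|f 0| + c * (2 * e * V t x)) * (√(t' - t) * √T) := by gcongr
    _ = √(t' - t) / √T * (T * |f 0| + 2 * (c * T) * e * V t x) := by
      have h7 : T / √T = √T := Real.div_sqrt
      calc _ = (|f 0| + c * (2 * e * V t x)) * (√(t' - t) * (T / √T)) := by rw [h7]
        _ = _ := by ring
    _ ≤ _ := by gcongr

/-- Again dynamic programming: the spatial second-order estimate is applied at time t' to X^x, X^y,
x', y'. The time integrals differ by a Lipschitz term only. -/
lemma fixedPoint_second {t t' : ℝ} (ht : 0 ≤ t) (htt : t ≤ t') (ht' : t' ≤ T) (x y x' y' : E) :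
    |(u t x - u t y) - (u t' x' - u t' y')| ≤ 9 * Real.exp (c * T) ^ 9 *
      ((V t x + V t y + V t' x' + V t' y') / 4) ^ 3 * (‖(x - y) - (x' - y')‖ / √T
        + (‖x - y‖ + ‖x' - y'‖) * (√(t' - t) + ‖x - x'‖) / T) := by
  obtain ⟨hα₁, hα₂, hα⟩ := hX.costs
  obtain ⟨he, hcT⟩ := hX.exp_facts
  have hT := hX.T_pos
  have hc := hX.c_pos
  have htm : t ∈ Icc 0 T := ⟨ht, htt.trans ht'⟩
  have htm' : t' ∈ Icc 0 T := ⟨ht.trans htt, ht'⟩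
  have hVx := hX.one_le_V t htm x
  have hVy := hX.one_le_V t htm y
  have hVx' := hX.one_le_V t' htm' x'
  have hVy' := hX.one_le_V t' htm' y'
  have hα₂' := (hX.cost_le_one).2
  set e := Real.exp (c * T) with he'
  set W := (V t x + V t y + V t' x' + V t' y') / 4 with hW
  have hW1 : 1 ≤ W := by linarith
  have hXm := fun z => hX.measurable_X ht htt ht' z
  have hint := fun z => (hX.lpLe_comp_X hXb hu.meas ht htt ht' (by positivity) (hu.le t' htm')
    z).integrable (hX.cost_le_one).1
  set η := ‖x - y‖ + ‖x' - y'‖ with hη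
  set δ := ‖(x - y) - (x' - y')‖
  set σ := √(t' - t) with hσ
  have hT2 : √T * √T = T := Real.mul_self_sqrt hT.le
  have hsT : 0 < √T := by positivity
  have h1 : LpLe P 1 (fun ω => (u t' (X t t' x ω) - u t' (X t t' y ω)) - (u t' x' - u t' y'))
      (2 * e ^ 8 / √T * (W ^ 2 * (2 * W * (η * (σ / √T)) + δ))
        + 2 * e ^ 8 / T * (W ^ 2 * (e * η * (2 * W * σ + ‖x - x'‖)))) := by
    have hv : LpLe P (1 / p₁) (fun ω => (V t' (X t t' x ω) + V t' (X t t' y ω)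
        + V t' x' + V t' y') / 4) W := by
      have h := ((hX.lpLe_V_avg₂ hXb ht htt ht' x y).add (LpLe.const (P := P)
        ((V t' x' + V t' y') / 2) (1 / p₁)) (hX.cost_le_one).1 (by positivity)
        (norm_nonneg _)).const_mul (1 / 2)
      rw [abs_of_pos (by norm_num), Real.norm_of_nonneg (by positivity)] at h
      convert h using 2 <;> ring
    -- The flow changes x-y only by an amount of order √(t'-t), proportional to the distance itself;
    -- this supplies the factor `η` next to the time increment.
    have hd : LpLe P (1 / p₂) (fun ω => ‖(X t t' x ω - X t t' y ω) - (x' - y')‖)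
        (2 * W * (η * (σ / √T)) + δ) := by
      have h := (lpLe_iff (one_pos.trans_le hX.one_le_p₂)).2 ⟨(((hXm x).sub (hXm y)).sub
        measurable_const).aestronglyMeasurable, hX.X_incr t t' ht htt ht' x y⟩
      have h' := h.add (LpLe.const (P := P) ((x - y) - (x' - y')) (1 / p₂)) hα₂' (by positivity)
        (norm_nonneg _)
      refine (h'.congr_ae (.of_forall fun ω => ?_)).norm.mono_bound ?_
      · simp only [Pi.sub_apply]; abel
      · rw [abs_of_nonneg (sub_nonneg.2 htt)]
        have k1 : (V t x + V t y) / 2 ≤ 2 * W := by linarith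
        have k2 : ‖x - y‖ ≤ η := by rw [hη]; linarith [norm_nonneg (x' - y')]
        calc _ = (V t x + V t y) / 2 * (‖x - y‖ * (σ / √T)) + δ := by ring
          _ ≤ _ := by gcongr
    have hdη : LpLe P (1 / p₂) (fun ω => ‖X t t' x ω - X t t' y ω‖ + ‖x' - y'‖) (e * η) := by
      have h := (hX.lpLe_X_sub_X hXb ht htt ht' x y).add
        (LpLe.const (P := P) ‖x' - y'‖ (1 / p₂)) hα₂' (by positivity) (norm_nonneg _)
      refine h.mono_bound ?_
      rw [norm_norm, hη, mul_add]
      gcongr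
      exact le_mul_of_one_le_left (norm_nonneg _) he
    have hl : LpLe P (1 / p₂) (fun ω => ‖X t t' x ω - x'‖) (2 * W * σ + ‖x - x'‖) := by
      refine (hX.lpLe_X_sub_const hXb hX₀ ht htt ht' x x').mono_bound ?_
      have k1 : V t x / 2 ≤ 2 * W := by linarith
      have := mul_le_mul_of_nonneg_right k1 (Real.sqrt_nonneg (t' - t))
      linarith
    have k1 := ((hv.pow_mul (α := 1) hd hα₁ hα₂ (by positivity) 2
      (by push_cast; linarith)).const_mul (2 * e ^ 8 / √T))
    have k2 := (hv.pow_mul_mul (α := 1) hdη hl hα₁ hα₂ (by positivity) (by positivity) 2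
      (by push_cast; linarith)).const_mul (2 * e ^ 8 / T)
    rw [abs_of_nonneg (by positivity)] at k1 k2
    refine (k1.add k2 le_rfl (by positivity) (by positivity)).mono_real
      (((hint x).1.sub (hint y).1).sub aestronglyMeasurable_const) fun ω => ?_
    refine (hX.abs_fixedPoint_second_le hXb hX₀ (by positivity) hu hup htm' _ _ _ _).trans_eq ?_
    ring
  have h2 := h1.norm_integral_le le_rfl (by positivity)
  rw [integral_sub (f := fun ω => u t' (X t t' x ω) - u t' (X t t' y ω))
    ((hint x).sub (hint y)) (integrable_const _), integral_sub (hint x) (hint y),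
    integral_const, probReal_univ, one_smul, Real.norm_eq_abs] at h2
  have hmean := fun z => hX.intervalIntegrable_mean hXb (by positivity) hu ht le_rfl htt ht' z
  have h3 := intervalIntegral.norm_integral_le_of_norm_le_const (a := t) (b := t')
    (f := fun r => (∫ ω, f (u r (X t r x ω)) ∂P) - ∫ ω, f (u r (X t r y ω)) ∂P)
    (C := c * e ^ 2 / √T * (2 * W * (e * η))) fun r hr => by
      rw [uIoc_of_le htt] at hr
      have hrT := hr.2.trans ht'
      have hrm : r ∈ Icc 0 T := ⟨ht.trans hr.1.le, hrT⟩
      have hf := fun z => (hX.lpLe_f_comp_X hXb hu.meas ht hr.1.le hrT (by positivity)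
        (hu.le r hrm) z).integrable (hX.cost_le_one).1
      rw [← integral_sub (hf x) (hf y)]
      have h := ((hX.lpLe_V_avg₂ hXb ht hr.1.le hrT x y).pow_mul (α := 1)
        (hX.lpLe_X_sub_X hXb ht hr.1.le hrT x y) hα₁ hα₂ (by positivity) 1
        (by push_cast; linarith)).const_mul (c * e ^ 2 / √T)
      rw [abs_of_nonneg (by positivity), pow_one] at h
      refine (((h.mono_real ((hf x).1.sub (hf y).1)) fun ω => ?_).norm_integral_le le_rfl
        (by positivity)).trans ?_
      · refine (hX.abs_f_sub_le _ _).trans ((mul_le_mul_of_nonneg_left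
          (hX.abs_fixedPoint_sub_le hXb hX₀ (by positivity) hu hup hrm _ _) hc.le).trans_eq ?_)
        rw [pow_one]; ring
      · have k1 : (V t x + V t y) / 2 ≤ 2 * W := by linarith
        have k2 : ‖x - y‖ ≤ η := by rw [hη]; linarith [norm_nonneg (x' - y')]
        gcongr
  rw [intervalIntegral.integral_sub (hmean x) (hmean y), Real.norm_eq_abs,
    abs_of_nonneg (sub_nonneg.2 htt)] at h3
  have h4 : (u t x - u t y) - (u t' x' - u t' y')
      = ((∫ ω, u t' (X t t' x ω) ∂P) - (∫ ω, u t' (X t t' y ω) ∂P) - (u t' x' - u t' y'))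
        + ((∫ r in t..t', ∫ ω, f (u r (X t r x ω)) ∂P)
          - ∫ r in t..t', ∫ ω, f (u r (X t r y ω)) ∂P) := by
    rw [hX.dynamic_programming hXb (by positivity) hu hup ht htt ht' x,
      hX.dynamic_programming hXb (by positivity) hu hup ht htt ht' y]; ring
  rw [h4]
  refine (abs_add_le _ _).trans ((add_le_add h2 h3).trans ?_)
  have h5 : t' - t ≤ σ * √T := le_sqrt_mul_sqrt (by linarith)
  have harith := fixedPoint_second_time_arith (e := e) (W := W) (D := δ / √T) (a := η * σ / T)
    (M := η * ‖x - x'‖ / T) he hW1 (by positivity) (by positivity) (by positivity) hcT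
  calc _ ≤ 2 * e ^ 8 / √T * (W ^ 2 * (2 * W * (η * (σ / √T)) + δ))
        + 2 * e ^ 8 / T * (W ^ 2 * (e * η * (2 * W * σ + ‖x - x'‖)))
        + c * e ^ 2 / √T * (2 * W * (e * η)) * (σ * √T) := by gcongr
    _ = 2 * e ^ 8 * W ^ 2 * ((2 * W * (η * σ / (√T * √T)) + δ / √T)
          + e * (2 * W * (η * σ / T) + η * ‖x - x'‖ / T))
        + 2 * (c * T) * e ^ 3 * W * (η * σ / T) := by field_simp
    _ ≤ _ := by rw [hT2]; refine harith.trans_eq ?_; ring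

lemma solutionBounds : SolutionBounds c T V u where
  meas := hu.meas
  growth := hu.le
  hoelder _ _ ht htt ht' x x' := hX.fixedPoint_hoelder hXb hX₀ hu hup ht htt ht' x x'
  second _ _ ht htt ht' x y x' y' := hX.fixedPoint_second hXb hX₀ hu hup ht htt ht' x y x' y'

end FlowAssumptions

end MLPHoelder

end

/-! ### Moment inequality for sums of independent centred random variables. -/

section

namespace MLPHoelder

section MomentInequality

/-- Up to a factor this is the second derivative of |y|^{q+2}. At the origin the difference quotient
is |t|^q itself. -/
lemma hasDerivAt_abs_rpow_mul_self {q : ℝ} (hq : 0 ≤ q) (x : ℝ) :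
    HasDerivAt (fun y : ℝ => |y| ^ q * y) ((q + 1) * |x| ^ q) x := by
  rcases hq.eq_or_lt with rfl | hq
  · simpa using hasDerivAt_id' x
  rcases eq_or_ne x 0 with rfl | hx
  · rw [hasDerivAt_iff_tendsto_slope_zero]
    have h1 : Filter.Tendsto (fun t : ℝ => |t| ^ q) (nhdsWithin 0 {0}ᶜ) (nhds (|(0 : ℝ)| ^ q)) :=
      ((continuous_abs.rpow_const fun _ => .inr hq.le).tendsto 0).mono_left nhdsWithin_le_nhds
    have h2 : (q + 1) * |(0 : ℝ)| ^ q = |(0 : ℝ)| ^ q := by simp [hq.ne']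
    rw [h2]
    refine h1.congr' ?_
    filter_upwards [self_mem_nhdsWithin] with t ht
    have ht : t ≠ 0 := ht
    simp only [zero_add, mul_zero, sub_zero, smul_eq_mul]
    field_simp
  · have h1 := ((hasDerivAt_abs hx).rpow_const (p := q) (.inl (abs_ne_zero.2 hx))).mul
      (hasDerivAt_id x)
    refine h1.congr_deriv ?_
    have h2 : (SignType.sign x : ℝ) * x = |x| := by
      rw [mul_comm]; exact self_mul_sign x
    have h3 : |x| ^ q = |x| ^ (q - 1) * |x| := by
      rw [Real.rpow_sub_one (abs_ne_zero.2 hx), div_mul_cancel₀ _ (abs_ne_zero.2 hx)]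
    simp only [id, mul_one]
    calc _ = q * |x| ^ (q - 1) * ((SignType.sign x : ℝ) * x) + |x| ^ q := by ring
      _ = _ := by rw [h2, h3]; ring

lemma rpow_sub_two_mul_le {p M w y z : ℝ} (hp : 2 ≤ p) (hw : |w| ≤ M) (hy : |y| ≤ M)
    (hz : |z| ≤ M) : |w| ^ (p - 2) * |y| * |z| ≤ M ^ p := by
  have hM : 0 ≤ M := (abs_nonneg w).trans hw
  rcases hM.eq_or_lt with rfl | hM
  · have : y = 0 := abs_nonpos_iff.1 hy
    simp [this, Real.zero_rpow (by linarith : p ≠ 0)]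
  · have : M ^ p = M ^ (p - 2) * M * M := by
      rw [mul_assoc, ← sq, ← Real.rpow_natCast M 2, ← Real.rpow_add hM]; norm_num
    rw [this]
    have : |w| ^ (p - 2) ≤ M ^ (p - 2) := Real.rpow_le_rpow (abs_nonneg _) hw (by linarith)
    gcongr

variable {Ω : Type*} [MeasurableSpace Ω] {P : Measure Ω} [IsProbabilityMeasure P] {p : ℝ}

lemma LpLe.integrable_abs_rpow {Z : Ω → ℝ} {b : ℝ} (hp : 0 < p) (h : LpLe P (1 / p) Z b)
    (hb : 0 ≤ b) : Integrable (fun ω => |Z ω| ^ p) P ∧ ∫ ω, |Z ω| ^ p ∂P ≤ b ^ p := by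
  have h1 := h.norm.rpow (fun _ => norm_nonneg _) hb hp
  rw [mul_one_div_cancel hp.ne'] at h1
  refine ⟨h1.integrable le_rfl, ?_⟩
  refine le_trans (le_of_eq ?_) (h1.integral_norm_le le_rfl (by positivity))
  congr 1
  ext ω
  rw [Real.norm_of_nonneg (by positivity), Real.norm_eq_abs]

omit [IsProbabilityMeasure P] in
lemma lpLe_of_integral_rpow_le {Z : Ω → ℝ} {b B : ℝ} (hp : 0 < p) (h : LpLe P (1 / p) Z b)
    (hle : (∫ ω, |Z ω| ^ p ∂P) ^ (2 / p) ≤ B) : LpLe P (1 / p) Z (√B) := by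
  have hm := h.memLp
  refine ⟨h.1, ?_⟩
  have h1 : (ENNReal.ofReal (1 / p))⁻¹ = ENNReal.ofReal p := by
    rw [one_div, ENNReal.ofReal_inv_of_pos hp, inv_inv]
  rw [h1] at hm ⊢
  rw [hm.eLpNorm_eq_integral_rpow_norm (by simpa using hp) ENNReal.ofReal_ne_top,
    ENNReal.toReal_ofReal hp.le]
  refine ENNReal.ofReal_le_ofReal ?_
  simp only [Real.norm_eq_abs]
  have hI : 0 ≤ ∫ ω, |Z ω| ^ p ∂P := integral_nonneg fun ω => by positivity
  refine Real.le_sqrt_of_sq_le (le_trans (le_of_eq ?_) hle)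
  rw [← Real.rpow_natCast, ← Real.rpow_mul hI]
  congr 1
  push_cast
  ring

/-- If the derivative of `t ↦ 𝔼|X + tY|ᵖ` vanishes at `t = 0`, then
`‖X + Y‖² ≤ ‖X‖² + (p - 1)‖Y‖²` in `Lᵖ`. -/
lemma rpow_integral_add_le (hp : 2 ≤ p) {X Y : Ω → ℝ} {a b : ℝ} (hX : LpLe P (1 / p) X a)
    (hY : LpLe P (1 / p) Y b) (ha : 0 ≤ a) (hb : 0 ≤ b)
    (h0 : ∫ ω, |X ω| ^ (p - 2) * X ω * Y ω ∂P = 0) :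
    (∫ ω, |X ω + Y ω| ^ p ∂P) ^ (2 / p) ≤ (∫ ω, |X ω| ^ p ∂P) ^ (2 / p) + (p - 1) * b ^ 2 := by
  have hp0 : 0 < p := by linarith
  have hp1 : 1 / p ≤ 1 := by rw [div_le_one hp0]; linarith
  -- With h(t) = E|X+tY|^p, Hölder's inequality gives h'' ≤ p(p-1) h^{(p-2)/p} b². Hence h^{2/p} has
  -- second derivative at most 2(p-1)b², while its first derivative vanishes at 0; comparison with
  -- (p-1)b²t² on [0,1] gives the claim.
  set h : ℝ → ℝ := fun t => ∫ ω, |X ω + t * Y ω| ^ p ∂P with hh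
  set h' : ℝ → ℝ := fun t => ∫ ω, p * (|X ω + t * Y ω| ^ (p - 2) * (X ω + t * Y ω)) * Y ω ∂P with hh'
  set h'' : ℝ → ℝ := fun t => ∫ ω, p * ((p - 1) * |X ω + t * Y ω| ^ (p - 2) * Y ω) * Y ω ∂P with hh''
  have hlin : ∀ t, LpLe P (1 / p) (fun ω => X ω + t * Y ω) (a + |t| * b) := fun t =>
    hX.add (hY.const_mul t) hp1 ha (by positivity)
  -- (|X| + 2|Y|)^p dominates the derivatives for |t| < 2; the radius 2 leaves a neighbourhood of
  -- every t in [0,1].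
  have hM := (hX.norm.add (hY.norm.const_mul 2) hp1 ha (by positivity)).integrable_abs_rpow hp0
    (by positivity)
  have hMi : Integrable (fun ω => p * (p - 1) * (|X ω| + 2 * |Y ω|) ^ p) P := by
    refine (hM.1.congr (.of_forall fun ω => ?_)).const_mul _
    simp only [Real.norm_eq_abs]
    rw [abs_of_nonneg (by positivity)]
  have hbd : ∀ ω, ∀ t ∈ Metric.ball (0 : ℝ) 2, |X ω + t * Y ω| ≤ |X ω| + 2 * |Y ω| := by
    intro ω t ht
    rw [mem_ball_zero_iff, Real.norm_eq_abs] at ht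
    refine (abs_add_le _ _).trans ?_
    rw [abs_mul]
    gcongr
  have hYM : ∀ ω, |Y ω| ≤ |X ω| + 2 * |Y ω| := fun ω => by
    linarith [abs_nonneg (X ω), abs_nonneg (Y ω)]
  have hball : ∀ t ∈ Icc (0 : ℝ) 1, Metric.ball (0 : ℝ) 2 ∈ nhds t := fun t ht =>
    Metric.isOpen_ball.mem_nhds (by
      rw [mem_ball_zero_iff, Real.norm_of_nonneg ht.1]; linarith [ht.2])
  have hae : ∀ t, AEStronglyMeasurable
      (fun ω => p * (|X ω + t * Y ω| ^ (p - 2) * (X ω + t * Y ω)) * Y ω) P := fun t => by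
    have h1 := (hlin t).1.aemeasurable
    have h2 := hY.1.aemeasurable
    refine AEMeasurable.aestronglyMeasurable ?_
    exact ((((continuous_abs.measurable.comp_aemeasurable h1).pow_const _).mul h1).const_mul
      p).mul h2
  have hae' : ∀ t, AEStronglyMeasurable
      (fun ω => p * ((p - 1) * |X ω + t * Y ω| ^ (p - 2) * Y ω) * Y ω) P := fun t => by
    have h1 := (hlin t).1.aemeasurable
    have h2 := hY.1.aemeasurable
    refine AEMeasurable.aestronglyMeasurable ?_
    exact (((((continuous_abs.measurable.comp_aemeasurable h1).pow_const _).const_mul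
      (p - 1)).mul h2).const_mul p).mul h2
  have hle1 : ∀ ω, ∀ t ∈ Metric.ball (0 : ℝ) 2,
      ‖p * (|X ω + t * Y ω| ^ (p - 2) * (X ω + t * Y ω)) * Y ω‖
        ≤ p * (p - 1) * (|X ω| + 2 * |Y ω|) ^ p := fun ω t ht => by
    have h1 := rpow_sub_two_mul_le hp (hbd ω t ht) (hbd ω t ht) (hYM ω)
    have h2 : 0 ≤ (|X ω| + 2 * |Y ω|) ^ p := by positivity
    rw [norm_mul, norm_mul, norm_mul, Real.norm_of_nonneg hp0.le,
      Real.norm_of_nonneg (by positivity), Real.norm_eq_abs, Real.norm_eq_abs]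
    have h3 := h1.trans (le_mul_of_one_le_left h2 (by linarith : (1 : ℝ) ≤ p - 1))
    calc _ = p * (|X ω + t * Y ω| ^ (p - 2) * |X ω + t * Y ω| * |Y ω|) := by ring
      _ ≤ p * ((p - 1) * (|X ω| + 2 * |Y ω|) ^ p) := by gcongr
      _ = _ := by ring
  have hle2 : ∀ ω, ∀ t ∈ Metric.ball (0 : ℝ) 2,
      ‖p * ((p - 1) * |X ω + t * Y ω| ^ (p - 2) * Y ω) * Y ω‖
        ≤ p * (p - 1) * (|X ω| + 2 * |Y ω|) ^ p := fun ω t ht => by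
    have h1 := rpow_sub_two_mul_le hp (hbd ω t ht) (hYM ω) (hYM ω)
    have hp1 : 0 ≤ p - 1 := by linarith
    rw [norm_mul, norm_mul, norm_mul, norm_mul, Real.norm_of_nonneg hp0.le,
      Real.norm_of_nonneg hp1, Real.norm_of_nonneg (by positivity), Real.norm_eq_abs]
    calc _ = p * (p - 1) * (|X ω + t * Y ω| ^ (p - 2) * |Y ω| * |Y ω|) := by ring
      _ ≤ _ := by gcongr
  have hD1 : ∀ t ∈ Icc (0 : ℝ) 1, HasDerivAt h (h' t) t := fun t ht =>
    (hasDerivAt_integral_of_dominated_loc_of_deriv_le (hball t ht)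
      (.of_forall fun s => ((continuous_abs.measurable.comp_aemeasurable
        (hlin s).1.aemeasurable).pow_const p).aestronglyMeasurable)
      ((hlin t).integrable_abs_rpow hp0 (by positivity)).1 (hae t)
      (.of_forall hle1) hMi (.of_forall fun ω s _ => by
        have h1 := (hasDerivAt_abs_rpow (X ω + s * Y ω) (p := p) (by linarith)).comp s
          (((hasDerivAt_id s).mul_const (Y ω)).const_add (X ω))
        refine h1.congr_deriv ?_
        ring)).2
  have hD2 : ∀ t ∈ Icc (0 : ℝ) 1, HasDerivAt h' (h'' t) t := fun t ht =>
    (hasDerivAt_integral_of_dominated_loc_of_deriv_le (hball t ht)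
      (.of_forall hae) (hMi.mono' (hae t) (.of_forall fun ω => hle1 ω t (mem_of_mem_nhds (hball t ht))))
      (hae' t) (.of_forall hle2) hMi (.of_forall fun ω s _ => by
        have h1 := (hasDerivAt_abs_rpow_mul_self (q := p - 2) (by linarith) (X ω + s * Y ω)).comp s
          (((hasDerivAt_id s).mul_const (Y ω)).const_add (X ω))
        refine ((h1.const_mul p).mul_const (Y ω)).congr_deriv ?_
        ring)).2
  have hpos : ∀ t, 0 ≤ h t := fun t => integral_nonneg fun ω => by positivity
  have hsnd : ∀ t, h'' t ≤ p * (p - 1) * (h t ^ ((p - 2) / p) * b ^ 2) := by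
    intro t
    have hW : LpLe P (1 / p) (fun ω => X ω + t * Y ω) (h t ^ (1 / p)) := by
      have h1 := lpLe_of_integral_rpow_le hp0 (hlin t) (B := h t ^ (2 / p)) le_rfl
      have h2 : √(h t ^ (2 / p)) = h t ^ (1 / p) := by
        rw [Real.sqrt_eq_rpow, ← Real.rpow_mul (hpos t)]
        congr 1; ring
      rwa [h2] at h1
    have hY2 := hY.norm.pow (by positivity) hb 2
    have key : LpLe P 1 (fun ω => |X ω + t * Y ω| ^ (p - 2) * (‖Y ω‖ ^ 2))
        (h t ^ ((p - 2) / p) * b ^ 2) := by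
      -- For p = 2 the first factor has exponent zero and Hölder's inequality is not needed;
      -- otherwise the costs (p-2)/p and 2/p add up to 1.
      rcases hp.eq_or_lt with rfl | hp
      · have := hY2
        norm_num at this ⊢
        exact this
      · have h1 := (hW.norm.rpow (fun _ => norm_nonneg _) (Real.rpow_nonneg (hpos t) _)
          (by linarith : 0 < p - 2)).mul hY2 (by
            have : 0 ≤ p - 2 := by linarith
            positivity) (by positivity)
          (Real.rpow_nonneg (Real.rpow_nonneg (hpos t) _) _)
        convert h1 using 2
        · push_cast; field_simp; ring
        · rfl
        · rw [← Real.rpow_mul (hpos t)]; congr 2; ring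
    have h1 := key.integral_norm_le le_rfl (mul_nonneg (Real.rpow_nonneg (hpos t) _) (by positivity))
    calc h'' t = p * (p - 1) * ∫ ω, ‖|X ω + t * Y ω| ^ (p - 2) * (‖Y ω‖ ^ 2)‖ ∂P := by
          rw [← integral_const_mul, hh'']
          refine integral_congr_ae (.of_forall fun ω => ?_)
          simp only
          rw [Real.norm_of_nonneg (by positivity), Real.norm_eq_abs, sq_abs]
          ring
      _ ≤ _ := by
        have : 0 ≤ p - 1 := by linarith
        gcongr
  have hh0 : h' 0 = 0 := by
    simp only [hh', zero_mul, add_zero]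
    calc _ = p * ∫ ω, |X ω| ^ (p - 2) * X ω * Y ω ∂P := by
          rw [← integral_const_mul]; congr 1; ext ω; ring
      _ = 0 := by rw [h0, mul_zero]
  -- comparison for `(h + ε)^{2/p}`
  have main : ∀ ε : ℝ, 0 < ε → (h 1 + ε) ^ (2 / p) ≤ (h 0 + ε) ^ (2 / p) + (p - 1) * b ^ 2 := by
    intro ε hε
    have hpe : ∀ t, 0 < h t + ε := fun t => by linarith [hpos t]
    -- Derivative of (h+ε)^{2/p} - (p-1)b²t². The shift by ε avoids the singularity of the power 2/p
    -- where h vanishes.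
    set G' : ℝ → ℝ := fun t => h' t * (2 / p) * (h t + ε) ^ (2 / p - 1) - (p - 1) * b ^ 2 * (2 * t)
      with hG'
    have hG1 : ∀ t ∈ Icc (0 : ℝ) 1, HasDerivAt
        (fun t => (h t + ε) ^ (2 / p) - (p - 1) * b ^ 2 * t ^ 2) (G' t) t := fun t ht => by
      have h1 := ((hD1 t ht).add_const ε).rpow_const (p := 2 / p) (.inl (hpe t).ne')
      have h2 := (hasDerivAt_pow 2 t).const_mul ((p - 1) * b ^ 2)
      refine (h1.sub h2).congr_deriv ?_
      simp [hG']
    have hG2 : ∀ t ∈ Icc (0 : ℝ) 1, HasDerivAt G'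
        (h'' t * (2 / p) * (h t + ε) ^ (2 / p - 1) + h' t * (2 / p) *
          (h' t * (2 / p - 1) * (h t + ε) ^ (2 / p - 1 - 1)) - (p - 1) * b ^ 2 * 2) t := fun t ht => by
      have h1 := ((hD1 t ht).add_const ε).rpow_const (p := 2 / p - 1) (.inl (hpe t).ne')
      have h2 := ((hD2 t ht).mul_const (2 / p)).mul h1
      have h3 := ((hasDerivAt_id t).const_mul 2).const_mul ((p - 1) * b ^ 2)
      refine (h2.sub h3).congr_deriv ?_
      simp
    have hconv : Convex ℝ (Icc (0 : ℝ) 1) := convex_Icc 0 1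
    have hanti' : AntitoneOn G' (Icc 0 1) := by
      refine antitoneOn_of_hasDerivWithinAt_nonpos hconv
        (fun t ht => (hG2 t ht).continuousAt.continuousWithinAt)
        (fun t ht => (hG2 t (interior_subset ht)).hasDerivWithinAt) fun t _ => ?_
      -- The term with the square of h' carries the factor 2/p - 1 ≤ 0 and can be dropped.
      have h1 : h' t * (2 / p) * (h' t * (2 / p - 1) * (h t + ε) ^ (2 / p - 1 - 1)) ≤ 0 := by
        have h2 : 2 / p - 1 ≤ 0 := by rw [sub_nonpos, div_le_one hp0]; exact hp
        have h3 : 0 ≤ (h t + ε) ^ (2 / p - 1 - 1) := Real.rpow_nonneg (hpe t).le _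
        calc _ = (2 / p - 1) * ((h' t) ^ 2 * (2 / p) * (h t + ε) ^ (2 / p - 1 - 1)) := by ring
          _ ≤ 0 := mul_nonpos_of_nonpos_of_nonneg h2 (by positivity)
      have h2 : h'' t * (2 / p) * (h t + ε) ^ (2 / p - 1) ≤ (p - 1) * b ^ 2 * 2 := by
        have h3 : h'' t ≤ p * (p - 1) * ((h t + ε) ^ ((p - 2) / p) * b ^ 2) := by
          refine (hsnd t).trans ?_
          have h5 : 0 ≤ p - 1 := by linarith
          have h6 : h t ^ ((p - 2) / p) ≤ (h t + ε) ^ ((p - 2) / p) :=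
            Real.rpow_le_rpow (hpos t) (by linarith) (div_nonneg (by linarith) hp0.le)
          gcongr
        have h4 : (h t + ε) ^ ((p - 2) / p) * (h t + ε) ^ (2 / p - 1) = 1 := by
          rw [← Real.rpow_add (hpe t)]
          have : (p - 2) / p + (2 / p - 1) = 0 := by field_simp; ring
          rw [this, Real.rpow_zero]
        have h5 : 0 ≤ (h t + ε) ^ (2 / p - 1) := Real.rpow_nonneg (hpe t).le _
        calc _ ≤ p * (p - 1) * ((h t + ε) ^ ((p - 2) / p) * b ^ 2) * (2 / p)
              * (h t + ε) ^ (2 / p - 1) := by gcongr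
          _ = 2 * (p - 1) * b ^ 2 * (p / p)
              * ((h t + ε) ^ ((p - 2) / p) * (h t + ε) ^ (2 / p - 1)) := by ring
          _ = _ := by rw [h4, div_self hp0.ne']; ring
      linarith
    have hanti : AntitoneOn (fun t => (h t + ε) ^ (2 / p) - (p - 1) * b ^ 2 * t ^ 2) (Icc 0 1) := by
      refine antitoneOn_of_hasDerivWithinAt_nonpos hconv
        (fun t ht => (hG1 t ht).continuousAt.continuousWithinAt)
        (fun t ht => (hG1 t (interior_subset ht)).hasDerivWithinAt) fun t ht => ?_
      have ht := interior_subset ht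
      refine (hanti' (left_mem_Icc.2 zero_le_one) ht ht.1).trans_eq ?_
      simp [hG', hh0]
    have := hanti (left_mem_Icc.2 zero_le_one) (right_mem_Icc.2 zero_le_one) zero_le_one
    simp only [one_pow, mul_one] at this
    norm_num at this
    linarith
  have hcont : ∀ a : ℝ, Filter.Tendsto (fun ε : ℝ => (a + ε) ^ (2 / p)) (nhdsWithin 0 (Ioi 0))
      (nhds (a ^ (2 / p))) := fun a => by
    have h1 : Continuous fun ε : ℝ => (a + ε) ^ (2 / p) :=
      (continuous_const.add continuous_id).rpow_const fun _ => .inr (by positivity)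
    have h2 := (h1.tendsto 0).mono_left (nhdsWithin_le_nhds (s := Ioi 0))
    simpa using h2
  have hfin := le_of_tendsto_of_tendsto (hcont (h 1)) ((hcont (h 0)).add_const ((p - 1) * b ^ 2))
    (by filter_upwards [self_mem_nhdsWithin] with ε hε using main ε hε)
  simpa [hh] using hfin

/-- Independence factorizes E[|X|^{p-2} X Y], and E[Y] = 0 makes it vanish. This orthogonality is
all that the smoothness inequality requires. -/
lemma IndepFun.lpLe_add (hp : 2 ≤ p) {X Y : Ω → ℝ} {A b : ℝ} (hXY : IndepFun X Y P)
    (hX : LpLe P (1 / p) X (√A)) (hY : LpLe P (1 / p) Y b) (hA : 0 ≤ A) (hb : 0 ≤ b)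
    (h0 : ∫ ω, Y ω ∂P = 0) :
    LpLe P (1 / p) (fun ω => X ω + Y ω) (√(A + (p - 1) * b ^ 2)) := by
  have hp0 : 0 < p := by linarith
  have hp1 : 1 / p ≤ 1 := by rw [div_le_one hp0]; linarith
  refine lpLe_of_integral_rpow_le hp0 (hX.add hY hp1 (by positivity) hb) ?_
  refine (rpow_integral_add_le hp hX hY (by positivity) hb ?_).trans ?_
  · have h1 : Measurable fun x : ℝ => |x| ^ (p - 2) * x :=
      (measurable_id.abs.pow_const _).mul measurable_id
    have h2 := (hXY.comp h1 measurable_id).integral_fun_mul_eq_mul_integral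
      ((h1.comp_aemeasurable hX.1.aemeasurable).aestronglyMeasurable) hY.1
    simp only [Function.comp_apply, id] at h2
    rw [h2, h0, mul_zero]
  · have h1 := (hX.integrable_abs_rpow hp0 (by positivity)).2
    have h2 := Real.rpow_le_rpow (integral_nonneg fun ω => by positivity) h1
      (by positivity : 0 ≤ 2 / p)
    rw [← Real.rpow_mul (by positivity), mul_div_cancel₀ _ hp0.ne', Real.rpow_two,
      Real.sq_sqrt hA] at h2
    linarith

/-- A Marcinkiewicz–Zygmund inequality for independent centred random variables. -/
lemma lpLe_sum_of_indepFun {ι : Type*} (hp : 2 ≤ p) {Z : ι → Ω → ℝ} {b : ℝ} (hb : 0 ≤ b)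
    {s : Finset ι}
    (hZ : ∀ u ⊆ s, ∀ i ∈ s, i ∉ u → IndepFun (fun ω => ∑ j ∈ u, Z j ω) (Z i) P)
    (h : ∀ i ∈ s, LpLe P (1 / p) (Z i) b) (h0 : ∀ i ∈ s, ∫ ω, Z i ω ∂P = 0) :
    LpLe P (1 / p) (fun ω => ∑ i ∈ s, Z i ω) (√(s.card * ((p - 1) * b ^ 2))) := by
  classical
  have hp1 : 0 ≤ p - 1 := by linarith
  induction s using Finset.induction_on with
  | empty => simpa using LpLe.const (P := P) (0 : ℝ) (1 / p)
  | insert i s hi ih =>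
    have hsub := Finset.subset_insert i s
    have h3 := IndepFun.lpLe_add hp (hZ s hsub i (Finset.mem_insert_self i s) hi)
      (ih (fun u hu j hj => hZ u (hu.trans hsub) j (hsub hj)) (fun j hj => h j (hsub hj))
        fun j hj => h0 j (hsub hj)) (h i (by simp)) (by positivity) hb (h0 i (by simp))
    refine (h3.congr_ae (.of_forall fun ω => ?_)).mono_bound (le_of_eq ?_)
    · simp only [Finset.sum_insert hi]; ring
    · rw [Finset.card_insert_of_notMem hi]; push_cast; ring_nf

end MomentInequality

end MLPHoelder

end

/-! ### Independence along the index tree and measurability of the approximations. -/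

section

namespace MLPHoelder

set_option linter.unusedSectionVars false

universe v

section General

variable {ι Ω S S' : Type*}

lemma generateFrom_inter_eq_sup (m n : MeasurableSpace Ω) :
    MeasurableSpace.generateFrom
      {s | ∃ A B, MeasurableSet[m] A ∧ MeasurableSet[n] B ∧ s = A ∩ B} = m ⊔ n := by
  refine le_antisymm (MeasurableSpace.generateFrom_le ?_) (sup_le ?_ ?_)
  · rintro _ ⟨A, B, hA, hB, rfl⟩
    exact @MeasurableSet.inter _ (m ⊔ n) _ _ (le_sup_left (a := m) (b := n) _ hA)
      (le_sup_right (a := m) (b := n) _ hB)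
  · intro A hA
    exact MeasurableSpace.measurableSet_generateFrom ⟨A, univ, hA, @MeasurableSet.univ _ n, by simp⟩
  · intro B hB
    exact MeasurableSpace.measurableSet_generateFrom ⟨univ, B, @MeasurableSet.univ _ m, hB, by simp⟩

/-- The intersections A ∩ B form a π-system generating `m i ⊔ n i`. On it the probability
factorizes, first between the two families and then within each of them. -/
lemma iIndep_sup {m n : ι → MeasurableSpace Ω} {mΩ : MeasurableSpace Ω} {P : Measure Ω}
    (hm' : ∀ i, m i ≤ mΩ) (hn' : ∀ i, n i ≤ mΩ) (hm : iIndep m P) (hn : iIndep n P)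
    (hmn : Indep (⨆ i, m i) (⨆ i, n i) P) : iIndep (fun i => m i ⊔ n i) P := by
  classical
  refine iIndepSets.iIndep (fun i => sup_le (hm' i) (hn' i))
    (fun i => {s | ∃ A B, MeasurableSet[m i] A ∧ MeasurableSet[n i] B ∧ s = A ∩ B}) ?_ ?_ ?_
  · rintro i _ ⟨A, B, hA, hB, rfl⟩ _ ⟨A', B', hA', hB', rfl⟩ -
    exact ⟨A ∩ A', B ∩ B', @MeasurableSet.inter _ (m i) _ _ hA hA',
      @MeasurableSet.inter _ (n i) _ _ hB hB', inter_inter_inter_comm _ _ _ _⟩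
  · exact fun i => (generateFrom_inter_eq_sup (m i) (n i)).symm
  · rw [iIndepSets_iff]
    intro s F hF
    choose! A B hA hB hAB using hF
    have key : ∀ t : Finset ι, t ⊆ s → P (⋂ i ∈ t, A i ∩ B i) = (∏ i ∈ t, P (A i)) * ∏ i ∈ t, P (B i) := by
      intro t hts
      have h1 : (⋂ i ∈ t, A i ∩ B i) = (⋂ i ∈ t, A i) ∩ ⋂ i ∈ t, B i := by
        ext ω; simp only [mem_iInter, mem_inter_iff]
        exact ⟨fun h => ⟨fun i hi => (h i hi).1, fun i hi => (h i hi).2⟩,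
          fun h i hi => ⟨h.1 i hi, h.2 i hi⟩⟩
      rw [h1, (Indep_iff _ _ _).1 hmn, hm.meas_biInter fun i hi => hA i (hts hi),
        hn.meas_biInter fun i hi => hB i (hts hi)]
      · exact @Finset.measurableSet_biInter _ _ (⨆ i, m i) _ t fun i hi =>
          le_iSup m i _ (hA i (hts hi))
      · exact @Finset.measurableSet_biInter _ _ (⨆ i, n i) _ t fun i hi =>
          le_iSup n i _ (hB i (hts hi))
    have h1 : (⋂ i ∈ s, F i) = ⋂ i ∈ s, A i ∩ B i := iInter₂_congr hAB
    rw [h1, key s subset_rfl, ← Finset.prod_mul_distrib]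
    refine Finset.prod_congr rfl fun i hi => ?_
    have := key {i} (by simpa using hi)
    simp only [Finset.mem_singleton, iInter_iInter_eq_left, Finset.prod_singleton] at this
    rw [hAB i hi, this]

/-- Laws of `Φ (W ω, ω)` with frozen first argument determine the law of the composition. -/
lemma identDistrib_freeze [MeasurableSpace S] [MeasurableSpace S'] {m m' mΩ : MeasurableSpace Ω}
    {P : Measure Ω} [IsProbabilityMeasure P] {W W' : Ω → S} (hm : m ≤ mΩ) (hm' : m' ≤ mΩ)
    (hW : Measurable W) (hW' : Measurable W') (hWW : IdentDistrib W W' P P)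
    (h : Indep (MeasurableSpace.comap W inferInstance) m P)
    (h' : Indep (MeasurableSpace.comap W' inferInstance) m' P) {Φ Φ' : S × Ω → S'}
    (hΦ : Measurable[(inferInstance : MeasurableSpace S).prod m] Φ)
    (hΦ' : Measurable[(inferInstance : MeasurableSpace S).prod m'] Φ')
    (hid : ∀ s, IdentDistrib (fun ω => Φ (s, ω)) (fun ω => Φ' (s, ω)) P P) :
    IdentDistrib (fun ω => Φ (W ω, ω)) (fun ω => Φ' (W' ω, ω)) P P := by
  have hmeas : Measurable (fun ω => Φ (W ω, ω)) :=
    (measurable_of_sub hm hΦ).comp (hW.prodMk measurable_id)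
  have hmeas' : Measurable (fun ω => Φ' (W' ω, ω)) :=
    (measurable_of_sub hm' hΦ').comp (hW'.prodMk measurable_id)
  refine ⟨hmeas.aemeasurable, hmeas'.aemeasurable, ?_⟩
  ext B hB
  have hind : Measurable (B.indicator (1 : S' → ℝ≥0∞)) := measurable_one.indicator hB
  have e1 : ∀ {Z : Ω → S'}, Measurable Z → P.map Z B = ∫⁻ ω, B.indicator 1 (Z ω) ∂P := fun hZ => by
    rw [← lintegral_map hind hZ, lintegral_indicator_one hB]
  rw [e1 hmeas, e1 hmeas', lintegral_freeze hm hW h (Φ := fun q => B.indicator 1 (Φ q))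
    (hind.comp hΦ), lintegral_freeze hm' hW' h' (Φ := fun q => B.indicator 1 (Φ' q))
    (hind.comp hΦ')]
  have e2 : ∀ s, ∫⁻ ω, B.indicator 1 (Φ (s, ω)) ∂P = ∫⁻ ω, B.indicator 1 (Φ' (s, ω)) ∂P := fun s => by
    have h3 : Measurable fun ω => Φ (s, ω) :=
      (measurable_of_sub hm hΦ).comp (measurable_const.prodMk measurable_id)
    have h4 : Measurable fun ω => Φ' (s, ω) :=
      (measurable_of_sub hm' hΦ').comp (measurable_const.prodMk measurable_id)
    rw [← e1 h3, ← e1 h4, (hid s).map_eq]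
  have hF : Measurable fun s => ∫⁻ ω, B.indicator 1 (Φ' (s, ω)) ∂P :=
    (hind.comp (measurable_of_sub hm' hΦ')).lintegral_prod_right'
  calc _ = ∫⁻ ω, (fun s => ∫⁻ ω', B.indicator 1 (Φ' (s, ω')) ∂P) (W ω) ∂P :=
        lintegral_congr fun ω => e2 (W ω)
    _ = _ := by rw [← lintegral_map hF hW, hWW.map_eq, lintegral_map hF hW']

/-- Induction over the summands: laws of independent pairs are determined by the marginals, and each
partial sum is independent of the next summand. -/
lemma identDistrib_sum {mΩ : MeasurableSpace Ω} {P : Measure Ω} [IsProbabilityMeasure P]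
    {s : Finset ι} {Z Z' : ι → Ω → ℝ} (h : ∀ i ∈ s, IdentDistrib (Z i) (Z' i) P P)
    (hZ : ∀ t ⊆ s, ∀ i ∈ s, i ∉ t → IndepFun (fun ω => ∑ j ∈ t, Z j ω) (Z i) P)
    (hZ' : ∀ t ⊆ s, ∀ i ∈ s, i ∉ t → IndepFun (fun ω => ∑ j ∈ t, Z' j ω) (Z' i) P) :
    IdentDistrib (fun ω => ∑ i ∈ s, Z i ω) (fun ω => ∑ i ∈ s, Z' i ω) P P := by
  classical
  have key : ∀ t ⊆ s, IdentDistrib (fun ω => ∑ i ∈ t, Z i ω) (fun ω => ∑ i ∈ t, Z' i ω) P P := by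
    intro t
    induction t using Finset.induction_on with
    | empty => intro; simpa using IdentDistrib.refl aemeasurable_const
    | insert i t hi ih =>
      intro ht
      have his : i ∈ s := ht (by simp)
      have hts : t ⊆ s := fun j hj => ht (by simp [hj])
      have := ((ih hts).prodMk (h i his) (hZ t hts i his hi) (hZ' t hts i his hi)).comp
        (u := fun q : ℝ × ℝ => q.2 + q.1) (measurable_snd.add measurable_fst)
      simp only [Finset.sum_insert hi]
      exact this
  exact key s subset_rfl

end General

namespace Idx

/-- The indices that extend `θ`. -/
def branch (θ : Idx) : Set Idx := {η | θ.1 <+: η.1}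

/-- The indices used by the approximation with index `θ`. -/
def below (θ : Idx) : Set Idx := {η | ∃ a b, η ∈ (θ.snoc a b).branch}

lemma self_mem_branch (θ : Idx) : θ ∈ θ.branch := List.prefix_rfl

lemma below_subset_branch (θ : Idx) : θ.below ⊆ θ.branch := by
  rintro η ⟨a, b, h⟩
  exact (List.prefix_append θ.1 [a, b]).trans h

lemma branch_snoc_subset_below (θ : Idx) (a b : ℤ) : (θ.snoc a b).branch ⊆ θ.below :=
  fun _ h => ⟨a, b, h⟩

lemma notMem_below (θ : Idx) : θ ∉ θ.below := by
  rintro ⟨a, b, h⟩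
  have := List.IsPrefix.length_le h
  simp [snoc] at this

/-- Two prefixes of equal length of the same list coincide. -/
lemma disjoint_branch_snoc (θ : Idx) {a b a' b' : ℤ} (h : (a, b) ≠ (a', b')) :
    Disjoint (θ.snoc a b).branch (θ.snoc a' b').branch := by
  rw [Set.disjoint_left]
  intro η h1 h2
  refine h ?_
  have h3 := List.prefix_of_prefix_length_le h1 h2 (by simp [snoc])
  have h4 := h3.eq_of_length (by simp [snoc])
  have h5 := List.append_cancel_left h4
  simp only [List.cons.injEq, and_true] at h5
  exact Prod.ext h5.1 h5.2

end Idx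

variable {E : Type*} [NormedAddCommGroup E] [NormedSpace ℝ E] [FiniteDimensional ℝ E]
  [MeasurableSpace E] [BorelSpace E] {Ω : Type*} [mΩ : MeasurableSpace Ω] {P : Measure Ω}
  {p₁ p₂ c T : ℝ} {f : ℝ → ℝ} {g : E → ℝ} {V : ℝ → E → ℝ} {X : ℝ → ℝ → E → Ω → E}
  {r : Idx → Ω → ℝ} {Y : ℕ → Idx → ℝ → ℝ → E → Ω → E}

/-- The sigma-algebra generated by the random time and the random field with index `θ`. -/
@[reducible] def own (T : ℝ) (r : Idx → Ω → ℝ) (Y : ℕ → Idx → ℝ → ℝ → E → Ω → E) (θ : Idx) :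
    MeasurableSpace Ω :=
  MeasurableSpace.comap (r θ) inferInstance ⊔
    MeasurableSpace.comap (approxPath T Y θ) MeasurableSpace.pi

/-- The sigma-algebra generated by the random times and fields with indices in `S`. -/
@[reducible] def joint (T : ℝ) (r : Idx → Ω → ℝ) (Y : ℕ → Idx → ℝ → ℝ → E → Ω → E) (S : Set Idx) :
    MeasurableSpace Ω :=
  ⨆ θ ∈ S, own T r Y θ

lemma joint_mono {S S' : Set Idx} (h : S ⊆ S') : joint T r Y S ≤ joint T r Y S' :=
  biSup_mono h

lemma own_le_joint {S : Set Idx} {θ : Idx} (h : θ ∈ S) : own T r Y θ ≤ joint T r Y S :=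
  le_iSup₂ (f := fun θ (_ : θ ∈ S) => own T r Y θ) θ h

/-- The summands of the multilevel Picard approximations. -/
noncomputable def mlpTerm (T : ℝ) (f : ℝ → ℝ) (g : E → ℝ) (r : Idx → Ω → ℝ)
    (Y : ℕ → Idx → ℝ → ℝ → E → Ω → E) (m : ℕ) (θ : Idx) (l i : ℕ) (t : ℝ) (x : E) (ω : Ω) : ℝ :=
  g (Y (m ^ l) (θ.snoc l i) t T x ω)
    - (if l = 0 then 0 else g (Y (m ^ (l - 1)) (θ.snoc l i) t T x ω))
    + (T - t) * f (mlp T f g r Y l m (θ.snoc l i) (t + (T - t) * r (θ.snoc l i) ω)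
        (Y (m ^ l) (θ.snoc l i) t (t + (T - t) * r (θ.snoc l i) ω) x ω) ω)
    - (if l = 0 then 0 else (T - t) * f (mlp T f g r Y (l - 1) m (θ.snoc l (-(i : ℤ)))
        (t + (T - t) * r (θ.snoc l i) ω)
        (Y (m ^ (l - 1)) (θ.snoc l i) t (t + (T - t) * r (θ.snoc l i) ω) x ω) ω))

lemma mlp_eq (n m : ℕ) (θ : Idx) (t : ℝ) (x : E) (ω : Ω) :
    mlp T f g r Y n m θ t x ω = ∑ l ∈ Finset.range n, (1 / (m : ℝ) ^ (n - l)) *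
      ∑ i ∈ Finset.Icc 1 (m ^ (n - l)), mlpTerm T f g r Y m θ l i t x ω := by
  rw [mlp, ← Fin.sum_univ_eq_sum_range
    (fun l => (1 / (m : ℝ) ^ (n - l)) *
      ∑ i ∈ Finset.Icc 1 (m ^ (n - l)), mlpTerm T f g r Y m θ l i t x ω)]
  rfl

/-- The indices used by the summand `mlpTerm m θ l i`. -/
def termIdx (θ : Idx) (l i : ℕ) : Set Idx :=
  (θ.snoc l i).branch ∪ (θ.snoc l (-(i : ℤ))).branch

lemma termIdx_subset_below (θ : Idx) (l i : ℕ) : termIdx θ l i ⊆ θ.below :=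
  union_subset (θ.branch_snoc_subset_below _ _) (θ.branch_snoc_subset_below _ _)

/-- Positivity of the sample numbers is essential: it prevents ±i from matching ±i' unless i = i'.
-/
lemma disjoint_termIdx (θ : Idx) {l i l' i' : ℕ} (hi : 1 ≤ i) (hi' : 1 ≤ i')
    (h : (l, i) ≠ (l', i')) : Disjoint (termIdx θ l i) (termIdx θ l' i') := by
  have key : ∀ {a b : ℤ}, (a = i ∨ a = -i) → (b = i' ∨ b = -i') → ((l : ℤ), a) ≠ ((l' : ℤ), b) := by
    intro a b ha hb hab
    rw [Prod.mk.injEq] at hab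
    refine h (Prod.ext (by exact_mod_cast hab.1) ?_)
    change i = i'
    omega
  simp only [termIdx, disjoint_union_left, disjoint_union_right]
  exact ⟨⟨θ.disjoint_branch_snoc (key (.inl rfl) (.inl rfl)),
    θ.disjoint_branch_snoc (key (.inr rfl) (.inl rfl))⟩,
    θ.disjoint_branch_snoc (key (.inl rfl) (.inr rfl)),
    θ.disjoint_branch_snoc (key (.inr rfl) (.inr rfl))⟩

namespace ApproxAssumptions

variable (hX : FlowAssumptions P p₁ p₂ c T f g V X) (hY : ApproxAssumptions P p₁ p₂ c T V X r Y)
include hY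

lemma comap_approxPath_le (θ : Idx) :
    MeasurableSpace.comap (approxPath T Y θ) MeasurableSpace.pi ≤ mΩ :=
  (measurable_pi_lambda _ fun q => (hY.Y_field θ).1 q).comap_le

lemma own_le (θ : Idx) : own T r Y θ ≤ mΩ :=
  sup_le (hY.r_meas θ).comap_le (hY.comap_approxPath_le θ)

lemma joint_le (S : Set Idx) : joint T r Y S ≤ mΩ := iSup₂_le fun θ _ => hY.own_le θ

/-- The random times and the fields are each independent over the index, and the two families are
independent of each other. -/
lemma iIndep_own : iIndep (own T r Y) P := by
  refine iIndep_sup (fun θ => (hY.r_meas θ).comap_le) hY.comap_approxPath_le hY.r_indep.iIndep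
    hY.Y_indep.iIndep ?_
  have h := ((IndepFun_iff_Indep _ _ _).1 hY.indep_r).symm
  refine indep_of_indep_of_le_left (indep_of_indep_of_le_right h (iSup_le fun θ => ?_))
    (iSup_le fun θ => ?_)
  · have : approxPath T Y θ = (fun q : (TimeDom T × E → E) ×
        (Idx → {n : ℕ // 1 ≤ n} × TimeDom T × E → E) => q.2 θ) ∘
        fun ω => (flowPath T X ω, fun θ => approxPath T Y θ ω) := rfl
    rw [this, ← MeasurableSpace.comap_comp]
    exact MeasurableSpace.comap_mono ((measurable_pi_apply θ).comp measurable_snd).comap_le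
  · have : r θ = (fun q : Idx → ℝ => q θ) ∘ fun ω θ => r θ ω := rfl
    rw [this, ← MeasurableSpace.comap_comp]
    exact MeasurableSpace.comap_mono (measurable_pi_apply θ).comap_le

lemma indep_joint {S S' : Set Idx} (h : Disjoint S S') :
    Indep (joint T r Y S) (joint T r Y S') P :=
  indep_iSup_of_disjoint hY.own_le hY.iIndep_own h

lemma measurable_r_comp {A : Type*} [MeasurableSpace A] {w : A → Ω} {θ : Idx}
    (hw : @Measurable A Ω _ (own T r Y θ) w) : Measurable fun a => r θ (w a) := by
  have h1 : Measurable[own T r Y θ] (r θ) :=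
    (comap_measurable (r θ)).mono le_sup_left le_rfl
  exact h1.comp hw

lemma measurable_Y_comp_of_path {A : Type*} [MeasurableSpace A] {s t : A → ℝ} {x : A → E} {w : A → Ω}
    {θ : Idx} {k : ℕ} (hk : 1 ≤ k) (hs : Measurable s) (ht : Measurable t) (hx : Measurable x)
    (hw : @Measurable A Ω _ (MeasurableSpace.comap (approxPath T Y θ) MeasurableSpace.pi) w)
    (hst : ∀ a, 0 ≤ s a ∧ s a ≤ t a ∧ t a ≤ T) :
    Measurable fun a => Y k θ (s a) (t a) (x a) (w a) := by
  have h := (hY.Y_field θ).2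
  refine h.comp (g := fun q : ({n : ℕ // 1 ≤ n} × TimeDom T × E) × Ω => approxPath T Y θ q.2 q.1)
    (f := fun a => ((⟨k, hk⟩, ⟨(s a, t a), hst a⟩, x a), w a)) ?_
  refine @Measurable.prodMk _ _ _ (_) (_) (_) _ _ ?_ hw
  exact measurable_const.prodMk (((hs.prodMk ht).subtype_mk).prodMk hx)

lemma measurable_Y_comp {A : Type*} [MeasurableSpace A] {s t : A → ℝ} {x : A → E} {w : A → Ω}
    {θ : Idx} {k : ℕ} (hk : 1 ≤ k) (hs : Measurable s) (ht : Measurable t) (hx : Measurable x)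
    (hw : @Measurable A Ω _ (own T r Y θ) w) (hst : ∀ a, 0 ≤ s a ∧ s a ≤ t a ∧ t a ≤ T) :
    Measurable fun a => Y k θ (s a) (t a) (x a) (w a) :=
  hY.measurable_Y_comp_of_path hk hs ht hx (hw.mono le_rfl le_sup_right) hst

lemma time_mem {t : ℝ} (ht : t ∈ Icc 0 T) (θ : Idx) (ω : Ω) :
    t + (T - t) * r θ ω ∈ Icc t T := by
  obtain ⟨h1, h2⟩ := hY.r_mem θ ω
  have h3 : 0 ≤ T - t := sub_nonneg.2 ht.2
  constructor <;> nlinarith [mul_nonneg h3 h1]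

include hX

/-- Measurability is stated along arbitrary measurable substitutions for (t,x,ω), because
approximations are evaluated at random times and positions. In this form ω can also be measured by
the sigma-algebra of the indices actually used. -/
lemma measurable_mlpTerm_of {m : ℕ} (hm : 1 ≤ m) {θ : Idx} {l i : ℕ}
    (ih : ∀ j ≤ l, ∀ (η : Idx) {A : Type v} [MeasurableSpace A] {t : A → ℝ} {x : A → E}
      {w : A → Ω}, Measurable t → Measurable x →
      @Measurable A Ω _ (joint T r Y η.below) w → (∀ a, t a ∈ Icc 0 T) →
      Measurable fun a => mlp T f g r Y j m η (t a) (x a) (w a))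
    {A : Type v} [MeasurableSpace A] {t : A → ℝ} {x : A → E} {w : A → Ω} (ht : Measurable t)
    (hx : Measurable x) (hw : @Measurable A Ω _ (joint T r Y (termIdx θ l i)) w)
    (htm : ∀ a, t a ∈ Icc 0 T) :
    Measurable fun a => mlpTerm T f g r Y m θ l i (t a) (x a) (w a) := by
  have hw1 : @Measurable A Ω _ (own T r Y (θ.snoc l i)) w :=
    hw.mono le_rfl (own_le_joint (.inl (Idx.self_mem_branch _)))
  have hw2 : @Measurable A Ω _ (joint T r Y (θ.snoc l i).below) w :=
    hw.mono le_rfl (joint_mono fun _ h => .inl (Idx.below_subset_branch _ h))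
  have hw3 : @Measurable A Ω _ (joint T r Y (θ.snoc l (-(i : ℤ))).below) w :=
    hw.mono le_rfl (joint_mono fun _ h => .inr (Idx.below_subset_branch _ h))
  have hpow : ∀ j, 1 ≤ m ^ j := fun j => Nat.one_le_pow _ _ hm
  have hρ := ht.add ((measurable_const.sub ht).mul (hY.measurable_r_comp hw1)) (f := t)
    (g := fun a => (T - t a) * r (θ.snoc l i) (w a))
  have hρm := fun a => hY.time_mem (htm a) (θ.snoc l i) (w a)
  have hρ0 : ∀ a, t a + (T - t a) * r (θ.snoc l i) (w a) ∈ Icc 0 T := fun a =>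
    ⟨(htm a).1.trans (hρm a).1, (hρm a).2⟩
  have hT := fun k => hX.g_cont.measurable.comp
    (hY.measurable_Y_comp (hpow k) ht (measurable_const (a := T)) hx hw1 fun a =>
      ⟨(htm a).1, (htm a).2, le_rfl⟩)
  have hyρ := fun k => hY.measurable_Y_comp (hpow k) ht hρ hx hw1 fun a =>
    ⟨(htm a).1, (hρm a).1, (hρm a).2⟩
  have hfm := hX.f_cont.measurable
  have hτ : Measurable fun a => T - t a := measurable_const.sub ht
  have h1 := hτ.mul (hfm.comp (ih l le_rfl (θ.snoc l i) hρ (hyρ l) hw2 hρ0))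
  unfold mlpTerm
  split_ifs with hl
  · exact (((hT l).sub measurable_const).add h1).sub measurable_const
  · exact (((hT l).sub (hT (l - 1))).add h1).sub
      (hτ.mul (hfm.comp (ih (l - 1) (Nat.sub_le _ _) (θ.snoc l (-(i : ℤ))) hρ (hyρ (l - 1)) hw3 hρ0)))

lemma measurable_mlp {m : ℕ} (hm : 1 ≤ m) (n : ℕ) : ∀ (θ : Idx) {A : Type v} [MeasurableSpace A]
    {t : A → ℝ} {x : A → E} {w : A → Ω}, Measurable t → Measurable x →
    @Measurable A Ω _ (joint T r Y θ.below) w → (∀ a, t a ∈ Icc 0 T) →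
    Measurable fun a => mlp T f g r Y n m θ (t a) (x a) (w a) := by
  induction n using Nat.strong_induction_on with
  | _ n ih =>
    intro θ A _ t x w ht hx hw htm
    simp only [mlp_eq]
    refine Finset.measurable_sum _ fun l hl => (Finset.measurable_sum _ fun i _ => ?_).const_mul _
    have hl := Finset.mem_range.1 hl
    exact hY.measurable_mlpTerm_of hX hm (fun j hj => ih j (hj.trans_lt hl)) ht hx
      (hw.mono le_rfl (joint_mono (termIdx_subset_below θ l i))) htm

lemma measurable_mlpTerm {m : ℕ} (hm : 1 ≤ m) (θ : Idx) (l i : ℕ)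
    {A : Type v} [MeasurableSpace A] {t : A → ℝ} {x : A → E} {w : A → Ω} (ht : Measurable t)
    (hx : Measurable x) (hw : @Measurable A Ω _ (joint T r Y (termIdx θ l i)) w)
    (htm : ∀ a, t a ∈ Icc 0 T) :
    Measurable fun a => mlpTerm T f g r Y m θ l i (t a) (x a) (w a) :=
  hY.measurable_mlpTerm_of hX hm (fun j _ => hY.measurable_mlp hX hm j) ht hx hw htm

end ApproxAssumptions

end MLPHoelder

end

/-! ### The law of an approximation does not depend on its index. -/

section

namespace MLPHoelder

set_option linter.unusedSectionVars false

variable {E : Type*} [NormedAddCommGroup E] [NormedSpace ℝ E] [FiniteDimensional ℝ E]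
  [MeasurableSpace E] [BorelSpace E] {Ω : Type*} [mΩ : MeasurableSpace Ω] {P : Measure Ω}
  {p₁ p₂ c T : ℝ} {f : ℝ → ℝ} {g : E → ℝ} {V : ℝ → E → ℝ} {X : ℝ → ℝ → E → Ω → E}
  {r : Idx → Ω → ℝ} {Y : ℕ → Idx → ℝ → ℝ → E → Ω → E}

/-- The sigma-algebra generated by all random fields. -/
@[reducible] def fields (T : ℝ) (X : ℝ → ℝ → E → Ω → E) (Y : ℕ → Idx → ℝ → ℝ → E → Ω → E) :
    MeasurableSpace Ω :=
  MeasurableSpace.comap (fun ω => (flowPath T X ω, fun θ => approxPath T Y θ ω)) inferInstance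

/-- The random time and the values of two random fields with index `η`. -/
noncomputable def sample (r : Idx → Ω → ℝ) (Y : ℕ → Idx → ℝ → ℝ → E → Ω → E) (k k' : ℕ) (η : Idx)
    {t T : ℝ} (htT : t ≤ T) (x : E) (ω : Ω) : Icc t T × E × E × E × E :=
  (projIcc t T htT (t + (T - t) * r η ω), Y k η t T x ω, Y k' η t T x ω,
    Y k η t (projIcc t T htT (t + (T - t) * r η ω)) x ω,
    Y k' η t (projIcc t T htT (t + (T - t) * r η ω)) x ω)

namespace ApproxAssumptions

variable (hX : FlowAssumptions P p₁ p₂ c T f g V X) (hY : ApproxAssumptions P p₁ p₂ c T V X r Y)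
include hY

lemma indep_fields (θ : Idx) : Indep (MeasurableSpace.comap (r θ) inferInstance) (fields T X Y) P := by
  have h := ((IndepFun_iff_Indep _ _ _).1 hY.indep_r).symm
  refine indep_of_indep_of_le_left h ?_
  have : r θ = (fun q : Idx → ℝ => q θ) ∘ fun ω θ => r θ ω := rfl
  rw [this, ← MeasurableSpace.comap_comp]
  exact MeasurableSpace.comap_mono (measurable_pi_apply θ).comap_le

omit hY in
lemma comap_approxPath_le_fields (θ : Idx) :
    MeasurableSpace.comap (approxPath T Y θ) MeasurableSpace.pi ≤ fields T X Y := by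
  have : approxPath T Y θ = (fun q : (TimeDom T × E → E) ×
      (Idx → {n : ℕ // 1 ≤ n} × TimeDom T × E → E) => q.2 θ) ∘
      fun ω => (flowPath T X ω, fun θ => approxPath T Y θ ω) := rfl
  rw [this, ← MeasurableSpace.comap_comp]
  exact MeasurableSpace.comap_mono ((measurable_pi_apply θ).comp measurable_snd).comap_le

omit hY in
lemma comap_flow_le_fields {t : ℝ} (ht : t ∈ Icc 0 T) :
    MeasurableSpace.comap (fun (ω : Ω) (q : Icc t T × E) => X t q.1 q.2 ω) MeasurableSpace.pi
      ≤ fields T X Y := by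
  have : (fun (ω : Ω) (q : Icc t T × E) => X t q.1 q.2 ω) = (fun (q : (TimeDom T × E → E) ×
      (Idx → {n : ℕ // 1 ≤ n} × TimeDom T × E → E)) (z : Icc t T × E) =>
        q.1 (⟨(t, z.1), ht.1, z.1.2.1, z.1.2.2⟩, z.2)) ∘
      fun ω => (flowPath T X ω, fun θ => approxPath T Y θ ω) := rfl
  rw [this, ← MeasurableSpace.comap_comp]
  exact MeasurableSpace.comap_mono
    (measurable_pi_lambda _ fun z => (measurable_pi_apply _).comp measurable_fst).comap_le

include hX in
lemma fields_le : fields T X Y ≤ mΩ := by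
  refine Measurable.comap_le (Measurable.prodMk (measurable_pi_lambda _ fun q => ?_)
    (measurable_pi_lambda _ fun θ => measurable_pi_lambda _ fun q => (hY.Y_field θ).1 q))
  exact hX.measurable_X q.1.2.1 q.1.2.2.1 q.1.2.2.2 q.2

lemma projIcc_time {t : ℝ} (ht : t ∈ Icc 0 T) (θ : Idx) (ω : Ω) :
    (projIcc t T ht.2 (t + (T - t) * r θ ω) : ℝ) = t + (T - t) * r θ ω := by
  rw [projIcc_of_mem _ (hY.time_mem ht θ ω)]

lemma measurable_sample_frozen {k k' : ℕ} (hk : 1 ≤ k) (hk' : 1 ≤ k') (η : Idx) {t : ℝ}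
    (ht : t ∈ Icc 0 T) (x : E) :
    Measurable[(inferInstance : MeasurableSpace ℝ).prod
      (MeasurableSpace.comap (approxPath T Y η) MeasurableSpace.pi)]
      (fun q : ℝ × Ω => ((projIcc t T ht.2 (t + (T - t) * q.1), Y k η t T x q.2, Y k' η t T x q.2,
        Y k η t (projIcc t T ht.2 (t + (T - t) * q.1)) x q.2,
        Y k' η t (projIcc t T ht.2 (t + (T - t) * q.1)) x q.2) : Icc t T × E × E × E × E)) := by
  let _ : MeasurableSpace (ℝ × Ω) := (inferInstance : MeasurableSpace ℝ).prod
      (MeasurableSpace.comap (approxPath T Y η) MeasurableSpace.pi)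
  have hw : @Measurable (ℝ × Ω) Ω _ (MeasurableSpace.comap (approxPath T Y η) MeasurableSpace.pi)
    Prod.snd := @measurable_snd _ _ _ (_)
  have h1 : Measurable (Prod.fst : ℝ × Ω → ℝ) := @measurable_fst _ _ _ (_)
  have hρ : Measurable fun q : ℝ × Ω => projIcc t T ht.2 (t + (T - t) * q.1) :=
    continuous_projIcc.measurable.comp ((h1.const_mul (T - t)).const_add t)
  have hρ' : Measurable fun q : ℝ × Ω => (projIcc t T ht.2 (t + (T - t) * q.1) : ℝ) :=
    measurable_subtype_coe.comp hρ
  have hd : ∀ q : ℝ × Ω, 0 ≤ t ∧ t ≤ (projIcc t T ht.2 (t + (T - t) * q.1) : ℝ) ∧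
    (projIcc t T ht.2 (t + (T - t) * q.1) : ℝ) ≤ T := fun q =>
    ⟨ht.1, (projIcc t T ht.2 _).2.1, (projIcc t T ht.2 _).2.2⟩
  have hT : ∀ q : ℝ × Ω, 0 ≤ t ∧ t ≤ T ∧ T ≤ T := fun _ => ⟨ht.1, ht.2, le_rfl⟩
  exact hρ.prodMk ((hY.measurable_Y_comp_of_path hk measurable_const measurable_const
      measurable_const hw hT).prodMk ((hY.measurable_Y_comp_of_path hk' measurable_const
      measurable_const measurable_const hw hT).prodMk ((hY.measurable_Y_comp_of_path hk
      measurable_const hρ' measurable_const hw hd).prodMk (hY.measurable_Y_comp_of_path hk'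
      measurable_const hρ' measurable_const hw hd))))

lemma measurable_sample {k k' : ℕ} (hk : 1 ≤ k) (hk' : 1 ≤ k') (η : Idx) {t : ℝ}
    (ht : t ∈ Icc 0 T) (x : E) : Measurable[own T r Y η] (sample r Y k k' η ht.2 x) := by
  have h := hY.measurable_sample_frozen hk hk' η ht x
  refine h.comp (f := fun ω => (r η ω, ω)) ?_
  exact @Measurable.prodMk _ _ _ (_) (_) (_) _ _ ((comap_measurable (r η)).mono le_sup_left le_rfl)
    (measurable_id'' le_sup_right)

variable [IsProbabilityMeasure P]

/-- Once the random time is frozen, the sample is a functional of a single path at fixed times,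
whose law is independent of the index. -/
lemma identDistrib_sample {k k' : ℕ} (hk : 1 ≤ k) (hk' : 1 ≤ k') (η η' : Idx) {t : ℝ}
    (ht : t ∈ Icc 0 T) (x : E) :
    IdentDistrib (sample r Y k k' η ht.2 x) (sample r Y k k' η' ht.2 x) P P := by
  have hind : ∀ η, Indep (MeasurableSpace.comap (r η) inferInstance)
      (MeasurableSpace.comap (approxPath T Y η) MeasurableSpace.pi) P := fun η =>
    indep_of_indep_of_le_right (hY.indep_fields η) (comap_approxPath_le_fields η)
  refine identDistrib_freeze (hY.comap_approxPath_le η) (hY.comap_approxPath_le η') (hY.r_meas η)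
    (hY.r_meas η') ((hY.r_ident η).trans (hY.r_ident η').symm) (hind η) (hind η')
    (hY.measurable_sample_frozen hk hk' η ht x) (hY.measurable_sample_frozen hk hk' η' ht x)
    fun s => ?_
  set ρ := projIcc t T ht.2 (t + (T - t) * s)
  have := hY.identDistrib_comp η η' (ι := Fin 4)
    ![(⟨k, hk⟩, ⟨(t, T), ht.1, ht.2, le_rfl⟩, x), (⟨k', hk'⟩, ⟨(t, T), ht.1, ht.2, le_rfl⟩, x),
      (⟨k, hk⟩, ⟨(t, ρ), ht.1, ρ.2.1, ρ.2.2⟩, x), (⟨k', hk'⟩, ⟨(t, ρ), ht.1, ρ.2.1, ρ.2.2⟩, x)]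
    (u := fun z => (ρ, z 0, z 1, z 2, z 3))
    (measurable_const.prodMk ((measurable_pi_apply 0).prodMk ((measurable_pi_apply 1).prodMk
      ((measurable_pi_apply 2).prodMk (measurable_pi_apply 3)))))
  exact this

lemma indep_sample {k k' : ℕ} (hk : 1 ≤ k) (hk' : 1 ≤ k') {η : Idx} {t : ℝ}
    (ht : t ∈ Icc 0 T) (x : E) {S : Set Idx} (hS : η ∉ S) :
    Indep (MeasurableSpace.comap (sample r Y k k' η ht.2 x) inferInstance) (joint T r Y S) P :=
  indep_of_indep_of_le_left (hY.indep_joint (disjoint_singleton_left.2 hS))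
    ((hY.measurable_sample hk hk' η ht x).comap_le.trans (own_le_joint (mem_singleton η)))

include hX

lemma measurable_mlp_apply {m : ℕ} (hm : 1 ≤ m) (n : ℕ) (θ : Idx) {t : ℝ} (ht : t ∈ Icc 0 T)
    (x : E) : Measurable[joint T r Y θ.below] (mlp T f g r Y n m θ t x) :=
  @measurable_mlp E _ _ _ _ _ Ω _ P p₁ p₂ c T f g V X r Y hX hY m hm n θ Ω (joint T r Y θ.below)
    (fun _ => t) (fun _ => x) id (@measurable_const _ _ _ (_) _) (@measurable_const _ _ _ (_) _)
    (@measurable_id _ (_)) fun _ => ht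

lemma measurable_mlpTerm_apply {m : ℕ} (hm : 1 ≤ m) (θ : Idx) (l i : ℕ) {t : ℝ} (ht : t ∈ Icc 0 T)
    (x : E) : Measurable[joint T r Y (termIdx θ l i)] (mlpTerm T f g r Y m θ l i t x) :=
  @measurable_mlpTerm E _ _ _ _ _ Ω _ P p₁ p₂ c T f g V X r Y hX hY m hm θ l i Ω
    (joint T r Y (termIdx θ l i))
    (fun _ => t) (fun _ => x) id (@measurable_const _ _ _ (_) _) (@measurable_const _ _ _ (_) _)
    (@measurable_id _ (_)) fun _ => ht

omit hX in
/-- Finite sums of summands do not interact with further summands. -/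
lemma indepFun_sum_of_termIdx (θ : Idx) {ι : Type*} {s : Finset ι}
    {l i : ι → ℕ} (hi : ∀ a ∈ s, 1 ≤ i a)
    (hli : ∀ a ∈ s, ∀ b ∈ s, a ≠ b → (l a, i a) ≠ (l b, i b)) {Z : ι → Ω → ℝ}
    (hZ : ∀ a, Measurable[joint T r Y (termIdx θ (l a) (i a))] (Z a))
    {u : Finset ι} (hu : u ⊆ s) {a : ι} (ha : a ∈ s) (hau : a ∉ u) :
    IndepFun (fun ω => ∑ b ∈ u, Z b ω) (Z a) P := by
  have hdis : Disjoint (⋃ b ∈ u, termIdx θ (l b) (i b)) (termIdx θ (l a) (i a)) := by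
    rw [disjoint_iUnion₂_left]
    intro b hb
    exact disjoint_termIdx θ (hi b (hu hb)) (hi a ha)
      (hli b (hu hb) a ha fun h => hau (h ▸ hb))
  refine (IndepFun_iff_Indep _ _ _).2 (indep_of_indep_of_le_left (indep_of_indep_of_le_right
    (hY.indep_joint hdis) (hZ a).comap_le) (Measurable.comap_le ?_))
  refine Finset.measurable_sum _ fun b hb => (hZ b).mono (joint_mono ?_) le_rfl
  exact subset_biUnion_of_mem (u := fun b => termIdx θ (l b) (i b)) hb

/-- A summand is a function of its sample and of two inner approximations. Freezing the sample
leaves two approximations at deterministic points, independent because they live on disjoint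
branches, with laws given by the induction hypothesis. -/
lemma identDistrib_mlpTerm {m : ℕ} (hm : 1 ≤ m) {l : ℕ}
    (ih : ∀ j ≤ l, ∀ θ θ' : Idx, ∀ t ∈ Icc 0 T, ∀ x, IdentDistrib (mlp T f g r Y j m θ t x)
      (mlp T f g r Y j m θ' t x) P P) (θ θ' : Idx) {i : ℕ} (hi : 1 ≤ i)
    {t : ℝ} (ht : t ∈ Icc 0 T) (x : E) :
    IdentDistrib (mlpTerm T f g r Y m θ l i t x) (mlpTerm T f g r Y m θ' l i t x) P P := by
  have hpow : ∀ j, 1 ≤ m ^ j := fun j => Nat.one_le_pow _ _ hm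
  have hfm := hX.f_cont.measurable
  have hgm := hX.g_cont.measurable
  set Sθ : Idx → Set Idx := fun θ => (θ.snoc l i).below ∪ (θ.snoc l (-(i : ℤ))).below with hSθ
  set Φ : Idx → (Icc t T × E × E × E × E) × Ω → ℝ := fun θ q =>
    g q.1.2.1 - (if l = 0 then 0 else g q.1.2.2.1)
      + (T - t) * f (mlp T f g r Y l m (θ.snoc l i) q.1.1 q.1.2.2.2.1 q.2)
      - (if l = 0 then 0 else
          (T - t) * f (mlp T f g r Y (l - 1) m (θ.snoc l (-(i : ℤ))) q.1.1 q.1.2.2.2.2 q.2)) with hΦ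
  have hdis : ∀ θ : Idx, Disjoint (θ.snoc l i).branch (θ.snoc l (-(i : ℤ))).branch := fun θ =>
    θ.disjoint_branch_snoc fun h => by
      rw [Prod.mk.injEq] at h
      omega
  -- The sampling index is used by neither inner approximation; hence the sample is independent of
  -- both and may be frozen.
  have hnot : ∀ θ : Idx, θ.snoc l i ∉ Sθ θ := by
    rintro θ (h | h)
    · exact Idx.notMem_below _ h
    · exact Set.disjoint_left.1 (hdis θ) (Idx.self_mem_branch _) (Idx.below_subset_branch _ h)
  have heq : ∀ θ ω, mlpTerm T f g r Y m θ l i t x ω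
      = Φ θ (sample r Y (m ^ l) (m ^ (l - 1)) (θ.snoc l i) ht.2 x ω, ω) := fun θ ω => by
    simp only [hΦ, sample, hY.projIcc_time ht]
    rfl
  have hmeas : ∀ θ, Measurable[(inferInstance : MeasurableSpace (Icc t T × E × E × E × E)).prod
      (joint T r Y (Sθ θ))] (Φ θ) := by
    intro θ
    let _ : MeasurableSpace ((Icc t T × E × E × E × E) × Ω) :=
      (inferInstance : MeasurableSpace (Icc t T × E × E × E × E)).prod (joint T r Y (Sθ θ))
    have h1 : Measurable (Prod.fst : (Icc t T × E × E × E × E) × Ω → _) := @measurable_fst _ _ _ (_)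
    have h2 : @Measurable ((Icc t T × E × E × E × E) × Ω) Ω _ (joint T r Y (Sθ θ)) Prod.snd :=
      @measurable_snd _ _ _ (_)
    have hρ := measurable_subtype_coe.comp (measurable_fst.comp h1)
    have ha := measurable_fst.comp (measurable_snd.comp h1)
    have hb := measurable_fst.comp (measurable_snd.comp (measurable_snd.comp h1))
    have hy := measurable_fst.comp (measurable_snd.comp (measurable_snd.comp (measurable_snd.comp h1)))
    have hy' := measurable_snd.comp (measurable_snd.comp (measurable_snd.comp (measurable_snd.comp h1)))
    have hdom : ∀ q : (Icc t T × E × E × E × E) × Ω, (q.1.1 : ℝ) ∈ Icc 0 T := fun q =>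
      ⟨ht.1.trans q.1.1.2.1, q.1.1.2.2⟩
    have hU := (hfm.comp (hY.measurable_mlp hX hm l (θ.snoc l i) hρ hy
      (h2.mono le_rfl (joint_mono subset_union_left)) hdom)).const_mul (T - t)
    have hU' := (hfm.comp (hY.measurable_mlp hX hm (l - 1) (θ.snoc l (-(i : ℤ))) hρ hy'
      (h2.mono le_rfl (joint_mono subset_union_right)) hdom)).const_mul (T - t)
    simp only [hΦ]
    split_ifs with hl
    · exact (((hgm.comp ha).sub measurable_const).add hU).sub measurable_const
    · exact (((hgm.comp ha).sub (hgm.comp hb)).add hU).sub hU'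
  have key := identDistrib_freeze (hY.joint_le (Sθ θ)) (hY.joint_le (Sθ θ'))
    ((hY.measurable_sample (hpow l) (hpow (l - 1)) (θ.snoc l i) ht x).mono (hY.own_le _) le_rfl)
    ((hY.measurable_sample (hpow l) (hpow (l - 1)) (θ'.snoc l i) ht x).mono (hY.own_le _) le_rfl)
    (hY.identDistrib_sample (hpow l) (hpow (l - 1)) _ _ ht x)
    (hY.indep_sample (hpow l) (hpow (l - 1)) ht x (hnot θ))
    (hY.indep_sample (hpow l) (hpow (l - 1)) ht x (hnot θ')) (hmeas θ) (hmeas θ') fun s => ?_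
  · simp only [← heq] at key
    exact key
  · obtain ⟨ρ, a, b, y, y'⟩ := s
    have hρ : (ρ : ℝ) ∈ Icc 0 T := ⟨ht.1.trans ρ.2.1, ρ.2.2⟩
    have hindep : ∀ θ : Idx, IndepFun (mlp T f g r Y l m (θ.snoc l i) ρ y)
        (mlp T f g r Y (l - 1) m (θ.snoc l (-(i : ℤ))) ρ y') P := fun θ =>
      (IndepFun_iff_Indep _ _ _).2 (indep_of_indep_of_le_left (indep_of_indep_of_le_right
        (hY.indep_joint ((hdis θ).mono (Idx.below_subset_branch _) (Idx.below_subset_branch _)))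
        (hY.measurable_mlp_apply hX hm _ _ hρ y').comap_le)
        (hY.measurable_mlp_apply hX hm _ _ hρ y).comap_le)
    have h := (ih l le_rfl (θ.snoc l i) (θ'.snoc l i) ρ hρ y).prodMk
      (ih (l - 1) (Nat.sub_le _ _) (θ.snoc l (-(i : ℤ))) (θ'.snoc l (-(i : ℤ))) ρ hρ y')
      (hindep θ) (hindep θ')
    have hu : Measurable fun q : ℝ × ℝ => g a - (if l = 0 then 0 else g b) + (T - t) * f q.1
        - (if l = 0 then 0 else (T - t) * f q.2) := by
      have h1 : Measurable fun q : ℝ × ℝ => (T - t) * f q.1 :=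
        (hfm.comp measurable_fst).const_mul (T - t)
      have h2 : Measurable fun q : ℝ × ℝ => (T - t) * f q.2 :=
        (hfm.comp measurable_snd).const_mul (T - t)
      split_ifs with hl
      · exact (measurable_const.add h1).sub measurable_const
      · exact (measurable_const.add h1).sub h2
    exact h.comp hu

/-- The law of `mlp n m θ t x` does not depend on `θ`. -/
lemma identDistrib_mlp {m : ℕ} (hm : 1 ≤ m) (n : ℕ) : ∀ θ θ' : Idx, ∀ t ∈ Icc 0 T, ∀ x,
    IdentDistrib (mlp T f g r Y n m θ t x) (mlp T f g r Y n m θ' t x) P P := by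
  induction n using Nat.strong_induction_on with
  | _ n ih =>
    intro θ θ' t ht x
    -- The double sum is flattened so that levels and samples form one family with disjoint index
    -- sets.
    set s : Finset (Σ _ : ℕ, ℕ) := (Finset.range n).sigma fun l => Finset.Icc 1 (m ^ (n - l))
    have hs : ∀ a ∈ s, a.1 < n ∧ 1 ≤ a.2 := fun a ha => by
      have := Finset.mem_sigma.1 ha
      exact ⟨Finset.mem_range.1 this.1, (Finset.mem_Icc.1 this.2).1⟩
    have heq : ∀ θ, mlp T f g r Y n m θ t x = fun ω => ∑ a ∈ s,
        1 / (m : ℝ) ^ (n - a.1) * mlpTerm T f g r Y m θ a.1 a.2 t x ω := fun θ => by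
      ext ω
      rw [mlp_eq, Finset.sum_sigma]
      exact Finset.sum_congr rfl fun l _ => Finset.mul_sum _ _ _
    have hne : ∀ a ∈ s, ∀ b ∈ s, a ≠ b → (a.1, a.2) ≠ (b.1, b.2) := fun a _ b _ hab h =>
      hab (by rw [Prod.mk.injEq] at h; exact Sigma.ext h.1 (heq_of_eq h.2))
    have hind : ∀ θ : Idx, ∀ u ⊆ s, ∀ a ∈ s, a ∉ u → IndepFun (fun ω => ∑ b ∈ u,
        1 / (m : ℝ) ^ (n - b.1) * mlpTerm T f g r Y m θ b.1 b.2 t x ω)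
        (fun ω => 1 / (m : ℝ) ^ (n - a.1) * mlpTerm T f g r Y m θ a.1 a.2 t x ω) P :=
      fun θ u hu a ha hau => hY.indepFun_sum_of_termIdx θ (fun a ha => (hs a ha).2) hne (fun a =>
        (measurable_const_mul (1 / (m : ℝ) ^ (n - a.1))).comp
          (hY.measurable_mlpTerm_apply hX hm θ a.1 a.2 ht x)) hu ha hau
    rw [heq θ, heq θ']
    refine identDistrib_sum (fun a ha => ?_) (hind θ) (hind θ')
    exact (hY.identDistrib_mlpTerm hX hm (fun j hj => ih j (hj.trans_lt (hs a ha).1)) θ θ'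
      (hs a ha).2 ht x).comp (measurable_const_mul _)

/-- The law of an approximation at a sampled point depends neither on the index of the
approximation nor on the index of the sample. -/
lemma identDistrib_mlp_sample {m : ℕ} (hm : 1 ≤ m) (n : ℕ) {k : ℕ} (hk : 1 ≤ k) {η η' ζ ζ' : Idx}
    (hη : η ∉ η'.below) (hζ : ζ ∉ ζ'.below) {t : ℝ} (ht : t ∈ Icc 0 T) (x : E) :
    IdentDistrib
      (fun ω => mlp T f g r Y n m η' (t + (T - t) * r η ω) (Y k η t (t + (T - t) * r η ω) x ω) ω)
      (fun ω => mlp T f g r Y n m ζ' (t + (T - t) * r ζ ω) (Y k ζ t (t + (T - t) * r ζ ω) x ω) ω)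
      P P := by
  set Φ : Idx → (Icc t T × E × E × E × E) × Ω → ℝ := fun θ q =>
    mlp T f g r Y n m θ q.1.1 q.1.2.2.2.1 q.2 with hΦ
  have hmeas : ∀ θ, Measurable[(inferInstance : MeasurableSpace (Icc t T × E × E × E × E)).prod
      (joint T r Y θ.below)] (Φ θ) := by
    intro θ
    let _ : MeasurableSpace ((Icc t T × E × E × E × E) × Ω) :=
      (inferInstance : MeasurableSpace (Icc t T × E × E × E × E)).prod (joint T r Y θ.below)
    have h1 : Measurable (Prod.fst : (Icc t T × E × E × E × E) × Ω → _) := @measurable_fst _ _ _ (_)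
    have h2 : @Measurable ((Icc t T × E × E × E × E) × Ω) Ω _ (joint T r Y θ.below) Prod.snd :=
      @measurable_snd _ _ _ (_)
    exact hY.measurable_mlp hX hm n θ (measurable_subtype_coe.comp (measurable_fst.comp h1))
      (measurable_fst.comp (measurable_snd.comp (measurable_snd.comp (measurable_snd.comp h1)))) h2
      fun q => ⟨ht.1.trans q.1.1.2.1, q.1.1.2.2⟩
  have key := identDistrib_freeze (hY.joint_le η'.below) (hY.joint_le ζ'.below)
    ((hY.measurable_sample hk hk η ht x).mono (hY.own_le _) le_rfl)
    ((hY.measurable_sample hk hk ζ ht x).mono (hY.own_le _) le_rfl)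
    (hY.identDistrib_sample hk hk _ _ ht x) (hY.indep_sample hk hk ht x hη)
    (hY.indep_sample hk hk ht x hζ) (hmeas η') (hmeas ζ') fun s =>
      hY.identDistrib_mlp hX hm n η' ζ' s.1 ⟨ht.1.trans s.1.2.1, s.1.2.2⟩ s.2.2.2.1
  simpa only [hΦ, sample, hY.projIcc_time ht] using key

end ApproxAssumptions

end MLPHoelder

end

/-! ### Weighted norms and second-order estimates for f composed with the solution. -/

section

namespace MLPHoelder

set_option linter.unusedSectionVars false

/-- The conditions on the exponents of the weighted norms. -/
structure Exponents (p₁ p₂ p q₁ q₂ : ℝ) : Prop where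
  two_le : 2 ≤ p
  three_le : 3 ≤ q₁
  nine_le : 9 ≤ q₂
  moments : (q₂ + 1) / p₁ + 2 / p₂ ≤ 1 / p
  add_two_le : q₁ + 2 ≤ q₂

lemma avg_rpow_le {a b q : ℝ} (ha : 0 ≤ a) (hb : 0 ≤ b) (hq : 1 ≤ q) :
    ((a + b) / 2) ^ q ≤ (a ^ q + b ^ q) / 2 := by
  have h := (convexOn_rpow hq).2 (mem_Ici.2 ha) (mem_Ici.2 hb) (by norm_num : (0 : ℝ) ≤ 1 / 2)
    (by norm_num : (0 : ℝ) ≤ 1 / 2) (by norm_num)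
  simp only [smul_eq_mul] at h
  calc _ = (1 / 2 * a + 1 / 2 * b) ^ q := by congr 1; ring
    _ ≤ _ := h
    _ = _ := by ring

lemma avg_pow_le {a b q : ℝ} (ha : 1 ≤ a) (hb : 1 ≤ b) (k : ℕ) (hk : (k : ℝ) ≤ q) (hq : 1 ≤ q) :
    ((a + b) / 2) ^ k ≤ (a ^ q + b ^ q) / 2 := by
  refine le_trans ?_ (avg_rpow_le (by linarith) (by linarith) hq)
  rw [← Real.rpow_natCast]
  exact Real.rpow_le_rpow_of_exponent_le (by linarith) hk

variable {E : Type*} [NormedAddCommGroup E] [NormedSpace ℝ E] [FiniteDimensional ℝ E]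
  [MeasurableSpace E] [BorelSpace E] {Ω : Type*} [mΩ : MeasurableSpace Ω] {P : Measure Ω}
  {p₁ p₂ p q₁ q₂ c T : ℝ} {f : ℝ → ℝ} {g : E → ℝ} {V : ℝ → E → ℝ} {X : ℝ → ℝ → E → Ω → E}

/-- The weighted parabolic distance. -/
noncomputable def gap (T : ℝ) (V : ℝ → E → ℝ) (t : ℝ) (x : E) (t' : ℝ) (x' : E) : ℝ :=
  (V t x + V t' x') / 2 * (√(t' - t) / √T) + ‖x - x'‖ / √T

/-- `H` is bounded by `φ` in the weighted norms, with explicit dependence on the starting time. -/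
structure WBound (P : Measure Ω) (p q₁ q₂ T : ℝ) (V : ℝ → E → ℝ) (H : ℝ → E → Ω → ℝ)
    (φ : ℝ → ℝ) : Prop where
  one : ∀ t ∈ Icc 0 T, ∀ x, LpLe P (1 / p) (H t x) (φ t * V t x ^ q₁)
  two : ∀ t t' : ℝ, 0 ≤ t → t ≤ t' → t' ≤ T → ∀ x x',
    LpLe P (1 / p) (fun ω => H t x ω - H t' x' ω)
      (φ t * ((V t x ^ q₂ + V t' x' ^ q₂) / 2 * gap T V t x t' x'))

/-- The intermediate time reached from `t` after the fraction `s` of the remaining time. -/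
def midTime (T t s : ℝ) : ℝ := t + (T - t) * s

lemma midTime_mem {t s : ℝ} (ht : t ∈ Icc 0 T) (hs : s ∈ Icc (0 : ℝ) 1) :
    midTime T t s ∈ Icc t T := by
  have h3 : 0 ≤ T - t := sub_nonneg.2 ht.2
  constructor <;> unfold midTime <;> nlinarith [mul_nonneg h3 hs.1, hs.2]

lemma midTime_mono {t t' s : ℝ} (htt : t ≤ t') (hs : s ∈ Icc (0 : ℝ) 1) :
    midTime T t s ≤ midTime T t' s := by
  unfold midTime
  nlinarith [mul_nonneg (sub_nonneg.2 htt) (sub_nonneg.2 hs.2)]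

lemma midTime_sub_le {t t' s : ℝ} (htt : t ≤ t') (hs : s ∈ Icc (0 : ℝ) 1) :
    midTime T t' s - midTime T t s ≤ t' - t := by
  unfold midTime
  nlinarith [mul_nonneg (sub_nonneg.2 htt) hs.1]

/-- The contribution of the terminal condition and of the nonlinearity along the field `A`. -/
def increment (T : ℝ) (f : ℝ → ℝ) (g : E → ℝ) (u : ℝ → E → ℝ) (A : ℝ → ℝ → E → Ω → E) (s t : ℝ)
    (x : E) (ω : Ω) : ℝ :=
  g (A t T x ω) + (T - t) * f (u (midTime T t s) (A t (midTime T t s) x ω))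

namespace FlowAssumptions

variable [IsProbabilityMeasure P] (hX : FlowAssumptions P p₁ p₂ c T f g V X) {u : ℝ → E → ℝ} (hu : SolutionBounds c T V u)
include hX hu

lemma abs_f_sub_same_time {τ : ℝ} (hτ : τ ∈ Icc 0 T) (a b : E) :
    |f (u τ a) - f (u τ b)| ≤
      c * (8 * Real.exp (c * T) ^ 2 * ((V τ a + V τ b) / 2) * (‖a - b‖ / √T)) := by
  have h := hu.hoelder τ τ hτ.1 le_rfl hτ.2 a b
  simp only [sub_self, Real.sqrt_zero, zero_div, mul_zero, zero_add] at h
  exact (hX.abs_f_sub_le _ _).trans (mul_le_mul_of_nonneg_left h hX.c_pos.le)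

/-- The linear part of the condition on f meets the second-order bound for u. The quadratic part
multiplies a spatial difference by a space-time difference of u, whence the constant 16·16·2/2 =
256. The parameter `h` allows the time step to be replaced by a larger one. -/
lemma abs_f_second_le {τ τ' h : ℝ} (hτ : 0 ≤ τ) (hττ : τ ≤ τ') (hτ' : τ' ≤ T)
    (hh : √(τ' - τ) ≤ h) (a b a' b' : E) :
    |(f (u τ a) - f (u τ b)) - (f (u τ' a') - f (u τ' b'))| ≤
      c * (9 * Real.exp (c * T) ^ 9 * (((V τ a + V τ b + V τ' a' + V τ' b') / 4) ^ 3 *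
        (‖(a - b) - (a' - b')‖ / √T))
        + (9 * Real.exp (c * T) ^ 9 + 256 * Real.exp (c * T) ^ 4) *
          (((V τ a + V τ b + V τ' a' + V τ' b') / 4) ^ 3 *
            ((‖a - b‖ + ‖a' - b'‖) * (h + ‖a - a'‖) / T))) := by
  have hT := hX.T_pos
  have hm : τ ∈ Icc 0 T := ⟨hτ, hττ.trans hτ'⟩
  have hm' : τ' ∈ Icc 0 T := ⟨hτ.trans hττ, hτ'⟩
  have h1 := hX.one_le_V τ hm a
  have h2 := hX.one_le_V τ hm b
  have h3 := hX.one_le_V τ' hm' a'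
  have h4 := hX.one_le_V τ' hm' b'
  set e := Real.exp (c * T)
  have he : 0 < e := Real.exp_pos _
  set v := (V τ a + V τ b + V τ' a' + V τ' b') / 4 with hv
  have hv1 : 1 ≤ v := by linarith
  set η := ‖a - b‖ + ‖a' - b'‖ with hη
  set l := ‖a - a'‖
  have hh0 : 0 ≤ h := (Real.sqrt_nonneg _).trans hh
  have k1 : |u τ a - u τ b| ≤ 16 * e ^ 2 * v * (‖a - b‖ / √T) := by
    have h := hu.hoelder τ τ hτ le_rfl hm.2 a b
    simp only [sub_self, Real.sqrt_zero, zero_div, mul_zero, zero_add] at h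
    refine h.trans ?_
    have : (V τ a + V τ b) / 2 ≤ 2 * v := by linarith
    calc _ ≤ 8 * e ^ 2 * (2 * v) * (‖a - b‖ / √T) := by gcongr
      _ = _ := by ring
  have k2 : |u τ' a' - u τ' b'| ≤ 16 * e ^ 2 * v * (‖a' - b'‖ / √T) := by
    have h := hu.hoelder τ' τ' hm'.1 le_rfl hτ' a' b'
    simp only [sub_self, Real.sqrt_zero, zero_div, mul_zero, zero_add] at h
    refine h.trans ?_
    have : (V τ' a' + V τ' b') / 2 ≤ 2 * v := by linarith
    calc _ ≤ 8 * e ^ 2 * (2 * v) * (‖a' - b'‖ / √T) := by gcongr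
      _ = _ := by ring
  have k3 : |u τ a - u τ' a'| ≤ 16 * e ^ 2 * v * ((2 * v) * (h + l) / √T) := by
    refine (hu.hoelder τ τ' hτ hττ hτ' a a').trans ?_
    have k : (V τ a + V τ' a') / 2 ≤ 2 * v := by linarith
    have k' : l ≤ 2 * v * l := le_mul_of_one_le_left (norm_nonneg _) (by linarith)
    calc _ ≤ 8 * e ^ 2 * (2 * v) * (2 * v * (h / √T) + 2 * v * l / √T) := by gcongr
      _ = _ := by ring
  have k4 : |(u τ a - u τ b) - (u τ' a' - u τ' b')| ≤ 9 * e ^ 9 * v ^ 3 *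
      (‖(a - b) - (a' - b')‖ / √T + η * (h + l) / T) := by
    refine (hu.second τ τ' hτ hττ hτ' a b a' b').trans ?_
    gcongr
  have hsT : √T * √T = T := Real.mul_self_sqrt hT.le
  refine (hX.f_diff _ _ _ _).trans ?_
  have hc := hX.c_pos
  calc _ ≤ c * (9 * e ^ 9 * v ^ 3 * (‖(a - b) - (a' - b')‖ / √T + η * (h + l) / T))
        + c * (16 * e ^ 2 * v * (‖a - b‖ / √T) + 16 * e ^ 2 * v * (‖a' - b'‖ / √T))
          * (16 * e ^ 2 * v * ((2 * v) * (h + l) / √T)) / 2 := by gcongr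
    _ = c * (9 * e ^ 9 * v ^ 3 * (‖(a - b) - (a' - b')‖ / √T + η * (h + l) / T))
        + c * (256 * e ^ 4 * (v ^ 3 * (η * (h + l) / (√T * √T)))) := by
          rw [hη]; field_simp; ring
    _ = _ := by rw [hsT]; ring

lemma increment_sub_second_le {τ τ' t t' h : ℝ} (ht : 0 ≤ t) (htt : t ≤ t') (ht' : t' ≤ T)
    (hτ : t ≤ τ) (hττ : τ ≤ τ') (hτ' : τ' ≤ T) (hh : h = √(t' - t)) (hτh : √(τ' - τ) ≤ h)
    (a b a' b' : E) :
    |(T - t) * (f (u τ a) - f (u τ b)) - (T - t') * (f (u τ' a') - f (u τ' b'))| ≤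
      4 * Real.exp (c * T) ^ 10 * (((V τ a + V τ b + V τ' a' + V τ' b') / 4) ^ 3 *
        (‖(a - b) - (a' - b')‖ / √T))
        + 104 * Real.exp (c * T) ^ 10 * (((V τ a + V τ b + V τ' a' + V τ' b') / 4) ^ 3 *
            ((‖a - b‖ + ‖a' - b'‖) * (h + ‖a - a'‖) / T)) := by
  have hT := hX.T_pos
  have hc := hX.c_pos
  have hm : τ ∈ Icc 0 T := ⟨ht.trans hτ, hττ.trans hτ'⟩
  have hm' : τ' ∈ Icc 0 T := ⟨hm.1.trans hττ, hτ'⟩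
  have h1 := hX.one_le_V τ hm a
  have h2 := hX.one_le_V τ hm b
  have h3 := hX.one_le_V τ' hm' a'
  have h4 := hX.one_le_V τ' hm' b'
  obtain ⟨he, hcT⟩ := hX.exp_facts
  have k1 := hX.abs_f_second_le hu hm.1 hττ hτ' hτh a b a' b'
  have k2 := hX.abs_f_sub_same_time hu hm a b
  set e := Real.exp (c * T)
  set v := (V τ a + V τ b + V τ' a' + V τ' b') / 4 with hv
  have hv1 : 1 ≤ v := by linarith
  set η := ‖a - b‖ + ‖a' - b'‖ with hη
  set l := ‖a - a'‖
  set δ := ‖(a - b) - (a' - b')‖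
  have hh0 : 0 ≤ h := (Real.sqrt_nonneg _).trans hτh
  have hsT : √T * √T = T := Real.mul_self_sqrt hT.le
  have hsT0 : 0 < √T := Real.sqrt_pos.2 hT
  have k3 : t' - t ≤ h * √T := hh ▸ le_sqrt_mul_sqrt (by linarith)
  have k4 : c * (8 * e ^ 2 * ((V τ a + V τ b) / 2) * (‖a - b‖ / √T)) * (h * √T)
      ≤ c * T * (16 * e ^ 2 * (v ^ 3 * (η * (h + l) / T))) := by
    have i1 : (V τ a + V τ b) / 2 ≤ 2 * v ^ 3 := by
      have : v ≤ v ^ 3 := le_self_pow₀ hv1 (by norm_num)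
      linarith
    have i2 : ‖a - b‖ ≤ η := by rw [hη]; linarith [norm_nonneg (a' - b')]
    have i3 : h ≤ h + l := by linarith [norm_nonneg (a - a')]
    calc _ = c * (8 * e ^ 2 * ((V τ a + V τ b) / 2) * (‖a - b‖ * h)) := by field_simp
      _ ≤ c * (8 * e ^ 2 * (2 * v ^ 3) * (η * (h + l))) := by gcongr
      _ = _ := by field_simp; ring
  -- The second difference is taken with the common factor T-t'; the change of the prefactor leaves
  -- a single spatial difference multiplied by t'-t. The final constants come from 37/100·9 ≤ 4 and
  -- 37/100·(9+256+16) ≤ 104.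
  have h0 : (T - t) * (f (u τ a) - f (u τ b)) - (T - t') * (f (u τ' a') - f (u τ' b'))
      = (T - t') * ((f (u τ a) - f (u τ b)) - (f (u τ' a') - f (u τ' b')))
        + (t' - t) * (f (u τ a) - f (u τ b)) := by ring
  have hTt : 0 ≤ T - t' := sub_nonneg.2 ht'
  have htt0 : 0 ≤ t' - t := sub_nonneg.2 htt
  have e9 : c * T * e ^ 9 ≤ 37 / 100 * e ^ 10 := by
    calc _ ≤ 37 / 100 * e * e ^ 9 := by gcongr
      _ = _ := by ring
  have e4 : e ^ 4 ≤ e ^ 9 := pow_le_pow_right₀ he (by norm_num)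
  have e2 : e ^ 2 ≤ e ^ 9 := pow_le_pow_right₀ he (by norm_num)
  rw [h0]
  refine (abs_add_le _ _).trans ?_
  rw [abs_mul, abs_mul, abs_of_nonneg hTt, abs_of_nonneg htt0]
  have hA : 0 ≤ v ^ 3 * (δ / √T) := by positivity
  have hB : 0 ≤ v ^ 3 * (η * (h + l) / T) := by positivity
  set A := v ^ 3 * (δ / √T)
  set B := v ^ 3 * (η * (h + l) / T)
  calc _ ≤ T * (c * (9 * e ^ 9 * A + (9 * e ^ 9 + 256 * e ^ 4) * B))
        + (h * √T) * (c * (8 * e ^ 2 * ((V τ a + V τ b) / 2) * (‖a - b‖ / √T))) := by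
          gcongr
          linarith
    _ ≤ T * (c * (9 * e ^ 9 * A + (9 * e ^ 9 + 256 * e ^ 9) * B)) + c * T * (16 * e ^ 9 * B) := by
          refine add_le_add (by gcongr) ?_
          rw [mul_comm]
          refine k4.trans (by gcongr)
    _ = c * T * e ^ 9 * (9 * A + 281 * B) := by ring
    _ ≤ 37 / 100 * e ^ 10 * (9 * A + 281 * B) := by gcongr
    _ ≤ _ := by
        have hA' := mul_nonneg (by positivity : 0 ≤ e ^ 10) hA
        have hB' := mul_nonneg (by positivity : 0 ≤ e ^ 10) hB
        linarith

end FlowAssumptions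

end MLPHoelder

end

/-! ### Bounds for the terminal and nonlinear contributions along one field or two coupled fields.
-/

section

namespace MLPHoelder

set_option linter.unusedSectionVars false

variable {E : Type*} [NormedAddCommGroup E] [NormedSpace ℝ E] [FiniteDimensional ℝ E]
  [MeasurableSpace E] [BorelSpace E] {Ω : Type*} [mΩ : MeasurableSpace Ω] {P : Measure Ω}
  {p₁ p₂ p q₁ q₂ c T : ℝ} {f : ℝ → ℝ} {g : E → ℝ} {V : ℝ → E → ℝ} {X : ℝ → ℝ → E → Ω → E}

/-- The condition e ≤ W turns W h + e d into at most W (W h + d), so the factor in front of the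
spatial distance costs only one weight. The coefficients sum to 1 + 1/2 + 4 + 208 ≤ 220. -/
lemma coupled_increment_arith {e W h d ε S : ℝ} (he : 1 ≤ e) (hW : e ≤ W) (hh : 0 ≤ h) (hd : 0 ≤ d)
    (hε : 0 ≤ ε) (hS : 0 < S) :
    (1 / S * (W ^ 1 * (W * (h + d) * ε)) + 1 / (2 * (S * S)) * (W ^ 1 * (W * S * ε * (W * h + e * d))))
      + (4 * e ^ 10 / S * (W ^ 3 * (W * (h + d) * ε))
        + 104 * e ^ 10 / (S * S) * (W ^ 3 * (W * S * ε * (h + (W * h + e * d)))))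
      ≤ 220 * e ^ 10 * ε * (W ^ 5 * ((W * h + d) / S)) := by
  have hW1 : 1 ≤ W := he.trans hW
  have k1 : h + d ≤ W * h + d := by nlinarith
  have k2 : W * h + e * d ≤ W * (W * h + d) := by
    have := mul_le_mul_of_nonneg_right hW hd
    have := mul_le_mul_of_nonneg_right hW1 (by positivity : 0 ≤ W * h)
    nlinarith
  have k3 : h + (W * h + e * d) ≤ W * (2 * (W * h + d)) := by
    have : h ≤ W * (W * h) := by nlinarith
    nlinarith
  set z := W * h + d with hz
  have hz0 : 0 ≤ z := by positivity
  have w2 : W ^ 2 ≤ e ^ 10 * W ^ 5 := by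
    calc W ^ 2 ≤ W ^ 5 := pow_le_pow_right₀ hW1 (by norm_num)
      _ ≤ _ := le_mul_of_one_le_left (by positivity) (one_le_pow₀ he)
  have w3 : W ^ 3 ≤ e ^ 10 * W ^ 5 := by
    calc W ^ 3 ≤ W ^ 5 := pow_le_pow_right₀ hW1 (by norm_num)
      _ ≤ _ := le_mul_of_one_le_left (by positivity) (one_le_pow₀ he)
  have w4 : e ^ 10 * W ^ 4 ≤ e ^ 10 * W ^ 5 := by
    have := pow_le_pow_right₀ hW1 (by norm_num : 4 ≤ 5)
    gcongr
  have hεS : 0 ≤ ε / S := by positivity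
  calc _ ≤ (1 / S * (W ^ 1 * (W * z * ε)) + 1 / (2 * (S * S)) * (W ^ 1 * (W * S * ε * (W * z))))
      + (4 * e ^ 10 / S * (W ^ 3 * (W * z * ε))
        + 104 * e ^ 10 / (S * S) * (W ^ 3 * (W * S * ε * (W * (2 * z))))) := by gcongr
    _ = (ε / S * z) * (W ^ 2 + W ^ 3 / 2 + 4 * (e ^ 10 * W ^ 4) + 208 * (e ^ 10 * W ^ 5)) := by
        field_simp; ring
    _ ≤ (ε / S * z) * (220 * (e ^ 10 * W ^ 5)) := by
        have : 0 ≤ e ^ 10 * W ^ 5 := by positivity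
        gcongr
        linarith
    _ = _ := by ring

lemma increment_arith {e W h d S k : ℝ} (he : 1 ≤ e) (hW : e ≤ W) (hh : 0 ≤ h) (hd : 0 ≤ d)
    (hS : 0 < S) (hk : k ≤ 37 / 100 * e) (_hk0 : 0 ≤ k) :
    1 / S * (W ^ 1 * (W * h + e * d)) + (8 * k * e ^ 2 / S * (W ^ 1 * (W * h + (W * h + e * d)))
      + 2 * (1 + 2 * k * e) * (h / S) * W) ≤ 220 * e ^ 10 * (W ^ 5 * ((W * h + d) / S)) := by
  have hW1 : 1 ≤ W := he.trans hW
  have k2 : W * h + e * d ≤ W * (W * h + d) := by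
    have := mul_le_mul_of_nonneg_right hW hd
    have := mul_le_mul_of_nonneg_right hW1 (by positivity : 0 ≤ W * h)
    nlinarith
  have k3 : W * h + (W * h + e * d) ≤ W * (2 * (W * h + d)) := by
    have := mul_le_mul_of_nonneg_right hW1 (by positivity : 0 ≤ W * h)
    nlinarith
  have k4 : h * W ≤ W ^ 2 * (W * h + d) := by
    have h1 : 0 ≤ W ^ 2 * d := by positivity
    have h2 : 1 * (h * W) ≤ W ^ 2 * (h * W) := by
      have := one_le_pow₀ hW1 (n := 2)
      gcongr
    nlinarith
  set z := W * h + d with hz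
  have hz0 : 0 ≤ z := by positivity
  have w2 : W ^ 2 ≤ W ^ 5 := pow_le_pow_right₀ hW1 (by norm_num)
  have e0 : 1 ≤ e ^ 10 := one_le_pow₀ he
  have e2 : e ^ 2 ≤ e ^ 10 := pow_le_pow_right₀ he (by norm_num)
  have e3 : e ^ 3 ≤ e ^ 10 := pow_le_pow_right₀ he (by norm_num)
  calc _ ≤ 1 / S * (W ^ 1 * (W * z)) + (8 * (37 / 100 * e) * e ^ 2 / S * (W ^ 1 * (W * (2 * z)))
      + 2 * (1 + 2 * (37 / 100 * e) * e) * (W ^ 2 * z / S)) := by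
        have : 2 * (1 + 2 * k * e) * (h / S) * W = 2 * (1 + 2 * k * e) * (h * W / S) := by ring
        rw [this]
        gcongr
    _ = (W ^ 2 * (z / S)) * (3 + 148 / 25 * e ^ 3 + 37 / 25 * e ^ 2) := by field_simp; ring
    _ ≤ (W ^ 5 * (z / S)) * (220 * e ^ 10) := by
        gcongr
        linarith
    _ = _ := by ring

section Moments

variable [IsProbabilityMeasure P] {A B : ℝ → ℝ → E → Ω → E} {ε : ℝ}
  (hX : FlowAssumptions P p₁ p₂ c T f g V X)
include hX

lemma FlowAssumptions.lpLe_V_four (hA : FieldBound P p₁ p₂ c T V A)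
    (hB : FieldBound P p₁ p₂ c T V B) {t τ t' τ' : ℝ} (ht : 0 ≤ t) (htτ : t ≤ τ) (hτ : τ ≤ T)
    (ht' : 0 ≤ t') (htτ' : t' ≤ τ') (hτ' : τ' ≤ T) (x x' : E) :
    LpLe P (1 / p₁) (fun ω => (V τ (A t τ x ω) + V τ (B t τ x ω) + V τ' (A t' τ' x' ω)
      + V τ' (B t' τ' x' ω)) / 4) ((V t x + V t' x') / 2) := by
  have h1 := (hX.cost_le_one).1
  have hV := (hX.V_pos ⟨ht, htτ.trans hτ⟩ x).le
  have hV' := (hX.V_pos ⟨ht', htτ'.trans hτ'⟩ x').le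
  have h := ((((hA.V_le t τ ht htτ hτ x).add (hB.V_le t τ ht htτ hτ x) h1 hV hV).add
    (hA.V_le t' τ' ht' htτ' hτ' x') h1 (by positivity) hV').add
    (hB.V_le t' τ' ht' htτ' hτ' x') h1 (by positivity) hV').const_mul (1 / 4)
  rw [abs_of_pos (by norm_num)] at h
  convert h using 2 <;> ring

lemma FlowAssumptions.lpLe_field_sub (hA : FieldBound P p₁ p₂ c T V A) {t τ t' τ' : ℝ}
    (ht : 0 ≤ t) (htt : t ≤ t') (htτ : t ≤ τ) (htτ' : t' ≤ τ') (hττ : τ ≤ τ') (hτ' : τ' ≤ T)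
    (hs : τ' - τ ≤ t' - t) (x x' : E) :
    LpLe P (1 / p₂) (fun ω => ‖A t τ x ω - A t' τ' x' ω‖)
      ((V t x + V t' x') / 2 * √(t' - t) + Real.exp (c * T) * ‖x - x'‖) := by
  refine (hA.hoelder t τ t' τ' ht htt htτ htτ' (hττ.trans hτ') hτ' x x').norm.mono_bound ?_
  have hV := (hX.V_pos ⟨ht, htτ.trans (hττ.trans hτ')⟩ x).le
  have hV' := (hX.V_pos ⟨ht.trans htt, htτ'.trans hτ'⟩ x').le
  rw [abs_sub_comm t, abs_sub_comm τ, abs_of_nonneg (sub_nonneg.2 htt),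
    abs_of_nonneg (sub_nonneg.2 hττ)]
  have : √(τ' - τ) ≤ √(t' - t) := Real.sqrt_le_sqrt hs
  gcongr
  linarith

lemma FlowAssumptions.lpLe_coupling_second (hAB : Coupling P p₁ p₂ c T V A B ε) (hε : 0 ≤ ε)
    {t τ t' τ' : ℝ}
    (ht : 0 ≤ t) (htt : t ≤ t') (htτ : t ≤ τ) (htτ' : t' ≤ τ') (hττ : τ ≤ τ') (hτ' : τ' ≤ T)
    (hs : τ' - τ ≤ t' - t) (x x' : E) :
    LpLe P (1 / p₂) (fun ω => ‖(A t τ x ω - B t τ x ω) - (A t' τ' x' ω - B t' τ' x' ω)‖)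
      ((V t x + V t' x') / 2 * (√(t' - t) + ‖x - x'‖) * ε) := by
  refine (hAB.diff t τ t' τ' ht htt htτ htτ' (hττ.trans hτ') hτ' x x').norm.mono_bound ?_
  have hV := (hX.V_pos ⟨ht, htτ.trans (hττ.trans hτ')⟩ x).le
  have hV' := (hX.V_pos ⟨ht.trans htt, htτ'.trans hτ'⟩ x').le
  rw [abs_sub_comm t, abs_sub_comm τ, abs_of_nonneg (sub_nonneg.2 htt),
    abs_of_nonneg (sub_nonneg.2 hττ)]
  have : √(τ' - τ) ≤ √(t' - t) := Real.sqrt_le_sqrt hs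
  gcongr
  linarith

lemma FlowAssumptions.lpLe_coupling_dist (hAB : Coupling P p₁ p₂ c T V A B ε) (hε : 0 ≤ ε)
    {t τ t' τ' : ℝ} (ht : 0 ≤ t) (htτ : t ≤ τ) (hτ : τ ≤ T) (ht' : 0 ≤ t') (htτ' : t' ≤ τ')
    (hτ' : τ' ≤ T) (x x' : E) :
    LpLe P (1 / p₂) (fun ω => ‖A t τ x ω - B t τ x ω‖ + ‖A t' τ' x' ω - B t' τ' x' ω‖)
      ((V t x + V t' x') / 2 * √T * ε) := by
  have hV := (hX.V_pos ⟨ht, htτ.trans hτ⟩ x).le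
  have hV' := (hX.V_pos ⟨ht', htτ'.trans hτ'⟩ x').le
  refine ((hAB.dist t τ ht htτ hτ x).norm.add (hAB.dist t' τ' ht' htτ' hτ' x').norm
    (hX.cost_le_one).2 (by positivity) (by positivity)).mono_bound ?_
  have h1 : √(τ - t) ≤ √T := Real.sqrt_le_sqrt (by linarith)
  have h2 : √(τ' - t') ≤ √T := Real.sqrt_le_sqrt (by linarith)
  calc _ ≤ V t x * (√T / 2) * ε + V t' x' * (√T / 2) * ε := by gcongr
    _ = _ := by ring

variable {u : ℝ → E → ℝ} (hu : SolutionBounds c T V u) (hE : Exponents p₁ p₂ p q₁ q₂)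
  (heV : ∀ t ∈ Icc 0 T, ∀ x, Real.exp (c * T) ≤ V t x) {s : ℝ} (hs : s ∈ Icc (0 : ℝ) 1)
include hu hE heV hs

omit hu heV hs in
-- Since q₂ + 1 ≥ 10, the exponent hypothesis also pays for the cheaper products of up to three
-- weights and two distances.
lemma FlowAssumptions.costs_le : (q₂ + 1) * (1 / p₁) + 2 * (1 / p₂) ≤ 1 / p ∧
    3 * (1 / p₁) + 2 * (1 / p₂) ≤ 1 / p ∧ 1 / p₁ + 1 / p₂ ≤ 1 / p ∧ 1 / p ≤ 1 ∧ 0 ≤ 1 / p := by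
  obtain ⟨hα₁, hα₂, -⟩ := hX.costs
  have h1 := hE.moments
  rw [div_eq_mul_one_div, div_eq_mul_one_div 2 p₂] at h1
  have h2 := hE.nine_le
  have h3 := hE.two_le
  have h4 : 3 * (1 / p₁) ≤ (q₂ + 1) * (1 / p₁) := by gcongr; linarith
  refine ⟨h1, by linarith, by linarith, ?_, by positivity⟩
  rw [div_le_one (by linarith)]; linarith

omit hE heV in
lemma FlowAssumptions.measurable_increment (hA : FieldBound P p₁ p₂ c T V A) {t : ℝ}
    (ht : t ∈ Icc 0 T) (x : E) : Measurable (increment T f g u A s t x) := by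
  have hm := midTime_mem ht hs
  exact (hX.g_cont.measurable.comp (hA.meas t T ht.1 ht.2 le_rfl x)).add
    ((hX.f_cont.measurable.comp (hu.meas.comp (measurable_const.prodMk
      (hA.meas t _ ht.1 hm.1 hm.2 x)))).const_mul _)

/-- Every term contains either the distance of the two fields or its increment, and both carry ε.
For the Hölder part the second-order conditions on g and f∘u are needed, as plain Lipschitz bounds
would lose either ε or the increment. -/
lemma FlowAssumptions.wBound_increment_sub (hAB : Coupling P p₁ p₂ c T V A B ε) (hε : 0 ≤ ε) :
    WBound P p q₁ q₂ T V
      (fun t x ω => increment T f g u A s t x ω - increment T f g u B s t x ω)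
      (fun _ => 220 * Real.exp (c * T) ^ 10 * ε) := by
  obtain ⟨hα₁, hα₂, -⟩ := hX.costs
  obtain ⟨hα, hα', hα'', hp1, hp0⟩ := hX.costs_le hE
  obtain ⟨he, hcT⟩ := hX.exp_facts
  have hT := hX.T_pos
  have hc := hX.c_pos
  have hsT : √T * √T = T := Real.mul_self_sqrt hT.le
  have hsT0 : 0 < √T := Real.sqrt_pos.2 hT
  have hmeas : ∀ {t : ℝ}, t ∈ Icc 0 T → ∀ x, Measurable fun ω =>
      increment T f g u A s t x ω - increment T f g u B s t x ω := fun ht x =>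
    (hX.measurable_increment hu hs hAB.left ht x).sub (hX.measurable_increment hu hs hAB.right ht x)
  constructor
  · intro t ht x
    have hm := midTime_mem ht hs
    have hV := hX.one_le_V t ht x
    have heV := heV t ht x
    set e := Real.exp (c * T)
    -- The two-point situation is treated as a degenerate four-point one, to reuse the moment
    -- lemmas; the doubled distance is compensated by the factor 1/2 in the prefactors below.
    have key : ∀ {τ}, t ≤ τ → τ ≤ T → LpLe P (1 / p) (fun ω => ((V τ (A t τ x ω) + V τ (B t τ x ω)
        + V τ (A t τ x ω) + V τ (B t τ x ω)) / 4) ^ 1 * (‖A t τ x ω - B t τ x ω‖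
          + ‖A t τ x ω - B t τ x ω‖)) (((V t x + V t x) / 2) ^ 1 * ((V t x + V t x) / 2 * √T * ε)) :=
      fun h1 h2 => (hX.lpLe_V_four hAB.left hAB.right ht.1 h1 h2 ht.1 h1 h2 x x).pow_mul
        (hX.lpLe_coupling_dist hAB hε ht.1 h1 h2 ht.1 h1 h2 x x) hα₁ hα₂ (by linarith) 1
        (by push_cast; linarith)
    have h1 := ((key ht.2 le_rfl).const_mul (1 / (2 * √T))).add
      ((key hm.1 hm.2).const_mul (8 * (c * T) * e ^ 2 / (2 * √T))) hp1 (by positivity) (by positivity)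
    rw [abs_of_nonneg (by positivity), abs_of_nonneg (by positivity)] at h1
    refine (h1.mono_real (hmeas ht x).aestronglyMeasurable fun ω => ?_).mono_bound ?_
    · have g1 := hX.abs_g_sub_le (A t T x ω) (B t T x ω)
      have f1 := hX.abs_f_sub_same_time hu ⟨ht.1.trans hm.1, hm.2⟩ (A t (midTime T t s) x ω)
        (B t (midTime T t s) x ω)
      have ha := (hX.V_pos ⟨ht.1.trans hm.1, hm.2⟩ (A t (midTime T t s) x ω)).le
      have hb := (hX.V_pos ⟨ht.1.trans hm.1, hm.2⟩ (B t (midTime T t s) x ω)).le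
      have h2 : increment T f g u A s t x ω - increment T f g u B s t x ω
          = (g (A t T x ω) - g (B t T x ω)) + (T - t) * (f (u (midTime T t s) (A t (midTime T t s) x ω))
            - f (u (midTime T t s) (B t (midTime T t s) x ω))) := by
        unfold increment; ring
      rw [Real.norm_eq_abs, h2]
      refine (abs_add_le _ _).trans ?_
      rw [abs_mul, abs_of_nonneg (sub_nonneg.2 ht.2)]
      refine add_le_add (g1.trans_eq (by field_simp; ring)) ?_
      calc _ ≤ T * _ := mul_le_mul (by linarith [ht.1]) f1 (abs_nonneg _) hT.le
        _ = _ := by simp only [e]; field_simp; ring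
    · have h3 : V t x ^ 2 ≤ V t x ^ q₁ := by
        rw [← Real.rpow_natCast]
        exact Real.rpow_le_rpow_of_exponent_le hV (by have := hE.three_le; push_cast; linarith)
      have e3 : e ^ 3 ≤ e ^ 10 := pow_le_pow_right₀ he (by norm_num)
      have e0 : 1 ≤ e ^ 10 := one_le_pow₀ he
      have h4 : c * T * e ^ 2 ≤ 37 / 100 * e ^ 10 := by
        calc _ ≤ 37 / 100 * e * e ^ 2 := by gcongr
          _ = 37 / 100 * e ^ 3 := by ring
          _ ≤ _ := by gcongr
      calc _ = (1 / 2 + 4 * (c * T * e ^ 2)) * ε * V t x ^ 2 := by field_simp; ring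
        _ ≤ (220 * e ^ 10) * ε * V t x ^ q₁ := by
          gcongr
          linarith
  · intro t t' ht htt ht' x x'
    have htm : t ∈ Icc 0 T := ⟨ht, htt.trans ht'⟩
    have htm' : t' ∈ Icc 0 T := ⟨ht.trans htt, ht'⟩
    have hm := midTime_mem htm hs
    have hm' := midTime_mem htm' hs
    have hmm := midTime_mono (T := T) htt hs
    have hms := midTime_sub_le (T := T) htt hs
    have hV := hX.one_le_V t htm x
    have hV' := hX.one_le_V t' htm' x'
    have hW1 : Real.exp (c * T) ≤ (V t x + V t' x') / 2 := by
      linarith [heV t htm x, heV t' htm' x']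
    have hW0 : 0 ≤ (V t x + V t' x') / 2 := by linarith
    have hWq : ((V t x + V t' x') / 2) ^ 5 ≤ (V t x ^ q₂ + V t' x' ^ q₂) / 2 :=
      avg_pow_le hV hV' 5 (by have := hE.nine_le; push_cast; linarith) (by linarith [hE.nine_le])
    set τ := midTime T t s with hτ
    set τ' := midTime T t' s with hτ'
    have g1 := (hX.lpLe_V_four hAB.left hAB.right ht htm.2 le_rfl htm'.1 ht' le_rfl x x').pow_mul
      (α := 1 / p) (hX.lpLe_coupling_second hAB hε ht htt htm.2 ht' le_rfl le_rfl
        (by rw [sub_self]; linarith) x x') hα₁ hα₂ hW0 1 (by push_cast; linarith)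
    have g2 := (hX.lpLe_V_four hAB.left hAB.right ht htm.2 le_rfl htm'.1 ht' le_rfl x x').pow_mul_mul
      (α := 1 / p) (hX.lpLe_coupling_dist hAB hε ht htm.2 le_rfl htm'.1 ht' le_rfl x x')
      (hX.lpLe_field_sub hAB.left ht htt htm.2 ht' le_rfl le_rfl (by rw [sub_self]; linarith) x x')
      hα₁ hα₂ hW0 (by positivity) 1 (by push_cast; linarith)
    have hv := hX.lpLe_V_four hAB.left hAB.right ht hm.1 hm.2 htm'.1 hm'.1 hm'.2 x x'
    have d1 := hv.pow_mul (α := 1 / p)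
      (hX.lpLe_coupling_second hAB hε ht htt hm.1 hm'.1 hmm hm'.2 hms x x') hα₁ hα₂ hW0 3
      (by push_cast; linarith)
    have d2 := hv.pow_mul_mul (α := 1 / p)
      (hX.lpLe_coupling_dist hAB hε ht hm.1 hm.2 htm'.1 hm'.1 hm'.2 x x')
      ((LpLe.const (P := P) √(t' - t) (1 / p₂)).add
        (hX.lpLe_field_sub hAB.left ht htt hm.1 hm'.1 hmm hm'.2 hms x x')
        (hX.cost_le_one).2 (norm_nonneg _) (by positivity))
      hα₁ hα₂ hW0 (by positivity) 3 (by push_cast; linarith)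
    rw [Real.norm_of_nonneg (Real.sqrt_nonneg _)] at d2
    have hsum := ((g1.const_mul (1 / √T)).add (g2.const_mul (1 / (2 * (√T * √T)))) hp1
      (by positivity) (by positivity)).add ((d1.const_mul (4 * Real.exp (c * T) ^ 10 / √T)).add
        (d2.const_mul (104 * Real.exp (c * T) ^ 10 / (√T * √T))) hp1 (by positivity) (by positivity))
        hp1 (by positivity) (by positivity)
    rw [abs_of_nonneg (by positivity), abs_of_nonneg (by positivity), abs_of_nonneg (by positivity),
      abs_of_nonneg (by positivity)] at hsum
    refine (hsum.mono_real ((hmeas htm x).sub (hmeas htm' x')).aestronglyMeasurable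
      fun ω => ?_).mono_bound ?_
    · have k1 := hX.g_diff (A t T x ω) (B t T x ω) (A t' T x' ω) (B t' T x' ω)
      have k2 := hX.increment_sub_second_le hu ht htt ht' hm.1 hmm hm'.2 rfl
        (Real.sqrt_le_sqrt hms) (A t τ x ω) (B t τ x ω) (A t' τ' x' ω) (B t' τ' x' ω)
      have h2 : (increment T f g u A s t x ω - increment T f g u B s t x ω)
          - (increment T f g u A s t' x' ω - increment T f g u B s t' x' ω)
          = ((g (A t T x ω) - g (B t T x ω)) - (g (A t' T x' ω) - g (B t' T x' ω)))
            + ((T - t) * (f (u τ (A t τ x ω)) - f (u τ (B t τ x ω)))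
              - (T - t') * (f (u τ' (A t' τ' x' ω)) - f (u τ' (B t' τ' x' ω)))) := by
        unfold increment; ring
      rw [Real.norm_eq_abs, Pi.sub_apply, h2]
      refine (abs_add_le _ _).trans (add_le_add (k1.trans_eq ?_) (k2.trans_eq ?_))
      · rw [hsT]; ring
      · rw [hsT]; ring
    · have hg : 0 ≤ gap T V t x t' x' := by unfold gap; positivity
      refine (coupled_increment_arith he hW1 (Real.sqrt_nonneg _) (norm_nonneg _) hε hsT0).trans ?_
      rw [show ((V t x + V t' x') / 2 * √(t' - t) + ‖x - x'‖) / √T = gap T V t x t' x' by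
          unfold gap; ring]
      gcongr

/-- The analogue for a single field, without a small factor; it bounds the summands on level 0. -/
lemma FlowAssumptions.wBound_increment (hA : FieldBound P p₁ p₂ c T V A) :
    WBound P p q₁ q₂ T V (increment T f g u A s) (fun _ => 220 * Real.exp (c * T) ^ 10) := by
  obtain ⟨hα₁, hα₂, -⟩ := hX.costs
  obtain ⟨hα, hα', hα'', hp1, hp0⟩ := hX.costs_le hE
  obtain ⟨he, hcT⟩ := hX.exp_facts
  have hT := hX.T_pos
  have hc := hX.c_pos
  have hcT0 : 0 ≤ c * T := by positivity
  have hsT : √T * √T = T := Real.mul_self_sqrt hT.le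
  have hsT0 : 0 < √T := Real.sqrt_pos.2 hT
  have hmeas : ∀ {t : ℝ}, t ∈ Icc 0 T → ∀ x, Measurable (increment T f g u A s t x) :=
    fun ht x => hX.measurable_increment hu hs hA ht x
  -- The part with 1/T comes from T|f(0)| ≤ V, the other from the growth of u.
  have hf : ∀ τ ∈ Icc 0 T, ∀ y, |f (u τ y)| ≤ (1 / T + 2 * c * Real.exp (c * T)) * V τ y := by
    intro τ hτ y
    have h1 := hX.abs_f_le (u τ y)
    have h2 := hu.growth τ hτ y
    have h3 := hX.f_zero τ hτ y
    rw [abs_mul, abs_of_pos hT] at h3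
    have h4 : |f 0| ≤ 1 / T * V τ y := by
      rw [one_div, ← div_eq_inv_mul, le_div_iff₀ hT]; linarith
    have h5 := mul_le_mul_of_nonneg_left h2 hc.le
    linarith
  constructor
  · intro t ht x
    have hm := midTime_mem ht hs
    have hV := hX.one_le_V t ht x
    set e := Real.exp (c * T)
    have h1 := (hA.V_le t T ht.1 ht.2 le_rfl x).add ((hA.V_le t _ ht.1 hm.1 hm.2 x).const_mul
      (T * (1 / T + 2 * c * e))) (hX.cost_le_one).1 (by linarith) (by positivity)
    rw [abs_of_nonneg (by positivity)] at h1
    refine ((h1.mono_cost (by linarith : 1 / p₁ ≤ 1 / p)).mono_real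
      (hmeas ht x).aestronglyMeasurable fun ω => ?_).mono_bound ?_
    · have f1 := hf _ ⟨ht.1.trans hm.1, hm.2⟩ (A t (midTime T t s) x ω)
      have hm1 : midTime T t s ∈ Icc 0 T := ⟨ht.1.trans hm.1, hm.2⟩
      rw [Real.norm_eq_abs]
      refine (abs_add_le _ _).trans (add_le_add (hX.g_growth _) ?_)
      rw [abs_mul, abs_of_nonneg (sub_nonneg.2 ht.2), mul_assoc]
      exact mul_le_mul (by linarith [ht.1]) f1 (abs_nonneg _) hT.le
    · have h3 : V t x ≤ V t x ^ q₁ := by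
        conv_lhs => rw [← Real.rpow_one (V t x)]
        exact Real.rpow_le_rpow_of_exponent_le hV (by linarith [hE.three_le])
      have e2 : e ^ 2 ≤ e ^ 10 := pow_le_pow_right₀ he (by norm_num)
      have e0 : 1 ≤ e ^ 10 := one_le_pow₀ he
      have h4 : c * T * e ≤ 37 / 100 * e ^ 10 := by
        calc _ ≤ 37 / 100 * e * e := by gcongr
          _ = 37 / 100 * e ^ 2 := by ring
          _ ≤ _ := by gcongr
      calc _ = (2 + 2 * (c * T * e)) * V t x := by field_simp; ring
        _ ≤ (220 * e ^ 10) * V t x ^ q₁ := by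
          gcongr
          linarith
  · intro t t' ht htt ht' x x'
    have htm : t ∈ Icc 0 T := ⟨ht, htt.trans ht'⟩
    have htm' : t' ∈ Icc 0 T := ⟨ht.trans htt, ht'⟩
    have hm := midTime_mem htm hs
    have hm' := midTime_mem htm' hs
    have hmm := midTime_mono (T := T) htt hs
    have hms := midTime_sub_le (T := T) htt hs
    have hV := hX.one_le_V t htm x
    have hV' := hX.one_le_V t' htm' x'
    have hW1 : Real.exp (c * T) ≤ (V t x + V t' x') / 2 := by
      linarith [heV t htm x, heV t' htm' x']
    have hW0 : 0 ≤ (V t x + V t' x') / 2 := by linarith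
    have hWq : ((V t x + V t' x') / 2) ^ 5 ≤ (V t x ^ q₂ + V t' x' ^ q₂) / 2 :=
      avg_pow_le hV hV' 5 (by have := hE.nine_le; push_cast; linarith) (by linarith [hE.nine_le])
    set τ := midTime T t s with hτ
    set τ' := midTime T t' s with hτ'
    have hτm : τ ∈ Icc 0 T := ⟨ht.trans hm.1, hm.2⟩
    have hτm' : τ' ∈ Icc 0 T := ⟨htm'.1.trans hm'.1, hm'.2⟩
    set e := Real.exp (c * T)
    set h := √(t' - t) with hh
    have g1 := (hX.lpLe_V_four hA hA ht htm.2 le_rfl htm'.1 ht' le_rfl x x').pow_mul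
      (α := 1 / p) (hX.lpLe_field_sub hA ht htt htm.2 ht' le_rfl le_rfl
        (by rw [sub_self]; linarith) x x') hα₁ hα₂ hW0 1 (by push_cast; linarith)
    have hv := hX.lpLe_V_four hA hA ht hm.1 hm.2 htm'.1 hm'.1 hm'.2 x x'
    have hl := hX.lpLe_field_sub hA ht htt hm.1 hm'.1 hmm hm'.2 hms x x'
    have d1 := (hv.pow_mul (α := 2 * (1 / p₁)) (hv.const_mul h) hα₁ hα₁ hW0 1
      (by push_cast; linarith)).mono_cost (by linarith : 2 * (1 / p₁) ≤ 1 / p)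
    have d2 := hv.pow_mul (α := 1 / p) hl hα₁ hα₂ hW0 1 (by push_cast; linarith)
    have d3 := (hv.mono_cost (by linarith : 1 / p₁ ≤ 1 / p)).const_mul (2 * (1 + 2 * (c * T) * e) * (h / √T))
    have hsum := (g1.const_mul (1 / √T)).add (((d1.add d2 hp1 (by positivity)
      (by positivity)).const_mul (8 * (c * T) * e ^ 2 / √T)).add d3 hp1
      (by positivity) (by positivity)) hp1 (by positivity) (by positivity)
    rw [abs_of_nonneg (by positivity), abs_of_nonneg (by positivity), abs_of_nonneg (by positivity),
      abs_of_nonneg (by positivity)] at hsum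
    refine (hsum.mono_real ((hmeas htm x).sub (hmeas htm' x')).aestronglyMeasurable
      fun ω => ?_).mono_bound ?_
    · have k1 := hX.abs_g_sub_le (A t T x ω) (A t' T x' ω)
      have k2 := (hX.abs_f_sub_le _ _).trans (mul_le_mul_of_nonneg_left
        (hu.hoelder τ τ' hτm.1 hmm hm'.2 (A t τ x ω) (A t' τ' x' ω)) hc.le)
      have k3 := hf τ hτm (A t τ x ω)
      have hva := (hX.V_pos hτm (A t τ x ω)).le
      have hva' := (hX.V_pos hτm' (A t' τ' x' ω)).le
      have hsq : √(τ' - τ) ≤ h := Real.sqrt_le_sqrt hms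
      have h2 : increment T f g u A s t x ω - increment T f g u A s t' x' ω
          = (g (A t T x ω) - g (A t' T x' ω))
            + ((T - t') * (f (u τ (A t τ x ω)) - f (u τ' (A t' τ' x' ω)))
              + (t' - t) * f (u τ (A t τ x ω))) := by
        unfold increment; ring
      have k4 : t' - t ≤ h * √T := hh ▸ le_sqrt_mul_sqrt (by linarith)
      rw [Real.norm_eq_abs, Pi.sub_apply, h2]
      refine (abs_add_le _ _).trans (add_le_add (k1.trans_eq (by ring)) ((abs_add_le _ _).trans
        (add_le_add ?_ ?_)))
      · rw [abs_mul, abs_of_nonneg (sub_nonneg.2 ht')]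
        calc _ ≤ T * (c * (8 * e ^ 2 * ((V τ (A t τ x ω) + V τ' (A t' τ' x' ω)) / 2) *
              ((V τ (A t τ x ω) + V τ' (A t' τ' x' ω)) / 2 * (h / √T)
                + ‖A t τ x ω - A t' τ' x' ω‖ / √T))) := by
                refine mul_le_mul (by linarith [htm'.1]) (k2.trans ?_) (abs_nonneg _) hT.le
                gcongr
          _ = _ := by ring
      · rw [abs_mul, abs_of_nonneg (sub_nonneg.2 htt)]
        calc _ ≤ (h * √T) * ((1 / T + 2 * c * e) * (2 * ((V τ (A t τ x ω) + V τ (A t τ x ω)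
              + V τ' (A t' τ' x' ω) + V τ' (A t' τ' x' ω)) / 4))) := by
                refine mul_le_mul k4 (k3.trans ?_) (abs_nonneg _) (by positivity)
                gcongr
                linarith
          _ = 2 * (1 + 2 * (c * T) * e) * (h * (√T / T)) * ((V τ (A t τ x ω) + V τ (A t τ x ω)
              + V τ' (A t' τ' x' ω) + V τ' (A t' τ' x' ω)) / 4) := by field_simp
          _ = _ := by rw [Real.sqrt_div_self, ← div_eq_mul_inv]
    · refine le_trans (le_of_eq ?_) ((increment_arith he hW1 (Real.sqrt_nonneg (t' - t))
        (norm_nonneg (x - x')) hsT0 hcT hcT0).trans ?_)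
      · ring
      · have hg : 0 ≤ gap T V t x t' x' := by unfold gap; positivity
        rw [show ((V t x + V t' x') / 2 * √(t' - t) + ‖x - x'‖) / √T = gap T V t x t' x' by
          unfold gap; ring]
        gcongr

end Moments

end MLPHoelder

end

/-! ### Propagation of the error through the nonlinearity. -/

section

namespace MLPHoelder

set_option linter.unusedSectionVars false

/-- Chebyshev's inequality for two similarly ordered pairs. -/
lemma avg_mul_avg_le {a b x y : ℝ} (h : 0 ≤ (a - b) * (x - y)) :
    (x + y) / 2 * ((a + b) / 2) ≤ (x * a + y * b) / 2 := by nlinarith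

/-- Chebyshev's inequality twice. This is where q₁ + 2 ≤ q₂ enters: the weight of the sup norm times
the two weights in the Hölder bound of u fits into the weight of the Hölder seminorm. -/
lemma avg_rpow_mul_sq_le {a b q q' : ℝ} (ha : 1 ≤ a) (hb : 1 ≤ b) (hq : 0 ≤ q) (hqq : q + 2 ≤ q') :
    (a ^ q + b ^ q) / 2 * ((a + b) / 2) ^ 2 ≤ (a ^ q' + b ^ q') / 2 := by
  have hmono : ∀ {k : ℝ}, 0 ≤ k → 0 ≤ (a - b) * (a ^ k - b ^ k) := by
    intro k hk
    rcases le_total a b with h | h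
    · exact mul_nonneg_of_nonpos_of_nonpos (sub_nonpos.2 h)
        (sub_nonpos.2 (Real.rpow_le_rpow (by linarith) h hk))
    · exact mul_nonneg (sub_nonneg.2 h) (sub_nonneg.2 (Real.rpow_le_rpow (by linarith) h hk))
  have h1 := avg_mul_avg_le (hmono hq)
  have h2 := avg_mul_avg_le (hmono (by linarith : 0 ≤ q + 1))
  have hs : ∀ {z k : ℝ}, 1 ≤ z → z ^ k * z = z ^ (k + 1) := fun hz => by
    rw [Real.rpow_add_one (by linarith)]
  rw [hs ha, hs hb] at h1 h2
  have hle : ∀ {z : ℝ}, 1 ≤ z → z ^ (q + 1 + 1) ≤ z ^ q' := fun hz =>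
    Real.rpow_le_rpow_of_exponent_le hz (by linarith)
  have := hle ha
  have := hle hb
  have hab : 0 ≤ (a + b) / 2 := by linarith
  calc _ = (a ^ q + b ^ q) / 2 * ((a + b) / 2) * ((a + b) / 2) := by ring
    _ ≤ (a ^ (q + 1) + b ^ (q + 1)) / 2 * ((a + b) / 2) := by gcongr
    _ ≤ _ := by linarith

lemma measurable_comp_map_fst {S S' F Ω : Type*} [MeasurableSpace S] [MeasurableSpace S']
    [MeasurableSpace F] {m : MeasurableSpace Ω} {Φ : S × Ω → F}
    (h : Measurable[(inferInstance : MeasurableSpace S).prod m] Φ) {k : S' → S}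
    (hk : Measurable k) :
    Measurable[(inferInstance : MeasurableSpace S').prod m] fun q : S' × Ω => Φ (k q.1, q.2) :=
  h.comp ((hk.comp measurable_fst).prodMk measurable_snd)

/-- Verified on the π-system of intersections. It yields that a random time is independent of its
own field together with all randomness of an inner approximation. -/
lemma Indep.sup_right {Ω : Type*} {m₁ m₂ m₃ mΩ : MeasurableSpace Ω} {P : Measure Ω}
    [IsProbabilityMeasure P] (h₁ : m₁ ≤ mΩ) (h₂ : m₂ ≤ mΩ) (h₃ : m₃ ≤ mΩ) (h₁₂ : Indep m₁ m₂ P)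
    (h : Indep (m₁ ⊔ m₂) m₃ P) : Indep m₁ (m₂ ⊔ m₃) P := by
  refine IndepSets.indep (p1 := {s | MeasurableSet[m₁] s})
    (p2 := {s | ∃ A B, MeasurableSet[m₂] A ∧ MeasurableSet[m₃] B ∧ s = A ∩ B})
    h₁ (sup_le h₂ h₃) (@MeasurableSpace.isPiSystem_measurableSet _ m₁) ?_
    (@MeasurableSpace.generateFrom_measurableSet _ m₁).symm (generateFrom_inter_eq_sup m₂ m₃).symm ?_
  · rintro _ ⟨A, B, hA, hB, rfl⟩ _ ⟨A', B', hA', hB', rfl⟩ -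
    exact ⟨A ∩ A', B ∩ B', @MeasurableSet.inter _ m₂ _ _ hA hA',
      @MeasurableSet.inter _ m₃ _ _ hB hB', inter_inter_inter_comm _ _ _ _⟩
  · rw [IndepSets_iff]
    rintro C _ hC ⟨A, B, hA, hB, rfl⟩
    have hC' : MeasurableSet[m₁ ⊔ m₂] C := le_sup_left (a := m₁) (b := m₂) _ hC
    have hA' : MeasurableSet[m₁ ⊔ m₂] A := le_sup_right (a := m₁) (b := m₂) _ hA
    rw [← inter_assoc, (Indep_iff _ _ _).1 h _ _ (@MeasurableSet.inter _ (m₁ ⊔ m₂) _ _ hC' hA') hB,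
      (Indep_iff _ _ _).1 h₁₂ _ _ hC hA, (Indep_iff _ _ _).1 h _ _ hA' hB, mul_assoc]

variable {E : Type*} [NormedAddCommGroup E] [NormedSpace ℝ E] [FiniteDimensional ℝ E]
  [MeasurableSpace E] [BorelSpace E] {Ω : Type*}
  {p₁ p₂ p q₁ q₂ c T : ℝ} {f : ℝ → ℝ} {g : E → ℝ} {V : ℝ → E → ℝ} {X : ℝ → ℝ → E → Ω → E}

/-- A family of random fields that is bounded for every fixed value of a parameter is bounded
when an independent random variable is inserted for the parameter. -/
lemma WBound.freeze {S : Type*} [MeasurableSpace S] {m mΩ : MeasurableSpace Ω} {P : Measure Ω}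
    [IsProbabilityMeasure P] {R : Ω → S} (hm : m ≤ mΩ) (hR : Measurable R)
    (h : Indep (MeasurableSpace.comap R inferInstance) m P) {H : S → ℝ → E → Ω → ℝ}
    (hH : ∀ t ∈ Icc 0 T, ∀ x, Measurable[(inferInstance : MeasurableSpace S).prod m]
      fun q : S × Ω => H q.1 t x q.2) (hp : 0 < p) (hV : ∀ t ∈ Icc 0 T, ∀ x, 0 ≤ V t x)
    {φ : S → ℝ → ℝ} {ψ : ℝ → ℝ} (hφ0 : ∀ s, ∀ t ∈ Icc 0 T, 0 ≤ φ s t)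
    (hφ : ∀ s, WBound P p q₁ q₂ T V (H s) (φ s))
    (hψ : ∀ t ∈ Icc 0 T, LpLe P (1 / p) (fun ω => φ (R ω) t) (ψ t)) :
    WBound P p q₁ q₂ T V (fun t x ω => H (R ω) t x ω) ψ := by
  constructor
  · intro t ht x
    have hw : 0 ≤ V t x ^ q₁ := Real.rpow_nonneg (hV t ht x) _
    have hb := (hψ t ht).const_mul (V t x ^ q₁)
    rw [abs_of_nonneg hw, mul_comm _ (ψ t)] at hb
    refine LpLe.freeze hm hR h (hH t ht x) (by positivity) (B := fun s => V t x ^ q₁ * φ s t)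
      (fun ω => mul_nonneg hw (hφ0 _ t ht)) (fun ω => ?_) hb
    rw [mul_comm]
    exact (hφ (R ω)).one t ht x
  · intro t t' ht htt ht' x x'
    have htm : t ∈ Icc 0 T := ⟨ht, htt.trans ht'⟩
    have htm' : t' ∈ Icc 0 T := ⟨ht.trans htt, ht'⟩
    have h1 := hV t htm x
    have h2 := hV t' htm' x'
    have hw : 0 ≤ (V t x ^ q₂ + V t' x' ^ q₂) / 2 * gap T V t x t' x' := by
      unfold gap; positivity
    have hb := (hψ t htm).const_mul ((V t x ^ q₂ + V t' x' ^ q₂) / 2 * gap T V t x t' x')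
    rw [abs_of_nonneg hw, mul_comm _ (ψ t)] at hb
    have hΦ : Measurable[(inferInstance : MeasurableSpace S).prod m]
        fun q : S × Ω => H q.1 t x q.2 - H q.1 t' x' q.2 := by
      have h1 := hH t htm x
      have h2 := hH t' htm' x'
      let _ : MeasurableSpace (S × Ω) := (inferInstance : MeasurableSpace S).prod m
      exact h1.sub h2
    refine LpLe.freeze hm hR h hΦ (by positivity)
      (B := fun s => (V t x ^ q₂ + V t' x' ^ q₂) / 2 * gap T V t x t' x' * φ s t)
      (fun ω => mul_nonneg hw (hφ0 _ t htm)) (fun ω => ?_) hb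
    rw [mul_comm]
    exact (hφ (R ω)).two t t' ht htt ht' x x'

/-- The effect on the nonlinearity of replacing the solution `u` by a random field `U`. -/
def nonlinError (T : ℝ) (f : ℝ → ℝ) (u : ℝ → E → ℝ) (U : ℝ → E → Ω → ℝ) (A : ℝ → ℝ → E → Ω → E)
    (s t : ℝ) (x : E) (ω : Ω) : ℝ :=
  (T - t) * (f (U (midTime T t s) (A t (midTime T t s) x ω) ω)
    - f (u (midTime T t s) (A t (midTime T t s) x ω)))

section Nonlin

variable {m n mΩ : MeasurableSpace Ω} {P : Measure Ω} [IsProbabilityMeasure P]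
  {A : ℝ → ℝ → E → Ω → E} {U : ℝ → E → Ω → ℝ} {u : ℝ → E → ℝ}

/-- Here `S` is √T and `τ` is √(T-t). The three contributions yield 2 + 16 + 2 = 20, after the
surplus weights are absorbed by `hQ` and one factor e by W. -/
lemma FlowAssumptions.nonlinError_two_arith {e W d h S k Q Q₁ G Φ τ : ℝ} (he : 1 ≤ e) (hW : e ≤ W)
    (hh : 0 ≤ h) (hd : 0 ≤ d) (hS : 0 < S) (hk : 0 ≤ k) (hΦ : 0 ≤ Φ) (hQ₁ : 0 ≤ Q₁)
    (hQ : Q₁ * W ^ 2 ≤ Q) (hG : G = (W * h + d) / S) (hτ : 0 ≤ τ) :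
    k * Φ * (τ * S) / S * (Q * (h * W + (W * h + e * d)))
      + (8 * e ^ 2 * k * Φ * (τ * S) / S * (Q₁ * (W * (h * W + (W * h + e * d))))
        + 2 * k * Φ * (h * τ) * Q₁) ≤ 20 * e ^ 2 * k * S * τ * Φ * (Q * G) := by
  have hW1 : 1 ≤ W := he.trans hW
  have hz : 0 ≤ W * h + d := by positivity
  have k1 : h * W + (W * h + e * d) ≤ 2 * e * (W * h + d) := by
    have := mul_le_mul_of_nonneg_right he (by positivity : 0 ≤ W * h)
    have : 0 ≤ e * d := by positivity
    nlinarith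
  have hQ0 : 0 ≤ Q := le_trans (by positivity) hQ
  have k2 : e * (Q₁ * W) ≤ Q := by
    refine le_trans ?_ hQ
    calc e * (Q₁ * W) ≤ W * (Q₁ * W) := by gcongr
      _ = _ := by ring
  have k3 : h * Q₁ ≤ Q * (W * h + d) := by
    have : Q₁ ≤ Q := (le_mul_of_one_le_right hQ₁ (one_le_pow₀ hW1)).trans hQ
    have h2 : h ≤ W * h + d := by nlinarith
    calc h * Q₁ ≤ (W * h + d) * Q := by gcongr
      _ = _ := by ring
  set z := W * h + d with hzd
  have hkΦ : 0 ≤ k * Φ * τ := by positivity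
  calc _ = k * Φ * τ * (Q * (h * W + (W * h + e * d)) + 8 * e ^ 2 * (Q₁ * W)
        * (h * W + (W * h + e * d)) + 2 * (h * Q₁)) := by field_simp; ring
    _ ≤ k * Φ * τ * (Q * (2 * e * z) + 8 * e ^ 2 * (Q₁ * W) * (2 * e * z) + 2 * (Q * z)) := by
        gcongr
    _ = k * Φ * τ * (z * (2 * e * Q + 16 * e ^ 2 * (e * (Q₁ * W)) + 2 * Q)) := by ring
    _ ≤ k * Φ * τ * (z * (2 * e ^ 2 * Q + 16 * e ^ 2 * Q + 2 * e ^ 2 * Q)) := by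
        have e1 : e ≤ e ^ 2 := le_self_pow₀ he (by norm_num)
        have e0 : 1 ≤ e ^ 2 := one_le_pow₀ he
        have : 2 * Q ≤ 2 * e ^ 2 * Q := by nlinarith
        gcongr
    _ = _ := by rw [hG]; field_simp; ring

variable (hX : FlowAssumptions P p₁ p₂ c T f g V X) (hu : SolutionBounds c T V u)
  (hE : Exponents p₁ p₂ p q₁ q₂) (heV : ∀ t ∈ Icc 0 T, ∀ x, Real.exp (c * T) ≤ V t x)
include hX hu hE heV

omit heV in
-- At deterministic points the difference splits into three parts: the Hölder seminorm of U - u, the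
-- sup norm of U - u times an increment of u, and the sup norm times t'-t from the change of
-- prefactor. All of them are linear in `φ`.
lemma FlowAssumptions.lpLe_nonlinError_frozen {φ : ℝ → ℝ} {t t' τ τ' : ℝ}
    (ht : t ∈ Icc 0 T) (htt : t ≤ t') (ht' : t' ≤ T) (hτm : τ ∈ Icc 0 T) (hττ : τ ≤ τ')
    (hτ' : τ' ≤ T) (hτs : τ' - τ ≤ t' - t) (hφτ : 0 ≤ φ τ) (hφτ' : φ τ' ≤ φ τ)
    (hU : WBound P p q₁ q₂ T V (fun t x ω => U t x ω - u t x) φ) (y y' : E)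
    (hmeas : Measurable fun ω' => (T - t) * (f (U τ y ω') - f (u τ y))
      - (T - t') * (f (U τ' y' ω') - f (u τ' y'))) :
    LpLe P (1 / p) (fun ω' => (T - t) * (f (U τ y ω') - f (u τ y))
      - (T - t') * (f (U τ' y' ω') - f (u τ' y')))
      (c * φ τ * (√(T - t) * √T) / √T * ((1 / 2 * (V τ y ^ q₂ + V τ' y' ^ q₂)) *
          (√(t' - t) * (1 / 2 * (V τ y + V τ' y')) + ‖y - y'‖))
        + (8 * Real.exp (c * T) ^ 2 * c * φ τ * (√(T - t) * √T) / √T *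
          ((1 / 2 * (V τ y ^ q₁ + V τ' y' ^ q₁)) * ((1 / 2 * (V τ y + V τ' y')) *
            (√(t' - t) * (1 / 2 * (V τ y + V τ' y')) + ‖y - y'‖)))
        + 2 * c * φ τ * (√(t' - t) * √(T - t)) * (1 / 2 * (V τ y ^ q₁ + V τ' y' ^ q₁)))) := by
  obtain ⟨-, -, -, hp1, -⟩ := hX.costs_le hE
  have hT := hX.T_pos
  have hc := hX.c_pos
  have hsT0 : 0 < √T := Real.sqrt_pos.2 hT
  have hτm' : τ' ∈ Icc 0 T := ⟨hτm.1.trans hττ, hτ'⟩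
  have h1 := hX.one_le_V τ hτm y
  have h2 := hX.one_le_V τ' hτm' y'
  have hTt : 0 ≤ T - t' := sub_nonneg.2 ht'
  have htt0 : 0 ≤ t' - t := sub_nonneg.2 htt
  have hsub1 : T - t' ≤ √(T - t) * √T := (by linarith : T - t' ≤ T - t).trans
    (le_sqrt_mul_sqrt (by linarith [ht.1]))
  -- Uses t' ≤ T. Each part thereby retains the factor √(T-t), which is needed for the gain from the
  -- random time.
  have hsub2 : t' - t ≤ √(t' - t) * √(T - t) := by
    calc t' - t = √(t' - t) * √(t' - t) := (Real.mul_self_sqrt htt0).symm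
      _ ≤ _ := by gcongr
  have hR := Real.sqrt_nonneg (T - t)
  set e := Real.exp (c * T)
  set h := √(t' - t) with hh
  have hh0 : 0 ≤ h := Real.sqrt_nonneg _
  have hVm : 0 ≤ V τ y := by linarith
  have hgap : gap T V τ y τ' y' ≤
      (h * (1 / 2 * (V τ y + V τ' y')) + ‖y - y'‖) / √T := by
    have : √(τ' - τ) ≤ h := Real.sqrt_le_sqrt hτs
    calc gap T V τ y τ' y' ≤ (V τ y + V τ' y') / 2 * (h / √T) + ‖y - y'‖ / √T := by
          unfold gap; gcongr
      _ = _ := by ring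
  have hgap0 : 0 ≤ gap T V τ y τ' y' := by unfold gap; positivity
  set z := h * (1 / 2 * (V τ y + V τ' y')) + ‖y - y'‖ with hz
  have hz0 : 0 ≤ z := by positivity
  have w1 := (hU.one τ hτm y).norm
  have w2 := (hU.one τ' hτm' y').norm.mono_bound
    (mul_le_mul_of_nonneg_right hφτ' (by positivity : 0 ≤ V τ' y' ^ q₁))
  have w3 := (hU.two τ τ' hτm.1 hττ hτ' y y').norm
  have hud : |u τ y - u τ' y'| ≤ 8 * e ^ 2 * (1 / 2 * (V τ y + V τ' y')) * (z / √T) := by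
    refine (hu.hoelder τ τ' hτm.1 hττ hτ' y y').trans ?_
    change 8 * e ^ 2 * ((V τ y + V τ' y') / 2) * gap T V τ y τ' y' ≤ _
    calc _ = 8 * e ^ 2 * (1 / 2 * (V τ y + V τ' y')) * gap T V τ y τ' y' := by ring
      _ ≤ _ := by gcongr
  obtain ⟨δ, hδ⟩ : ∃ δ, δ = |u τ y - u τ' y'| := ⟨_, rfl⟩
  have hδ0 : 0 ≤ δ := hδ ▸ abs_nonneg _
  rw [← hδ] at hud
  have hsum := ((w3.const_mul ((T - t') * c)).add ((w1.add w2 hp1 (by positivity)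
    (by positivity)).const_mul ((T - t') * c * δ / 2)) hp1 (by positivity)
    (by positivity)).add (w1.const_mul ((t' - t) * c)) hp1 (by positivity) (by positivity)
  rw [abs_of_nonneg (by positivity), abs_of_nonneg (by positivity),
    abs_of_nonneg (by positivity)] at hsum
  refine (hsum.mono_real hmeas.aestronglyMeasurable fun ω' => ?_).mono_bound ?_
  -- The base points v, v' are the deterministic values of u, so the quadratic remainder multiplies
  -- the error by |u - u'| and not by an increment of U.
  · have k1 := hX.f_diff (u τ y) (U τ y ω') (u τ' y') (U τ' y' ω')
    have k2 := hX.abs_f_sub_le (U τ y ω') (u τ y)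
    rw [abs_sub_comm (u τ y) (U τ y ω'), abs_sub_comm (u τ' y') (U τ' y' ω'),
      show (u τ y - U τ y ω') - (u τ' y' - U τ' y' ω')
        = -((U τ y ω' - u τ y) - (U τ' y' ω' - u τ' y')) by ring, abs_neg,
      show (f (u τ y) - f (U τ y ω')) - (f (u τ' y') - f (U τ' y' ω'))
        = -((f (U τ y ω') - f (u τ y)) - (f (U τ' y' ω') - f (u τ' y'))) by ring, abs_neg, ← hδ] at k1
    simp only [Real.norm_eq_abs]
    rw [show (T - t) * (f (U τ y ω') - f (u τ y)) - (T - t') * (f (U τ' y' ω') - f (u τ' y'))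
        = (T - t') * ((f (U τ y ω') - f (u τ y)) - (f (U τ' y' ω') - f (u τ' y')))
          + (t' - t) * (f (U τ y ω') - f (u τ y)) by ring]
    refine (abs_add_le _ _).trans ?_
    rw [abs_mul, abs_mul, abs_of_nonneg hTt, abs_of_nonneg htt0]
    refine (add_le_add (mul_le_mul_of_nonneg_left k1 hTt)
      (mul_le_mul_of_nonneg_left k2 htt0)).trans_eq ?_
    ring
  · have hQy : 0 ≤ V τ y ^ q₂ + V τ' y' ^ q₂ := by positivity
    have hQ1 : 0 ≤ V τ y ^ q₁ + V τ' y' ^ q₁ := by positivity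
    have hq1 : 0 ≤ V τ' y' ^ q₁ := by positivity
    have hq1' : 0 ≤ V τ y ^ q₁ := by positivity
    calc _ = (T - t') * (c * φ τ * ((V τ y ^ q₂ + V τ' y' ^ q₂) / 2 * gap T V τ y τ' y'))
          + (T - t') * (c * φ τ * δ / 2 * (V τ y ^ q₁ + V τ' y' ^ q₁))
          + (t' - t) * (c * φ τ * V τ y ^ q₁) := by ring
      _ ≤ (√(T - t) * √T) * (c * φ τ * ((V τ y ^ q₂ + V τ' y' ^ q₂) / 2 * (z / √T)))
          + (√(T - t) * √T) * (c * φ τ * (8 * e ^ 2 * (1 / 2 * (V τ y + V τ' y')) * (z / √T)) / 2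
            * (V τ y ^ q₁ + V τ' y' ^ q₁))
          + (h * √(T - t)) * (c * φ τ * (V τ y ^ q₁ + V τ' y' ^ q₁)) := by
          gcongr
          linarith
      _ = _ := by ring

set_option maxHeartbeats 400000 in
/-- A bound on `U - u` is inherited, with an additional integration in time, by `nonlinError`. -/
lemma FlowAssumptions.wBound_nonlinError (hA : FieldBound P p₁ p₂ c T V A) (hm : m ≤ mΩ)
    (hUm : Measurable[(inferInstance : MeasurableSpace (Icc 0 T × E)).prod m]
      fun q : (Icc 0 T × E) × Ω => U q.1.1 q.1.2 q.2) (hn : n ≤ mΩ)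
    (hAn : ∀ t τ, 0 ≤ t → t ≤ τ → τ ≤ T → ∀ x, Measurable[n] (A t τ x)) (hnm : Indep n m P)
    {φ : ℝ → ℝ} (hφ : AntitoneOn φ (Icc 0 T)) (hφ0 : ∀ t ∈ Icc 0 T, 0 ≤ φ t)
    (hU : WBound P p q₁ q₂ T V (fun t x ω => U t x ω - u t x) φ) {s : ℝ} (hs : s ∈ Icc (0 : ℝ) 1) :
    WBound P p q₁ q₂ T V (nonlinError T f u U A s)
      (fun t => 20 * Real.exp (c * T) ^ 2 * c * √T * √(T - t) * φ (midTime T t s)) := by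
  obtain ⟨hα₁, hα₂, -⟩ := hX.costs
  obtain ⟨hα, hα', hα'', hp1, hp0⟩ := hX.costs_le hE
  obtain ⟨he, hcT⟩ := hX.exp_facts
  have hT := hX.T_pos
  have hc := hX.c_pos
  have hp : 0 < p := by linarith [hE.two_le]
  have hp' : 0 < 1 / p := by positivity
  have hq₁ := hE.three_le
  have hq₂ := hE.nine_le
  have hqq := hE.add_two_le
  have hsT0 : 0 < √T := Real.sqrt_pos.2 hT
  have hUτ : ∀ τ ∈ Icc 0 T, Measurable[(inferInstance : MeasurableSpace E).prod m]
      fun q : E × Ω => U τ q.1 q.2 := fun τ hτ => by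
    refine hUm.comp (f := fun q : E × Ω => (((⟨τ, hτ⟩ : Icc 0 T), q.1), q.2)) ?_
    refine @Measurable.prodMk _ _ _ (_) (_) (_) _ _ ?_ (@measurable_snd _ _ _ (_))
    exact @Measurable.prodMk _ _ _ (_) (_) (_) _ _ measurable_const (@measurable_fst _ _ _ (_))
  have hsq : ∀ {t}, t ∈ Icc 0 T → T - t ≤ √T * √(T - t) := fun ht => by
    rw [mul_comm]; exact le_sqrt_mul_sqrt (by linarith [ht.1])
  constructor
  · intro t ht x
    have hτ := midTime_mem ht hs
    unfold nonlinError
    set τ := midTime T t s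
    have hτm : τ ∈ Icc 0 T := ⟨ht.1.trans hτ.1, hτ.2⟩
    have hV : ∀ y, 0 ≤ V τ y := fun y => (hX.V_pos hτm y).le
    have hTt : 0 ≤ T - t := sub_nonneg.2 ht.2
    have hφτ := hφ0 τ hτm
    have hΦ : Measurable[(inferInstance : MeasurableSpace E).prod m]
        fun q : E × Ω => (T - t) * (f (U τ q.1 q.2) - f (u τ q.1)) := by
      let _ : MeasurableSpace (E × Ω) := (inferInstance : MeasurableSpace E).prod m
      refine ((hX.f_cont.measurable.comp (hUτ τ hτm)).sub (hX.f_cont.measurable.comp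
        (hu.meas.comp (measurable_const.prodMk ?_)))).const_mul (T - t)
      exact @measurable_fst _ _ _ m
    have hb := (((hA.V_le t τ ht.1 hτ.1 hτ.2 x).rpow (fun ω => hV _) (hX.V_pos ht x).le
      (by linarith : 0 < q₁)).mono_cost (β := 1 / p)
      (by nlinarith)).const_mul ((T - t) * (c * φ τ))
    rw [abs_of_nonneg (by positivity)] at hb
    refine (LpLe.freeze hm ((hAn t τ ht.1 hτ.1 hτ.2 x).mono hn le_rfl)
      (indep_of_indep_of_le_left hnm (hAn t τ ht.1 hτ.1 hτ.2 x).comap_le) hΦ hp'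
      (B := fun y => (T - t) * (c * φ τ) * V τ y ^ q₁) (fun ω => ?_) (fun ω => ?_) hb).mono_bound ?_
    · have := Real.rpow_nonneg (hV (A t τ x ω)) q₁
      positivity
    · have h1 := (hU.one τ hτm (A t τ x ω)).norm.const_mul ((T - t) * c)
      rw [abs_of_nonneg (by positivity)] at h1
      have hmeas : Measurable fun ω' => (T - t) * (f (U τ (A t τ x ω) ω') - f (u τ (A t τ x ω))) :=
        (measurable_of_sub hm hΦ).comp (measurable_const.prodMk measurable_id)
      refine (h1.mono_real hmeas.aestronglyMeasurable fun ω' => ?_).mono_bound (by ring_nf; rfl)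
      simp only [Real.norm_eq_abs]
      rw [abs_mul, abs_of_nonneg hTt, mul_assoc]
      gcongr
      exact hX.abs_f_sub_le _ _
    · have hw : 0 ≤ V t x ^ q₁ := Real.rpow_nonneg (hX.V_pos ht x).le _
      have e2 : 1 ≤ 20 * Real.exp (c * T) ^ 2 := by
        have := one_le_pow₀ he (n := 2)
        linarith
      calc _ ≤ (√T * √(T - t)) * (c * φ τ) * V t x ^ q₁ := by gcongr; exact hsq ht
        _ ≤ (20 * Real.exp (c * T) ^ 2) * ((√T * √(T - t)) * (c * φ τ) * V t x ^ q₁) :=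
            le_mul_of_one_le_left (by positivity) e2
        _ = _ := by ring
  · intro t t' ht htt ht' x x'
    have htm : t ∈ Icc 0 T := ⟨ht, htt.trans ht'⟩
    have htm' : t' ∈ Icc 0 T := ⟨ht.trans htt, ht'⟩
    have hτ := midTime_mem htm hs
    have hτ' := midTime_mem htm' hs
    have hττ := midTime_mono (T := T) htt hs
    have hτs := midTime_sub_le (T := T) htt hs
    unfold nonlinError
    set τ := midTime T t s
    set τ' := midTime T t' s
    have hτm : τ ∈ Icc 0 T := ⟨ht.trans hτ.1, hτ.2⟩
    have hτm' : τ' ∈ Icc 0 T := ⟨hτm.1.trans hττ, hτ'.2⟩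
    have hV := hX.one_le_V t htm x
    have hV' := hX.one_le_V t' htm' x'
    have hVy : ∀ y, 1 ≤ V τ y := hX.one_le_V τ hτm
    have hVy' : ∀ y, 1 ≤ V τ' y := hX.one_le_V τ' hτm'
    have hφτ := hφ0 τ hτm
    -- The later time has the smaller bound, so everything can be expressed through the earlier one.
    have hφτ' : φ τ' ≤ φ τ := hφ hτm hτm' hττ
    have hTt : 0 ≤ T - t' := sub_nonneg.2 ht'
    have htt0 : 0 ≤ t' - t := sub_nonneg.2 htt
    have hR := Real.sqrt_nonneg (T - t)
    have hW : Real.exp (c * T) ≤ (V t x + V t' x') / 2 := by linarith [heV t htm x, heV t' htm' x']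
    have hQ := avg_rpow_mul_sq_le hV hV' (by linarith : 0 ≤ q₁) hqq
    set e := Real.exp (c * T)
    set h := √(t' - t) with hh
    have hh0 : 0 ≤ h := Real.sqrt_nonneg _
    have hsub1 : T - t' ≤ √(T - t) * √T := (by linarith : T - t' ≤ T - t).trans
      (le_sqrt_mul_sqrt (by linarith))
    have hsub2 : t' - t ≤ h * √(T - t) := by
      calc t' - t = h * h := (Real.mul_self_sqrt htt0).symm
        _ ≤ _ := by gcongr; exact Real.sqrt_le_sqrt (by linarith)
    have hΦ : Measurable[(inferInstance : MeasurableSpace (E × E)).prod m]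
        fun q : (E × E) × Ω => (T - t) * (f (U τ q.1.1 q.2) - f (u τ q.1.1))
          - (T - t') * (f (U τ' q.1.2 q.2) - f (u τ' q.1.2)) := by
      have h1 := measurable_comp_map_fst (hUτ τ hτm) (measurable_fst (α := E) (β := E))
      have h2 := measurable_comp_map_fst (hUτ τ' hτm') (measurable_snd (α := E) (β := E))
      let _ : MeasurableSpace ((E × E) × Ω) := (inferInstance : MeasurableSpace (E × E)).prod m
      have f1 : Measurable fun q : (E × E) × Ω => q.1 := @measurable_fst _ _ _ m
      exact (((hX.f_cont.measurable.comp h1).sub (hX.f_cont.measurable.comp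
        (hu.meas.comp (measurable_const.prodMk (measurable_fst.comp f1))))).const_mul (T - t)).sub
        (((hX.f_cont.measurable.comp h2).sub (hX.f_cont.measurable.comp
        (hu.meas.comp (measurable_const.prodMk (measurable_snd.comp f1))))).const_mul (T - t'))
    have hAm := hAn t τ ht hτ.1 hτ.2 x
    have hAm' := hAn t' τ' htm'.1 hτ'.1 hτ'.2 x'
    have hWm : Measurable[n] fun ω => (A t τ x ω, A t' τ' x' ω) :=
      Measurable.prodMk hAm hAm'
    -- moments of the weights along the field
    have hpw : ∀ {k : ℝ}, 0 < k → k * (1 / p₁) ≤ 1 → LpLe P (k * (1 / p₁))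
        (fun ω => 1 / 2 * (V τ (A t τ x ω) ^ k + V τ' (A t' τ' x' ω) ^ k))
        ((V t x ^ k + V t' x' ^ k) / 2) := by
      intro k hk hk1
      have h1 := ((hA.V_le t τ ht hτ.1 hτ.2 x).rpow (fun ω => zero_le_one.trans (hVy _))
        (by linarith) hk).add ((hA.V_le t' τ' htm'.1 hτ'.1 hτ'.2 x').rpow
        (fun ω => zero_le_one.trans (hVy' _)) (by linarith) hk) hk1 (by positivity) (by positivity)
      have h2 := h1.const_mul (1 / 2)
      rw [abs_of_pos (by norm_num)] at h2
      exact h2.mono_bound (by linarith)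
    have hVW : LpLe P (1 / p₁) (fun ω => 1 / 2 * (V τ (A t τ x ω) + V τ' (A t' τ' x' ω)))
        ((V t x + V t' x') / 2) := by
      have := hpw one_pos (by linarith)
      simpa only [one_mul, Real.rpow_one] using this
    have hL := ((hVW.const_mul h).mono_cost (by linarith : 1 / p₁ ≤ 1 / p₁ + 1 / p₂)).add
      ((hX.lpLe_field_sub hA ht htt hτ.1 hτ'.1 hττ hτ'.2 hτs x x').mono_cost
        (by linarith : 1 / p₂ ≤ 1 / p₁ + 1 / p₂)) (by linarith) (by positivity) (by positivity)
    rw [abs_of_nonneg hh0] at hL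
    have hq2 : q₂ * (1 / p₁) ≤ 1 := by nlinarith
    have hq12 : (q₁ + 2) * (1 / p₁) ≤ q₂ * (1 / p₁) := by gcongr
    -- The most expensive product of this estimate: V^{q₂} together with a factor of cost 1/p₁ +
    -- 1/p₂. The exponent hypothesis pays for it.
    have m1 := ((hpw (by linarith : 0 < q₂) hq2).mul hL (by positivity) (by positivity)
      (by positivity)).mono_cost (by linarith : q₂ * (1 / p₁) + (1 / p₁ + 1 / p₂) ≤ 1 / p)
    have m2 := ((hpw (by linarith : 0 < q₁) (by linarith)).mul (hVW.mul hL hα₁ (by positivity)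
      (by positivity)) (by positivity) (by positivity) (by positivity)).mono_cost
      (by linarith : q₁ * (1 / p₁) + (1 / p₁ + (1 / p₁ + 1 / p₂)) ≤ 1 / p)
    have m3 := (hpw (by linarith : 0 < q₁) (by linarith)).mono_cost
      (by linarith : q₁ * (1 / p₁) ≤ 1 / p)
    have hb := (m1.const_mul (c * φ τ * (√(T - t) * √T) / √T)).add
      ((m2.const_mul (8 * e ^ 2 * c * φ τ * (√(T - t) * √T) / √T)).add
        (m3.const_mul (2 * c * φ τ * (h * √(T - t)))) hp1 (by positivity) (by positivity)) hp1
        (by positivity) (by positivity)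
    rw [abs_of_nonneg (by positivity), abs_of_nonneg (by positivity),
      abs_of_nonneg (by positivity)] at hb
    refine (LpLe.freeze (Φ := fun q : (E × E) × Ω => (T - t) * (f (U τ q.1.1 q.2) - f (u τ q.1.1))
        - (T - t') * (f (U τ' q.1.2 q.2) - f (u τ' q.1.2))) hm (hWm.mono hn le_rfl)
      (indep_of_indep_of_le_left hnm hWm.comap_le) hΦ hp'
      (B := fun y => c * φ τ * (√(T - t) * √T) / √T * ((1 / 2 * (V τ y.1 ^ q₂ + V τ' y.2 ^ q₂)) *
          (h * (1 / 2 * (V τ y.1 + V τ' y.2)) + ‖y.1 - y.2‖))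
        + (8 * e ^ 2 * c * φ τ * (√(T - t) * √T) / √T * ((1 / 2 * (V τ y.1 ^ q₁ + V τ' y.2 ^ q₁)) *
          ((1 / 2 * (V τ y.1 + V τ' y.2)) * (h * (1 / 2 * (V τ y.1 + V τ' y.2)) + ‖y.1 - y.2‖)))
        + 2 * c * φ τ * (h * √(T - t)) * (1 / 2 * (V τ y.1 ^ q₁ + V τ' y.2 ^ q₁))))
      (fun ω => ?_) (fun ω => ?_) hb).mono_bound ?_
    · have h1 := hVy (A t τ x ω)
      have h2 := hVy' (A t' τ' x' ω)
      positivity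
    · exact hX.lpLe_nonlinError_frozen hu hE htm htt ht' hτm hττ hτ'.2 hτs hφτ hφτ' hU _ _
        ((measurable_of_sub hm hΦ).comp
          ((measurable_const (a := (A t τ x ω, A t' τ' x' ω))).prodMk measurable_id))
    · refine (nonlinError_two_arith he hW hh0 (norm_nonneg (x - x')) hsT0 hc.le hφτ
        (by positivity) hQ (G := gap T V t x t' x') (by unfold gap; ring) hR).trans_eq ?_
      ring

end Nonlin

end MLPHoelder

end

/-! ### Insertion of the uniform random time and the resulting gain. -/

section

namespace MLPHoelder

set_option linter.unusedSectionVars false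

variable {E : Type*} [NormedAddCommGroup E] [NormedSpace ℝ E] [FiniteDimensional ℝ E]
  [MeasurableSpace E] [BorelSpace E] {Ω : Type*}
  {p₁ p₂ p q₁ q₂ c T : ℝ} {f : ℝ → ℝ} {g : E → ℝ} {V : ℝ → E → ℝ} {X : ℝ → ℝ → E → Ω → E}
  {r : Idx → Ω → ℝ} {Y : ℕ → Idx → ℝ → ℝ → E → Ω → E}

section JointMeasurability

variable {m n mΩ : MeasurableSpace Ω} {P : Measure Ω} [IsProbabilityMeasure P]
  {A : ℝ → ℝ → E → Ω → E} {U : ℝ → E → Ω → ℝ} {u : ℝ → E → ℝ}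
  (hX : FlowAssumptions P p₁ p₂ c T f g V X) (hu : SolutionBounds c T V u)
include hX hu

lemma FlowAssumptions.measurable_increment_prod {t : ℝ} (ht : t ∈ Icc 0 T) (x : E)
    (hA : Measurable[(inferInstance : MeasurableSpace (Icc t T)).prod m]
      fun q : Icc t T × Ω => A t q.1 x q.2) :
    Measurable[(inferInstance : MeasurableSpace (Icc (0 : ℝ) 1)).prod m]
      fun q : Icc (0 : ℝ) 1 × Ω => increment T f g u A q.1 t x q.2 := by
  have hτ : Measurable fun s : Icc (0 : ℝ) 1 => (⟨midTime T t s, midTime_mem ht s.2⟩ : Icc t T) :=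
    ((measurable_subtype_coe.const_mul (T - t)).const_add t).subtype_mk
  have h1 := measurable_comp_map_fst (S' := Icc (0 : ℝ) 1) hA
    (measurable_const (a := (⟨T, ht.2, le_rfl⟩ : Icc t T)))
  have h2 := measurable_comp_map_fst hA hτ
  let _ : MeasurableSpace (Icc (0 : ℝ) 1 × Ω) :=
    (inferInstance : MeasurableSpace (Icc (0 : ℝ) 1)).prod m
  have f1 : Measurable fun q : Icc (0 : ℝ) 1 × Ω => q.1 := @measurable_fst _ _ _ m
  exact (hX.g_cont.measurable.comp h1).add ((hX.f_cont.measurable.comp (hu.meas.comp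
    ((measurable_subtype_coe.comp (hτ.comp f1)).prodMk h2))).const_mul (T - t))

lemma FlowAssumptions.measurable_nonlinError_prod {t : ℝ} (ht : t ∈ Icc 0 T) (x : E)
    (hA : Measurable[(inferInstance : MeasurableSpace (Icc t T)).prod n]
      fun q : Icc t T × Ω => A t q.1 x q.2)
    (hU : Measurable[(inferInstance : MeasurableSpace (Icc 0 T × E)).prod m]
      fun q : (Icc 0 T × E) × Ω => U q.1.1 q.1.2 q.2) :
    Measurable[(inferInstance : MeasurableSpace (Icc (0 : ℝ) 1)).prod (n ⊔ m)]
      fun q : Icc (0 : ℝ) 1 × Ω => nonlinError T f u U A q.1 t x q.2 := by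
  have hτ : Measurable fun s : Icc (0 : ℝ) 1 => (⟨midTime T t s, midTime_mem ht s.2⟩ : Icc t T) :=
    ((measurable_subtype_coe.const_mul (T - t)).const_add t).subtype_mk
  have hτ' : Measurable fun s : Icc (0 : ℝ) 1 => (⟨midTime T t s, ht.1.trans (midTime_mem ht s.2).1,
      (midTime_mem ht s.2).2⟩ : Icc 0 T) :=
    ((measurable_subtype_coe.const_mul (T - t)).const_add t).subtype_mk
  have h2 := (measurable_comp_map_fst hA hτ).mono
    (sup_le_sup le_rfl (MeasurableSpace.comap_mono (le_sup_left (a := n) (b := m)))) le_rfl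
  have h3 := hU.mono
    (sup_le_sup le_rfl (MeasurableSpace.comap_mono (le_sup_right (a := n) (b := m)))) le_rfl
  let _ : MeasurableSpace (Icc (0 : ℝ) 1 × Ω) :=
    (inferInstance : MeasurableSpace (Icc (0 : ℝ) 1)).prod (n ⊔ m)
  let _ : MeasurableSpace ((Icc 0 T × E) × Ω) :=
    (inferInstance : MeasurableSpace (Icc 0 T × E)).prod (n ⊔ m)
  have f1 : Measurable fun q : Icc (0 : ℝ) 1 × Ω => q.1 := @measurable_fst _ _ _ (n ⊔ m)
  have f2 : @Measurable _ _ _ (n ⊔ m) fun q : Icc (0 : ℝ) 1 × Ω => q.2 :=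
    @measurable_snd _ _ _ (n ⊔ m)
  have h5 : Measurable fun q : Icc (0 : ℝ) 1 × Ω => (((⟨midTime T t q.1, ht.1.trans
      (midTime_mem ht q.1.2).1, (midTime_mem ht q.1.2).2⟩ : Icc 0 T),
        A t (midTime T t q.1) x q.2), q.2) :=
    @Measurable.prodMk _ _ (Icc 0 T × E) Ω _ (n ⊔ m) _ _ ((hτ'.comp f1).prodMk h2) f2
  have h4 := h3.comp h5
  exact ((hX.f_cont.measurable.comp h4).sub (hX.f_cont.measurable.comp (hu.meas.comp
    ((measurable_subtype_coe.comp (hτ.comp f1)).prodMk h2)))).const_mul (T - t)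

end JointMeasurability

variable {𝓜 : MeasurableSpace Ω} [mΩ : MeasurableSpace Ω] {P : Measure Ω}

lemma FlowAssumptions.measurable_X_prod (hX : FlowAssumptions P p₁ p₂ c T f g V X) {t : ℝ}
    (ht : t ∈ Icc 0 T) (x : E) :
    Measurable[(inferInstance : MeasurableSpace (Icc t T)).prod (fields T X Y)]
      fun q : Icc t T × Ω => X t q.1 x q.2 :=
  (measurable_comp_map_fst (hX.X_field t ht).2
    (measurable_id.prodMk (measurable_const (a := x)))).mono
    (sup_le_sup le_rfl (MeasurableSpace.comap_mono (ApproxAssumptions.comap_flow_le_fields ht))) le_rfl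

namespace ApproxAssumptions

section

variable (hY : ApproxAssumptions P p₁ p₂ c T V X r Y)
include hY

lemma measurable_Y_prod {k : ℕ} (hk : 1 ≤ k) (η : Idx) {t : ℝ} (ht : t ∈ Icc 0 T) (x : E) :
    Measurable[(inferInstance : MeasurableSpace (Icc t T)).prod
      (MeasurableSpace.comap (approxPath T Y η) MeasurableSpace.pi)]
      fun q : Icc t T × Ω => Y k η t q.1 x q.2 := by
  let _ : MeasurableSpace (Icc t T × Ω) := (inferInstance : MeasurableSpace (Icc t T)).prod
    (MeasurableSpace.comap (approxPath T Y η) MeasurableSpace.pi)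
  have hw : @Measurable (Icc t T × Ω) Ω _
      (MeasurableSpace.comap (approxPath T Y η) MeasurableSpace.pi) Prod.snd :=
    @measurable_snd _ _ _ (_)
  have h1 : Measurable (Prod.fst : Icc t T × Ω → Icc t T) := @measurable_fst _ _ _ (_)
  exact hY.measurable_Y_comp_of_path hk measurable_const (measurable_subtype_coe.comp h1)
    measurable_const hw fun q => ⟨ht.1, q.1.2.1, q.1.2.2⟩

variable [IsProbabilityMeasure P]

/-- The values lie in [0,1], so the prescribed distribution function determines the law. -/
lemma map_r (θ : Idx) : P.map (r θ) = volume.restrict (Icc (0 : ℝ) 1) := by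
  have : IsProbabilityMeasure (P.map (r Idx.zero)) :=
    Measure.isProbabilityMeasure_map (hY.r_meas _).aemeasurable
  rw [(hY.r_ident θ).map_eq]
  refine Measure.ext_of_Iic _ _ fun a => ?_
  rw [Measure.map_apply (hY.r_meas _) measurableSet_Iic, Measure.restrict_apply measurableSet_Iic]
  have hmem := hY.r_mem Idx.zero
  rcases lt_or_ge a 0 with ha | ha
  · have h1 : r Idx.zero ⁻¹' Iic a = ∅ := by
      ext ω
      simpa using ha.trans_le (hmem ω).1
    have h2 : Iic a ∩ Icc (0 : ℝ) 1 = ∅ := by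
      ext s
      simp only [mem_inter_iff, mem_Iic, mem_Icc, mem_empty_iff_false, iff_false]
      exact fun h => absurd (h.2.1.trans h.1) (not_le.2 ha)
    rw [h1, h2, measure_empty, measure_empty]
  · rcases le_total a 1 with ha1 | ha1
    · have h2 : Iic a ∩ Icc (0 : ℝ) 1 = Icc 0 a := by
        ext s
        simp only [mem_inter_iff, mem_Iic, mem_Icc]
        exact ⟨fun h => ⟨h.2.1, h.1⟩, fun h => ⟨h.2, h.1, h.2.trans ha1⟩⟩
      rw [h2, Real.volume_Icc, sub_zero]
      exact hY.r_unif a ⟨ha, ha1⟩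
    · have h1 : r Idx.zero ⁻¹' Iic a = univ := by
        ext ω
        simpa using (hmem ω).2.trans ha1
      have h2 : Iic a ∩ Icc (0 : ℝ) 1 = Icc 0 1 :=
        inter_eq_right.2 fun s hs => hs.2.trans ha1
      rw [h1, h2, measure_univ, Real.volume_Icc]
      norm_num

/-- With M = m^{p/2}, the p-th moment is at most τ ∫ e^{Mτ(1-s)} ds over [0,1], which is (e^{Mτ} -
1)/M; here τ^{p/2} ≤ τ because τ ≤ 1 and p ≥ 2. The p-th root of 1/M is 1/√m, which explains the
exponent p/2 in the weight. -/
lemma lpLe_exp_time (hp : 2 ≤ p) {m : ℕ} (hm : 1 ≤ m) (θ : Idx) {τ : ℝ}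
    (hτ : τ ∈ Icc (0 : ℝ) 1) :
    LpLe P (1 / p) (fun ω => √τ * Real.exp ((m : ℝ) ^ (p / 2) * (τ * (1 - r θ ω)) / p))
      (1 / √m * Real.exp ((m : ℝ) ^ (p / 2) * τ / p)) := by
  have hp0 : 0 < p := by linarith
  have hm0 : (0 : ℝ) < m := by exact_mod_cast hm
  -- At τ = 0 the variable vanishes; the exponential integral below needs a positive rate.
  rcases hτ.1.eq_or_lt with h0 | h0
  · have := LpLe.const (P := P) (0 : ℝ) (1 / p)
    refine (this.mono_bound (b := 1 / √m * Real.exp ((m : ℝ) ^ (p / 2) * τ / p))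
      (by rw [norm_zero]; positivity)).congr_ae (.of_forall fun ω => ?_)
    simp [← h0]
  set M := (m : ℝ) ^ (p / 2) with hM
  have hM0 : 0 < M := by positivity
  have hr := hY.r_meas θ
  rw [lpLe_iff hp0]
  refine ⟨by fun_prop, ?_⟩
  rw [eLpNorm_eq_lintegral_rpow_enorm_toReal (by simpa using hp0) ENNReal.ofReal_ne_top,
    ENNReal.toReal_ofReal hp0.le, one_div, ENNReal.rpow_inv_le_iff hp0]
  have h1 : ∀ ω, ‖√τ * Real.exp (M * (τ * (1 - r θ ω)) / p)‖ₑ ^ p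
      = ENNReal.ofReal (τ ^ (p / 2)) * ENNReal.ofReal (Real.exp (M * τ * (1 - r θ ω))) := by
    intro ω
    rw [Real.enorm_of_nonneg (by positivity), ENNReal.ofReal_rpow_of_nonneg (by positivity) hp0.le,
      ← ENNReal.ofReal_mul (by positivity), Real.mul_rpow (by positivity) (by positivity),
      Real.sqrt_eq_rpow, ← Real.rpow_mul hτ.1, ← Real.exp_mul]
    congr 3
    · ring
    · field_simp
  have h2 : ∫⁻ ω, ENNReal.ofReal (Real.exp (M * τ * (1 - r θ ω))) ∂P
      = ∫⁻ s in Icc (0 : ℝ) 1, ENNReal.ofReal (Real.exp (M * τ * (1 - s))) := by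
    rw [← hY.map_r θ, lintegral_map (by fun_prop) hr]
  have h3 := lintegral_exp_Icc (a := M * τ) (t := 0) (T := 1) (by positivity) zero_le_one
  simp_rw [h1]
  rw [lintegral_const_mul _ (by fun_prop), h2, ENNReal.ofReal_rpow_of_nonneg (by positivity) hp0.le]
  have h4 : (1 / √(m : ℝ) * Real.exp (M * τ / p)) ^ p = M⁻¹ * Real.exp (M * τ) := by
    rw [Real.mul_rpow (by positivity) (by positivity), ← Real.exp_mul, one_div √(m : ℝ),
      Real.inv_rpow (by positivity), Real.sqrt_eq_rpow, ← Real.rpow_mul hm0.le,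
      div_mul_cancel₀ _ hp0.ne', hM]
    congr 3
    ring
  rw [h4]
  have h5 : τ ^ (p / 2) ≤ M⁻¹ * (M * τ) := by
    rw [inv_mul_cancel_left₀ hM0.ne']
    conv_rhs => rw [← Real.rpow_one τ]
    exact Real.rpow_le_rpow_of_exponent_ge h0 hτ.2 (by linarith)
  calc _ ≤ ENNReal.ofReal (M⁻¹ * (M * τ)) *
        ∫⁻ s in Icc (0 : ℝ) 1, ENNReal.ofReal (Real.exp (M * τ * (1 - s))) := by gcongr
    _ = ENNReal.ofReal M⁻¹ * ENNReal.ofReal (Real.exp (M * τ * (1 - 0)) - 1) := by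
        rw [ENNReal.ofReal_mul (by positivity), mul_assoc, h3]
    _ ≤ _ := by
        rw [← ENNReal.ofReal_mul (by positivity), sub_zero, mul_one]
        gcongr
        linarith

end

section RandomTime

variable [IsProbabilityMeasure P] (hX : FlowAssumptions P p₁ p₂ c T f g V X)
  (hY : ApproxAssumptions P p₁ p₂ c T V X r Y) {u : ℝ → E → ℝ} (hu : SolutionBounds c T V u)
  (hE : Exponents p₁ p₂ p q₁ q₂)
include hX hY hu hE

omit hu in
/-- A family of fields with a common bound inherits the bound at an independent random time. -/
lemma wBound_comp_r (h𝓜 : 𝓜 ≤ mΩ) {η : Idx}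
    (hind : Indep (MeasurableSpace.comap (r η) inferInstance) 𝓜 P) {H : ℝ → ℝ → E → Ω → ℝ}
    (hH : ∀ t ∈ Icc 0 T, ∀ x, Measurable[(inferInstance : MeasurableSpace (Icc (0 : ℝ) 1)).prod 𝓜]
      fun q : Icc (0 : ℝ) 1 × Ω => H q.1 t x q.2) {φ : ℝ → ℝ → ℝ} {ψ : ℝ → ℝ}
    (hφ0 : ∀ s ∈ Icc (0 : ℝ) 1, ∀ t ∈ Icc 0 T, 0 ≤ φ s t)
    (hφ : ∀ s ∈ Icc (0 : ℝ) 1, WBound P p q₁ q₂ T V (H s) (φ s))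
    (hψ : ∀ t ∈ Icc 0 T, LpLe P (1 / p) (fun ω => φ (r η ω) t) (ψ t)) :
    WBound P p q₁ q₂ T V (fun t x ω => H (r η ω) t x ω) ψ := by
  have hR : Measurable[MeasurableSpace.comap (r η) inferInstance]
      fun ω => (⟨r η ω, hY.r_mem η ω⟩ : Icc (0 : ℝ) 1) :=
    Measurable.subtype_mk (comap_measurable (r η))
  exact WBound.freeze h𝓜 (hR.mono (hY.r_meas η).comap_le le_rfl)
    (indep_of_indep_of_le_left hind hR.comap_le) hH (by linarith [hE.two_le])
    (fun t ht x => (hX.V_pos ht x).le) (φ := fun s => φ s) (fun s => hφ0 s s.2)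
    (fun s => hφ s s.2) hψ

omit hX hu hE in
lemma indep_r_path (η : Idx) : Indep (MeasurableSpace.comap (r η) inferInstance)
    (MeasurableSpace.comap (approxPath T Y η) MeasurableSpace.pi) P :=
  indep_of_indep_of_le_right (hY.indep_fields η) (comap_approxPath_le_fields η)

lemma wBound_increment_r {k : ℕ} (hk : 1 ≤ k) (η : Idx) :
    WBound P p q₁ q₂ T V (fun t x ω => increment T f g u (Y k η) (r η ω) t x ω)
      (fun _ => 220 * Real.exp (c * T) ^ 10) := by
  refine hY.wBound_comp_r hX hE (hY.comap_approxPath_le η) (hY.indep_r_path η)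
    (fun t ht x => hX.measurable_increment_prod hu ht x (hY.measurable_Y_prod hk η ht x))
    (φ := fun _ _ => 220 * Real.exp (c * T) ^ 10) (fun _ _ _ _ => by positivity)
    (fun s hs => hX.wBound_increment hu hE (fun t ht x => hY.exp_le_V hX ht x) hs
      (hY.fieldBound_Y hX hk η)) fun t _ => ?_
  have := LpLe.const (P := P) (220 * Real.exp (c * T) ^ 10) (1 / p)
  rwa [Real.norm_of_nonneg (by positivity)] at this

lemma wBound_increment_sub_r {k k' : ℕ} (hk : 1 ≤ k) (hk' : 1 ≤ k') (η : Idx) :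
    WBound P p q₁ q₂ T V (fun t x ω => increment T f g u (Y k η) (r η ω) t x ω
      - increment T f g u (Y k' η) (r η ω) t x ω)
      (fun _ => 220 * Real.exp (c * T) ^ 10 * (1 / √k + 1 / √k')) := by
  refine hY.wBound_comp_r hX hE (hY.comap_approxPath_le η) (hY.indep_r_path η)
    (H := fun s t x ω => increment T f g u (Y k η) s t x ω - increment T f g u (Y k' η) s t x ω)
    (fun t ht x => ?_)
    (φ := fun _ _ => 220 * Real.exp (c * T) ^ 10 * (1 / √k + 1 / √k'))
    (fun _ _ _ _ => by positivity)
    (fun s hs => hX.wBound_increment_sub hu hE (fun t ht x => hY.exp_le_V hX ht x) hs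
      (hY.coupling_Y_Y hX hk hk' η) (by positivity)) fun t _ => ?_
  · have h1 := hX.measurable_increment_prod hu ht x (hY.measurable_Y_prod hk η ht x)
    have h2 := hX.measurable_increment_prod hu ht x (hY.measurable_Y_prod hk' η ht x)
    let _ : MeasurableSpace (Icc (0 : ℝ) 1 × Ω) :=
      (inferInstance : MeasurableSpace (Icc (0 : ℝ) 1)).prod
        (MeasurableSpace.comap (approxPath T Y η) MeasurableSpace.pi)
    exact h1.sub h2
  · have := LpLe.const (P := P) (220 * Real.exp (c * T) ^ 10 * (1 / √k + 1 / √k')) (1 / p)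
    rwa [Real.norm_of_nonneg (by positivity)] at this

omit hE in
lemma measurable_increment_fields {t : ℝ} (ht : t ∈ Icc 0 T) (x : E) :
    Measurable[(inferInstance : MeasurableSpace (Icc (0 : ℝ) 1)).prod (fields T X Y)]
      fun q : Icc (0 : ℝ) 1 × Ω => increment T f g u X q.1 t x q.2 :=
  hX.measurable_increment_prod hu ht x (hX.measurable_X_prod ht x)

lemma wBound_increment_X_r (η : Idx) :
    WBound P p q₁ q₂ T V (fun t x ω => increment T f g u X (r η ω) t x ω)
      (fun _ => 220 * Real.exp (c * T) ^ 10) := by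
  refine hY.wBound_comp_r hX hE (hY.fields_le hX) (hY.indep_fields η)
    (fun t ht x => hY.measurable_increment_fields hX hu ht x)
    (φ := fun _ _ => 220 * Real.exp (c * T) ^ 10) (fun _ _ _ _ => by positivity)
    (fun s hs => hX.wBound_increment hu hE (fun t ht x => hY.exp_le_V hX ht x) hs
      (hY.fieldBound_X hX)) fun t _ => ?_
  have := LpLe.const (P := P) (220 * Real.exp (c * T) ^ 10) (1 / p)
  rwa [Real.norm_of_nonneg (by positivity)] at this

lemma wBound_increment_sub_X_r {k : ℕ} (hk : 1 ≤ k) :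
    WBound P p q₁ q₂ T V (fun t x ω => increment T f g u (Y k Idx.zero) (r Idx.zero ω) t x ω
      - increment T f g u X (r Idx.zero ω) t x ω)
      (fun _ => 220 * Real.exp (c * T) ^ 10 * (1 / √k)) := by
  refine hY.wBound_comp_r hX hE (hY.fields_le hX) (hY.indep_fields Idx.zero)
    (H := fun s t x ω => increment T f g u (Y k Idx.zero) s t x ω - increment T f g u X s t x ω)
    (fun t ht x => ?_)
    (φ := fun _ _ => 220 * Real.exp (c * T) ^ 10 * (1 / √k))
    (fun _ _ _ _ => by positivity)
    (fun s hs => hX.wBound_increment_sub hu hE (fun t ht x => hY.exp_le_V hX ht x) hs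
      (hY.coupling_Y_X hX hk (hY.fieldBound_X hX)) (by positivity)) fun t _ => ?_
  · have h1 := (hX.measurable_increment_prod hu ht x (hY.measurable_Y_prod hk Idx.zero ht x)).mono
      (sup_le_sup le_rfl (MeasurableSpace.comap_mono
        (comap_approxPath_le_fields (X := X) Idx.zero))) le_rfl
    have h2 := hY.measurable_increment_fields hX hu ht x
    let _ : MeasurableSpace (Icc (0 : ℝ) 1 × Ω) :=
      (inferInstance : MeasurableSpace (Icc (0 : ℝ) 1)).prod (fields T X Y)
    exact h1.sub h2
  · have := LpLe.const (P := P) (220 * Real.exp (c * T) ^ 10 * (1 / √k)) (1 / p)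
    rwa [Real.norm_of_nonneg (by positivity)] at this

/-- One Picard step gains the factor `1 / √m` in exponentially weighted norms. -/
lemma wBound_nonlinError_r {m : ℕ} (hm : 1 ≤ m) {S : Set Idx} {η : Idx} (hη : η ∉ S)
    {U : ℝ → E → Ω → ℝ}
    (hUm : Measurable[(inferInstance : MeasurableSpace (Icc 0 T × E)).prod (joint T r Y S)]
      fun q : (Icc 0 T × E) × Ω => U q.1.1 q.1.2 q.2) {K : ℝ} (hK : 0 ≤ K)
    (hU : WBound P p q₁ q₂ T V (fun t x ω => U t x ω - u t x)
      (fun t => K * Real.exp ((m : ℝ) ^ (p / 2) * ((T - t) / T) / p))) {k : ℕ} (hk : 1 ≤ k) :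
    WBound P p q₁ q₂ T V (fun t x ω => nonlinError T f u U (Y k η) (r η ω) t x ω)
      (fun t => 37 / 5 * Real.exp (c * T) ^ 3 * K * (1 / √m)
        * Real.exp ((m : ℝ) ^ (p / 2) * ((T - t) / T) / p)) := by
  have hT := hX.T_pos
  have hc := hX.c_pos
  have hp0 : 0 < p := by linarith [hE.two_le]
  obtain ⟨he, hcT⟩ := hX.exp_facts
  have hjoint : Indep (own T r Y η) (joint T r Y S) P :=
    indep_of_indep_of_le_left (hY.indep_joint (disjoint_singleton_left.2 hη))
      (own_le_joint (mem_singleton η))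
  -- The time must be independent of the field and the inner approximation jointly, since both occur
  -- in the frozen expression.
  have hind : Indep (MeasurableSpace.comap (r η) inferInstance)
      (MeasurableSpace.comap (approxPath T Y η) MeasurableSpace.pi ⊔ joint T r Y S) P :=
    Indep.sup_right (hY.r_meas η).comap_le (hY.comap_approxPath_le η) (hY.joint_le S)
      (hY.indep_r_path η) hjoint
  have hanti : AntitoneOn (fun t => K * Real.exp ((m : ℝ) ^ (p / 2) * ((T - t) / T) / p))
      (Icc 0 T) := by
    intro t _ t' _ htt
    dsimp only
    gcongr
  refine hY.wBound_comp_r hX hE (sup_le (hY.comap_approxPath_le η) (hY.joint_le S)) hind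
    (fun t ht x => hX.measurable_nonlinError_prod hu ht x (hY.measurable_Y_prod hk η ht x) hUm)
    (φ := fun s t => 20 * Real.exp (c * T) ^ 2 * c * √T * √(T - t) *
      (K * Real.exp ((m : ℝ) ^ (p / 2) * ((T - midTime T t s) / T) / p)))
    (fun _ _ _ _ => by positivity)
    (fun s hs => hX.wBound_nonlinError hu hE (fun t ht x => hY.exp_le_V hX ht x)
      (hY.fieldBound_Y hX hk η) (hY.joint_le S) hUm (hY.comap_approxPath_le η) ?_
      (indep_of_indep_of_le_left hjoint le_sup_right) hanti (fun _ _ => by positivity) hU hs)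
    fun t ht => ?_
  · intro t τ ht htτ hτ x
    exact (hY.measurable_Y_prod hk η ⟨ht, htτ.trans hτ⟩ x).comp
      (measurable_prodMk_left (x := (⟨τ, htτ, hτ⟩ : Icc t T)))
  · have hτ : (T - t) / T ∈ Icc (0 : ℝ) 1 :=
      ⟨div_nonneg (sub_nonneg.2 ht.2) hT.le, (div_le_one hT).2 (by linarith [ht.1])⟩
    have h1 := (hY.lpLe_exp_time hE.two_le hm η hτ).const_mul
      (20 * Real.exp (c * T) ^ 2 * (c * T) * K)
    rw [abs_of_nonneg (by positivity)] at h1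
    have h2 : √T * √(T - t) = T * √((T - t) / T) := by
      rw [Real.sqrt_div (sub_nonneg.2 ht.2)]
      field_simp
      rw [Real.sq_sqrt hT.le]
    refine (h1.congr_ae (.of_forall fun ω => ?_)).mono_bound ?_
    · have h3 : (T - midTime T t (r η ω)) / T = (T - t) / T * (1 - r η ω) := by
        unfold midTime; ring
      simp only [h3]
      calc _ = 20 * Real.exp (c * T) ^ 2 * c * (T * √((T - t) / T)) *
          (K * Real.exp ((m : ℝ) ^ (p / 2) * ((T - t) / T * (1 - r η ω)) / p)) := by ring
        _ = _ := by rw [← h2]; ring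
    · set e := Real.exp (c * T)
      -- The factor cT is exchanged for 37/100 e^{cT}, and 20·37/100 = 37/5.
      calc _ ≤ 20 * e ^ 2 * (37 / 100 * e) * K * (1 / √m
            * Real.exp ((m : ℝ) ^ (p / 2) * ((T - t) / T) / p)) := by gcongr
        _ = _ := by ring

omit hE in
/-- The solution is the mean of the increment along the flow at a uniformly distributed time. -/
lemma integral_increment_X (hE : Exponents p₁ p₂ p q₁ q₂)
    (hup : ∀ t ∈ Icc 0 T, ∀ x, u t x = picard P T f g X u t x) {t : ℝ} (ht : t ∈ Icc 0 T) (x : E) :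
    ∫ ω, increment T f g u X (r Idx.zero ω) t x ω ∂P = u t x := by
  have hgi : Integrable (fun ω => g (X t T x ω)) P :=
    (hX.lpLe_g_X (hY.fieldBound_X hX) ht x).integrable (hX.cost_le_one).1
  have hinc := ((hY.wBound_increment_X_r hX hu hE Idx.zero).one t ht x).integrable
    (hX.costs_le hE).2.2.2.1
  set R : Ω → Icc (0 : ℝ) 1 := fun ω => projIcc 0 1 zero_le_one (r Idx.zero ω) with hR
  have hRr : ∀ ω, (R ω : ℝ) = r Idx.zero ω := fun ω => by
    simp only [hR]
    rw [projIcc_of_mem _ (hY.r_mem Idx.zero ω)]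
  have hRm : Measurable[MeasurableSpace.comap (r Idx.zero) inferInstance] R :=
    continuous_projIcc.measurable.comp (comap_measurable (r Idx.zero))
  -- Only the nonlinear part depends on the random time. Its frozen mean is integrated over [0,1],
  -- and the substitution τ = t + (T-t)s gives the time integral of the fixed-point equation.
  set Φ : Icc (0 : ℝ) 1 × Ω → ℝ := fun q => increment T f g u X q.1 t x q.2 - g (X t T x q.2)
    with hΦ
  have hΦm : Measurable[(inferInstance : MeasurableSpace (Icc (0 : ℝ) 1)).prod (fields T X Y)] Φ := by
    have h1 := hY.measurable_increment_fields hX hu ht x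
    have h2 := measurable_comp_map_fst (S' := Icc (0 : ℝ) 1) (hX.measurable_X_prod (Y := Y) ht x)
      (measurable_const (a := (⟨T, ht.2, le_rfl⟩ : Icc t T)))
    let _ : MeasurableSpace (Icc (0 : ℝ) 1 × Ω) :=
      (inferInstance : MeasurableSpace (Icc (0 : ℝ) 1)).prod (fields T X Y)
    exact h1.sub (hX.g_cont.measurable.comp h2)
  have hΦR : ∀ ω, Φ (R ω, ω) = increment T f g u X (r Idx.zero ω) t x ω - g (X t T x ω) :=
    fun ω => by simp only [hΦ, hRr]
  have hΦi : Integrable (fun ω => Φ (R ω, ω)) P := by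
    simp_rw [hΦR]
    exact hinc.sub hgi
  have hfr := integral_freeze (hY.fields_le hX) (hRm.mono (hY.r_meas _).comap_le le_rfl)
    (indep_of_indep_of_le_left (hY.indep_fields Idx.zero) hRm.comap_le) hΦm hΦi
  have hF : Measurable fun s : ℝ => ∫ ω, Φ (projIcc 0 1 zero_le_one s, ω) ∂P :=
    (measurable_of_sub (hY.fields_le hX) hΦm).stronglyMeasurable.integral_prod_right'.measurable.comp
      continuous_projIcc.measurable
  have hmean : ∫ ω, Φ (R ω, ω) ∂P = ∫ τ in t..T, ∫ ω, f (u τ (X t τ x ω)) ∂P := by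
    rw [hfr, ← integral_map (hY.r_meas Idx.zero).aemeasurable
      (f := fun s : ℝ => ∫ ω, Φ (projIcc 0 1 zero_le_one s, ω) ∂P) hF.aestronglyMeasurable,
      hY.map_r, integral_Icc_eq_integral_Ioc, ← intervalIntegral.integral_of_le zero_le_one]
    have h1 : ∀ s ∈ uIcc (0 : ℝ) 1, ∫ ω, Φ (projIcc 0 1 zero_le_one s, ω) ∂P
        = (T - t) * ∫ ω, f (u (t + (T - t) * s) (X t (t + (T - t) * s) x ω)) ∂P := by
      intro s hs
      rw [uIcc_of_le zero_le_one] at hs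
      rw [← integral_const_mul]
      refine integral_congr_ae (.of_forall fun ω => ?_)
      simp only [hΦ, increment, midTime, projIcc_of_mem zero_le_one hs]
      ring
    rw [intervalIntegral.integral_congr h1, intervalIntegral.integral_const_mul]
    have h2 := intervalIntegral.mul_integral_comp_add_mul (a := 0) (b := 1)
      (f := fun τ => ∫ ω, f (u τ (X t τ x ω)) ∂P) (T - t) t
    rw [h2]
    congr 1 <;> ring
  rw [hup t ht x, picard, ← hmean, ← integral_add hgi hΦi]
  refine integral_congr_ae (.of_forall fun ω => ?_)
  simp only [hΦR]
  ring

end RandomTime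

end ApproxAssumptions

end MLPHoelder

end

/-! ### Algebra of the weighted bounds and the size of a summand. -/

section

namespace MLPHoelder

set_option linter.unusedSectionVars false

variable {E : Type*} [NormedAddCommGroup E] [NormedSpace ℝ E] [FiniteDimensional ℝ E]
  [MeasurableSpace E] [BorelSpace E] {Ω : Type*} [mΩ : MeasurableSpace Ω] {P : Measure Ω}
  {p₁ p₂ p q₁ q₂ c T : ℝ} {f : ℝ → ℝ} {g : E → ℝ} {V : ℝ → E → ℝ} {X : ℝ → ℝ → E → Ω → E}
  {r : Idx → Ω → ℝ} {Y : ℕ → Idx → ℝ → ℝ → E → Ω → E}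

section WBound

variable {H H' : ℝ → E → Ω → ℝ} {φ ψ : ℝ → ℝ}

lemma WBound.congr (h : WBound P p q₁ q₂ T V H φ)
    (hH : ∀ t ∈ Icc 0 T, ∀ x ω, H t x ω = H' t x ω) : WBound P p q₁ q₂ T V H' φ := by
  refine ⟨fun t ht x => (h.one t ht x).congr_ae (.of_forall fun ω => hH t ht x ω),
    fun t t' ht htt ht' x x' => (h.two t t' ht htt ht' x x').congr_ae (.of_forall fun ω => ?_)⟩
  simp only [hH t ⟨ht, htt.trans ht'⟩, hH t' ⟨ht.trans htt, ht'⟩]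

lemma gap_nonneg (hV : ∀ t ∈ Icc 0 T, ∀ x, 0 ≤ V t x) {t t' : ℝ} (ht : t ∈ Icc 0 T)
    (ht' : t' ∈ Icc 0 T) (x x' : E) : 0 ≤ gap T V t x t' x' := by
  have := hV t ht x
  have := hV t' ht' x'
  unfold gap
  positivity

variable (hV : ∀ t ∈ Icc 0 T, ∀ x, 0 ≤ V t x)
include hV

lemma weight_nonneg {t t' : ℝ} (ht : t ∈ Icc 0 T) (ht' : t' ∈ Icc 0 T) (x x' : E) :
    0 ≤ (V t x ^ q₂ + V t' x' ^ q₂) / 2 * gap T V t x t' x' := by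
  have := hV t ht x
  have := hV t' ht' x'
  have := gap_nonneg hV ht ht' x x'
  positivity

lemma WBound.mono (h : WBound P p q₁ q₂ T V H φ) (hφ : ∀ t ∈ Icc 0 T, φ t ≤ ψ t) :
    WBound P p q₁ q₂ T V H ψ := by
  refine ⟨fun t ht x => (h.one t ht x).mono_bound
      (mul_le_mul_of_nonneg_right (hφ t ht) (Real.rpow_nonneg (hV t ht x) _)),
    fun t t' ht htt ht' x x' => (h.two t t' ht htt ht' x x').mono_bound ?_⟩
  exact mul_le_mul_of_nonneg_right (hφ t ⟨ht, htt.trans ht'⟩)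
    (weight_nonneg hV ⟨ht, htt.trans ht'⟩ ⟨ht.trans htt, ht'⟩ x x')

lemma WBound.add (h : WBound P p q₁ q₂ T V H φ) (h' : WBound P p q₁ q₂ T V H' ψ) (hp : 1 / p ≤ 1)
    (hφ : ∀ t ∈ Icc 0 T, 0 ≤ φ t) (hψ : ∀ t ∈ Icc 0 T, 0 ≤ ψ t) :
    WBound P p q₁ q₂ T V (fun t x ω => H t x ω + H' t x ω) (fun t => φ t + ψ t) := by
  constructor
  · intro t ht x
    have hw := Real.rpow_nonneg (hV t ht x) q₁
    refine ((h.one t ht x).add (h'.one t ht x) hp (mul_nonneg (hφ t ht) hw)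
      (mul_nonneg (hψ t ht) hw)).mono_bound (by rw [add_mul])
  · intro t t' ht htt ht' x x'
    have htm : t ∈ Icc 0 T := ⟨ht, htt.trans ht'⟩
    have hw := weight_nonneg (q₂ := q₂) hV htm ⟨ht.trans htt, ht'⟩ x x'
    refine (((h.two t t' ht htt ht' x x').add (h'.two t t' ht htt ht' x x') hp
      (mul_nonneg (hφ t htm) hw) (mul_nonneg (hψ t htm) hw)).mono_bound
      (by rw [add_mul])).congr_ae (.of_forall fun ω => ?_)
    dsimp only
    ring

omit hV in
lemma WBound.neg (h : WBound P p q₁ q₂ T V H φ) :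
    WBound P p q₁ q₂ T V (fun t x ω => -H t x ω) φ := by
  refine ⟨fun t ht x => (h.one t ht x).neg, fun t t' ht htt ht' x x' =>
    (h.two t t' ht htt ht' x x').neg.congr_ae (.of_forall fun ω => ?_)⟩
  dsimp only
  ring

lemma WBound.sub (h : WBound P p q₁ q₂ T V H φ) (h' : WBound P p q₁ q₂ T V H' ψ) (hp : 1 / p ≤ 1)
    (hφ : ∀ t ∈ Icc 0 T, 0 ≤ φ t) (hψ : ∀ t ∈ Icc 0 T, 0 ≤ ψ t) :
    WBound P p q₁ q₂ T V (fun t x ω => H t x ω - H' t x ω) (fun t => φ t + ψ t) := by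
  simpa only [sub_eq_add_neg] using h.add hV h'.neg hp hφ hψ

omit hV in
/-- The linear functionals `H ↦ H t x - κ * H t' x'` that are bounded by the weighted norms,
together with the corresponding weight `w`. -/
def IsTest (q₁ q₂ T : ℝ) (V : ℝ → E → ℝ) (κ t : ℝ) (x : E) (t' : ℝ) (x' : E) (w : ℝ) : Prop :=
  (κ = 0 ∧ t ∈ Icc 0 T ∧ t' = t ∧ x' = x ∧ w = V t x ^ q₁) ∨
    (κ = 1 ∧ 0 ≤ t ∧ t ≤ t' ∧ t' ≤ T ∧
      w = (V t x ^ q₂ + V t' x' ^ q₂) / 2 * gap T V t x t' x')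

omit hV in
lemma IsTest.mem {κ t t' w : ℝ} {x x' : E} (h : IsTest q₁ q₂ T V κ t x t' x' w) :
    t ∈ Icc 0 T ∧ t' ∈ Icc 0 T := by
  rcases h with ⟨-, ht, rfl, -⟩ | ⟨-, ht, htt, ht', -⟩
  · exact ⟨ht, ht⟩
  · exact ⟨⟨ht, htt.trans ht'⟩, ht.trans htt, ht'⟩

lemma IsTest.nonneg {κ t t' w : ℝ} {x x' : E} (h : IsTest q₁ q₂ T V κ t x t' x' w) : 0 ≤ w := by
  have hm := h.mem
  rcases h with ⟨-, ht, -, -, rfl⟩ | ⟨-, -, -, -, rfl⟩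
  · exact Real.rpow_nonneg (hV t ht x) _
  · exact weight_nonneg hV hm.1 hm.2 x x'

omit hV in
lemma WBound.test {κ t t' w : ℝ} {x x' : E} (h : WBound P p q₁ q₂ T V H φ)
    (hz : IsTest q₁ q₂ T V κ t x t' x' w) :
    LpLe P (1 / p) (fun ω => H t x ω - κ * H t' x' ω) (φ t * w) := by
  rcases hz with ⟨rfl, ht, rfl, rfl, rfl⟩ | ⟨rfl, ht, htt, ht', rfl⟩
  · simpa using h.one _ ht _
  · simpa using h.two t t' ht htt ht' x x'

omit hV in
-- Both weighted norms are L^p bounds for linear functionals of the field. With the switch κ ∈ {0,1}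
-- the Monte Carlo argument has to be carried out only once.
lemma wBound_of_test (h : ∀ κ t x t' x' w, IsTest q₁ q₂ T V κ t x t' x' w →
    LpLe P (1 / p) (fun ω => H t x ω - κ * H t' x' ω) (φ t * w)) :
    WBound P p q₁ q₂ T V H φ := by
  refine ⟨fun t ht x => ?_, fun t t' ht htt ht' x x' => ?_⟩
  · simpa using h 0 t x t x _ (Or.inl ⟨rfl, ht, rfl, rfl, rfl⟩)
  · simpa using h 1 t x t' x' _ (Or.inr ⟨rfl, ht, htt, ht', rfl⟩)

end WBound

/-- The sampled terminal and nonlinear contribution of one approximation. -/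
noncomputable def cell (T : ℝ) (f : ℝ → ℝ) (g : E → ℝ) (r : Idx → Ω → ℝ)
    (Y : ℕ → Idx → ℝ → ℝ → E → Ω → E) (m k n : ℕ) (η η' : Idx) (t : ℝ) (x : E) (ω : Ω) : ℝ :=
  g (Y k η t T x ω) + (T - t) * f (mlp T f g r Y n m η' (t + (T - t) * r η ω)
    (Y k η t (t + (T - t) * r η ω) x ω) ω)

lemma mlpTerm_zero (m : ℕ) (θ : Idx) (i : ℕ) (t : ℝ) (x : E) (ω : Ω) :
    mlpTerm T f g r Y m θ 0 i t x ω
      = cell T f g r Y m (m ^ 0) 0 (θ.snoc 0 i) (θ.snoc 0 i) t x ω := by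
  simp [mlpTerm, cell]

/-- Both cells share the sampled time and the field index, so they are coupled; only the inner
approximations use different branches. -/
lemma mlpTerm_succ (m : ℕ) (θ : Idx) (l i : ℕ) (t : ℝ) (x : E) (ω : Ω) :
    mlpTerm T f g r Y m θ (l + 1) i t x ω
      = cell T f g r Y m (m ^ (l + 1)) (l + 1) (θ.snoc (l + 1 : ℕ) i) (θ.snoc (l + 1 : ℕ) i) t x ω
        - cell T f g r Y m (m ^ l) l (θ.snoc (l + 1 : ℕ) i) (θ.snoc (l + 1 : ℕ) (-(i : ℤ))) t x ω := by
  simp only [mlpTerm, cell, Nat.add_one_ne_zero, if_false, Nat.add_sub_cancel]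
  ring

/-- Inserting u separates the discretization error of the field from the error of the inner
approximation. -/
lemma cell_eq (u : ℝ → E → ℝ) (m k n : ℕ) (η η' : Idx) (t : ℝ) (x : E) (ω : Ω) :
    cell T f g r Y m k n η η' t x ω = increment T f g u (Y k η) (r η ω) t x ω
      + nonlinError T f u (mlp T f g r Y n m η') (Y k η) (r η ω) t x ω := by
  simp only [cell, increment, nonlinError, midTime]
  ring

lemma Idx.snoc_notMem_below_snoc (θ : Idx) (l : ℤ) {i : ℕ} (hi : 1 ≤ i) :
    θ.snoc l i ∉ (θ.snoc l (-(i : ℤ))).below := fun h =>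
  Set.disjoint_left.1 (θ.disjoint_branch_snoc (a := l) (b := i) (a' := l) (b' := -(i : ℤ))
    fun h => by rw [Prod.mk.injEq] at h; omega)
    (Idx.self_mem_branch _) (Idx.below_subset_branch _ h)

lemma one_div_sqrt_natCast_pow (m l : ℕ) : 1 / √((m ^ l : ℕ) : ℝ) = (1 / √(m : ℝ)) ^ l := by
  have h : ((m ^ l : ℕ) : ℝ) = (√(m : ℝ) ^ l) ^ 2 := by
    rw [← pow_mul, mul_comm, pow_mul, Real.sq_sqrt (Nat.cast_nonneg m), Nat.cast_pow]
  rw [h, Real.sqrt_sq (by positivity), div_pow, one_pow]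

namespace ApproxAssumptions

variable [IsProbabilityMeasure P] (hX : FlowAssumptions P p₁ p₂ c T f g V X)
  (hY : ApproxAssumptions P p₁ p₂ c T V X r Y) {u : ℝ → E → ℝ} (hu : SolutionBounds c T V u)
  (hE : Exponents p₁ p₂ p q₁ q₂) {m : ℕ} (hm : 1 ≤ m)
include hX hY hm

lemma measurable_mlp_prod (n : ℕ) (θ : Idx) :
    Measurable[(inferInstance : MeasurableSpace (Icc 0 T × E)).prod (joint T r Y θ.below)]
      fun q : (Icc 0 T × E) × Ω => mlp T f g r Y n m θ q.1.1 q.1.2 q.2 := by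
  let _ : MeasurableSpace ((Icc 0 T × E) × Ω) :=
    (inferInstance : MeasurableSpace (Icc 0 T × E)).prod (joint T r Y θ.below)
  have h1 : Measurable (Prod.fst : (Icc 0 T × E) × Ω → _) := @measurable_fst _ _ _ (_)
  have h2 : @Measurable ((Icc 0 T × E) × Ω) Ω _ (joint T r Y θ.below) Prod.snd :=
    @measurable_snd _ _ _ (_)
  exact hY.measurable_mlp hX hm n θ (measurable_subtype_coe.comp (measurable_fst.comp h1))
    (measurable_snd.comp h1) h2 fun q => q.1.1.2

include hu hE

lemma wBound_nonlinError_mlp {n : ℕ} {η η' : Idx} (hη : η ∉ η'.below) {K : ℝ} (hK : 0 ≤ K)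
    (hU : WBound P p q₁ q₂ T V (fun t x ω => mlp T f g r Y n m η' t x ω - u t x)
      (fun t => K * Real.exp ((m : ℝ) ^ (p / 2) * ((T - t) / T) / p))) {k : ℕ} (hk : 1 ≤ k) :
    WBound P p q₁ q₂ T V (fun t x ω =>
        nonlinError T f u (mlp T f g r Y n m η') (Y k η) (r η ω) t x ω)
      (fun t => 37 / 5 * Real.exp (c * T) ^ 3 * K * (1 / √m)
        * Real.exp ((m : ℝ) ^ (p / 2) * ((T - t) / T) / p)) :=
  hY.wBound_nonlinError_r hX hu hE hm hη (hY.measurable_mlp_prod hX hm n η') hK hU hk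

/-- The bound 220 (m^{-l/2} + m^{-(l-1)/2}) ≤ 440 √m · m^{-l/2} treats the increments. The nonlinear
error of the lower level lacks one factor 1/√m, which the random time restores, and β ≥ 37 makes it
at most 1/37 of the other one: 37/5·(1 + 1/37) = 38/5. -/
lemma wBound_mlpTerm (θ : Idx) {l i : ℕ} (hi : 1 ≤ i) {C β : ℝ} (hC : 0 ≤ C) (hβ : 37 ≤ β)
    (ih : ∀ j ≤ l, ∀ θ : Idx, WBound P p q₁ q₂ T V (fun t x ω => mlp T f g r Y j m θ t x ω - u t x)
      (fun t => C * (1 / √m) ^ j * β ^ j * Real.exp ((m : ℝ) ^ (p / 2) * ((T - t) / T) / p))) :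
    WBound P p q₁ q₂ T V (mlpTerm T f g r Y m θ l i)
      (fun t => (1 / √m) ^ l * (440 * Real.exp (c * T) ^ 10 * √m + 38 / 5 * Real.exp (c * T) ^ 3 * C
        * β ^ l * Real.exp ((m : ℝ) ^ (p / 2) * ((T - t) / T) / p))) := by
  have hp1 := (hX.costs_le hE).2.2.2.1
  have hV : ∀ t ∈ Icc 0 T, ∀ x, 0 ≤ V t x := fun t ht x => (hX.V_pos ht x).le
  have hpow : ∀ j, 1 ≤ m ^ j := fun j => Nat.one_le_pow _ _ hm
  have hm1 : 1 ≤ √(m : ℝ) := Real.one_le_sqrt.2 (by exact_mod_cast hm)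
  have hm0 : 0 < √(m : ℝ) := by linarith
  have hμ0 : 0 ≤ 1 / √(m : ℝ) := by positivity
  have hμ1 : 1 / √(m : ℝ) ≤ 1 := (div_le_one hm0).2 hm1
  have hβ0 : 0 ≤ β := by linarith
  have hne : ∀ j ≤ l, ∀ {η η' : Idx}, η ∉ η'.below → WBound P p q₁ q₂ T V (fun t x ω =>
      nonlinError T f u (mlp T f g r Y j m η') (Y (m ^ j) η) (r η ω) t x ω) _ :=
    fun j hj η η' hη => hY.wBound_nonlinError_mlp hX hu hE hm hη (by positivity) (ih j hj η')
      (hpow j)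
  set e := Real.exp (c * T)
  have he0 : 0 < e := Real.exp_pos _
  cases l with
  | zero =>
    have h := (hY.wBound_increment_r hX hu hE (hpow 0) (θ.snoc 0 i)).add hV
      (hne 0 le_rfl (η := θ.snoc 0 i) (Idx.notMem_below _)) hp1 (fun _ _ => by positivity)
      (fun _ _ => by positivity)
    refine (h.congr fun t _ x ω => ?_).mono hV fun t _ => ?_
    · rw [mlpTerm_zero, cell_eq u]
    · have hEt := (Real.exp_pos ((m : ℝ) ^ (p / 2) * ((T - t) / T) / p)).le
      set Et := Real.exp ((m : ℝ) ^ (p / 2) * ((T - t) / T) / p)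
      simp only [pow_zero, mul_one, one_mul]
      have h1 : 220 * e ^ 10 ≤ 440 * e ^ 10 * √m := by
        have : e ^ 10 * 1 ≤ e ^ 10 * √m := by gcongr
        have : 0 < e ^ 10 := by positivity
        nlinarith
      have h2 : 37 / 5 * e ^ 3 * C * (1 / √m) * Et ≤ 38 / 5 * e ^ 3 * C * 1 * Et := by
        gcongr
        norm_num
      rw [mul_one] at h2
      exact add_le_add h1 h2
  | succ l =>
    have h := ((hY.wBound_increment_sub_r hX hu hE (hpow (l + 1)) (hpow l)
      (θ.snoc (l + 1 : ℕ) i)).add hV (hne (l + 1) le_rfl (η := θ.snoc (l + 1 : ℕ) i)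
        (Idx.notMem_below _)) hp1 (fun _ _ => by positivity) (fun _ _ => by positivity)).sub hV
      (hne l (Nat.le_succ l) (θ.snoc_notMem_below_snoc (l + 1 : ℕ) hi)) hp1
      (fun _ _ => by positivity) (fun _ _ => by positivity)
    refine (h.congr fun t _ x ω => ?_).mono hV fun t _ => ?_
    · rw [mlpTerm_succ, cell_eq u, cell_eq u]
      ring
    · have hEt := (Real.exp_pos ((m : ℝ) ^ (p / 2) * ((T - t) / T) / p)).le
      set Et := Real.exp ((m : ℝ) ^ (p / 2) * ((T - t) / T) / p)
      rw [one_div_sqrt_natCast_pow, one_div_sqrt_natCast_pow]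
      have hs : (1 / √(m : ℝ)) ^ l = (1 / √(m : ℝ)) ^ (l + 1) * √m := by
        rw [pow_succ]; field_simp
      have hβl : β ^ l ≤ β ^ (l + 1) / 37 := by
        rw [pow_succ, le_div_iff₀ (by norm_num)]
        gcongr
      set μ := 1 / √(m : ℝ)
      have k1 : 220 * e ^ 10 * (μ ^ (l + 1) + μ ^ l) ≤ μ ^ (l + 1) * (440 * e ^ 10 * √m) := by
        rw [hs]
        calc _ = μ ^ (l + 1) * (220 * e ^ 10 * (1 + √m)) := by ring
          _ ≤ μ ^ (l + 1) * (220 * e ^ 10 * (√m + √m)) := by gcongr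
          _ = _ := by ring
      calc _ ≤ μ ^ (l + 1) * (440 * e ^ 10 * √m)
            + 37 / 5 * e ^ 3 * (C * μ ^ (l + 1) * β ^ (l + 1)) * 1 * Et
            + 37 / 5 * e ^ 3 * (C * μ ^ l * (β ^ (l + 1) / 37)) * μ * Et := by gcongr
        _ = _ := by rw [pow_succ μ l]; ring

end ApproxAssumptions

end MLPHoelder

end

/-! ### One step of the error recursion: fluctuation and bias. -/

section

namespace MLPHoelder

set_option linter.unusedSectionVars false

variable {E : Type*} [NormedAddCommGroup E] [NormedSpace ℝ E] [FiniteDimensional ℝ E]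
  [MeasurableSpace E] [BorelSpace E] {Ω : Type*} [mΩ : MeasurableSpace Ω] {P : Measure Ω}
  {p₁ p₂ p q₁ q₂ c T : ℝ} {f : ℝ → ℝ} {g : E → ℝ} {V : ℝ → E → ℝ} {X : ℝ → ℝ → E → Ω → E}
  {r : Idx → Ω → ℝ} {Y : ℕ → Idx → ℝ → ℝ → E → Ω → E}

variable [IsProbabilityMeasure P]

/-- The fluctuation of a Monte Carlo average. -/
lemma lpLe_average_sub (hp : 2 ≤ p) {Z : ℕ → Ω → ℝ} {B d : ℝ} (hB : 0 ≤ B) {N : ℕ} (hN : 1 ≤ N)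
    (h : ∀ i ∈ Finset.Icc 1 N, LpLe P (1 / p) (Z i) B)
    (hd : ∀ i ∈ Finset.Icc 1 N, ∫ ω, Z i ω ∂P = d)
    (hZ : ∀ u ⊆ Finset.Icc 1 N, ∀ i ∈ Finset.Icc 1 N, i ∉ u →
      IndepFun (fun ω => ∑ j ∈ u, (Z j ω - d)) (fun ω => Z i ω - d) P) :
    LpLe P (1 / p) (fun ω => 1 / (N : ℝ) * ∑ i ∈ Finset.Icc 1 N, Z i ω - d)
      (2 * √(p - 1) * B * (1 / √(N : ℝ))) := by
  have hp1 : 1 / p ≤ 1 := (div_le_one (by linarith)).2 (by linarith)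
  have hN0 : (0 : ℝ) < N := by exact_mod_cast hN
  have h1 : ∀ i ∈ Finset.Icc 1 N, LpLe P (1 / p) (fun ω => Z i ω - d) (2 * B) := fun i hi => by
    -- Centring at most doubles the norm; this is the origin of the factor 2.
    have hdB : ‖d‖ ≤ B := hd i hi ▸ (h i hi).norm_integral_le hp1 hB
    exact ((h i hi).sub (LpLe.const d (1 / p)) hp1 hB (norm_nonneg _)).mono_bound (by linarith)
  have h2 := (lpLe_sum_of_indepFun hp (by positivity : 0 ≤ 2 * B) hZ h1 fun i hi => by
    rw [integral_sub ((h i hi).integrable hp1) (integrable_const d), hd i hi]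
    simp).const_mul (1 / (N : ℝ))
  rw [abs_of_pos (by positivity), Nat.card_Icc, Nat.add_sub_cancel] at h2
  refine (h2.congr_ae (.of_forall fun ω => ?_)).mono_bound (le_of_eq ?_)
  · simp only [Finset.sum_sub_distrib, Finset.sum_const, Nat.card_Icc, Nat.add_sub_cancel,
      nsmul_eq_mul]
    field_simp
  · rw [Real.sqrt_mul hN0.le, Real.sqrt_mul (by linarith), Real.sqrt_sq (by positivity)]
    have : (N : ℝ) = √N * √N := (Real.mul_self_sqrt hN0.le).symm
    have hs : 0 < √(N : ℝ) := Real.sqrt_pos.2 hN0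
    rw [show 1 / (N : ℝ) = 1 / (√N * √N) by rw [← this]]
    field_simp

lemma sum_range_sub_pred (G : ℕ → ℝ) (n : ℕ) :
    ∑ l ∈ Finset.range (n + 1), (G l - if l = 0 then 0 else G (l - 1)) = G n := by
  induction n with
  | zero => simp
  | succ n ih => rw [Finset.sum_range_succ, ih]; simp

namespace ApproxAssumptions

variable (hX : FlowAssumptions P p₁ p₂ c T f g V X)
  (hY : ApproxAssumptions P p₁ p₂ c T V X r Y) {u : ℝ → E → ℝ} (hu : SolutionBounds c T V u)
  (hE : Exponents p₁ p₂ p q₁ q₂) {m : ℕ} (hm : 1 ≤ m)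
include hX hY hm

/-- Means depend only on laws, so the terminal and the nonlinear part may be compared separately,
without regard to their joint law. -/
lemma integral_cell {n k : ℕ} (hk : 1 ≤ k) {η η' ζ ζ' : Idx} (hη : η ∉ η'.below)
    (hζ : ζ ∉ ζ'.below) {t : ℝ} (ht : t ∈ Icc 0 T) (x : E)
    (hi : Integrable (cell T f g r Y m k n η η' t x) P)
    (hi' : Integrable (cell T f g r Y m k n ζ ζ' t x) P) :
    ∫ ω, cell T f g r Y m k n η η' t x ω ∂P = ∫ ω, cell T f g r Y m k n ζ ζ' t x ω ∂P := by
  have hg : ∀ η, Integrable (fun ω => g (Y k η t T x ω)) P := fun η =>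
    (((hY.fieldBound_Y hX hk η).V_le t T ht.1 ht.2 le_rfl x).mono_real (hX.g_cont.measurable.comp
      (hY.measurable_Y hk η ht.1 ht.2 le_rfl x)).aestronglyMeasurable
      fun _ => hX.g_growth _).integrable (hX.cost_le_one).1
  have h1 := ((hY.identDistrib_sample hk hk η ζ ht x).comp
    (hX.g_cont.measurable.comp (measurable_fst.comp measurable_snd))).integral_eq
  have h2 := ((hY.identDistrib_mlp_sample hX hm n hk hη hζ ht x).comp
    (hX.f_cont.measurable.const_mul (T - t))).integral_eq
  have h3 : ∀ {η η'}, Integrable (cell T f g r Y m k n η η' t x) P →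
      ∫ ω, cell T f g r Y m k n η η' t x ω ∂P = (∫ ω, g (Y k η t T x ω) ∂P)
        + ∫ ω, (T - t) * f (mlp T f g r Y n m η' (t + (T - t) * r η ω)
          (Y k η t (t + (T - t) * r η ω) x ω) ω) ∂P := fun {η η'} hi => by
    rw [← integral_add (hg η)]
    · rfl
    · refine (hi.sub (hg η)).congr (.of_forall fun ω => ?_)
      simp only [cell, Pi.sub_apply]
      ring
  rw [h3 hi, h3 hi']
  exact congrArg₂ (· + ·) h1 h2

include hu hE

lemma wBound_cell {n k : ℕ} (hk : 1 ≤ k) {η η' : Idx} (hη : η ∉ η'.below) {K : ℝ} (hK : 0 ≤ K)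
    (hU : WBound P p q₁ q₂ T V (fun t x ω => mlp T f g r Y n m η' t x ω - u t x)
      (fun t => K * Real.exp ((m : ℝ) ^ (p / 2) * ((T - t) / T) / p))) :
    WBound P p q₁ q₂ T V (cell T f g r Y m k n η η')
      (fun t => 220 * Real.exp (c * T) ^ 10 + 37 / 5 * Real.exp (c * T) ^ 3 * K * (1 / √m)
        * Real.exp ((m : ℝ) ^ (p / 2) * ((T - t) / T) / p)) :=
  ((hY.wBound_increment_r hX hu hE hk η).add (fun t ht x => (hX.V_pos ht x).le)
    (hY.wBound_nonlinError_mlp hX hu hE hm hη hK hU hk) (hX.costs_le hE).2.2.2.1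
    (fun _ _ => by positivity) (fun _ _ => by positivity)).congr
    fun t _ x ω => (cell_eq u m k n η η' t x ω).symm

/-- The mean of the approximation on the finest level differs little from the solution. -/
lemma abs_integral_cell_sub_le
    (hup : ∀ t ∈ Icc 0 T, ∀ x, u t x = picard P T f g X u t x) {n k : ℕ} (hk : 1 ≤ k) {K : ℝ}
    (hK : 0 ≤ K)
    (hU : WBound P p q₁ q₂ T V (fun t x ω => mlp T f g r Y n m Idx.zero t x ω - u t x)
      (fun t => K * Real.exp ((m : ℝ) ^ (p / 2) * ((T - t) / T) / p)))
    {κ t t' w : ℝ} {x x' : E} (hz : IsTest q₁ q₂ T V κ t x t' x' w) :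
    |∫ ω, (cell T f g r Y m k n Idx.zero Idx.zero t x ω
      - κ * cell T f g r Y m k n Idx.zero Idx.zero t' x' ω) ∂P - (u t x - κ * u t' x')|
      ≤ (220 * Real.exp (c * T) ^ 10 * (1 / √k) + 37 / 5 * Real.exp (c * T) ^ 3 * K * (1 / √m)
        * Real.exp ((m : ℝ) ^ (p / 2) * ((T - t) / T) / p)) * w := by
  have hp1 := (hX.costs_le hE).2.2.2.1
  have hV : ∀ t ∈ Icc 0 T, ∀ x, 0 ≤ V t x := fun t ht x => (hX.V_pos ht x).le
  have hw := hz.nonneg hV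
  obtain ⟨ht, ht'⟩ := hz.mem
  have hc := (hY.wBound_cell hX hu hE hm hk (Idx.notMem_below Idx.zero) hK hU).test hz
  have hi := (hY.wBound_increment_X_r hX hu hE Idx.zero).test hz
  have hd := (((hY.wBound_increment_sub_X_r hX hu hE hk).add hV (hY.wBound_nonlinError_mlp hX hu hE
    hm (Idx.notMem_below Idx.zero) hK hU hk) hp1 (fun _ _ => by positivity)
    (fun _ _ => by positivity)).test hz).norm_integral_le hp1
      (mul_nonneg (by positivity) hw)
  have hu' : ∫ ω, (increment T f g u X (r Idx.zero ω) t x ω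
      - κ * increment T f g u X (r Idx.zero ω) t' x' ω) ∂P = u t x - κ * u t' x' := by
    rw [integral_sub, integral_const_mul, hY.integral_increment_X hX hu hE hup ht x,
      hY.integral_increment_X hX hu hE hup ht' x']
    · exact ((hY.wBound_increment_X_r hX hu hE Idx.zero).one t ht x).integrable hp1
    · exact (((hY.wBound_increment_X_r hX hu hE Idx.zero).one t' ht' x').integrable hp1).const_mul κ
  rw [← hu', ← integral_sub (hc.integrable hp1) (hi.integrable hp1)]
  refine le_trans (le_of_eq ?_) hd
  rw [Real.norm_eq_abs]
  congr 1
  refine integral_congr_ae (.of_forall fun ω => ?_)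
  simp only [cell_eq u]
  ring

/-- The mean of a summand of the approximation, expressed by means of the contributions of the
individual levels. -/
lemma integral_mlpTerm_test {l : ℕ} {K : ℕ → ℝ} (hK : ∀ j ≤ l, 0 ≤ K j)
    (ih : ∀ j ≤ l, ∀ θ : Idx, WBound P p q₁ q₂ T V (fun t x ω => mlp T f g r Y j m θ t x ω - u t x)
      (fun t => K j * Real.exp ((m : ℝ) ^ (p / 2) * ((T - t) / T) / p)))
    (θ : Idx) {i : ℕ} (hi : 1 ≤ i) {κ t t' w : ℝ} {x x' : E}
    (hz : IsTest q₁ q₂ T V κ t x t' x' w) :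
    ∫ ω, (mlpTerm T f g r Y m θ l i t x ω - κ * mlpTerm T f g r Y m θ l i t' x' ω) ∂P
      = (∫ ω, (cell T f g r Y m (m ^ l) l Idx.zero Idx.zero t x ω
          - κ * cell T f g r Y m (m ^ l) l Idx.zero Idx.zero t' x' ω) ∂P)
        - if l = 0 then 0 else ∫ ω, (cell T f g r Y m (m ^ (l - 1)) (l - 1) Idx.zero Idx.zero t x ω
          - κ * cell T f g r Y m (m ^ (l - 1)) (l - 1) Idx.zero Idx.zero t' x' ω) ∂P := by
  have hp1 := (hX.costs_le hE).2.2.2.1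
  have hpow : ∀ j, 1 ≤ m ^ j := fun j => Nat.one_le_pow _ _ hm
  obtain ⟨ht, ht'⟩ := hz.mem
  have hint : ∀ j ≤ l, ∀ {η η' : Idx}, η ∉ η'.below → ∀ {t : ℝ} (_ : t ∈ Icc 0 T) (x : E),
      Integrable (cell T f g r Y m (m ^ j) j η η' t x) P := fun j hj η η' hη t ht x =>
    ((hY.wBound_cell hX hu hE hm (hpow j) hη (hK j hj) (ih j hj η')).one t ht x).integrable hp1
  have key : ∀ j ≤ l, ∀ {η η' : Idx}, η ∉ η'.below →
      ∫ ω, (cell T f g r Y m (m ^ j) j η η' t x ω - κ * cell T f g r Y m (m ^ j) j η η' t' x' ω) ∂P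
        = ∫ ω, (cell T f g r Y m (m ^ j) j Idx.zero Idx.zero t x ω
          - κ * cell T f g r Y m (m ^ j) j Idx.zero Idx.zero t' x' ω) ∂P := fun j hj η η' hη => by
    have h0 := Idx.notMem_below Idx.zero
    rw [integral_sub (hint j hj hη ht x) ((hint j hj hη ht' x').const_mul κ),
      integral_sub (hint j hj h0 ht x) ((hint j hj h0 ht' x').const_mul κ), integral_const_mul,
      integral_const_mul,
      hY.integral_cell hX hm (hpow j) hη h0 ht x (hint j hj hη ht x) (hint j hj h0 ht x),
      hY.integral_cell hX hm (hpow j) hη h0 ht' x' (hint j hj hη ht' x') (hint j hj h0 ht' x')]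
  cases l with
  | zero =>
    simp only [mlpTerm_zero, if_true, sub_zero]
    exact key 0 le_rfl (Idx.notMem_below _)
  | succ l =>
    simp only [Nat.add_one_ne_zero, if_false, Nat.add_sub_cancel]
    have k1 := key (l + 1) le_rfl (Idx.notMem_below (θ.snoc (l + 1 : ℕ) i))
    have k2 := key l (Nat.le_succ l) (θ.snoc_notMem_below_snoc (l + 1 : ℕ) hi)
    rw [← k1, ← k2, ← integral_sub]
    · refine integral_congr_ae (.of_forall fun ω => ?_)
      simp only [mlpTerm_succ]
      ring
    · exact (hint _ le_rfl (Idx.notMem_below _) ht x).sub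
        ((hint _ le_rfl (Idx.notMem_below _) ht' x').const_mul κ)
    · exact (hint _ (Nat.le_succ l) (θ.snoc_notMem_below_snoc (l + 1 : ℕ) hi) ht x).sub
        ((hint _ (Nat.le_succ l) (θ.snoc_notMem_below_snoc (l + 1 : ℕ) hi) ht' x').const_mul κ)

/-- One step of the error recursion for multilevel Picard approximations. -/
lemma wBound_mlp_sub_step
    (hup : ∀ t ∈ Icc 0 T, ∀ x, u t x = picard P T f g X u t x) {n : ℕ} {C β : ℝ}
    (hC : 0 ≤ C) (hβ : 37 ≤ β)
    (ih : ∀ j ≤ n, ∀ θ : Idx, WBound P p q₁ q₂ T V (fun t x ω => mlp T f g r Y j m θ t x ω - u t x)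
      (fun t => C * (1 / √m) ^ j * β ^ j * Real.exp ((m : ℝ) ^ (p / 2) * ((T - t) / T) / p)))
    (θ : Idx) :
    WBound P p q₁ q₂ T V (fun t x ω => mlp T f g r Y (n + 1) m θ t x ω - u t x)
      (fun t => ∑ l ∈ Finset.range (n + 1), 2 * √(p - 1) * (1 / √m) ^ (n + 1) *
          (440 * Real.exp (c * T) ^ 10 * √m + 38 / 5 * Real.exp (c * T) ^ 3 * C * β ^ l *
            Real.exp ((m : ℝ) ^ (p / 2) * ((T - t) / T) / p))
        + (220 * Real.exp (c * T) ^ 10 * (1 / √m) ^ n + 37 / 5 * Real.exp (c * T) ^ 3 *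
          (C * (1 / √m) ^ n * β ^ n) * (1 / √m) *
            Real.exp ((m : ℝ) ^ (p / 2) * ((T - t) / T) / p))) := by
  have hp1 := (hX.costs_le hE).2.2.2.1
  have hV : ∀ t ∈ Icc 0 T, ∀ x, 0 ≤ V t x := fun t ht x => (hX.V_pos ht x).le
  have hpow : ∀ j, 1 ≤ m ^ j := fun j => Nat.one_le_pow _ _ hm
  have hβ0 : 0 ≤ β := by linarith
  refine wBound_of_test fun κ t x t' x' w hz => ?_
  have hw := hz.nonneg hV
  obtain ⟨ht, ht'⟩ := hz.mem
  have hbias := hY.abs_integral_cell_sub_le hX hu hE hm hup (hpow n) (by positivity)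
    (ih n le_rfl Idx.zero) hz
  rw [one_div_sqrt_natCast_pow] at hbias
  set G : ℕ → ℝ := fun l => ∫ ω, (cell T f g r Y m (m ^ l) l Idx.zero Idx.zero t x ω
          - κ * cell T f g r Y m (m ^ l) l Idx.zero Idx.zero t' x' ω) ∂P with hG
  -- The common mean of the samples on level `l`; summed over the levels it telescopes to `G n`.
  set d : ℕ → ℝ := fun l => G l - if l = 0 then 0 else G (l - 1) with hd
  set Z : ℕ → ℕ → Ω → ℝ := fun l i ω => mlpTerm T f g r Y m θ l i t x ω
    - κ * mlpTerm T f g r Y m θ l i t' x' ω with hZ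
  have hZm : ∀ l i, Measurable[joint T r Y (termIdx θ l i)] (Z l i) := fun l i =>
    (hY.measurable_mlpTerm_apply hX hm θ l i ht x).sub
      ((hY.measurable_mlpTerm_apply hX hm θ l i ht' x').const_mul κ)
  -- The average over m^{n+1-l} samples contributes (1/√m)^{n+1-l} and the size of a summand
  -- (1/√m)^l, so every level has the same order (1/√m)^{n+1}.
  have hlev : ∀ l ∈ Finset.range (n + 1), LpLe P (1 / p)
      (fun ω => 1 / (m : ℝ) ^ (n + 1 - l) * ∑ i ∈ Finset.Icc 1 (m ^ (n + 1 - l)), Z l i ω - d l)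
      (2 * √(p - 1) * (1 / √m) ^ (n + 1) *
          (440 * Real.exp (c * T) ^ 10 * √m + 38 / 5 * Real.exp (c * T) ^ 3 * C * β ^ l *
            Real.exp ((m : ℝ) ^ (p / 2) * ((T - t) / T) / p)) * w) := by
    intro l hl
    rw [Finset.mem_range] at hl
    have hln : ∀ j ≤ l, j ≤ n := fun j hj => hj.trans (Nat.lt_succ_iff.1 hl)
    have h1 := lpLe_average_sub (P := P) hE.two_le (Z := Z l) (d := d l)
      (mul_nonneg (by positivity) hw) (hpow (n + 1 - l))
      (fun i hi => (hY.wBound_mlpTerm hX hu hE hm θ (Finset.mem_Icc.1 hi).1 hC hβ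
        fun j hj => ih j (hln j hj)).test hz)
      (fun i hi => hY.integral_mlpTerm_test hX hu hE hm
        (K := fun j => C * (1 / √m) ^ j * β ^ j) (fun j _ => by positivity)
        (fun j hj => ih j (hln j hj)) θ (Finset.mem_Icc.1 hi).1 hz)
      fun v hv i hi hiv => hY.indepFun_sum_of_termIdx θ (l := fun _ => l) (i := id)
        (fun a ha => (Finset.mem_Icc.1 ha).1)
        (fun a _ b _ hab h => hab (Prod.mk.inj h).2) (Z := fun i ω => Z l i ω - d l)
        (fun a => (hZm l a).sub_const (d l)) hv hi hiv
    rw [one_div_sqrt_natCast_pow, Nat.cast_pow] at h1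
    refine h1.mono_bound (le_of_eq ?_)
    have : (1 / √(m : ℝ)) ^ (n + 1) = (1 / √m) ^ l * (1 / √m) ^ (n + 1 - l) := by
      rw [← pow_add]; congr 1; omega
    rw [this]
    ring
  -- Centred level averages plus the deterministic bias of the finest level.
  have hsum := (LpLe.sum hp1 (fun l _ => mul_nonneg (by positivity) hw) hlev).add
    (LpLe.const (P := P) (G n - (u t x - κ * u t' x')) (1 / p)) hp1
    (Finset.sum_nonneg fun l _ => mul_nonneg (by positivity) hw) (norm_nonneg _)
  refine (hsum.congr_ae (.of_forall fun ω => ?_)).mono_bound ?_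
  · have htel := sum_range_sub_pred G n
    dsimp only
    rw [Finset.sum_sub_distrib, htel, mlp_eq, mlp_eq]
    simp only [hZ, Finset.sum_sub_distrib, ← Finset.mul_sum, mul_sub]
    rw [Finset.mul_sum]
    have : ∀ l, 1 / (m : ℝ) ^ (n + 1 - l) * (κ * ∑ i ∈ Finset.Icc 1 (m ^ (n + 1 - l)),
        mlpTerm T f g r Y m θ l i t' x' ω) = κ * (1 / (m : ℝ) ^ (n + 1 - l) *
        ∑ i ∈ Finset.Icc 1 (m ^ (n + 1 - l)), mlpTerm T f g r Y m θ l i t' x' ω) := fun l => by ring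
    simp only [this]
    ring
  · rw [add_mul, Finset.sum_mul]
    gcongr
    exact hbias

end ApproxAssumptions

end MLPHoelder

end

/-! ### Solution of the recursion and passage to the weighted norms. -/

section

namespace MLPHoelder

set_option linter.unusedSectionVars false

variable {E : Type*} [NormedAddCommGroup E] [NormedSpace ℝ E] [FiniteDimensional ℝ E]
  [MeasurableSpace E] [BorelSpace E] {Ω : Type*} [mΩ : MeasurableSpace Ω] {P : Measure Ω}
  {p₁ p₂ p q₁ q₂ c T : ℝ} {f : ℝ → ℝ} {g : E → ℝ} {V : ℝ → E → ℝ} {X : ℝ → ℝ → E → Ω → E}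
  {r : Idx → Ω → ℝ} {Y : ℕ → Idx → ℝ → ℝ → E → Ω → E}

/-- `M` is √m, `N` the number of levels, `b` the n-th power of the ratio and `B` the geometric sum.
Fluctuations of the inner errors, the bias from the inner error and all discretization terms take
the shares 16, 8 and 13 of 37. The factor e^6 in `C` together with e^4 from the ratio matches the
e^10 of the increments. -/
lemma recursion_arith {e s M N b B R C : ℝ} (he : 1 ≤ e) (hs : 1 ≤ s) (hM : 1 ≤ M) (hN : 1 ≤ N)
    (hb : 1 ≤ b) (hR : 1 ≤ R) (hC : C = 1776 * M ^ 2 * N * e ^ 6) (hB : B ≤ 37 / 36 * b) :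
    N * (2 * s * (440 * e ^ 10 * M)) + 2 * s * (38 / 5 * e ^ 3 * C * B * R)
        + (220 * e ^ 10 * M + 37 / 5 * e ^ 3 * C * b * R)
      ≤ C * (37 * s * e ^ 4) * b * R := by
  have hC0 : 0 ≤ C := by rw [hC]; positivity
  have he34 : e ^ 3 ≤ s * e ^ 4 := by
    have : e ^ 3 ≤ e ^ 4 := pow_le_pow_right₀ he (by norm_num)
    exact this.trans (le_mul_of_one_le_left (by positivity) hs)
  have h1 : 2 * s * (38 / 5 * e ^ 3 * C * B * R) ≤ 16 * (s * e ^ 4) * (C * b * R) := by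
    have h34 : e ^ 3 ≤ e ^ 4 := pow_le_pow_right₀ he (by norm_num)
    calc 2 * s * (38 / 5 * e ^ 3 * C * B * R)
        ≤ 2 * s * (38 / 5 * e ^ 3 * C * (37 / 36 * b) * R) := by gcongr
      _ ≤ 2 * s * (38 / 5 * e ^ 4 * C * (37 / 36 * b) * R) := by gcongr
      _ = (76 / 5 * 37 / 36) * ((s * e ^ 4) * (C * b * R)) := by ring
      _ ≤ 16 * ((s * e ^ 4) * (C * b * R)) := by gcongr; norm_num
      _ = _ := by ring
  have h2 : 37 / 5 * e ^ 3 * C * b * R ≤ 8 * (s * e ^ 4) * (C * b * R) := by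
    calc 37 / 5 * e ^ 3 * C * b * R = 37 / 5 * e ^ 3 * (C * b * R) := by ring
      _ ≤ 8 * (s * e ^ 4) * (C * b * R) := by gcongr; norm_num
  have h3 : N * (2 * s * (440 * e ^ 10 * M)) + 220 * e ^ 10 * M
      ≤ 13 * (s * e ^ 4) * (C * b * R) := by
    have h4 : s * e ^ 10 * M ^ 2 * N * 1 ≤ s * e ^ 10 * M ^ 2 * N * (b * R) := by
      gcongr
      exact one_le_mul_of_one_le_of_one_le hb hR
    have h5 : M ≤ M ^ 2 := le_self_pow₀ hM two_ne_zero
    have h7 : 220 * e ^ 10 * M ≤ 220 * (s * e ^ 10 * M ^ 2 * N) := by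
      calc 220 * e ^ 10 * M ≤ 220 * e ^ 10 * M ^ 2 := by gcongr
        _ = 220 * (1 * e ^ 10 * M ^ 2 * 1) := by ring
        _ ≤ 220 * (s * e ^ 10 * M ^ 2 * N) := by gcongr
    calc N * (2 * s * (440 * e ^ 10 * M)) + 220 * e ^ 10 * M
        ≤ N * (2 * s * (440 * e ^ 10 * M ^ 2)) + 220 * (s * e ^ 10 * M ^ 2 * N) :=
          add_le_add (by gcongr) h7
      _ = 1100 * (s * e ^ 10 * M ^ 2 * N * 1) := by ring
      _ ≤ 13 * 1776 * (s * e ^ 10 * M ^ 2 * N * (b * R)) := by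
          gcongr
          norm_num
      _ = 13 * (s * e ^ 4) * (C * b * R) := by rw [hC]; ring
  have h6 : C * (37 * s * e ^ 4) * b * R = 37 * (s * e ^ 4) * (C * b * R) := by ring
  rw [h6]
  linarith

lemma sum_pow_le {β : ℝ} (hβ : 37 ≤ β) (n : ℕ) :
    ∑ l ∈ Finset.range (n + 1), β ^ l ≤ 37 / 36 * β ^ n := by
  induction n with
  | zero => norm_num
  | succ n ih =>
    rw [Finset.sum_range_succ]
    have : 0 < β ^ n := by positivity
    have h : 37 * β ^ n ≤ β ^ (n + 1) := by rw [pow_succ']; gcongr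
    linarith

lemma SolutionBounds.hoelder_rpow {u : ℝ → E → ℝ} (hu : SolutionBounds c T V u)
    (hV : ∀ t ∈ Icc 0 T, ∀ x, 1 ≤ V t x) (hq : 1 ≤ q₂) {t t' : ℝ} (ht : 0 ≤ t) (htt : t ≤ t')
    (ht' : t' ≤ T) (x x' : E) :
    |u t x - u t' x'| ≤ 8 * Real.exp (c * T) ^ 2 *
      ((V t x ^ q₂ + V t' x' ^ q₂) / 2 * gap T V t x t' x') := by
  have h1 := hV t ⟨ht, htt.trans ht'⟩ x
  have h2 := hV t' ⟨ht.trans htt, ht'⟩ x'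
  have hg := gap_nonneg (fun t ht x => zero_le_one.trans (hV t ht x)) (t := t) (t' := t')
    ⟨ht, htt.trans ht'⟩ ⟨ht.trans htt, ht'⟩ x x'
  have h3 := avg_pow_le (q := q₂) h1 h2 1 (by simpa using hq) hq
  rw [pow_one] at h3
  refine (hu.hoelder t t' ht htt ht' x x').trans ?_
  change _ * gap T V t x t' x' ≤ _
  rw [mul_assoc]
  gcongr

lemma SolutionBounds.growth_rpow {u : ℝ → E → ℝ} (hu : SolutionBounds c T V u)
    (hV : ∀ t ∈ Icc 0 T, ∀ x, 1 ≤ V t x) (hq : 1 ≤ q₁) {t : ℝ} (ht : t ∈ Icc 0 T) (x : E) :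
    |u t x| ≤ 2 * Real.exp (c * T) * V t x ^ q₁ := by
  refine (hu.growth t ht x).trans ?_
  gcongr
  exact Real.self_le_rpow_of_one_le (hV t ht x) hq

variable [IsProbabilityMeasure P]

lemma SolutionBounds.wBound {u : ℝ → E → ℝ} (hu : SolutionBounds c T V u) (hcT : 0 ≤ c * T)
    (hV : ∀ t ∈ Icc 0 T, ∀ x, 1 ≤ V t x) (hq₁ : 1 ≤ q₁) (hq₂ : 1 ≤ q₂) :
    WBound P p q₁ q₂ T V (fun t x _ => u t x) (fun _ => 8 * Real.exp (c * T) ^ 2) where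
  one t ht x := by
    refine (LpLe.const _ _).mono_bound ((hu.growth_rpow hV hq₁ ht x).trans ?_)
    have he := Real.one_le_exp hcT
    have := hV t ht x
    gcongr
    · norm_num
    · exact le_self_pow₀ he two_ne_zero
  two t t' ht htt ht' x x' :=
    (LpLe.const _ _).mono_bound (hu.hoelder_rpow hV hq₂ ht htt ht' x x')

namespace ApproxAssumptions

variable {m : ℕ} {u : ℝ → E → ℝ} (hY : ApproxAssumptions P p₁ p₂ c T V X r Y)
  (hX : FlowAssumptions P p₁ p₂ c T f g V X)
  (hu : SolutionBounds c T V u) (hE : Exponents p₁ p₂ p q₁ q₂) (hm : 1 ≤ m)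
include hY hX hu hE hm

/-- The error bound for multilevel Picard approximations in the weighted norms. -/
theorem wBound_mlp_sub (hup : ∀ t ∈ Icc 0 T, ∀ x, u t x = picard P T f g X u t x) (n : ℕ)
    (θ : Idx) :
    WBound P p q₁ q₂ T V (fun t x ω => mlp T f g r Y n m θ t x ω - u t x)
      (fun t => 1776 * m * (max n 1 : ℕ) * Real.exp (c * T) ^ 6 * (1 / √m) ^ n *
        (37 * √(p - 1) * Real.exp (c * T) ^ 4) ^ n *
        Real.exp ((m : ℝ) ^ (p / 2) * ((T - t) / T) / p)) := by
  have he := hX.exp_facts.1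
  have hT := hX.T_pos
  have hp := hE.two_le
  have hs : 1 ≤ √(p - 1) := Real.one_le_sqrt.2 (by linarith)
  have hm' : (1 : ℝ) ≤ m := by exact_mod_cast hm
  have hM : 1 ≤ √(m : ℝ) := Real.one_le_sqrt.2 hm'
  have hV : ∀ t ∈ Icc 0 T, ∀ x, 0 ≤ V t x := fun t ht x => (hX.V_pos ht x).le
  have hR : ∀ t ∈ Icc 0 T, 1 ≤ Real.exp ((m : ℝ) ^ (p / 2) * ((T - t) / T) / p) := fun t ht =>
    Real.one_le_exp (by have := sub_nonneg.2 ht.2; positivity)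
  have hβ : 37 ≤ 37 * √(p - 1) * Real.exp (c * T) ^ 4 := by
    nlinarith [one_le_mul_of_one_le_of_one_le hs (one_le_pow₀ he (n := 4))]
  induction n using Nat.strong_induction_on generalizing θ with
  | _ n ih =>
  cases n with
  | zero =>
    -- The approximation of order 0 vanishes, so its error is -u. The maximum with 1 in the bound
    -- keeps the constant positive here.
    have h := (hu.wBound (P := P) (p := p) (q₁ := q₁) (q₂ := q₂)
      (by have := hX.c_pos; positivity) hX.one_le_V (by linarith [hE.three_le])
      (by linarith [hE.nine_le])).neg
    refine (h.congr (fun t _ x ω => ?_)).mono hV fun t ht => ?_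
    · simp [mlp_eq]
    · have h1 := hR t ht
      simp only [pow_zero, mul_one, zero_le, sup_of_le_right, Nat.cast_one]
      calc 8 * Real.exp (c * T) ^ 2 ≤ 1776 * Real.exp (c * T) ^ 6 := by
            gcongr
            · norm_num
            · norm_num
        _ = 1776 * 1 * Real.exp (c * T) ^ 6 * 1 := by ring
        _ ≤ _ := by gcongr
  | succ n =>
    -- The constant is frozen at its value for n+1. The induction hypotheses for all lower orders
    -- are weakened to it, so that the recursion sees one common constant.
    set C : ℝ := 1776 * m * (max (n + 1) 1 : ℕ) * Real.exp (c * T) ^ 6 with hC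
    have hC0 : 0 ≤ C := by positivity
    refine (hY.wBound_mlp_sub_step hX hu hE hm hup hC0 hβ (fun j hj θ' =>
      (ih j (by omega) θ').mono hV fun t ht => ?_) θ).mono hV fun t ht => ?_
    · rw [hC]
      gcongr
      omega
    · have h1 := hR t ht
      have hN : (1 : ℝ) ≤ ((n + 1 : ℕ) : ℝ) := by exact_mod_cast Nat.succ_pos n
      have hC' : C = 1776 * √(m : ℝ) ^ 2 * ((n + 1 : ℕ) : ℝ) * Real.exp (c * T) ^ 6 := by
        rw [hC, Real.sq_sqrt (by positivity), max_eq_left (Nat.le_add_left 1 n)]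
      have key := recursion_arith he hs hM hN (one_le_pow₀ (by linarith) (n := n)) h1 hC'
        (sum_pow_le hβ n)
      have hμ : (1 / √(m : ℝ)) ^ n = (1 / √(m : ℝ)) ^ (n + 1) * √(m : ℝ) := by
        rw [pow_succ, mul_assoc, one_div_mul_cancel (by positivity), mul_one]
      generalize 37 * √(p - 1) * Real.exp (c * T) ^ 4 = β at *
      generalize Real.exp ((m : ℝ) ^ (p / 2) * ((T - t) / T) / p) = R at *
      have h2 := mul_le_mul_of_nonneg_left key (by positivity : 0 ≤ (1 / √(m : ℝ)) ^ (n + 1))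
      refine le_trans (le_of_eq ?_) (h2.trans (le_of_eq ?_))
      · rw [Finset.sum_congr rfl fun l _ => mul_add _ _ _, Finset.sum_add_distrib,
          Finset.sum_const, Finset.card_range, nsmul_eq_mul, ← Finset.mul_sum,
          ← Finset.sum_mul, ← Finset.mul_sum]
        have h3 : 1 / √(m : ℝ) * √(m : ℝ) = 1 := one_div_mul_cancel (by positivity)
        rw [hμ]
        linear_combination (37 / 5 * Real.exp (c * T) ^ 3 * C * β ^ n * R *
          (1 / √(m : ℝ)) ^ (n + 1)) * h3
      · ring

end ApproxAssumptions

lemma norm₁_le {H : ℝ → E → Ω → ℝ} (hp : 0 < p) {b s : ℝ} (hb : 0 ≤ b)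
    (h : ∀ t ∈ Icc s T, ∀ x, LpLe P (1 / p) (H t x) (b * V t x ^ q₁)) :
    norm₁ P T p q₁ V H s ≤ ENNReal.ofReal b :=
  iSup₂_le fun t ht => iSup_le fun x => ENNReal.div_le_of_le_mul <| by
    rw [← ENNReal.ofReal_mul hb]
    exact ((lpLe_iff hp).1 (h t ht x)).2

/-- Ordered times suffice, as the denominator of the seminorm is symmetric in the two points. -/
lemma norm₂_le {H : ℝ → E → Ω → ℝ} (hp : 0 < p) {b s : ℝ} (hb : 0 ≤ b)
    (h : ∀ t t', s ≤ t → t ≤ t' → t' ≤ T → ∀ x x', LpLe P (1 / p) (fun ω => H t x ω - H t' x' ω)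
      (b * ((V t x ^ q₂ + V t' x' ^ q₂) / 2 * gap T V t x t' x'))) :
    norm₂ P T p q₂ V H s ≤ ENNReal.ofReal b := by
  refine iSup₂_le fun t ht => iSup₂_le fun t' ht' => iSup₂_le fun x x' => iSup_le fun _ =>
    ENNReal.div_le_of_le_mul ?_
  rw [← ENNReal.ofReal_mul hb]
  refine ((lpLe_iff hp).1 ?_).2
  rcases le_total t t' with htt | htt
  · have h1 := h t t' ht.1 htt ht'.2 x x'
    rwa [gap, ← abs_of_nonneg (sub_nonneg.2 htt), abs_sub_comm t'] at h1
  · have h1 := (h t' t ht'.1 htt ht.2 x' x).neg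
    rw [gap, ← abs_of_nonneg (sub_nonneg.2 htt), norm_sub_rev, add_comm (V t' x' ^ q₂),
      add_comm (V t' x')] at h1
    simpa only [neg_sub] using h1

lemma WBound.hoelderNorm_le {H : ℝ → E → Ω → ℝ} {φ : ℝ → ℝ} (h : WBound P p q₁ q₂ T V H φ)
    (hV : ∀ t ∈ Icc 0 T, ∀ x, 0 ≤ V t x) (hp : 0 < p) {b s : ℝ} (hs : 0 ≤ s) (hb : 0 ≤ b)
    (hφ : ∀ t ∈ Icc s T, φ t ≤ b) : hoelderNorm P T p q₁ q₂ V H s ≤ ENNReal.ofReal b := by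
  refine max_le (norm₁_le hp hb fun t ht x => ?_) (norm₂_le hp hb fun t t' ht htt ht' x x' => ?_)
  · have ht0 : t ∈ Icc 0 T := ⟨hs.trans ht.1, ht.2⟩
    have := hV t ht0 x
    exact (h.one t ht0 x).mono_bound (by have := hφ t ht; gcongr)
  · have ht0 := hs.trans ht
    have := weight_nonneg (q₂ := q₂) hV (t := t) (t' := t') ⟨ht0, htt.trans ht'⟩
      ⟨ht0.trans htt, ht'⟩ x x'
    exact (h.two t t' ht0 htt ht' x x').mono_bound
      (mul_le_mul_of_nonneg_right (hφ t ⟨ht, htt.trans ht'⟩) this)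

lemma rate_eq {c T p : ℝ} (hp : 2 ≤ p) {m : ℕ} (hm : 1 ≤ m) (n : ℕ) :
    (1 / √(m : ℝ)) ^ n * (37 * √(p - 1) * Real.exp (c * T) ^ 4) ^ n
      = (m : ℝ) ^ (-(n : ℝ) / 2) * 37 ^ n * Real.exp (4 * n * c * T) * (p - 1) ^ ((n : ℝ) / 2) := by
  have h1 : (1 / √(m : ℝ)) ^ n = (m : ℝ) ^ (-(n : ℝ) / 2) := by
    rw [Real.sqrt_eq_rpow, one_div, ← Real.rpow_neg (by positivity), ← Real.rpow_natCast,
      ← Real.rpow_mul (by positivity)]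
    congr 1
    ring
  have h2 : √(p - 1) ^ n = (p - 1) ^ ((n : ℝ) / 2) := by
    rw [Real.sqrt_eq_rpow, ← Real.rpow_natCast, ← Real.rpow_mul (by linarith)]
    congr 1
    ring
  have h3 : (Real.exp (c * T) ^ 4) ^ n = Real.exp (4 * n * c * T) := by
    rw [← pow_mul, ← Real.exp_nat_mul]
    congr 1
    push_cast
    ring
  rw [mul_pow, mul_pow, h1, h2, h3]
  ring

end MLPHoelder

end

/-! ### The main theorem. -/

section

theorem theorem4p2
    {E : Type*} [NormedAddCommGroup E] [NormedSpace ℝ E] [FiniteDimensional ℝ E]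
    [MeasurableSpace E] [BorelSpace E]
    {Ω : Type*} [MeasurableSpace Ω] (P : Measure Ω) [IsProbabilityMeasure P]
    (p₁ p₂ c T : ℝ) (f : ℝ → ℝ) (g : E → ℝ) (V : ℝ → E → ℝ)
    (X : ℝ → ℝ → E → Ω → E) (r : MLPHoelder.Idx → Ω → ℝ)
    (Y : ℕ → MLPHoelder.Idx → ℝ → ℝ → E → Ω → E)
    (hX : MLPHoelder.FlowAssumptions P p₁ p₂ c T f g V X)
    (hY : MLPHoelder.ApproxAssumptions P p₁ p₂ c T V X r Y)
    (p q₁ q₂ : ℝ) (hp : 2 ≤ p) (hq₁ : 3 ≤ q₁) (hq₂ : 9 ≤ q₂)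
    (hpq : (q₂ + 1) / p₁ + 2 / p₂ ≤ 1 / p) (hqq : q₁ + 2 ≤ q₂) :
    ∃ u : ℝ → E → ℝ,
      MLPHoelder.IsFixedPointSolution P T f g V X u ∧
      (∀ v : ℝ → E → ℝ, MLPHoelder.IsFixedPointSolution P T f g V X v →
        ∀ t ∈ Icc 0 T, ∀ x, v t x = u t x) ∧
      (∀ s ∈ Icc 0 T,
        MLPHoelder.norm₁ P T p q₁ V (fun t x _ => u t x) s
          ≤ ENNReal.ofReal (2 * Real.exp (c * T)) ∧
        MLPHoelder.norm₂ P T p q₂ V (fun t x _ => u t x) s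
          ≤ ENNReal.ofReal (8 * Real.exp (2 * c * T))) ∧
      (∀ n m : ℕ, 1 ≤ n → 1 ≤ m → ∀ t ∈ Icc 0 T,
        MLPHoelder.hoelderNorm P T p q₁ q₂ V
            (fun t x ω => MLPHoelder.mlp T f g r Y n m MLPHoelder.Idx.zero t x ω - u t x) t
          ≤ ENNReal.ofReal (1776 * m * n * Real.exp (6 * c * T)
              * Real.exp ((m : ℝ) ^ (p / 2) / p) * (m : ℝ) ^ (-(n : ℝ) / 2) * 37 ^ n
              * Real.exp (4 * n * c * T) * (p - 1) ^ ((n : ℝ) / 2))) := by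
  open MLPHoelder in
  have hT := hX.T_pos
  have hcT : 0 ≤ c * T := (mul_pos hX.c_pos hT).le
  have hXb := hY.fieldBound_X hX
  have hV0 : ∀ t ∈ Icc 0 T, ∀ x, 0 ≤ V t x := fun t ht x => (hX.V_pos ht x).le
  have hp0 : 0 < p := by linarith
  obtain ⟨u, hum, hub, hup⟩ := hX.exists_fixedPoint hXb
  have hua : Admissible T V u (2 * Real.exp (c * T)) := ⟨hum, fun t ht x => by
    refine (hub t ht x).trans ?_
    have := hV0 t ht x
    have := hX.c_pos
    gcongr
    linarith [ht.1]⟩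
  have hu := hX.solutionBounds hXb hY.X_start hua hup
  have hE : Exponents p₁ p₂ p q₁ q₂ := ⟨hp, hq₁, hq₂, hpq, hqq⟩
  refine ⟨u, hX.isFixedPointSolution hXb (by positivity) hua hup, fun v hv t ht x => ?_,
    fun s hs => ⟨?_, ?_⟩, fun n m hn hm t ht => ?_⟩
  · obtain ⟨C, hC, hva, hvp⟩ := hX.admissible_clip_of_isFixedPointSolution hv
    have h := hX.fixedPoint_unique hXb hC (by positivity) hva hua hvp hup t ht x
    rwa [clip_eq ht] at h
  · exact norm₁_le hp0 (by positivity) fun t ht x => (LpLe.const _ _).mono_bound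
      (hu.growth_rpow hX.one_le_V (by linarith) ⟨hs.1.trans ht.1, ht.2⟩ x)
  · have h2 : Real.exp (2 * c * T) = Real.exp (c * T) ^ 2 := by
      rw [← Real.exp_nat_mul]
      congr 1
      push_cast
      ring
    rw [h2]
    exact norm₂_le hp0 (by positivity) fun t t' ht htt ht' x x' => (LpLe.const _ _).mono_bound
      (hu.hoelder_rpow hX.one_le_V (by linarith) (hs.1.trans ht) htt ht' x x')
  · have h6 : Real.exp (6 * c * T) = Real.exp (c * T) ^ 6 := by
      rw [← Real.exp_nat_mul]
      congr 1
      push_cast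
      ring
    have hs1 : 0 ≤ p - 1 := by linarith
    refine (hY.wBound_mlp_sub hX hu hE hm hup n Idx.zero).hoelderNorm_le hV0 hp0 ht.1
      (by positivity) fun t' ht' => ?_
    -- The auxiliary exponential weight is largest when the whole interval remains; this is the
    -- factor that survives in the final bound.
    have hR : Real.exp ((m : ℝ) ^ (p / 2) * ((T - t') / T) / p)
        ≤ Real.exp ((m : ℝ) ^ (p / 2) / p) := by
      gcongr
      refine mul_le_of_le_one_right (by positivity) ((div_le_one hT).2 ?_)
      linarith [ht.1, ht'.1]
    rw [max_eq_left hn, mul_assoc (1776 * (m : ℝ) * n * _), rate_eq hp hm, h6]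
    refine (mul_le_mul_of_nonneg_left hR (by positivity)).trans_eq ?_
    ring

end
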